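/- Let $k$ be a commutative ring and $A$ an associative unital $k$-algebra. **Notation.** $\Delta S_+$ is the category whose objects are the finite sets $\underline{n}$ with $n\ge 0$ elements and whose morphisms are maps of sets together with a total ordering of each preimage, composed by ordering preimages lexicographically; $\Delta S\subset\Delta S_+$ is the full subcategory of non-empty sets, and $\odot$ is disjoint union. The functor $B^{sym_+}_*A:\Delta S_+\to k\text{-Mod}$ sends $\underline n$ to $A^{\otimes n}$ and $f$ to $\bigotimes_x a_x\mapsto\bigotimes_y\prod_{x\in f^{-1}(y)}a_x$ (ordered products); $B^{sym}_*A$ is its restriction to $\Delta S$. Symmetric homology is $HS_*(A)=\mathrm{Tor}^{\Delta S}_*(k,B^{sym}_*A)$, with $k$ the constant contravariant functor. Let $\mathscr{Y}^+_*A=k[N(-\setminus\Delta S_+)]\otimes_{\Delta S_+}B^{sym_+}_*A$, where $N(c\setminus\Delta S_+)$ is the nerve of the under-category, and let $\mathcal N$ denote the normalized complex (quotient by degenerate elements). Let $\mathscr D_{\mathrm{sm}}(m)=k[N(ES_m)]$, where $ES_m$ is the groupoid with object set $S_m$ and exactly one morphism between any two objects, with $S_m$ acting by right multiplication and with structure maps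 induced by $(\sigma,\tau_1,\dots,\tau_m)\mapsto\sigma\{k_1,\dots,k_m\}(\tau_1\oplus\dots\oplus\tau_m)$ (here $\sigma\{k_1,\dots,k_m\}$ permutes $m$ blocks of sizes $k_1,\dots,k_m$ as $\sigma$ permutes letters), and let $\mathscr D_{\mathrm{ch}}=\mathcal N\mathscr D_{\mathrm{sm}}$ be the chain-level Barratt–Eccles operad, with structure maps the Eilenberg–Zilber shuffle maps followed by the normalizations of those of $\mathscr D_{\mathrm{sm}}$. For each $n$ let $\overline\chi:\mathscr D_{\mathrm{sm}}(n)\,\widehat\otimes\,(\mathscr Y^+_*A)^{\widehat\otimes n}\to\mathscr Y^+_*A$ be the map sending $\sigma\otimes(x_1\otimes V_1)\otimes\dots\otimes(x_n\otimes V_n)$, for $p$-simplices $\sigma=(\sigma_0,\dots,\sigma_p)$ and $x_i$ of $N(c_i\setminus\Delta S_+)$ with vertices $(x_i)_v:c_i\to d_{i,v}$, to $x\otimes(V_1\otimes\dots\otimes V_n)$, where $x$ is the simplex with vertices $\sigma_v\{d_{1,v},\dots,d_{n,v}\}\circ((x_1)_v\odot\dots\odot(x_n)_v)$ and with arrows the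 products of those of the $x_i$, conjugated by these block permutations. Let $\widetilde\chi:\mathscr D_{\mathrm{ch}}(n)\otimes(\mathcal N\mathscr Y^+_*A)^{\otimes n}\to\mathcal N\mathscr Y^+_*A$ be the shuffle map followed by $\mathcal N\overline\chi$. **Theorem.** 1. $\mathscr D_{\mathrm{sm}}$ is an operad in simplicial $k$-modules, and the maps $\overline\chi$ make $\mathscr Y^+_*A$ a $\mathscr D_{\mathrm{sm}}$-algebra. 2. $\mathscr D_{\mathrm{ch}}$ is an $E_\infty$-operad in chain complexes over $k$: it is an operad with a multiplicative, unital and $S_n$-invariant augmentation $\mathscr D_{\mathrm{ch}}(n)\to k$ that is a chain homotopy equivalence for every $n$, and each $\mathscr D_{\mathrm{ch}}(n)_d$ is a free $k[S_n]$-module on a set of generators. 3. The induced maps $\widetilde\chi$ make $\mathcal N\mathscr Y^+_*A$ a $\mathscr D_{\mathrm{ch}}$-algebra (hence an $E_\infty$-algebra). 4. There are isomorphisms $H_n(\mathcal N\mathscr Y^+_*A)\cong HS_n(A)$ of $k$-modules for all $n\ge0$ such that the following holds for every prime $p$ with $p=0$ in $k$. Let $\tau$ generate the cyclic group $C_p\subset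 S_p$, embedded by $\tau\mapsto(1,p,p-1,\dots,2)$, and let $W_*$ be the periodic resolution of $k$ by free $k[C_p]$-modules on generators $e_i$ ($i\ge0$), with $d e_{2i+1}=(\tau-1)e_{2i}$ and $d e_{2i+2}=(1+\tau+\dots+\tau^{p-1})e_{2i+1}$. There is a $C_p$-equivariant augmentation-preserving chain map $\xi:W_*\to\mathscr D_{\mathrm{ch}}(p)$ ($C_p$ acting on the left of $\mathscr D_{\mathrm{ch}}(p)$ through inverses and the right action of $S_p$), and for all $i,q\ge 0$ there is exactly one function $D_i:HS_q(A)\to HS_{pq+i}(A)$ with $D_i[z]=[\widetilde\chi(\xi(e_i)\otimes z^{\otimes p})]$ for every such $\xi$ and every cycle $z$ of degree $q$ (the element in brackets being a cycle). Consequently the Dyer–Lashof operations are well defined, for all $s,q\ge0$: if $p=2$, $P_s:HS_q(A)\to HS_{q+s}(A)$, equal to $0$ if $s<q$ and to $D_{s-q}$ if $s\ge q$; if $p>2$, with $\nu(q)=(-1)^{s+q(q-1)(p-1)/4}\big[\big(\tfrac{p-1}{2}\big)!\big]^q$, the operations $P_s:HS_q(A)\to HS_{q+2s(p-1)}(A)$,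 equal to $0$ if $2s<q$ and to $\nu(q)D_{(2s-q)(p-1)}$ if $2s\ge q$, and $\beta P_s:HS_q(A)\to HS_{q+2s(p-1)-1}(A)$, equal to $0$ if $2s\le q$ and to $\nu(q)D_{(2s-q)(p-1)-1}$ if $2s>q$. -/

import Mathlib

open CategoryTheory Opposite Simplicial TensorProduct DirectSum

universe u

namespace SymHom

/-- Objects of the category `ΔS₊`, in its description as the category `F(as)` of noncommutative
sets: the object `⟨n⟩` is the finite set with `n` elements (the object `[n-1]` of `ΔS₊`). -/
structure NCSet : Type where
  size : ℕ

namespace NCSet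

/-- A morphism of noncommutative sets: a map of sets together with a total ordering of each
preimage, recorded as a duplicate-free list of the elements of the preimage. -/
@[ext]
structure Hom (m n : NCSet) : Type where
  toFun : Fin m.size → Fin n.size
  fib : Fin n.size → List (Fin m.size)
  nodup : ∀ y, (fib y).Nodup
  mem_fib : ∀ x y, x ∈ fib y ↔ toFun x = y

def Hom.id (m : NCSet) : Hom m m where
  toFun x := x
  fib y := [y]
  nodup y := by simp
  mem_fib x y := by simp

/-- Composition of set maps; the preimage of `z` is ordered lexicographically. -/
def Hom.comp {m n l : NCSet} (f : Hom m n) (g : Hom n l) : Hom m l where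
  toFun x := g.toFun (f.toFun x)
  fib z := (g.fib z).flatMap f.fib
  nodup z := by
    rw [List.nodup_flatMap]
    refine ⟨fun y _ => f.nodup y, ?_⟩
    refine (g.nodup z).imp ?_
    intro a b hab x hxa hxb
    rw [f.mem_fib] at hxa hxb
    exact hab (hxa.symm.trans hxb)
  mem_fib x z := by
    simp [List.mem_flatMap, f.mem_fib, g.mem_fib]

instance : Category NCSet where
  Hom := Hom
  id := Hom.id
  comp := Hom.comp
  id_comp f := by
    refine Hom.ext rfl ?_
    funext z
    simp [Hom.comp, Hom.id]
  comp_id f := by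
    refine Hom.ext rfl ?_
    funext z
    simp [Hom.comp, Hom.id]
  assoc f g h := by
    refine Hom.ext rfl ?_
    funext z
    simp [Hom.comp, List.flatMap_assoc]

/-- A permutation, as an automorphism of a noncommutative set. -/
def permHom {m : NCSet} (e : Equiv.Perm (Fin m.size)) : m ⟶ m :=
  show Hom m m from
  { toFun := e
    fib := fun y => [e.symm y]
    nodup := fun y => by simp
    mem_fib := fun x y => by simp [Equiv.eq_symm_apply] }

/-- The product `c 0 ⊙ ⋯ ⊙ c (n - 1)` of objects. -/
def sum {n : ℕ} (c : Fin n → NCSet) : NCSet := ⟨∑ i, (c i).size⟩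

/-- The identification of `c 0 ⊙ ⋯ ⊙ c (n - 1)` with consecutive blocks `c i`. -/
def blk {n : ℕ} (c : Fin n → NCSet) : ((i : Fin n) × Fin (c i).size) ≃ Fin (sum c).size :=
  finSigmaFinEquiv

/-- The product `f 0 ⊙ ⋯ ⊙ f (n - 1)` of morphisms, acting blockwise. -/
def sumHom {n : ℕ} {c d : Fin n → NCSet} (f : ∀ i, c i ⟶ d i) : sum c ⟶ sum d :=
  show Hom (sum c) (sum d) from
  { toFun := fun x =>
      blk d ⟨((blk c).symm x).1, Hom.toFun (f _) ((blk c).symm x).2⟩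
    fib := fun y => (Hom.fib (f ((blk d).symm y).1) ((blk d).symm y).2).map
      fun x => blk c ⟨((blk d).symm y).1, x⟩
    nodup := fun y => by
      refine (Hom.nodup (f _) _).map ?_
      intro a b h
      simpa using h
    mem_fib := fun x y => by
      simp only [List.mem_map, ← Equiv.eq_symm_apply]
      generalize (blk c).symm x = p
      generalize (blk d).symm y = q
      obtain ⟨i, x⟩ := p
      obtain ⟨j, y⟩ := q
      constructor
      · rintro ⟨a, ha, h⟩
        obtain ⟨rfl, h⟩ := Sigma.mk.inj_iff.mp h
        obtain rfl := eq_of_heq h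
        rw [(Hom.mem_fib (f _) _ _).mp ha]
      · intro h
        obtain ⟨rfl, h⟩ := Sigma.mk.inj_iff.mp h
        exact ⟨x, (Hom.mem_fib (f _) _ _).mpr (eq_of_heq h), rfl⟩ }

theorem sumHom_toFun {n : ℕ} {c d : Fin n → NCSet} (f : ∀ i, c i ⟶ d i)
    (p : (i : Fin n) × Fin (c i).size) :
    Hom.toFun (sumHom f) (blk c p) = blk d ⟨p.1, Hom.toFun (f p.1) p.2⟩ := by
  show (fun p : (i : Fin n) × Fin (c i).size => blk d ⟨p.1, Hom.toFun (f p.1) p.2⟩)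
    ((blk c).symm (blk c p)) = _
  rw [Equiv.symm_apply_apply]

theorem sumHom_fib {n : ℕ} {c d : Fin n → NCSet} (f : ∀ i, c i ⟶ d i)
    (p : (i : Fin n) × Fin (d i).size) :
    Hom.fib (sumHom f) (blk d p) =
      (Hom.fib (f p.1) p.2).map fun x => blk c ⟨p.1, x⟩ := by
  show (fun p : (i : Fin n) × Fin (d i).size =>
    (Hom.fib (f p.1) p.2).map fun x => blk c ⟨p.1, x⟩) ((blk d).symm (blk d p)) = _
  rw [Equiv.symm_apply_apply]

theorem permHom_comp {m : NCSet} (e e' : Equiv.Perm (Fin m.size)) :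
    permHom e ≫ permHom e' = permHom (e' * e) := by
  refine Hom.ext rfl ?_
  funext z
  show ([e'.symm z]).flatMap (fun y => [e.symm y]) = [(e' * e).symm z]
  simp
  rfl

theorem permHom_one {m : NCSet} : permHom (1 : Equiv.Perm (Fin m.size)) = 𝟙 m := rfl

theorem permHom_comp_symm {m : NCSet} (e : Equiv.Perm (Fin m.size)) :
    permHom e ≫ permHom e.symm = 𝟙 m := by
  rw [permHom_comp, show e.symm * e = 1 from inv_mul_cancel e, permHom_one]

theorem permHom_comp_symm_assoc {m l : NCSet} (e : Equiv.Perm (Fin m.size)) (h : m ⟶ l) :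
    permHom e ≫ permHom e.symm ≫ h = h := by
  rw [← Category.assoc, permHom_comp_symm, Category.id_comp]

theorem permHom_symm_comp {m : NCSet} (e : Equiv.Perm (Fin m.size)) :
    permHom e.symm ≫ permHom e = 𝟙 m := by
  rw [permHom_comp, show e * e.symm = 1 from mul_inv_cancel e, permHom_one]

theorem sumHom_comp {n : ℕ} {c d e : Fin n → NCSet} (f : ∀ i, c i ⟶ d i) (g : ∀ i, d i ⟶ e i) :
    sumHom (fun i => f i ≫ g i) = sumHom f ≫ sumHom g := by
  refine Hom.ext ?_ ?_
  · funext x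
    obtain ⟨p, rfl⟩ := (blk c).surjective x
    show _ = Hom.toFun (sumHom g) (Hom.toFun (sumHom f) (blk c p))
    rw [sumHom_toFun, sumHom_toFun, sumHom_toFun]
    rfl
  · funext z
    obtain ⟨p, rfl⟩ := (blk e).surjective z
    show _ = (Hom.fib (sumHom g) (blk e p)).flatMap (Hom.fib (sumHom f))
    rw [sumHom_fib, sumHom_fib, List.flatMap_map]
    show List.map _ ((Hom.fib (g p.1) p.2).flatMap (Hom.fib (f p.1))) = _
    rw [List.map_flatMap]
    congr 1
    funext y
    rw [sumHom_fib]

theorem sumHom_id {n : ℕ} (c : Fin n → NCSet) : sumHom (fun i => 𝟙 (c i)) = 𝟙 (sum c) := by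
  refine Hom.ext ?_ ?_
  · funext x
    obtain ⟨p, rfl⟩ := (blk c).surjective x
    rw [sumHom_toFun]
    rfl
  · funext x
    obtain ⟨p, rfl⟩ := (blk c).surjective x
    rw [sumHom_fib]
    rfl

end NCSet

/-- `σ{j 0, …, j (n-1)}`: the permutation of `∑ j` letters that moves the block number `s`
(of size `j s`) to the block position `σ s`. -/
def blockPerm {n : ℕ} (σ : Equiv.Perm (Fin n)) (j : Fin n → ℕ) :
    Equiv.Perm (Fin (∑ s, j s)) :=
  ((finSigmaFinEquiv.symm.trans (Equiv.sigmaCongrLeft' (β := fun s => Fin (j s)) σ)).trans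
    finSigmaFinEquiv).trans (finCongr (Equiv.sum_comp σ.symm j))

/-- `τ 0 ⊕ ⋯ ⊕ τ (n-1)`: the permutation of `∑ j` letters acting blockwise. -/
def dirSumPerm {n : ℕ} (j : Fin n → ℕ) (τ : ∀ s, Equiv.Perm (Fin (j s))) :
    Equiv.Perm (Fin (∑ s, j s)) :=
  (finSigmaFinEquiv.symm.trans (Equiv.sigmaCongrRight τ)).trans finSigmaFinEquiv

end SymHom
namespace SymHom

theorem sigma_castSucc {n : ℕ} (j : Fin (n+1) → ℕ) (i : Fin n) (t : Fin (j i.castSucc)) :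
    (finSigmaFinEquiv (n := j) ⟨i.castSucc, t⟩) = Fin.cast (Fin.sum_univ_castSucc j).symm
      (Fin.castAdd (j (Fin.last n)) (finSigmaFinEquiv (n := fun i => j i.castSucc) ⟨i, t⟩)) := by
  apply Fin.ext
  simp only [finSigmaFinEquiv_apply, Fin.val_cast, Fin.val_castAdd]
  rfl

theorem sigma_last {n : ℕ} (j : Fin (n+1) → ℕ) (t : Fin (j (Fin.last n))) :
    (finSigmaFinEquiv (n := j) ⟨Fin.last n, t⟩) = Fin.cast (Fin.sum_univ_castSucc j).symm
      (Fin.natAdd (∑ i : Fin n, j i.castSucc) t) := by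
  apply Fin.ext
  simp only [finSigmaFinEquiv_apply, Fin.val_cast, Fin.val_natAdd]
  rfl

theorem list_prod_ofFn_sigma {M : Type*} [Monoid M] :
    ∀ (n : ℕ) (j : Fin n → ℕ) (g : ∀ i, Fin (j i) → M),
    (List.ofFn fun i => (List.ofFn (g i)).prod).prod =
      (List.ofFn fun r : Fin (∑ i, j i) =>
        g (finSigmaFinEquiv.symm r).1 (finSigmaFinEquiv.symm r).2).prod := by
  intro n
  induction n with
  | zero =>
    intro j g
    rw [List.ofFn_congr (Fin.sum_univ_zero j)]
    simp
  | succ n ih =>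
    intro j g
    have hf : (fun r : Fin (∑ i, j i) =>
        g (finSigmaFinEquiv.symm r).1 (finSigmaFinEquiv.symm r).2) =
        Fin.append (fun r : Fin (∑ i : Fin n, j i.castSucc) =>
          g (finSigmaFinEquiv.symm r).1.castSucc (finSigmaFinEquiv.symm r).2)
          (g (Fin.last n)) ∘ Fin.cast (Fin.sum_univ_castSucc j) := by
      funext r
      obtain ⟨⟨i, t⟩, rfl⟩ := finSigmaFinEquiv.surjective r
      show (fun p : (i : Fin (n+1)) × Fin (j i) => g p.1 p.2) (finSigmaFinEquiv.symm _) = _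
      rw [Equiv.symm_apply_apply]
      induction i using Fin.lastCases with
      | last =>
        rw [sigma_last]
        simp
      | cast i =>
        rw [sigma_castSucc]
        simp only [Function.comp_apply, Fin.cast_cast, Fin.cast_eq_self, Fin.append_left]
        show _ = (fun p : (i : Fin n) × Fin (j i.castSucc) => g p.1.castSucc p.2)
          (finSigmaFinEquiv.symm _)
        rw [Equiv.symm_apply_apply]
    rw [hf, List.ofFn_succ', List.concat_eq_append, List.prod_append, ih]
    rw [show (Fin.append (fun r : Fin (∑ i : Fin n, j i.castSucc) =>
          g (finSigmaFinEquiv.symm r).1.castSucc (finSigmaFinEquiv.symm r).2)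
          (g (Fin.last n)) ∘ Fin.cast (Fin.sum_univ_castSucc j)) = fun i =>
          Fin.append (fun r : Fin (∑ i : Fin n, j i.castSucc) =>
          g (finSigmaFinEquiv.symm r).1.castSucc (finSigmaFinEquiv.symm r).2)
          (g (Fin.last n)) (Fin.cast (Fin.sum_univ_castSucc j) i) from rfl,
      ← List.ofFn_congr (Fin.sum_univ_castSucc j).symm, List.ofFn_fin_append,
      List.prod_append]
    simp

section Bsym

variable (k A : Type u) [CommRing k] [Ring A] [Algebra k A]

theorem exists_prod_update {ι : Type*} [DecidableEq ι] (l : List ι) (hl : l.Nodup) (a : ι → A)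
    (x : ι) (hx : x ∈ l) :
    ∃ p q : A, ∀ u : A, (l.map (Function.update a x u)).prod = p * u * q := by
  obtain ⟨s, t, rfl⟩ := List.append_of_mem hx
  rw [List.nodup_append] at hl
  obtain ⟨-, ht, hst⟩ := hl
  refine ⟨(s.map a).prod, (t.map a).prod, fun u => ?_⟩
  have h1 : s.map (Function.update a x u) = s.map a := by
    refine List.map_congr_left fun y hy => ?_
    exact Function.update_of_ne (fun h => hst y hy x (by simp) h) _ _
  have h2 : t.map (Function.update a x u) = t.map a := by
    refine List.map_congr_left fun y hy => ?_
    refine Function.update_of_ne (fun h => ?_) _ _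
    subst h
    simp at ht
    exact ht.1 hy
  simp [h1, h2, mul_assoc]

theorem prod_update_of_not_mem {ι : Type*} [DecidableEq ι] (l : List ι) (a : ι → A)
    (x : ι) (hx : x ∉ l) (u : A) :
    (l.map (Function.update a x u)).prod = (l.map a).prod := by
  congr 1
  refine List.map_congr_left fun y hy => Function.update_of_ne ?_ _ _
  rintro rfl
  exact hx hy

variable {A} in
/-- The tuple whose entry at `y` is the ordered product of the `a x`, for `x` in the preimage. -/
def pushTuple {m n : NCSet} (f : m ⟶ n) (a : Fin m.size → A) (y : Fin n.size) : A :=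
  ((NCSet.Hom.fib f y).map a).prod

variable {A} in
theorem pushTuple_update {m n : NCSet} (f : m ⟶ n) (a : Fin m.size → A) (x : Fin m.size) :
    ∃ p q : A, ∀ u, pushTuple f (Function.update a x u) =
      Function.update (pushTuple f a) (NCSet.Hom.toFun f x) (p * u * q) := by
  obtain ⟨p, q, h⟩ := exists_prod_update A (NCSet.Hom.fib f (NCSet.Hom.toFun f x))
    (NCSet.Hom.nodup f _) a x ((NCSet.Hom.mem_fib f _ _).mpr rfl)
  refine ⟨p, q, fun u => ?_⟩
  funext y
  by_cases hy : y = NCSet.Hom.toFun f x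
  · subst hy
    rw [Function.update_self]
    exact h u
  · rw [Function.update_of_ne hy]
    refine prod_update_of_not_mem A _ _ _ (fun hx => hy ?_) _
    exact ((NCSet.Hom.mem_fib f _ _).mp hx).symm

/-- The multilinear map `(a_x)_x ↦ ⨂_y ∏_{x ∈ f⁻¹(y)} a_x`. -/
noncomputable def pushMultilinear {m n : NCSet} (f : m ⟶ n) :
    MultilinearMap k (fun _ : Fin m.size => A) (⨂[k] _ : Fin n.size, A) :=
  MultilinearMap.mk' (fun a => PiTensorProduct.tprod k (pushTuple f a))
    (fun a x u v => by
      obtain ⟨p, q, h⟩ := pushTuple_update f a x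
      rw [h, h, h, ← MultilinearMap.map_update_add, mul_add, add_mul])
    (fun a x c u => by
      obtain ⟨p, q, h⟩ := pushTuple_update f a x
      rw [h, h, ← MultilinearMap.map_update_smul, mul_smul_comm, smul_mul_assoc])

/-- The action of a morphism on tensors: `⨂_x a_x ↦ ⨂_y ∏_{x ∈ f⁻¹(y)} a_x`, the product being
taken in the order of the preimage `f⁻¹(y)`. -/
noncomputable def pushTensor {m n : NCSet} (f : m ⟶ n) :
    (⨂[k] _ : Fin m.size, A) →ₗ[k] (⨂[k] _ : Fin n.size, A) :=
  PiTensorProduct.lift (pushMultilinear k A f)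

theorem pushTensor_tprod {m n : NCSet} (f : m ⟶ n) (a : Fin m.size → A) :
    pushTensor k A f (PiTensorProduct.tprod k a) = PiTensorProduct.tprod k (pushTuple f a) :=
  PiTensorProduct.lift.tprod _

variable {A} in
theorem pushTuple_id {m : NCSet} (a : Fin m.size → A) : pushTuple (𝟙 m) a = a := by
  funext y
  show (List.map a [y]).prod = a y
  simp

variable {A} in
theorem pushTuple_comp {m n l : NCSet} (f : m ⟶ n) (g : n ⟶ l) (a : Fin m.size → A) :
    pushTuple (f ≫ g) a = pushTuple g (pushTuple f a) := by
  funext z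
  show (List.map a ((NCSet.Hom.fib g z).flatMap (NCSet.Hom.fib f))).prod =
    (List.map (fun y => (List.map a (NCSet.Hom.fib f y)).prod) (NCSet.Hom.fib g z)).prod
  induction NCSet.Hom.fib g z with
  | nil => rfl
  | cons y t ih => simp [List.flatMap_cons, ih]

/-- The symmetric bar construction `B^{sym₊} A : ΔS₊ ⥤ k-Mod`, `n ↦ A^{⊗ n}`. -/
noncomputable def Bsym : NCSet ⥤ ModuleCat.{u} k where
  obj m := ModuleCat.of k (⨂[k] _ : Fin m.size, A)
  map f := ModuleCat.ofHom (pushTensor k A f)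
  map_id m := by
    refine ModuleCat.hom_ext (PiTensorProduct.ext (MultilinearMap.ext fun a => ?_))
    show pushTensor k A (𝟙 m) (PiTensorProduct.tprod k a) = PiTensorProduct.tprod k a
    rw [pushTensor_tprod, pushTuple_id]
  map_comp f g := by
    refine ModuleCat.hom_ext (PiTensorProduct.ext (MultilinearMap.ext fun a => ?_))
    show pushTensor k A (f ≫ g) (PiTensorProduct.tprod k a) =
      pushTensor k A g (pushTensor k A f (PiTensorProduct.tprod k a))
    rw [pushTensor_tprod, pushTensor_tprod, pushTensor_tprod, pushTuple_comp]

/-- The multilinear map `(V_0, …, V_{n-1}) ↦ V_0 ⊗ ⋯ ⊗ V_{n-1}`, from `∏ A^{⊗ c_i}` to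
`A^{⊗ ∑ c_i}`; it is computed by multiplying in the tensor algebra of `A`. -/
noncomputable def concat {n : ℕ} (c : Fin n → NCSet) :
    MultilinearMap k (fun i => ⨂[k] _ : Fin (c i).size, A)
      (⨂[k] _ : Fin (NCSet.sum c).size, A) :=
  ((DirectSum.component k ℕ (fun n => ⨂[k]^n A) (NCSet.sum c).size ∘ₗ
      (TensorAlgebra.toDirectSum (R := k) (M := A)).toLinearMap).compMultilinearMap
    (MultilinearMap.mkPiAlgebraFin k n (TensorAlgebra k A))).compLinearMap
    fun _ => TensorPower.toTensorAlgebra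

theorem concat_tprod {n : ℕ} (c : Fin n → NCSet) (a : ∀ i, Fin (c i).size → A) :
    concat k A c (fun i => PiTensorProduct.tprod k (a i)) =
      PiTensorProduct.tprod k (fun r => a ((NCSet.blk c).symm r).1 ((NCSet.blk c).symm r).2) := by
  show DirectSum.component k ℕ (fun n => ⨂[k]^n A) (NCSet.sum c).size
    (TensorAlgebra.toDirectSum (MultilinearMap.mkPiAlgebraFin k n (TensorAlgebra k A)
      (fun i => TensorPower.toTensorAlgebra (PiTensorProduct.tprod k (a i))))) = _
  rw [MultilinearMap.mkPiAlgebraFin_apply]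
  simp only [TensorPower.toTensorAlgebra_tprod, TensorAlgebra.tprod_apply]
  rw [list_prod_ofFn_sigma _ (fun i => (c i).size) (fun i x => TensorAlgebra.ι k (a i x))]
  show DirectSum.component k ℕ (fun n => ⨂[k]^n A) (NCSet.sum c).size
    (TensorAlgebra.toDirectSum (TensorAlgebra.tprod k A _ (fun r : Fin (∑ i, (c i).size) =>
      a (finSigmaFinEquiv.symm r).1 (finSigmaFinEquiv.symm r).2))) = _
  rw [TensorAlgebra.toDirectSum_tensorPower_tprod]
  exact DirectSum.component.lof_self _ _ _

end Bsym

end SymHom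
namespace SymHom

/-- `k[-]`: the free `k`-module on a set. -/
noncomputable def freeMod (k : Type u) [CommRing k] : Type ⥤ ModuleCat.{u} k where
  obj S := ModuleCat.of k (S →₀ k)
  map f := ModuleCat.ofHom (Finsupp.lmapDomain k k f)
  map_id S := by
    refine ModuleCat.hom_ext ?_
    exact Finsupp.lmapDomain_id k k
  map_comp f g := by
    refine ModuleCat.hom_ext ?_
    exact Finsupp.lmapDomain_comp k k f g

section TensorOver

variable {k : Type u} [CommRing k] {C : Type} [Category.{0} C]

open Classical in
/-- The relations `G(φ)(x) ⊗ y = x ⊗ F(φ)(y)` defining `G ⊗_C F`. -/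
noncomputable def tensorRel (F : C ⥤ ModuleCat.{u} k) (G : Cᵒᵖ ⥤ ModuleCat.{u} k) :
    Submodule k (⨁ c : C, (G.obj (op c)) ⊗[k] (F.obj c)) :=
  Submodule.span k
    {z | ∃ (c d : C) (φ : c ⟶ d) (x : G.obj (op d)) (y : F.obj c),
      z = DirectSum.lof k C (fun c => (G.obj (op c)) ⊗[k] (F.obj c)) c
            ((G.map φ.op).hom x ⊗ₜ[k] y)
        - DirectSum.lof k C (fun c => (G.obj (op c)) ⊗[k] (F.obj c)) d
            (x ⊗ₜ[k] (F.map φ).hom y)}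

/-- The map on `⨁_c G(c) ⊗ F(c)` induced by a natural transformation in the variable `G`. -/
noncomputable def tensorSumMap (F : C ⥤ ModuleCat.{u} k) {G G' : Cᵒᵖ ⥤ ModuleCat.{u} k}
    (η : G ⟶ G') : (⨁ c : C, (G.obj (op c)) ⊗[k] (F.obj c)) →ₗ[k]
      (⨁ c : C, (G'.obj (op c)) ⊗[k] (F.obj c)) :=
  DirectSum.lmap fun c => LinearMap.rTensor (F.obj c) (η.app (op c)).hom

theorem tensorSumMap_rel (F : C ⥤ ModuleCat.{u} k) {G G' : Cᵒᵖ ⥤ ModuleCat.{u} k}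
    (η : G ⟶ G') : tensorRel F G ≤ (tensorRel F G').comap (tensorSumMap F η) := by
  classical
  refine Submodule.span_le.mpr ?_
  rintro _ ⟨c, d, φ, x, y, rfl⟩
  refine Submodule.subset_span ⟨c, d, φ, (η.app (op d)).hom x, y, ?_⟩
  rw [map_sub]
  simp only [tensorSumMap, DirectSum.lmap_lof, LinearMap.rTensor_tmul]
  have h := congrArg (fun f => f.hom x) (η.naturality φ.op)
  have h' : (η.app (op c)).hom ((G.map φ.op).hom x) =
    (G'.map φ.op).hom ((η.app (op d)).hom x) := h
  rw [h']

/-- The tensor product `G ⊗_C F` of a contravariant and a covariant functor from `C` to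
`k`-modules, as a functor of `G`. -/
noncomputable def tensorOver (F : C ⥤ ModuleCat.{u} k) :
    (Cᵒᵖ ⥤ ModuleCat.{u} k) ⥤ ModuleCat.{u} k where
  obj G := ModuleCat.of k ((⨁ c : C, (G.obj (op c)) ⊗[k] (F.obj c)) ⧸ tensorRel F G)
  map {G G'} η := ModuleCat.ofHom
    (Submodule.mapQ (tensorRel F G) (tensorRel F G') (tensorSumMap F η) (tensorSumMap_rel F η))
  map_id G := by
    classical
    refine ModuleCat.hom_ext (Submodule.linearMap_qext _ (DirectSum.linearMap_ext k fun c =>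
      TensorProduct.ext' fun x y => ?_))
    simp [tensorSumMap]
  map_comp η θ := by
    classical
    refine ModuleCat.hom_ext (Submodule.linearMap_qext _ (DirectSum.linearMap_ext k fun c =>
      TensorProduct.ext' fun x y => ?_))
    simp [tensorSumMap]

instance (F : C ⥤ ModuleCat.{u} k) : (tensorOver F).Additive where
  map_add {G G'} η θ := by
    classical
    refine ModuleCat.hom_ext (Submodule.linearMap_qext _ (DirectSum.linearMap_ext k fun c =>
      TensorProduct.ext' fun x y => ?_))
    show (tensorRel F G').mkQ (tensorSumMap F (η + θ) (DirectSum.lof k C _ c (x ⊗ₜ[k] y))) =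
      (tensorRel F G').mkQ (tensorSumMap F η (DirectSum.lof k C _ c (x ⊗ₜ[k] y))) +
      (tensorRel F G').mkQ (tensorSumMap F θ (DirectSum.lof k C _ c (x ⊗ₜ[k] y)))
    rw [← map_add]
    congr 1
    simp [tensorSumMap]

/-- The class in `G ⊗_C F` of an elementary tensor `x ⊗ y`, with `x ∈ G(c)` and `y ∈ F(c)`. -/
noncomputable def tensorCls (F : C ⥤ ModuleCat.{u} k) (G : Cᵒᵖ ⥤ ModuleCat.{u} k) (c : C) :
    ((G.obj (op c)) ⊗[k] (F.obj c)) →ₗ[k] (tensorOver F).obj G :=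
  letI := Classical.decEq C
  (tensorRel F G).mkQ ∘ₗ DirectSum.lof k C (fun c => (G.obj (op c)) ⊗[k] (F.obj c)) c

end TensorOver

section EnoughProj

variable {k : Type u} [CommRing k] {D : Type} [Category.{0} D]

/-- A free functor with a surjection onto `F`. -/
noncomputable def freeCover (F : D ⥤ ModuleCat.{u} k) : D ⥤ ModuleCat.{u} k where
  obj e := ModuleCat.of k ((Σ d : D, (F.obj d) × (d ⟶ e)) →₀ k)
  map {e e'} φ := ModuleCat.ofHom (Finsupp.lmapDomain k k fun p => ⟨p.1, p.2.1, p.2.2 ≫ φ⟩)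
  map_id e := by
    refine ModuleCat.hom_ext (Finsupp.lhom_ext' fun p => LinearMap.ext_ring ?_)
    simp
  map_comp φ ψ := by
    refine ModuleCat.hom_ext (Finsupp.lhom_ext' fun p => LinearMap.ext_ring ?_)
    simp

/-- Natural transformations out of the free functor, from their values on generators. -/
noncomputable def freeCoverDesc (F : D ⥤ ModuleCat.{u} k) {E : D ⥤ ModuleCat.{u} k}
    (g : ∀ d, F.obj d → E.obj d) : freeCover F ⟶ E where
  app e := ModuleCat.ofHom
    (Finsupp.linearCombination k fun p : (Σ d : D, (F.obj d) × (d ⟶ e)) =>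
      (E.map p.2.2).hom (g p.1 p.2.1))
  naturality e e' φ := by
    refine ModuleCat.hom_ext (Finsupp.lhom_ext' fun p => LinearMap.ext_ring ?_)
    simp [freeCover]

theorem freeCoverDesc_single (F : D ⥤ ModuleCat.{u} k) {E : D ⥤ ModuleCat.{u} k}
    (g : ∀ d, F.obj d → E.obj d) (e : D) (p : Σ d : D, (F.obj d) × (d ⟶ e)) :
    ((freeCoverDesc F g).app e).hom (Finsupp.single p 1) = (E.map p.2.2).hom (g p.1 p.2.1) := by
  show Finsupp.linearCombination k _ _ = _
  simp

theorem freeCover_hom_ext (F : D ⥤ ModuleCat.{u} k) {E : D ⥤ ModuleCat.{u} k}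
    (a b : freeCover F ⟶ E) (h : ∀ d (x : F.obj d),
      (a.app d).hom (Finsupp.single ⟨d, x, 𝟙 d⟩ 1) = (b.app d).hom (Finsupp.single ⟨d, x, 𝟙 d⟩ 1)) :
    a = b := by
  refine NatTrans.ext (funext fun e => ?_)
  refine ModuleCat.hom_ext (Finsupp.lhom_ext' fun p => LinearMap.ext_ring ?_)
  obtain ⟨d, x, φ⟩ := p
  have key : ∀ a : freeCover F ⟶ E, (a.app e).hom (Finsupp.single ⟨d, x, φ⟩ 1) =
      (E.map φ).hom ((a.app d).hom (Finsupp.single ⟨d, x, 𝟙 d⟩ 1)) := by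
    intro a
    have h1 := congrArg (fun f => f.hom (Finsupp.single ⟨d, x, 𝟙 d⟩ 1)) (a.naturality φ)
    have h2 : (a.app e).hom (((freeCover F).map φ).hom (Finsupp.single ⟨d, x, 𝟙 d⟩ 1)) =
      (E.map φ).hom ((a.app d).hom (Finsupp.single ⟨d, x, 𝟙 d⟩ 1)) := h1
    rw [← h2]
    congr 1
    show _ = Finsupp.lmapDomain k k _ _
    simp
  show (a.app e).hom (Finsupp.single ⟨d, x, φ⟩ 1) = (b.app e).hom (Finsupp.single ⟨d, x, φ⟩ 1)
  rw [key, key, h]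

instance (F : D ⥤ ModuleCat.{u} k) : Projective (freeCover F) where
  factors {E X} f q hq := by
    have hs : ∀ d, Function.Surjective (q.app d).hom := fun d =>
      (ModuleCat.epi_iff_surjective _).mp inferInstance
    refine ⟨freeCoverDesc F fun d x => Function.surjInv (hs d)
      ((f.app d).hom (Finsupp.single ⟨d, x, 𝟙 d⟩ 1)), ?_⟩
    refine freeCover_hom_ext F _ _ fun d x => ?_
    show (q.app d).hom (((freeCoverDesc F _).app d).hom (Finsupp.single ⟨d, x, 𝟙 d⟩ 1)) = _
    rw [freeCoverDesc_single]
    simp [Function.surjInv_eq]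

instance : EnoughProjectives (D ⥤ ModuleCat.{u} k) where
  presentation F := ⟨{
    p := freeCover F
    projective := inferInstance
    f := freeCoverDesc F fun _ x => x
    epi := by
      have : ∀ d, Epi ((freeCoverDesc F fun _ x => x).app d) := fun d => by
        rw [ModuleCat.epi_iff_surjective]
        intro x
        refine ⟨Finsupp.single ⟨d, x, 𝟙 d⟩ 1, ?_⟩
        refine (freeCoverDesc_single F _ _ _).trans ?_
        simp
      exact NatTrans.epi_of_epi_app _ }⟩

end EnoughProj

section HS

variable (k : Type u) [CommRing k]

/-- `Tor_n^C(k, F)`: the `n`-th left derived functor of `- ⊗_C F`, evaluated at the constant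
functor `k`. -/
noncomputable def Tor {C : Type} [Category.{0} C] (n : ℕ) (F : C ⥤ ModuleCat.{u} k) :
    ModuleCat.{u} k :=
  ((tensorOver F).leftDerived n).obj ((Functor.const Cᵒᵖ).obj (ModuleCat.of k k))

/-- `ΔS`: the full subcategory of `ΔS₊` on the nonempty sets. -/
abbrev DeltaS : Type := ObjectProperty.FullSubcategory fun m : NCSet => 0 < m.size

variable (A : Type u) [Ring A] [Algebra k A]

/-- Symmetric homology `HS_n(A) = Tor_n^{ΔS}(k, B^{sym} A)`. -/
noncomputable def HS (n : ℕ) : ModuleCat.{u} k :=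
  Tor k n ((ObjectProperty.ι fun m : NCSet => 0 < m.size) ⋙ Bsym k A)

/-- The simplicial set `N(c \ ΔS₊)`, the nerve of the under-category, as a contravariant functor
of `c`. -/
def nerveUnder : NCSetᵒᵖ ⥤ SSet.{0} := Under.mapFunctor NCSet ⋙ nerveFunctor

/-- `k[N(- \ ΔS₊)]`, as a simplicial object in contravariant functors on `ΔS₊`. -/
noncomputable def kNerveUnder : SimplicialObject (NCSetᵒᵖ ⥤ ModuleCat.{u} k) :=
  (nerveUnder ⋙ (Functor.whiskeringRight SimplexCategoryᵒᵖ Type (ModuleCat.{u} k)).obj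
    (freeMod k)).flip

/-- The simplicial `k`-module `𝒴⁺A = k[N(- \ ΔS₊)] ⊗_{ΔS₊} B^{sym₊} A`. -/
noncomputable def YPlus : SimplicialObject (ModuleCat.{u} k) :=
  kNerveUnder k ⋙ tensorOver (Bsym k A)

/-- The class in `𝒴⁺A` of `x ⊗ V`, for a `p`-simplex `x` of `N(c \ ΔS₊)` and `V ∈ A^{⊗ c}`. -/
noncomputable def yCls (p : ℕ) (c : NCSet) (x : ComposableArrows (Under c) p) :
    (⨂[k] _ : Fin c.size, A) →ₗ[k] (YPlus k A) _⦋p⦌ :=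
  tensorCls (Bsym k A) ((kNerveUnder k).obj (op ⦋p⦌)) c ∘ₗ
    TensorProduct.mk k (ComposableArrows (Under c) p →₀ k) (⨂[k] _ : Fin c.size, A)
      (Finsupp.single x 1)

end HS

end SymHom
namespace SymHom

section Normalization

variable {k : Type u} [CommRing k]

/-- The submodule of degenerate elements of `X_n`, spanned by the elements that come from a
lower degree. -/
def degen (X : SimplicialObject (ModuleCat.{u} k)) (n : ℕ) : Submodule k (X _⦋n⦌) :=
  Submodule.span k {z | ∃ (m : ℕ) (_ : m < n) (θ : ⦋n⦌ ⟶ ⦋m⦌) (y : X _⦋m⦌),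
    z = (X.map θ.op).hom y}

theorem map_map_apply (X : SimplicialObject (ModuleCat.{u} k)) {a b c : ℕ} (θ : ⦋a⦌ ⟶ ⦋b⦌)
    (φ : ⦋b⦌ ⟶ ⦋c⦌) (y : X _⦋c⦌) :
    (X.map θ.op).hom ((X.map φ.op).hom y) = (X.map (θ ≫ φ).op).hom y := by
  rw [op_comp, X.map_comp]
  rfl

theorem map_mem_degen (X : SimplicialObject (ModuleCat.{u} k)) {n m : ℕ} (θ : ⦋n⦌ ⟶ ⦋m⦌)
    (hθ : ¬ Function.Injective θ.toOrderHom) (y : X _⦋m⦌) :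
    (X.map θ.op).hom y ∈ degen X n := by
  cases n with
  | zero => exact absurd (fun a b _ => Subsingleton.elim (α := Fin 1) a b) hθ
  | succ n =>
    obtain ⟨i, θ', rfl⟩ := SimplexCategory.eq_σ_comp_of_not_injective θ hθ
    refine Submodule.subset_span ⟨n, Nat.lt_succ_self n, SimplexCategory.σ i,
      (X.map θ'.op).hom y, ?_⟩
    rw [map_map_apply]

/-- The alternating sum of faces preserves degenerate elements. -/
theorem objD_degen (X : SimplicialObject (ModuleCat.{u} k)) (n : ℕ) :
    degen X (n + 1) ≤
      (degen X n).comap (AlgebraicTopology.AlternatingFaceMapComplex.objD X n).hom := by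
  refine Submodule.span_le.mpr ?_
  rintro _ ⟨m, hm, θ, y, rfl⟩
  have hθ : ¬ Function.Injective θ.toOrderHom := by
    intro h
    have := Fintype.card_le_of_injective _ h
    simp at this
    omega
  obtain ⟨j, θ', rfl⟩ := SimplexCategory.eq_σ_comp_of_not_injective θ hθ
  show (AlgebraicTopology.AlternatingFaceMapComplex.objD X n).hom _ ∈ degen X n
  rw [← map_map_apply]
  generalize (X.map θ'.op).hom y = y'
  have hsum : (AlgebraicTopology.AlternatingFaceMapComplex.objD X n).hom
      ((X.map (SimplexCategory.σ j).op).hom y') =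
      ∑ i : Fin (n + 2), (-1 : ℤ) ^ (i : ℕ) •
        (X.map (SimplexCategory.δ i ≫ SimplexCategory.σ j).op).hom y' := by
    simp only [AlgebraicTopology.AlternatingFaceMapComplex.objD, ModuleCat.hom_sum,
      LinearMap.sum_apply]
    refine Finset.sum_congr rfl fun i _ => ?_
    rw [← map_map_apply]
    rfl
  rw [hsum]
  rw [← Finset.add_sum_erase _ _ (Finset.mem_univ j.castSucc),
    ← Finset.add_sum_erase (Finset.univ.erase j.castSucc) _ (a := j.succ)
      (by simp [Fin.ext_iff]), ← add_assoc]
  have hcancel : (-1 : ℤ) ^ ((j.castSucc : Fin (n + 2)) : ℕ) •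
        (X.map (SimplexCategory.δ j.castSucc ≫ SimplexCategory.σ j).op).hom y' +
      (-1 : ℤ) ^ ((j.succ : Fin (n + 2)) : ℕ) •
        (X.map (SimplexCategory.δ j.succ ≫ SimplexCategory.σ j).op).hom y' = 0 := by
    rw [SimplexCategory.δ_comp_σ_self, SimplexCategory.δ_comp_σ_succ]
    simp [pow_succ]
  rw [hcancel, zero_add]
  refine Submodule.sum_mem _ fun i hi => ?_
  refine zsmul_mem (map_mem_degen X _ (fun hinj => ?_) y') _
  simp only [Finset.mem_erase, Finset.mem_univ, and_true, ne_eq] at hi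
  obtain ⟨h1, h2⟩ := hi
  obtain ⟨a, ha⟩ := Fin.exists_succAbove_eq (x := j.castSucc) (y := i) (Ne.symm h2)
  obtain ⟨b, hb⟩ := Fin.exists_succAbove_eq (x := j.succ) (y := i) (Ne.symm h1)
  have hab : a = b := by
    apply hinj
    show (SimplexCategory.σ j).toOrderHom ((SimplexCategory.δ i).toOrderHom a) =
      (SimplexCategory.σ j).toOrderHom ((SimplexCategory.δ i).toOrderHom b)
    show Fin.predAbove j (i.succAbove a) = Fin.predAbove j (i.succAbove b)
    rw [ha, hb]
    simp
  subst hab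
  exact absurd (ha.symm.trans hb) (by simp [Fin.ext_iff])

/-- The normalized complex `𝒩X`: in degree `n` the quotient of `X_n` by the degenerate elements,
with the differential induced by the alternating sum of the faces. -/
noncomputable def normalized (X : SimplicialObject (ModuleCat.{u} k)) :
    ChainComplex (ModuleCat.{u} k) ℕ :=
  ChainComplex.of (fun n => ModuleCat.of k (X _⦋n⦌ ⧸ degen X n))
    (fun n => ModuleCat.ofHom (Submodule.mapQ (degen X (n + 1)) (degen X n)
      (AlgebraicTopology.AlternatingFaceMapComplex.objD X n).hom (objD_degen X n)))
    (fun n => by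
      refine ModuleCat.hom_ext (Submodule.linearMap_qext _ (LinearMap.ext fun x => ?_))
      show (degen X n).mkQ ((AlgebraicTopology.AlternatingFaceMapComplex.objD X n).hom
        ((AlgebraicTopology.AlternatingFaceMapComplex.objD X (n + 1)).hom x)) = 0
      have h := congrArg (fun f => f.hom x)
        (AlgebraicTopology.AlternatingFaceMapComplex.d_squared X n)
      have h' : (AlgebraicTopology.AlternatingFaceMapComplex.objD X n).hom
        ((AlgebraicTopology.AlternatingFaceMapComplex.objD X (n + 1)).hom x) = 0 := h
      rw [h', map_zero])

theorem map_degen {X Y : SimplicialObject (ModuleCat.{u} k)} (f : X ⟶ Y) (n : ℕ) :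
    degen X n ≤ (degen Y n).comap (f.app (op ⦋n⦌)).hom := by
  refine Submodule.span_le.mpr ?_
  rintro _ ⟨m, hm, θ, y, rfl⟩
  refine Submodule.subset_span ⟨m, hm, θ, (f.app (op ⦋m⦌)).hom y, ?_⟩
  exact congrArg (fun f => f.hom y) (f.naturality θ.op)

/-- The map of normalized complexes induced by a map of simplicial modules. -/
noncomputable def normalizedMap {X Y : SimplicialObject (ModuleCat.{u} k)} (f : X ⟶ Y) :
    normalized X ⟶ normalized Y :=
  { f := fun n => ModuleCat.ofHom (Submodule.mapQ (degen X n) (degen Y n)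
      (f.app (op ⦋n⦌)).hom (map_degen f n))
    comm' := fun i n hn => by
      obtain rfl : n + 1 = i := hn
      refine ModuleCat.hom_ext (Submodule.linearMap_qext _ (LinearMap.ext fun x => ?_))
      simp only [normalized, ChainComplex.of_d]
      show (degen Y n).mkQ ((AlgebraicTopology.AlternatingFaceMapComplex.objD Y n).hom
        ((f.app (op ⦋n + 1⦌)).hom x)) = (degen Y n).mkQ ((f.app (op ⦋n⦌)).hom
          ((AlgebraicTopology.AlternatingFaceMapComplex.objD X n).hom x))
      congr 1
      simp only [AlgebraicTopology.AlternatingFaceMapComplex.objD, ModuleCat.hom_sum,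
        LinearMap.sum_apply, map_sum]
      refine Finset.sum_congr rfl fun i _ => ?_
      have h : (Y.δ i).hom ((f.app (op ⦋n + 1⦌)).hom x) =
          (f.app (op ⦋n⦌)).hom ((X.δ i).hom x) :=
        (congrArg (fun g => g.hom x) (f.naturality (SimplexCategory.δ i).op)).symm
      show (-1 : ℤ) ^ (i : ℕ) • (Y.δ i).hom _ = (f.app _).hom ((-1 : ℤ) ^ (i : ℕ) • (X.δ i).hom x)
      rw [map_zsmul, h] }

end Normalization

section Multi

variable {k : Type u} [CommRing k]

/-- The underlying (ungraded) module `⨁ K_p` of a complex. -/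
abbrev Tot (K : ChainComplex (ModuleCat.{u} k) ℕ) : Type u := ⨁ p : ℕ, K.X p

/-- The inclusion of the summand of degree `p`. -/
noncomputable abbrev Tot.of (K : ChainComplex (ModuleCat.{u} k) ℕ) (p : ℕ) : K.X p →ₗ[k] Tot K :=
  DirectSum.lof k ℕ (fun p => K.X p) p

/-- The differential of `K`, on `⨁ K_p`. -/
noncomputable def Tot.d (K : ChainComplex (ModuleCat.{u} k) ℕ) : Tot K →ₗ[k] Tot K :=
  DirectSum.toModule k ℕ _ fun p => Tot.of K (p - 1) ∘ₗ (K.d p (p - 1)).hom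

/-- The grading involution `x ↦ (-1)^{|x|} x`. -/
noncomputable def Tot.sgn (K : ChainComplex (ModuleCat.{u} k) ℕ) : Tot K →ₗ[k] Tot K :=
  DirectSum.toModule k ℕ _ fun p => ((-1 : k) ^ p) • Tot.of K p

/-- The map on `⨁ K_p` induced by a chain map. -/
noncomputable def Tot.map {K L : ChainComplex (ModuleCat.{u} k) ℕ} (f : K ⟶ L) :
    Tot K →ₗ[k] Tot L :=
  DirectSum.lmap fun p => (f.f p).hom

/-- A multilinear map `f(x; y_0, …, y_{n-1})` is a chain map `X ⊗ Y_0 ⊗ ⋯ ⊗ Y_{n-1} ⟶ Z` from the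
tensor product of complexes: it adds degrees, and satisfies the Leibniz rule
`d f(x; y) = f(d x; y) + ∑ i, (-1)^{|x| + |y_0| + ⋯ + |y_{i-1}|} f(x; y_0, …, d y_i, …, y_{n-1})`. -/
structure IsChainMultimap {n : ℕ} {X : ChainComplex (ModuleCat.{u} k) ℕ}
    {Y : Fin n → ChainComplex (ModuleCat.{u} k) ℕ} {Z : ChainComplex (ModuleCat.{u} k) ℕ}
    (f : Tot X →ₗ[k] MultilinearMap k (fun i => Tot (Y i)) (Tot Z)) : Prop where
  degree : ∀ (a : ℕ) (q : Fin n → ℕ) (x : X.X a) (y : ∀ i, (Y i).X (q i)),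
    ∃ z, f (Tot.of X a x) (fun i => Tot.of (Y i) (q i) (y i)) = Tot.of Z (a + ∑ i, q i) z
  leibniz : ∀ (x : Tot X) (y : ∀ i, Tot (Y i)), Tot.d Z (f x y) = f (Tot.d X x) y +
    ∑ i, f (Tot.sgn X x) fun j =>
      if j < i then Tot.sgn (Y j) (y j) else if j = i then Tot.d (Y j) (y j) else y j

/-- A map `X_0 ⊗̂ ⋯ ⊗̂ X_{n-1} ⟶ Z` from the degreewise tensor product of simplicial modules:
a multilinear map in each degree, compatible with the simplicial operators. -/
structure SMultimap {n : ℕ} (X : Fin n → SimplicialObject (ModuleCat.{u} k))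
    (Z : SimplicialObject (ModuleCat.{u} k)) where
  app (p : ℕ) : MultilinearMap k (fun i => (X i) _⦋p⦌) (Z _⦋p⦌)
  naturality : ∀ {p q : ℕ} (θ : ⦋q⦌ ⟶ ⦋p⦌) (x : ∀ i, (X i) _⦋p⦌),
    app q (fun i => ((X i).map θ.op).hom (x i)) = (Z.map θ.op).hom (app p x)

/-- A `(q 0, …, q (n-1))`-shuffle, recorded as a word of length `∑ q` in the letters
`0, …, n-1`, the letter `i` occurring `q i` times. -/
def Shuffle {n : ℕ} (q : Fin n → ℕ) : Type :=
  {w : Fin (∑ i, q i) → Fin n // ∀ i, (Finset.univ.filter fun t => w t = i).card = q i}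

instance {n : ℕ} (q : Fin n → ℕ) : Fintype (Shuffle q) := by
  unfold Shuffle
  infer_instance

/-- The sign of a shuffle: `(-1)` to the number of inversions of the word. -/
def Shuffle.sign {n : ℕ} {q : Fin n → ℕ} (w : Shuffle q) : ℤ :=
  (-1) ^ (Finset.univ.filter fun t : Fin (∑ i, q i) × Fin (∑ i, q i) =>
    t.1 < t.2 ∧ w.1 t.2 < w.1 t.1).card

/-- The degeneracy operator of a shuffle for the factor `i`: the monotone surjection
`[∑ q] → [q i]` that counts the occurrences of the letter `i` before a given place. -/
def Shuffle.proj {n : ℕ} {q : Fin n → ℕ} (w : Shuffle q) (i : Fin n) :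
    ⦋∑ i, q i⦌ ⟶ ⦋q i⦌ :=
  SimplexCategory.mkHom
    { toFun := fun s => ⟨(Finset.univ.filter fun t : Fin (∑ i, q i) =>
          t.castSucc < s ∧ w.1 t = i).card, by
        refine Nat.lt_succ_of_le (le_trans (Finset.card_le_card ?_) (w.2 i).le)
        intro t ht
        simp only [Finset.mem_filter, Finset.mem_univ, true_and] at ht ⊢
        exact ht.2⟩
      monotone' := fun s s' h => by
        refine Fin.mk_le_mk.mpr (Finset.card_le_card ?_)
        intro t ht
        simp only [Finset.mem_filter, Finset.mem_univ, true_and] at ht ⊢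
        exact ⟨ht.1.trans_le h, ht.2⟩ }

theorem multiQuot_aux {n : ℕ} {M : Fin n → Type u} [∀ i, AddCommGroup (M i)]
    [∀ i, Module k (M i)] {P : Type u} [AddCommGroup P] [Module k P]
    (N : ∀ i, Submodule k (M i)) (f : MultilinearMap k M P)
    (hf : ∀ x i, x i ∈ N i → f x = 0) (x y : ∀ i, M i)
    (hxy : ∀ i, (N i).mkQ (x i) = (N i).mkQ (y i)) : f x = f y := by
  have h : ∀ s : Finset (Fin n), f (s.piecewise x y) = f y := by
    intro s
    induction s using Finset.induction_on with
    | empty => simp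
    | insert i s his ih =>
      rw [← ih]
      have h1 : (insert i s).piecewise x y =
          Function.update (s.piecewise x y) i (y i + (x i - y i)) := by
        rw [Finset.piecewise_insert]
        simp
      rw [h1, MultilinearMap.map_update_add]
      have h2 : Function.update (s.piecewise x y) i (y i) = s.piecewise x y := by
        rw [Function.update_eq_self_iff]
        simp [his]
      rw [h2, hf (Function.update (s.piecewise x y) i (x i - y i)) i (by
        rw [Function.update_self]
        exact (Submodule.Quotient.eq _).mp (hxy i)), add_zero]
  simpa using h Finset.univ

/-- A multilinear map that vanishes as soon as one of its arguments lies in a given submodule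
descends to the quotients. -/
noncomputable def multiQuot {n : ℕ} {M : Fin n → Type u} [∀ i, AddCommGroup (M i)]
    [∀ i, Module k (M i)] {P : Type u} [AddCommGroup P] [Module k P]
    (N : ∀ i, Submodule k (M i)) (f : MultilinearMap k M P)
    (hf : ∀ x i, x i ∈ N i → f x = 0) : MultilinearMap k (fun i => M i ⧸ N i) P :=
  MultilinearMap.mk' (fun x => f fun i => Function.surjInv (N i).mkQ_surjective (x i))
    (fun x i a b => by
      set r : ∀ j, M j := fun j => Function.surjInv (N j).mkQ_surjective (x j) with hr
      have h : ∀ c : M i ⧸ N i, ∀ c' : M i, (N i).mkQ c' = c →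
          f (fun j => Function.surjInv (N j).mkQ_surjective (Function.update x i c j)) =
            f (Function.update r i c') := by
        intro c c' hc
        refine multiQuot_aux N f hf _ _ fun j => ?_
        rw [Function.surjInv_eq (N j).mkQ_surjective]
        by_cases hj : j = i
        · subst hj
          simp [← hc]
        · simp [hj, hr, Function.surjInv_eq (N j).mkQ_surjective]
      obtain ⟨a', ha⟩ := (N i).mkQ_surjective a
      obtain ⟨b', hb⟩ := (N i).mkQ_surjective b
      rw [h a a' ha, h b b' hb, h (a + b) (a' + b') (by rw [map_add, ha, hb]),
        MultilinearMap.map_update_add])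
    (fun x i t a => by
      set r : ∀ j, M j := fun j => Function.surjInv (N j).mkQ_surjective (x j) with hr
      have h : ∀ c : M i ⧸ N i, ∀ c' : M i, (N i).mkQ c' = c →
          f (fun j => Function.surjInv (N j).mkQ_surjective (Function.update x i c j)) =
            f (Function.update r i c') := by
        intro c c' hc
        refine multiQuot_aux N f hf _ _ fun j => ?_
        rw [Function.surjInv_eq (N j).mkQ_surjective]
        by_cases hj : j = i
        · subst hj
          simp [← hc]
        · simp [hj, hr, Function.surjInv_eq (N j).mkQ_surjective]
      obtain ⟨a', ha⟩ := (N i).mkQ_surjective a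
      rw [h a a' ha, h (t • a) (t • a') (by rw [map_smul, ha]),
        MultilinearMap.map_update_smul])

theorem multiQuot_mk {n : ℕ} {M : Fin n → Type u} [∀ i, AddCommGroup (M i)]
    [∀ i, Module k (M i)] {P : Type u} [AddCommGroup P] [Module k P]
    (N : ∀ i, Submodule k (M i)) (f : MultilinearMap k M P)
    (hf : ∀ x i, x i ∈ N i → f x = 0) (x : ∀ i, M i) :
    multiQuot N f hf (fun i => (N i).mkQ (x i)) = f x :=
  multiQuot_aux N f hf _ _ fun i => Function.surjInv_eq (N i).mkQ_surjective _

/-- A multilinear map vanishing on products of subsets vanishes on the products of their spans. -/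
theorem multilinear_eq_zero_of_span {n : ℕ} {M : Fin n → Type u} [∀ i, AddCommGroup (M i)]
    [∀ i, Module k (M i)] {P : Type u} [AddCommGroup P] [Module k P] (f : MultilinearMap k M P)
    (S : ∀ i, Set (M i)) (h : ∀ x, (∀ i, x i ∈ S i) → f x = 0) (x : ∀ i, M i)
    (hx : ∀ i, x i ∈ Submodule.span k (S i)) : f x = 0 := by
  have key : ∀ (s : Finset (Fin n)) (x : ∀ i, M i), (∀ i ∈ s, x i ∈ Submodule.span k (S i)) →
      (∀ i ∉ s, x i ∈ S i) → f x = 0 := by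
    intro s
    induction s using Finset.induction_on with
    | empty => exact fun x _ hx => h x fun i => hx i (by simp)
    | insert i s his ih =>
      intro x hx hx'
      have hlin : ∀ a ∈ Submodule.span k (S i), f (Function.update x i a) = 0 := by
        intro a ha
        induction ha using Submodule.span_induction with
        | mem a ha =>
          refine ih _ (fun j hj => ?_) (fun j hj => ?_)
          · have : j ≠ i := fun e => his (e ▸ hj)
            rw [Function.update_of_ne this]
            exact hx j (Finset.mem_insert_of_mem hj)
          · by_cases e : j = i
            · subst e
              simpa using ha
            · rw [Function.update_of_ne e]
              exact hx' j (by simp [e, hj])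
        | zero => exact f.map_coord_zero i (by simp)
        | add a b _ _ ha hb => rw [f.map_update_add, ha, hb, add_zero]
        | smul c a _ ha => rw [f.map_update_smul, ha, smul_zero]
      simpa using hlin (x i) (hx i (Finset.mem_insert_self i s))
  exact key Finset.univ x (fun i _ => hx i) (fun i hi => absurd (Finset.mem_univ i) hi)

variable {n : ℕ} {X : Fin n → SimplicialObject (ModuleCat.{u} k)}
  {Z : SimplicialObject (ModuleCat.{u} k)}

/-- The sum over all shuffles `w` of `± f(w_0^* x_0, …, w_{n-1}^* x_{n-1})`, modulo degenerate
elements. -/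
noncomputable def shuffleSum (f : SMultimap X Z) (q : Fin n → ℕ) :
    MultilinearMap k (fun i => (X i) _⦋q i⦌) (Z _⦋∑ i, q i⦌ ⧸ degen Z (∑ i, q i)) :=
  (degen Z (∑ i, q i)).mkQ.compMultilinearMap
    (∑ w : Shuffle q, w.sign •
      (f.app (∑ i, q i)).compLinearMap fun i => ((X i).map (w.proj i).op).hom)

theorem Shuffle.proj_succ {q : Fin n → ℕ} (w : Shuffle q) (i : Fin n) (t : Fin (∑ i, q i)) :
    ((w.proj i).toOrderHom t.succ : ℕ) =
      ((w.proj i).toOrderHom t.castSucc : ℕ) + if w.1 t = i then 1 else 0 := by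
  show (Finset.univ.filter fun s : Fin (∑ i, q i) => s.castSucc < t.succ ∧ w.1 s = i).card =
    (Finset.univ.filter fun s : Fin (∑ i, q i) => s.castSucc < t.castSucc ∧ w.1 s = i).card + _
  have hle : ∀ s : Fin (∑ i, q i), s.castSucc < t.succ ↔ s.castSucc < t.castSucc ∨ s = t := by
    intro s
    rw [Fin.lt_def, Fin.lt_def, Fin.ext_iff]
    simp only [Fin.val_castSucc, Fin.val_succ]
    omega
  split_ifs with h
  · rw [← Finset.card_insert_of_notMem (a := t) (by simp)]
    congr 1
    ext s
    simp only [Finset.mem_filter, Finset.mem_univ, true_and, Finset.mem_insert, hle]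
    constructor
    · rintro ⟨h1 | h1, h2⟩
      · exact Or.inr ⟨h1, h2⟩
      · exact Or.inl h1
    · rintro (rfl | ⟨h1, h2⟩)
      · exact ⟨Or.inr rfl, h⟩
      · exact ⟨Or.inl h1, h2⟩
  · rw [add_zero]
    congr 1
    ext s
    simp only [Finset.mem_filter, Finset.mem_univ, true_and, hle]
    constructor
    · rintro ⟨h1 | rfl, h2⟩
      · exact ⟨h1, h2⟩
      · exact absurd h2 h
    · rintro ⟨h1, h2⟩
      exact ⟨Or.inl h1, h2⟩

theorem Shuffle.exists_collapse {q : Fin n → ℕ} (w : Shuffle q) (i : Fin n) {m : ℕ}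
    (θ : ⦋q i⦌ ⟶ ⦋m⦌) (hm : m < q i) :
    ∃ t : Fin (∑ i, q i), (∀ j, j ≠ i → (w.proj j).toOrderHom t.castSucc =
        (w.proj j).toOrderHom t.succ) ∧
      (w.proj i ≫ θ).toOrderHom t.castSucc = (w.proj i ≫ θ).toOrderHom t.succ := by
  obtain ⟨l, hl⟩ : ∃ l : Fin (q i), θ.toOrderHom l.castSucc = θ.toOrderHom l.succ := by
    by_contra! hcon
    have hs : StrictMono θ.toOrderHom := Fin.strictMono_iff_lt_succ.mpr fun l =>
      lt_of_le_of_ne (θ.toOrderHom.monotone (Fin.castSucc_lt_succ).le) (hcon l)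
    have := Fintype.card_le_of_injective _ hs.injective
    simp at this
    omega
  obtain ⟨t, ht, hti⟩ : ∃ t : Fin (∑ i, q i),
      ((w.proj i).toOrderHom t.castSucc : ℕ) = l ∧ w.1 t = i := by
    by_contra! hcon
    have hle : ∀ s : Fin (∑ i, q i + 1), ((w.proj i).toOrderHom s : ℕ) ≤ l := by
      intro s
      induction s using Fin.induction with
      | zero =>
        have h0 : ((w.proj i).toOrderHom (0 : Fin (∑ i, q i + 1)) : ℕ) = 0 := by
          show (Finset.univ.filter fun t : Fin (∑ i, q i) => t.castSucc < 0 ∧ w.1 t = i).card = 0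
          simp
        exact h0.le.trans (Nat.zero_le _)
      | succ t ih =>
        rw [w.proj_succ]
        split_ifs with h
        · have h3 : ((w.proj i).toOrderHom t.castSucc : ℕ) ≠ l := fun e => hcon t e h
          omega
        · omega
    have hlast : ((w.proj i).toOrderHom (Fin.last (∑ i, q i)) : ℕ) = q i := by
      refine Eq.trans ?_ (w.2 i)
      show (Finset.univ.filter fun s : Fin (∑ i, q i) =>
        s.castSucc < Fin.last _ ∧ w.1 s = i).card = _
      congr 1
      ext s
      simp [Fin.castSucc_lt_last]
    have := hle (Fin.last _)
    have := l.2
    omega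
  refine ⟨t, fun j hj => Fin.ext ?_, ?_⟩
  · have := w.proj_succ j t
    rw [if_neg (fun e => hj (e.symm.trans hti))] at this
    exact this.symm
  · have h1 : (w.proj i).toOrderHom t.castSucc = l.castSucc := Fin.ext ht
    have h2 : (w.proj i).toOrderHom t.succ = l.succ := by
      refine Fin.ext ?_
      rw [w.proj_succ, if_pos hti, ht]
      rfl
    show θ.toOrderHom ((w.proj i).toOrderHom t.castSucc) =
      θ.toOrderHom ((w.proj i).toOrderHom t.succ)
    rw [h1, h2, hl]

theorem exists_map_eq_of_collapse (Y : SimplicialObject (ModuleCat.{u} k)) {p m : ℕ}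
    (φ : ⦋p + 1⦌ ⟶ ⦋m⦌) (t : Fin (p + 1))
    (h : φ.toOrderHom t.castSucc = φ.toOrderHom t.succ) (y : Y _⦋m⦌) :
    ∃ y', (Y.map φ.op).hom y = (Y.map (SimplexCategory.σ t).op).hom y' := by
  refine ⟨(Y.map (SimplexCategory.δ t.succ ≫ φ).op).hom y, ?_⟩
  rw [map_map_apply]
  congr 4
  refine SimplexCategory.Hom.ext _ _ (OrderHom.ext _ _ (funext fun a => ?_))
  show φ.toOrderHom a = φ.toOrderHom (t.succ.succAbove (t.predAbove a))
  by_cases ha : a = t.succ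
  · subst ha
    rw [← h]
    simp
  · simp [ha]

theorem app_mem_degen (f : SMultimap X Z) {P : ℕ} (t : Fin P) (u : ∀ j, (X j) _⦋P⦌)
    (h : ∀ j, ∃ (m : ℕ) (φ : ⦋P⦌ ⟶ ⦋m⦌) (y : (X j) _⦋m⦌),
      φ.toOrderHom t.castSucc = φ.toOrderHom t.succ ∧ u j = ((X j).map φ.op).hom y) :
    f.app P u ∈ degen Z P := by
  cases P with
  | zero => exact t.elim0
  | succ P =>
    have h' : ∀ j, ∃ y', u j = ((X j).map (SimplexCategory.σ t).op).hom y' := by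
      intro j
      obtain ⟨m, φ, y, h1, h2⟩ := h j
      rw [h2]
      exact exists_map_eq_of_collapse (X j) φ t h1 y
    choose y' hy' using h'
    obtain rfl : u = fun j => ((X j).map (SimplexCategory.σ t).op).hom (y' j) := funext hy'
    rw [f.naturality]
    exact Submodule.subset_span ⟨P, Nat.lt_succ_self P, SimplexCategory.σ t, _, rfl⟩

theorem shuffleSum_degen (f : SMultimap X Z) (q : Fin n → ℕ) (x : ∀ i, (X i) _⦋q i⦌) (i : Fin n)
    (hi : x i ∈ degen (X i) (q i)) : shuffleSum f q x = 0 := by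
  refine multilinear_eq_zero_of_span (shuffleSum f q)
    (fun j => if j = i then {z | ∃ (m : ℕ) (_ : m < q j) (θ : ⦋q j⦌ ⟶ ⦋m⦌) (y : (X j) _⦋m⦌),
      z = ((X j).map θ.op).hom y} else Set.univ) ?_ x ?_
  · intro x hx
    have hxi := hx i
    rw [if_pos rfl] at hxi
    obtain ⟨m, hm, θ, y, hy⟩ := hxi
    show (degen Z (∑ i, q i)).mkQ ((∑ w : Shuffle q, w.sign •
      (f.app (∑ i, q i)).compLinearMap fun i => ((X i).map (w.proj i).op).hom) x) = 0
    rw [_root_.sum_apply, map_sum]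
    refine Finset.sum_eq_zero fun w _ => ?_
    show (degen Z (∑ i, q i)).mkQ (w.sign •
      (f.app (∑ i, q i)) fun i => ((X i).map (w.proj i).op).hom (x i)) = 0
    rw [map_zsmul]
    refine (congrArg (w.sign • ·) ?_).trans (smul_zero _)
    rw [Submodule.mkQ_apply, Submodule.Quotient.mk_eq_zero]
    obtain ⟨t, ht, hti⟩ := w.exists_collapse i θ hm
    have hx' : ∀ j, ∃ (m : ℕ) (φ : ⦋∑ i, q i⦌ ⟶ ⦋m⦌) (y : (X j) _⦋m⦌),
        φ.toOrderHom t.castSucc = φ.toOrderHom t.succ ∧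
        ((X j).map (w.proj j).op).hom (x j) = ((X j).map φ.op).hom y := by
      intro j
      by_cases hj : j = i
      · subst hj
        exact ⟨m, w.proj j ≫ θ, y, hti, by rw [hy, map_map_apply]⟩
      · exact ⟨q j, w.proj j, x j, ht j hj, rfl⟩
    exact app_mem_degen f t _ hx'
  · intro j
    by_cases hj : j = i
    · subst hj
      rw [if_pos rfl]
      exact hi
    · simp [hj]

/-- The map of normalized complexes `𝒩X_0 ⊗ ⋯ ⊗ 𝒩X_{n-1} ⟶ 𝒩Z` induced by a map
`f : X_0 ⊗̂ ⋯ ⊗̂ X_{n-1} ⟶ Z` of simplicial modules: the composite of the Eilenberg–Zilber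
shuffle map with `𝒩f`. -/
noncomputable def shuffleMap (f : SMultimap X Z) :
    MultilinearMap k (fun i => Tot (normalized (X i))) (Tot (normalized Z)) :=
  MultilinearMap.fromDirectSumEquiv (R := k)
    (M := fun i p => (normalized (X i)).X p) fun q =>
      (Tot.of (normalized Z) (∑ i, q i)).compMultilinearMap
        (multiQuot (fun i => degen (X i) (q i)) (shuffleSum f q) (shuffleSum_degen f q))

end Multi

end SymHom
namespace SymHom

section Operads

variable (k : Type u) [CommRing k]

/-- A module with a family of submodules of homogeneous elements. -/
structure GMod where
  carrier : Type u
  [grp : AddCommGroup carrier]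
  [mod : Module k carrier]
  homog : ℕ → Submodule k carrier

attribute [instance] GMod.grp GMod.mod

variable {k}

/-- A module, in degree `0`. -/
def GMod.ofModule (M : ModuleCat.{u} k) : GMod k where
  carrier := M
  homog d := if d = 0 then ⊤ else ⊥

/-- The graded module underlying a complex. -/
noncomputable def GMod.tot (K : ChainComplex (ModuleCat.{u} k) ℕ) : GMod k where
  carrier := Tot K
  homog d := LinearMap.range (Tot.of K d)

variable (k) in
/-- The data of an operad in graded modules: structure maps
`V(n) ⊗ V(j_0) ⊗ ⋯ ⊗ V(j_{n-1}) → V(j_0 + ⋯ + j_{n-1})`, a unit and a right action of the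
symmetric groups. -/
structure OperadData where
  V : ℕ → GMod k
  γ : ∀ (n : ℕ) (j : Fin n → ℕ), (V n).carrier →ₗ[k]
    MultilinearMap k (fun s => (V (j s)).carrier) (V (∑ s, j s)).carrier
  one : (V 1).carrier
  act : ∀ n, Equiv.Perm (Fin n) → (V n).carrier →ₗ[k] (V n).carrier

/-- Transport along an equality of arities. -/
def OperadData.castV (O : OperadData k) {a b : ℕ} (h : a = b) (x : (O.V a).carrier) :
    (O.V b).carrier := h ▸ x

theorem sum_blocks {n : ℕ} (j : Fin n → ℕ) (i : ∀ s, Fin (j s) → ℕ) :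
    ∑ r : Fin (∑ s, j s), i (finSigmaFinEquiv.symm r).1 (finSigmaFinEquiv.symm r).2 =
      ∑ s, ∑ t, i s t := by
  rw [Equiv.sum_comp finSigmaFinEquiv.symm fun p : (s : Fin n) × Fin (j s) => i p.1 p.2,
    Fintype.sum_sigma]

/-- The exponent of the Koszul sign of the permutation `σ` of factors of degrees `b`. -/
def koszul {n : ℕ} (σ : Equiv.Perm (Fin n)) (b : Fin n → ℕ) : ℕ :=
  ∑ p : Fin n × Fin n with p.1 < p.2 ∧ σ p.2 < σ p.1, b p.1 * b p.2

/-- The exponent of the Koszul sign of the rearrangement of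
`y_0, …, y_{n-1}, z_{0,0}, …` into `y_0, z_{0,0}, z_{0,1}, …, y_1, z_{1,0}, …`,
the factors being of degrees `b s` and `c s t`. -/
def koszulShuffle {n : ℕ} {j : Fin n → ℕ} (b : Fin n → ℕ) (c : ∀ s, Fin (j s) → ℕ) : ℕ :=
  ∑ p : Fin n × Fin n with p.1 < p.2, b p.2 * ∑ t, c p.1 t

/-- The axioms of an operad: a right action of the symmetric groups, associativity, left and right
unit, and the two equivariance axioms. -/
structure IsOperad (O : OperadData k) : Prop where
  act_one : ∀ n x, O.act n 1 x = x
  act_mul : ∀ n σ τ x, O.act n (σ * τ) x = O.act n τ (O.act n σ x)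
  assoc : ∀ (n : ℕ) (j : Fin n → ℕ) (i : ∀ s, Fin (j s) → ℕ) (x : (O.V n).carrier)
    (b : Fin n → ℕ) (y : ∀ s, (O.V (j s)).carrier) (_ : ∀ s, y s ∈ (O.V (j s)).homog (b s))
    (c : ∀ s, Fin (j s) → ℕ) (z : ∀ s t, (O.V (i s t)).carrier)
    (_ : ∀ s t, z s t ∈ (O.V (i s t)).homog (c s t)),
    O.castV (sum_blocks j i) (O.γ (∑ s, j s)
        (fun r => i (finSigmaFinEquiv.symm r).1 (finSigmaFinEquiv.symm r).2) (O.γ n j x y)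
        (fun r => z (finSigmaFinEquiv.symm r).1 (finSigmaFinEquiv.symm r).2)) =
      (-1 : ℤ) ^ koszulShuffle b c •
        O.γ n (fun s => ∑ t, i s t) x (fun s => O.γ (j s) (i s) (y s) (z s))
  one_left : ∀ (n : ℕ) (x : (O.V n).carrier),
    O.castV (by simp) (O.γ 1 (fun _ => n) O.one (fun _ => x)) = x
  one_right : ∀ (n : ℕ) (x : (O.V n).carrier),
    O.castV (by simp) (O.γ n (fun _ => 1) x (fun _ => O.one)) = x
  equivariance_outer : ∀ (n : ℕ) (j : Fin n → ℕ) (σ : Equiv.Perm (Fin n)) (x : (O.V n).carrier)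
    (b : Fin n → ℕ) (y : ∀ s, (O.V (j s)).carrier) (_ : ∀ s, y s ∈ (O.V (j s)).homog (b s)),
    O.γ n j (O.act n σ x) y = (-1 : ℤ) ^ koszul σ b •
      O.act (∑ s, j s) (blockPerm σ j) (O.castV (Equiv.sum_comp σ.symm j)
        (O.γ n (fun s => j (σ.symm s)) x (fun s => y (σ.symm s))))
  equivariance_inner : ∀ (n : ℕ) (j : Fin n → ℕ) (τ : ∀ s, Equiv.Perm (Fin (j s)))
    (x : (O.V n).carrier) (y : ∀ s, (O.V (j s)).carrier),
    O.γ n j x (fun s => O.act (j s) (τ s) (y s)) =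
      O.act (∑ s, j s) (dirSumPerm j τ) (O.γ n j x y)

/-- The axioms of an algebra `X` over an operad, with structure maps `V(n) ⊗ X^{⊗ n} → X`:
compatibility with the structure maps and the unit of the operad, and equivariance. -/
structure IsOperadAlgebra (O : OperadData k) (X : GMod k)
    (χ : ∀ n, (O.V n).carrier →ₗ[k] MultilinearMap k (fun _ : Fin n => X.carrier) X.carrier) :
    Prop where
  assoc : ∀ (n : ℕ) (j : Fin n → ℕ) (x : (O.V n).carrier)
    (b : Fin n → ℕ) (y : ∀ s, (O.V (j s)).carrier) (_ : ∀ s, y s ∈ (O.V (j s)).homog (b s))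
    (c : ∀ s, Fin (j s) → ℕ) (z : ∀ s, Fin (j s) → X.carrier)
    (_ : ∀ s t, z s t ∈ X.homog (c s t)),
    χ (∑ s, j s) (O.γ n j x y)
        (fun r => z (finSigmaFinEquiv.symm r).1 (finSigmaFinEquiv.symm r).2) =
      (-1 : ℤ) ^ koszulShuffle b c • χ n x (fun s => χ (j s) (y s) (z s))
  unit : ∀ x : X.carrier, χ 1 O.one (fun _ => x) = x
  equivariance : ∀ (n : ℕ) (σ : Equiv.Perm (Fin n)) (x : (O.V n).carrier)
    (b : Fin n → ℕ) (z : Fin n → X.carrier) (_ : ∀ s, z s ∈ X.homog (b s)),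
    χ n (O.act n σ x) z = (-1 : ℤ) ^ koszul σ b • χ n x (fun s => z (σ.symm s))

/-- A map `X ⊗̂ Y_0 ⊗̂ ⋯ ⊗̂ Y_{n-1} ⟶ Z` of simplicial modules, in a degree `p`. -/
def SMultimap.level {n : ℕ} {X : SimplicialObject (ModuleCat.{u} k)}
    {Y : Fin n → SimplicialObject (ModuleCat.{u} k)} {Z : SimplicialObject (ModuleCat.{u} k)}
    (f : SMultimap (Fin.cons (α := fun _ => SimplicialObject (ModuleCat.{u} k)) X Y) Z) (p : ℕ) :
    (X _⦋p⦌) →ₗ[k] MultilinearMap k (fun i => (Y i) _⦋p⦌) (Z _⦋p⦌) :=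
  (f.app p).curryLeft

/-- Construction of a map `X ⊗̂ Y_0 ⊗̂ ⋯ ⊗̂ Y_{n-1} ⟶ Z` of simplicial modules. -/
def SMultimap.ofLevel {n : ℕ} {X : SimplicialObject (ModuleCat.{u} k)}
    {Y : Fin n → SimplicialObject (ModuleCat.{u} k)} {Z : SimplicialObject (ModuleCat.{u} k)}
    (f : ∀ p : ℕ, (X _⦋p⦌) →ₗ[k] MultilinearMap k (fun i => (Y i) _⦋p⦌) (Z _⦋p⦌))
    (hf : ∀ {p q : ℕ} (θ : ⦋q⦌ ⟶ ⦋p⦌) (x : X _⦋p⦌) (y : ∀ i, (Y i) _⦋p⦌),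
      f q ((X.map θ.op).hom x) (fun i => ((Y i).map θ.op).hom (y i)) =
        (Z.map θ.op).hom (f p x y)) :
    SMultimap (Fin.cons (α := fun _ => SimplicialObject (ModuleCat.{u} k)) X Y) Z where
  app p := LinearMap.uncurryLeft
    (M := fun i => (Fin.cons (α := fun _ => SimplicialObject (ModuleCat.{u} k)) X Y i) _⦋p⦌) (f p)
  naturality θ x := hf θ (x 0) fun i => x i.succ

variable (k) in
/-- The data of an operad in simplicial modules. -/
structure SOperadData where
  P : ℕ → SimplicialObject (ModuleCat.{u} k)
  γ : ∀ (n : ℕ) (j : Fin n → ℕ), SMultimap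
    (Fin.cons (α := fun _ => SimplicialObject (ModuleCat.{u} k)) (P n) fun s => P (j s))
    (P (∑ s, j s))
  one : (P 1) _⦋0⦌
  act : ∀ n, Equiv.Perm (Fin n) → (P n ⟶ P n)

/-- The degree `p` part of the data of an operad in simplicial modules. -/
def SOperadData.level (O : SOperadData k) (p : ℕ) : OperadData k where
  V n := GMod.ofModule ((O.P n) _⦋p⦌)
  γ n j := (O.γ n j).level p
  one := ((O.P 1).map (SimplexCategory.const ⦋p⦌ ⦋0⦌ 0).op).hom O.one
  act n σ := ((O.act n σ).app (op ⦋p⦌)).hom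

/-- Operads in simplicial modules (for the degreewise tensor product `⊗̂`), with `P(0)` the unit
object. -/
structure IsSOperad (O : SOperadData k) : Prop where
  level : ∀ p, IsOperad (O.level p)
  zero : Nonempty (O.P 0 ≅ (Functor.const _).obj (ModuleCat.of k k))

/-- Algebras over an operad in simplicial modules. -/
def IsSAlgebra (O : SOperadData k) (X : SimplicialObject (ModuleCat.{u} k))
    (χ : ∀ n, SMultimap (Fin.cons (α := fun _ => SimplicialObject (ModuleCat.{u} k)) (O.P n)
      fun _ : Fin n => X) X) : Prop :=
  ∀ p, IsOperadAlgebra (O.level p) (GMod.ofModule (X _⦋p⦌)) fun n => (χ n).level p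

variable (k) in
/-- The data of an operad in chain complexes. -/
structure DGOperadData where
  P : ℕ → ChainComplex (ModuleCat.{u} k) ℕ
  γ : ∀ (n : ℕ) (j : Fin n → ℕ), Tot (P n) →ₗ[k]
    MultilinearMap k (fun s => Tot (P (j s))) (Tot (P (∑ s, j s)))
  one : (P 1).X 0
  act : ∀ n, Equiv.Perm (Fin n) → (P n ⟶ P n)

/-- The underlying graded operad data. -/
noncomputable def DGOperadData.graded (O : DGOperadData k) : OperadData k where
  V n := GMod.tot (O.P n)
  γ n j := O.γ n j
  one := Tot.of (O.P 1) 0 O.one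
  act n σ := Tot.map (O.act n σ)

/-- Operads in chain complexes, with `P(0)` the unit object. -/
structure IsDGOperad (O : DGOperadData k) : Prop where
  chain : ∀ n j, IsChainMultimap (O.γ n j)
  graded : IsOperad O.graded
  zero : Nonempty (O.P 0 ≅ (ChainComplex.single₀ (ModuleCat.{u} k)).obj (ModuleCat.of k k))

/-- Algebras over an operad in chain complexes. -/
structure IsDGAlgebra (O : DGOperadData k) (X : ChainComplex (ModuleCat.{u} k) ℕ)
    (χ : ∀ n, Tot (O.P n) →ₗ[k] MultilinearMap k (fun _ : Fin n => Tot X) (Tot X)) : Prop where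
  chain : ∀ n, IsChainMultimap (χ n)
  graded : IsOperadAlgebra O.graded (GMod.tot X) χ

/-- The composite of the shuffle map with the normalization of a map
`X ⊗̂ Y_0 ⊗̂ ⋯ ⊗̂ Y_{n-1} ⟶ Z` of simplicial modules. -/
noncomputable def SMultimap.chains {n : ℕ} {X : SimplicialObject (ModuleCat.{u} k)}
    {Y : Fin n → SimplicialObject (ModuleCat.{u} k)} {Z : SimplicialObject (ModuleCat.{u} k)}
    (f : SMultimap (Fin.cons (α := fun _ => SimplicialObject (ModuleCat.{u} k)) X Y) Z) :
    Tot (normalized X) →ₗ[k]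
      MultilinearMap k (fun i => Tot (normalized (Y i))) (Tot (normalized Z)) :=
  (shuffleMap f).curryLeft

/-- The normalization of an operad in simplicial modules. -/
noncomputable def SOperadData.chains (O : SOperadData k) : DGOperadData k where
  P n := normalized (O.P n)
  γ n j := (O.γ n j).chains
  one := (degen (O.P 1) 0).mkQ O.one
  act n σ := normalizedMap (O.act n σ)

/-- The complex `k`, concentrated in degree `0`. -/
noncomputable abbrev unitComplex (k : Type u) [CommRing k] : ChainComplex (ModuleCat.{u} k) ℕ :=
  (ChainComplex.single₀ (ModuleCat.{u} k)).obj (ModuleCat.of k k)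

/-- The value of an augmentation `K ⟶ k` on elements of degree `0`. -/
noncomputable def augment {K : ChainComplex (ModuleCat.{u} k) ℕ} (ε : K ⟶ unitComplex k) :
    K.X 0 →ₗ[k] k :=
  (ε.f 0).hom

/-- `E_∞`-operads in chain complexes: operads with an augmentation to the commutative operad,
each `P(n) ⟶ k` being a homotopy equivalence, such that the symmetric groups act freely. -/
structure IsEInfinity (O : DGOperadData k) : Prop where
  operad : IsDGOperad O
  contractible : ∃ ε : ∀ n, O.P n ⟶ unitComplex k,
    (∀ n, ∃ e : HomotopyEquiv (O.P n) (unitComplex k), e.hom = ε n) ∧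
    (∀ n σ, O.act n σ ≫ ε n = ε n) ∧
    augment (ε 1) O.one = 1 ∧
    ∀ (n : ℕ) (j : Fin n → ℕ) (x : (O.P n).X 0) (y : ∀ s, (O.P (j s)).X 0)
      (z : (O.P (∑ s, j s)).X 0),
      O.γ n j (Tot.of _ 0 x) (fun s => Tot.of _ 0 (y s)) = Tot.of _ 0 z →
        augment (ε (∑ s, j s)) z = augment (ε n) x * ∏ s, augment (ε (j s)) (y s)
  free : ∀ n d, ∃ (ι : Type) (b : Module.Basis (ι × Equiv.Perm (Fin n)) k ((O.P n).X d)),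
    ∀ (i : ι) (τ σ : Equiv.Perm (Fin n)), ((O.act n σ).f d).hom (b (i, τ)) = b (i, τ * σ)

end Operads

end SymHom
namespace SymHom

section BarrattEccles

variable {k : Type u} [CommRing k]

/-- The multilinear extension of a function on a product of sets to the free modules. -/
noncomputable def multiExt {n : ℕ} {S : Fin n → Type} {M : Type u} [AddCommGroup M] [Module k M]
    (g : (∀ i, S i) → M) : MultilinearMap k (fun i => S i →₀ k) M :=
  letI := fun i => Classical.decEq (S i)
  letI := Classical.decEq k
  (Finsupp.linearCombination k g ∘ₗ
    (PiTensorProduct.ofFinsuppEquiv' (R := k) (κ := S)).toLinearMap).compMultilinearMap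
      (PiTensorProduct.tprod k)

theorem multiExt_single {n : ℕ} {S : Fin n → Type} {M : Type u} [AddCommGroup M] [Module k M]
    (g : (∀ i, S i) → M) (s : ∀ i, S i) :
    multiExt (k := k) g (fun i => Finsupp.single (s i) 1) = g s := by
  let := fun i => Classical.decEq (S i)
  let := Classical.decEq k
  show Finsupp.linearCombination k g (PiTensorProduct.ofFinsuppEquiv' (R := k) (κ := S)
    (PiTensorProduct.tprod k fun i => Finsupp.single (s i) 1)) = g s
  rw [PiTensorProduct.ofFinsuppEquiv'_tprod_single]
  simp

/-- The underlying functor of `N(ES_m)`: a `p`-simplex is a sequence `σ_0, …, σ_p` in `S_m` (a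
string of `p` composable arrows of `ES_m`, where each pair of objects is joined by one arrow). -/
def DSet (m : ℕ) : SSet.{0} where
  obj p := Fin (p.unop.len + 1) → Equiv.Perm (Fin m)
  map θ := ↾ fun v => v ∘ θ.unop.toOrderHom
  map_id _ := rfl
  map_comp _ _ := rfl

/-- The simplicial module `k[N(ES_m)]`. -/
noncomputable def DMod (k : Type u) [CommRing k] (m : ℕ) : SimplicialObject (ModuleCat.{u} k) :=
  DSet m ⋙ freeMod k

/-- The basis element of `k[N(ES_m)]` given by a simplex. -/
noncomputable def DMod.simplex (k : Type u) [CommRing k] {m p : ℕ}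
    (v : Fin (p + 1) → Equiv.Perm (Fin m)) : (DMod k m) _⦋p⦌ :=
  (Finsupp.single v 1 : (Fin (p + 1) → Equiv.Perm (Fin m)) →₀ k)

theorem DMod.map_simplex {m p q : ℕ} (v : Fin (p + 1) → Equiv.Perm (Fin m)) (θ : ⦋q⦌ ⟶ ⦋p⦌) :
    ((DMod k m).map θ.op).hom (DMod.simplex k v) = DMod.simplex k (v ∘ θ.toOrderHom) := by
  exact Finsupp.mapDomain_single (f := fun v : Fin (p + 1) → Equiv.Perm (Fin m) =>
    v ∘ θ.toOrderHom)

/-- Linear maps on `k[N(ES_m)]_p` are determined by the simplices. -/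
theorem DMod.hom_ext {m p : ℕ} {M : Type u} [AddCommGroup M] [Module k M]
    (f g : (DMod k m) _⦋p⦌ →ₗ[k] M) (h : ∀ v, f (DMod.simplex k v) = g (DMod.simplex k v)) :
    f = g :=
  Finsupp.lhom_ext' fun v => LinearMap.ext_ring (h v)

/-- The structure map of the operad, on `p`-simplices:
`(σ; τ_0, …, τ_{n-1}) ↦ σ{j_0, …, j_{n-1}} (τ_0 ⊕ ⋯ ⊕ τ_{n-1})` at each vertex. -/
noncomputable def DMod.comp (k : Type u) [CommRing k] (n : ℕ) (j : Fin n → ℕ) (p : ℕ) :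
    (DMod k n) _⦋p⦌ →ₗ[k] MultilinearMap k (fun s => (DMod k (j s)) _⦋p⦌)
      ((DMod k (∑ s, j s)) _⦋p⦌) :=
  Finsupp.linearCombination k fun σ : Fin (p + 1) → Equiv.Perm (Fin n) =>
    multiExt (S := fun s => Fin (p + 1) → Equiv.Perm (Fin (j s))) fun τ =>
      DMod.simplex k fun v => blockPerm (σ v) j * dirSumPerm j fun s => τ s v

theorem DMod.comp_simplex (n : ℕ) (j : Fin n → ℕ) (p : ℕ)
    (σ : Fin (p + 1) → Equiv.Perm (Fin n)) (τ : ∀ s, Fin (p + 1) → Equiv.Perm (Fin (j s))) :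
    DMod.comp k n j p (DMod.simplex k σ) (fun s => DMod.simplex k (τ s)) =
      DMod.simplex k fun v => blockPerm (σ v) j * dirSumPerm j fun s => τ s v := by
  refine Eq.trans (congrArg (fun f : MultilinearMap k (fun s => (DMod k (j s)) _⦋p⦌)
      ((DMod k (∑ s, j s)) _⦋p⦌) => f fun s => DMod.simplex k (τ s))
    ((Finsupp.linearCombination_single k 1 σ).trans (one_smul _ _))) ?_
  exact multiExt_single _ _

theorem DMod.comp_naturality (n : ℕ) (j : Fin n → ℕ) {p q : ℕ} (θ : ⦋q⦌ ⟶ ⦋p⦌)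
    (x : (DMod k n) _⦋p⦌) (y : ∀ s, (DMod k (j s)) _⦋p⦌) :
    DMod.comp k n j q (((DMod k n).map θ.op).hom x)
        (fun s => ((DMod k (j s)).map θ.op).hom (y s)) =
      ((DMod k (∑ s, j s)).map θ.op).hom (DMod.comp k n j p x y) := by
  have h : (MultilinearMap.compLinearMapₗ fun s => ((DMod k (j s)).map θ.op).hom) ∘ₗ
      DMod.comp k n j q ∘ₗ ((DMod k n).map θ.op).hom =
      ((DMod k (∑ s, j s)).map θ.op).hom.compMultilinearMapₗ k ∘ₗ DMod.comp k n j p := by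
    refine DMod.hom_ext _ _ fun σ => ?_
    refine Module.Basis.ext_multilinear (fun s => Finsupp.basisSingleOne
      (ι := Fin (p + 1) → Equiv.Perm (Fin (j s)))) fun τ => ?_
    show DMod.comp k n j q (((DMod k n).map θ.op).hom (DMod.simplex k σ))
        (fun s => ((DMod k (j s)).map θ.op).hom (Finsupp.basisSingleOne (τ s))) =
      ((DMod k (∑ s, j s)).map θ.op).hom (DMod.comp k n j p (DMod.simplex k σ)
        (fun s => Finsupp.basisSingleOne (τ s)))
    have hb : ∀ s, (Finsupp.basisSingleOne (R := k) (τ s) : (DMod k (j s)) _⦋p⦌) =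
        DMod.simplex k (τ s) := fun s =>
      congrFun (Finsupp.coe_basisSingleOne (R := k)) (τ s)
    simp only [hb, DMod.map_simplex, DMod.comp_simplex]
    rfl
  exact congrArg (fun f => f x y) h

/-- The operad `k[N(ES_*)]` in simplicial modules, with the symmetric groups acting by right
multiplication. -/
noncomputable def Dsm (k : Type u) [CommRing k] : SOperadData k where
  P := DMod k
  γ n j := SMultimap.ofLevel (DMod.comp k n j) (DMod.comp_naturality n j)
  one := DMod.simplex k fun _ => 1
  act n τ := Functor.whiskerRight
    { app := fun p => ↾ fun v : Fin (p.unop.len + 1) → Equiv.Perm (Fin n) => fun i => v i * τ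
      naturality := fun _ _ _ => rfl } (freeMod k)

/-- The Barratt–Eccles operad in chain complexes. -/
noncomputable def Dch (k : Type u) [CommRing k] : DGOperadData k := (Dsm k).chains

end BarrattEccles

end SymHom
namespace SymHom

section Mu

/-- The permutation `σ{d 0, …, d (n-1)}` of the blocks of `d 0 ⊙ ⋯ ⊙ d (n-1)`. -/
def blockHom {n : ℕ} (σ : Equiv.Perm (Fin n)) (d : Fin n → NCSet) : NCSet.sum d ⟶ NCSet.sum d :=
  NCSet.permHom (blockPerm σ fun i => (d i).size)

/-- The inverse of `blockHom σ d`. -/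
def blockHomInv {n : ℕ} (σ : Equiv.Perm (Fin n)) (d : Fin n → NCSet) :
    NCSet.sum d ⟶ NCSet.sum d :=
  NCSet.permHom (blockPerm σ fun i => (d i).size).symm

theorem blockHom_comp_inv {n : ℕ} (σ : Equiv.Perm (Fin n)) (d : Fin n → NCSet) {l : NCSet}
    (h : NCSet.sum d ⟶ l) : blockHom σ d ≫ blockHomInv σ d ≫ h = h :=
  NCSet.permHom_comp_symm_assoc _ h

theorem blockHom_conj {n : ℕ} (σ : Equiv.Perm (Fin n)) (d : Fin n → NCSet) {c e : NCSet}
    (a : c ⟶ NCSet.sum d) (m : NCSet.sum d ⟶ e) (r : e ⟶ e) :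
    (a ≫ blockHom σ d) ≫ blockHomInv σ d ≫ m ≫ r = (a ≫ m) ≫ r := by
  simp only [Category.assoc, blockHom_comp_inv]

theorem blockHomInv_comp {n : ℕ} (σ : Equiv.Perm (Fin n)) (d : Fin n → NCSet) :
    blockHomInv σ d ≫ blockHom σ d = 𝟙 _ :=
  NCSet.permHom_symm_comp _

/-- The string of objects of `ΔS₊` underlying `muFunctor`. -/
def muBase {n p : ℕ} (σ : Fin (p + 1) → Equiv.Perm (Fin n)) {c : Fin n → NCSet}
    (x : ∀ i, ComposableArrows (Under (c i)) p) : Fin (p + 1) ⥤ NCSet where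
  obj v := NCSet.sum fun i => ((x i).obj v).right
  map {v w} f := blockHomInv (σ v) (fun i => ((x i).obj v).right) ≫
    NCSet.sumHom (fun i => ((x i).map f).right) ≫
      blockHom (σ w) (fun i => ((x i).obj w).right)
  map_id v := by
    have h : NCSet.sumHom (fun i => ((x i).map (𝟙 v)).right) =
        𝟙 (NCSet.sum fun i => ((x i).obj v).right) := by
      rw [← NCSet.sumHom_id]
      congr 1
      funext i
      rw [(x i).map_id]
      rfl
    rw [h, Category.id_comp]
    exact blockHomInv_comp _ _
  map_comp {u v w} f g := by
    have h : NCSet.sumHom (fun i => ((x i).map (f ≫ g)).right) =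
        NCSet.sumHom (fun i => ((x i).map f).right) ≫
          NCSet.sumHom (fun i => ((x i).map g).right) := by
      rw [← NCSet.sumHom_comp]
      congr 1
      funext i
      rw [(x i).map_comp]
      rfl
    rw [h]
    simp only [Category.assoc]
    congr 2
    exact (blockHom_comp_inv _ _ _).symm

theorem muBase_w {n p : ℕ} (σ : Fin (p + 1) → Equiv.Perm (Fin n)) {c : Fin n → NCSet}
    (x : ∀ i, ComposableArrows (Under (c i)) p) {v w : Fin (p + 1)} (f : v ⟶ w) :
    (NCSet.sumHom (fun i => ((x i).obj v).hom) ≫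
      blockHom (σ v) (fun i => ((x i).obj v).right)) ≫ (muBase σ x).map f =
    NCSet.sumHom (fun i => ((x i).obj w).hom) ≫
      blockHom (σ w) (fun i => ((x i).obj w).right) := by
  have h : NCSet.sumHom (fun i => ((x i).obj v).hom) ≫
      NCSet.sumHom (fun i => ((x i).map f).right) =
      NCSet.sumHom (fun i => ((x i).obj w).hom) := by
    rw [← NCSet.sumHom_comp]
    congr 1
    funext i
    exact Under.w _
  exact (blockHom_conj _ _ _ _ _).trans (congrArg (· ≫ blockHom (σ w) _) h)

/-- The structure map of `N(- \ ΔS₊)` over `N(ES_n)`: the simplices `σ` of `N(ES_n)` and `x i` of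
`N(c i \ ΔS₊)` give the simplex of `N(c 0 ⊙ ⋯ ⊙ c (n-1) \ ΔS₊)` whose vertex number `v` is the
product of the vertices `(x i)_v : c i ⟶ d i`, followed by the permutation `σ_v{d 0, …, d (n-1)}`
of the blocks; the arrows are the products of the arrows of the `x i`, conjugated by these
permutations. -/
def muFunctor {n p : ℕ} (σ : Fin (p + 1) → Equiv.Perm (Fin n)) {c : Fin n → NCSet}
    (x : ∀ i, ComposableArrows (Under (c i)) p) : ComposableArrows (Under (NCSet.sum c)) p :=
  (muBase σ x).toUnder (NCSet.sum c)
    (fun v => NCSet.sumHom (fun i => ((x i).obj v).hom) ≫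
      blockHom (σ v) (fun i => ((x i).obj v).right))
    (muBase_w σ x)

theorem toUnder_congr {J : Type} [Category.{0} J] (D : J ⥤ NCSet) (c : NCSet)
    {f g : ∀ v, c ⟶ D.obj v} (hf : ∀ {v w} (h : v ⟶ w), f v ≫ D.map h = f w)
    (hg : ∀ {v w} (h : v ⟶ w), g v ≫ D.map h = g w) (h : f = g) :
    D.toUnder c f hf = D.toUnder c g hg := by
  subst h
  rfl

theorem muFunctor_map {n p : ℕ} (σ : Fin (p + 1) → Equiv.Perm (Fin n)) {c d : Fin n → NCSet}
    (φ : ∀ i, c i ⟶ d i) (x : ∀ i, ComposableArrows (Under (d i)) p) :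
    muFunctor σ (fun i => (x i) ⋙ Under.map (φ i)) =
      muFunctor σ x ⋙ Under.map (NCSet.sumHom φ) := by
  refine toUnder_congr (muBase σ x) (NCSet.sum c) (g := fun v => NCSet.sumHom φ ≫
    NCSet.sumHom (fun i => ((x i).obj v).hom) ≫
      blockHom (σ v) (fun i => ((x i).obj v).right)) (muBase_w σ fun i => x i ⋙ Under.map (φ i))
    (fun {v w} f => ?_) ?_
  · exact Under.w ((muFunctor σ x ⋙ Under.map (NCSet.sumHom φ)).map f)
  · funext v
    have h := NCSet.sumHom_comp φ fun i => ((x i).obj v).hom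
    exact (congrArg (· ≫ blockHom (σ v) fun i => ((x i).obj v).right) h).trans
      (Category.assoc _ _ _)

theorem concat_pushTensor (k A : Type u) [CommRing k] [Ring A] [Algebra k A] {n : ℕ}
    {c d : Fin n → NCSet} (φ : ∀ i, c i ⟶ d i) (a : ∀ i, Fin (c i).size → A) :
    pushTensor k A (NCSet.sumHom φ) (concat k A c fun i => PiTensorProduct.tprod k (a i)) =
      concat k A d fun i => PiTensorProduct.tprod k (pushTuple (φ i) (a i)) := by
  rw [concat_tprod, concat_tprod, pushTensor_tprod]
  congr 1
  funext y
  obtain ⟨q, rfl⟩ := (NCSet.blk d).surjective y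
  show ((NCSet.Hom.fib (NCSet.sumHom φ) (NCSet.blk d q)).map _).prod =
    (fun q : (i : Fin n) × Fin (d i).size => pushTuple (φ q.1) (a q.1) q.2)
      ((NCSet.blk d).symm (NCSet.blk d q))
  rw [Equiv.symm_apply_apply, NCSet.sumHom_fib, List.map_map]
  refine congrArg List.prod (List.map_congr_left fun x _ => ?_)
  show (fun q : (i : Fin n) × Fin (c i).size => a q.1 q.2)
    ((NCSet.blk c).symm (NCSet.blk c ⟨q.1, x⟩)) = _
  rw [Equiv.symm_apply_apply]

end Mu

section Chi

variable (k A : Type u) [CommRing k] [Ring A] [Algebra k A]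

/-- `⨁_c k[N(c \ ΔS₊)_p] ⊗ A^{⊗ c}`, of which `𝒴⁺A_p` is a quotient. -/
abbrev YPre (p : ℕ) : Type u :=
  ⨁ c : NCSet, ((kNerveUnder k).obj (op ⦋p⦌)).obj (op c) ⊗[k] (Bsym k A).obj c

open Classical in
/-- The generator of `YPre` given by a simplex of `N(c \ ΔS₊)` and an element of `A^{⊗ c}`. -/
noncomputable def YPre.gen (p : ℕ) (c : NCSet) (x : ComposableArrows (Under c) p) :
    (⨂[k] _ : Fin c.size, A) →ₗ[k] YPre k A p :=
  DirectSum.lof k NCSet (fun c => ((kNerveUnder k).obj (op ⦋p⦌)).obj (op c) ⊗[k] (Bsym k A).obj c)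
    c ∘ₗ TensorProduct.mk k (ComposableArrows (Under c) p →₀ k) (⨂[k] _ : Fin c.size, A)
      (Finsupp.single x 1)

theorem YPre.hom_ext {p : ℕ} {M : Type u} [AddCommGroup M] [Module k M] (f g : YPre k A p →ₗ[k] M)
    (h : ∀ c x a, f (YPre.gen k A p c x (PiTensorProduct.tprod k a)) =
      g (YPre.gen k A p c x (PiTensorProduct.tprod k a))) : f = g := by
  classical
  refine DirectSum.linearMap_ext k fun c => ?_
  refine TensorProduct.ext (Finsupp.lhom_ext' fun x => LinearMap.ext_ring ?_)
  exact PiTensorProduct.ext (MultilinearMap.ext fun a => h c x a)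

theorem YPre.span_gen (p : ℕ) : Submodule.span k {z | ∃ c x a,
    z = YPre.gen k A p c x (PiTensorProduct.tprod k a)} = ⊤ := by
  rw [← Submodule.ker_mkQ (Submodule.span k _), LinearMap.ker_eq_top]
  refine YPre.hom_ext k A _ _ fun c x a => ?_
  rw [Submodule.mkQ_apply, LinearMap.zero_apply, Submodule.Quotient.mk_eq_zero]
  exact Submodule.subset_span ⟨c, x, a, rfl⟩

theorem kNerveUnder_map (p : ℕ) {c d : NCSet} (φ : c ⟶ d) (x : ComposableArrows (Under d) p) :
    (((kNerveUnder k).obj (op ⦋p⦌)).map φ.op).hom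
      (Finsupp.single x 1 : ComposableArrows (Under d) p →₀ k) =
      (Finsupp.single (x ⋙ Under.map φ) 1 : ComposableArrows (Under c) p →₀ k) :=
  Finsupp.mapDomain_single (f := fun x : ComposableArrows (Under d) p =>
    (x ⋙ Under.map φ : ComposableArrows (Under c) p))

/-- The relations defining `𝒴⁺A_p` are spanned by the relations between generators. -/
theorem tensorRel_le (p : ℕ) : tensorRel (Bsym k A) ((kNerveUnder k).obj (op ⦋p⦌)) ≤
    Submodule.span k {z | ∃ (c d : NCSet) (φ : c ⟶ d) (x : ComposableArrows (Under d) p)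
      (a : Fin c.size → A), z = YPre.gen k A p c (x ⋙ Under.map φ) (PiTensorProduct.tprod k a) -
        YPre.gen k A p d x (PiTensorProduct.tprod k (pushTuple φ a))} := by
  classical
  refine Submodule.span_le.mpr ?_
  rintro _ ⟨c, d, φ, x, y, rfl⟩
  set N := Submodule.span k {z | ∃ (c d : NCSet) (φ : c ⟶ d) (x : ComposableArrows (Under d) p)
      (a : Fin c.size → A), z = YPre.gen k A p c (x ⋙ Under.map φ) (PiTensorProduct.tprod k a) -
        YPre.gen k A p d x (PiTensorProduct.tprod k (pushTuple φ a))} with hN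
  let G := (kNerveUnder k).obj (op ⦋p⦌)
  let F := Bsym k A
  let L : (c : NCSet) → (G.obj (op c)) ⊗[k] (F.obj c) →ₗ[k] YPre k A p ⧸ N := fun c =>
    N.mkQ ∘ₗ DirectSum.lof k NCSet (fun c => (G.obj (op c)) ⊗[k] (F.obj c)) c
  have key : L c ∘ₗ LinearMap.rTensor (F.obj c) (G.map φ.op).hom =
      L d ∘ₗ LinearMap.lTensor (G.obj (op d)) (F.map φ).hom := by
    refine TensorProduct.ext (Finsupp.lhom_ext' fun x => LinearMap.ext_ring ?_)
    refine PiTensorProduct.ext (MultilinearMap.ext fun a => ?_)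
    show L c ((G.map φ.op).hom (Finsupp.single x 1 : ComposableArrows (Under d) p →₀ k) ⊗ₜ[k]
      PiTensorProduct.tprod k a) =
      N.mkQ (YPre.gen k A p d x (pushTensor k A φ (PiTensorProduct.tprod k a)))
    rw [pushTensor_tprod]
    refine (congrArg (fun u => L c (u ⊗ₜ[k] PiTensorProduct.tprod k a))
      (kNerveUnder_map k p φ x)).trans ?_
    refine (Submodule.Quotient.eq N).mpr (Submodule.subset_span ⟨c, d, φ, x, a, rfl⟩)
  exact (Submodule.Quotient.eq N).mp (congrArg (fun f => f (x ⊗ₜ[k] y)) key)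

/-- The relation `[φ^* x ⊗ V] = [x ⊗ φ_* V]` in `𝒴⁺A_p`. -/
theorem yCls_rel (p : ℕ) {c d : NCSet} (φ : c ⟶ d) (x : ComposableArrows (Under d) p)
    (V : ⨂[k] _ : Fin c.size, A) :
    yCls k A p c (x ⋙ Under.map φ) V = yCls k A p d x (pushTensor k A φ V) := by
  classical
  refine (Submodule.Quotient.eq _).mpr (Submodule.subset_span ⟨c, d, φ,
    (Finsupp.single x 1 : ComposableArrows (Under d) p →₀ k), V, ?_⟩)
  rw [kNerveUnder_map]
  congr!

open Classical in
/-- The multilinear map `(x_i ⊗ V_i)_i ↦ [μ(σ; x_0, …, x_{n-1}) ⊗ (V_0 ⊗ ⋯ ⊗ V_{n-1})]`. -/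
noncomputable def chiPre {n p : ℕ} (σ : Fin (p + 1) → Equiv.Perm (Fin n)) :
    MultilinearMap k (fun _ : Fin n => YPre k A p) ((YPlus k A) _⦋p⦌) :=
  MultilinearMap.fromDirectSumEquiv (R := k) (ι := Fin n) (κ := fun _ => NCSet)
    (M := fun _ c => ((kNerveUnder k).obj (op ⦋p⦌)).obj (op c) ⊗[k] (Bsym k A).obj c) fun c =>
    (((Finsupp.lsum k fun x : ∀ i, ComposableArrows (Under (c i)) p =>
        yCls k A p (NCSet.sum c) (muFunctor σ x) ∘ₗ PiTensorProduct.lift (concat k A c)) ∘ₗ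
      (PiTensorProduct.ofFinsuppEquiv (R := k) (κ := fun i => ComposableArrows (Under (c i)) p)
        (M := fun i => ⨂[k] _ : Fin (c i).size, A)).toLinearMap).compMultilinearMap
      (PiTensorProduct.tprod k)).compLinearMap fun i =>
        (TensorProduct.finsuppScalarLeft k (⨂[k] _ : Fin (c i).size, A)
          (ComposableArrows (Under (c i)) p)).toLinearMap

theorem chiPre_gen {n p : ℕ} (σ : Fin (p + 1) → Equiv.Perm (Fin n)) (c : Fin n → NCSet)
    (x : ∀ i, ComposableArrows (Under (c i)) p) (V : ∀ i, ⨂[k] _ : Fin (c i).size, A) :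
    chiPre k A σ (fun i => YPre.gen k A p (c i) (x i) (V i)) =
      yCls k A p (NCSet.sum c) (muFunctor σ x) (concat k A c V) := by
  classical
  refine (MultilinearMap.fromDirectSumEquiv_lof (ι := Fin n) (κ := fun _ => NCSet)
    (M := fun _ c => ((kNerveUnder k).obj (op ⦋p⦌)).obj (op c) ⊗[k] (Bsym k A).obj c) _ c
    (fun i => (Finsupp.single (x i) 1 : ComposableArrows (Under (c i)) p →₀ k) ⊗ₜ[k] (V i))).trans ?_
  have hs : ∀ i, TensorProduct.finsuppScalarLeft k (⨂[k] _ : Fin (c i).size, A)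
      (ComposableArrows (Under (c i)) p)
      ((Finsupp.single (x i) 1 : ComposableArrows (Under (c i)) p →₀ k) ⊗ₜ[k] (V i)) =
      Finsupp.single (x i) (V i) := fun i => by
    rw [TensorProduct.finsuppScalarLeft_apply_tmul, Finsupp.sum_single_index (by simp), one_smul]
  show (Finsupp.lsum k fun x : ∀ i, ComposableArrows (Under (c i)) p =>
        yCls k A p (NCSet.sum c) (muFunctor σ x) ∘ₗ PiTensorProduct.lift (concat k A c))
      (PiTensorProduct.ofFinsuppEquiv (R := k) (κ := fun i => ComposableArrows (Under (c i)) p)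
        (M := fun i => ⨂[k] _ : Fin (c i).size, A) (PiTensorProduct.tprod k fun i =>
        TensorProduct.finsuppScalarLeft k (⨂[k] _ : Fin (c i).size, A)
          (ComposableArrows (Under (c i)) p)
          ((Finsupp.single (x i) 1 : ComposableArrows (Under (c i)) p →₀ k) ⊗ₜ[k] (V i)))) = _
  simp only [hs]
  rw [PiTensorProduct.ofFinsuppEquiv_tprod_single, Finsupp.lsum_single]
  show yCls k A p (NCSet.sum c) (muFunctor σ x) (PiTensorProduct.lift (concat k A c) _) = _
  rw [PiTensorProduct.lift.tprod]

theorem chiPre_rel {n p : ℕ} (σ : Fin (p + 1) → Equiv.Perm (Fin n)) (y : Fin n → YPre k A p)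
    (i : Fin n) (hi : y i ∈ tensorRel (Bsym k A) ((kNerveUnder k).obj (op ⦋p⦌))) :
    chiPre k A σ y = 0 := by
  refine multilinear_eq_zero_of_span (chiPre k A σ) (fun j => if j = i then
    {z | ∃ (c d : NCSet) (φ : c ⟶ d) (x : ComposableArrows (Under d) p)
      (a : Fin c.size → A), z = YPre.gen k A p c (x ⋙ Under.map φ) (PiTensorProduct.tprod k a) -
        YPre.gen k A p d x (PiTensorProduct.tprod k (pushTuple φ a))} else
    {z | ∃ c x a, z = YPre.gen k A p c x (PiTensorProduct.tprod k a)}) ?_ y ?_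
  · intro y hy
    have hd : ∀ j, ∃ (c d : NCSet) (φ : c ⟶ d) (x : ComposableArrows (Under d) p)
        (a : Fin c.size → A), (j = i →
          y j = YPre.gen k A p c (x ⋙ Under.map φ) (PiTensorProduct.tprod k a) -
            YPre.gen k A p d x (PiTensorProduct.tprod k (pushTuple φ a))) ∧
        (j ≠ i → y j = YPre.gen k A p c (x ⋙ Under.map φ) (PiTensorProduct.tprod k a) ∧
          y j = YPre.gen k A p d x (PiTensorProduct.tprod k (pushTuple φ a))) := by
      intro j
      have hj := hy j
      by_cases e : j = i
      · rw [if_pos e] at hj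
        obtain ⟨c, d, φ, x, a, h⟩ := hj
        exact ⟨c, d, φ, x, a, fun _ => h, fun h' => absurd e h'⟩
      · rw [if_neg e] at hj
        obtain ⟨c, x, a, h⟩ := hj
        have hid : x ⋙ Under.map (𝟙 c) = x := by
          rw [Under.mapId_eq]
          rfl
        refine ⟨c, c, 𝟙 c, x, a, fun h' => absurd h' e, fun _ => ⟨?_, ?_⟩⟩
        · rw [hid, h]
        · rw [pushTuple_id, h]
    choose c d φ x a h1 h2 using hd
    have hL : Function.update y i (YPre.gen k A p (c i) (x i ⋙ Under.map (φ i))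
        (PiTensorProduct.tprod k (a i))) = fun j =>
        YPre.gen k A p (c j) (x j ⋙ Under.map (φ j)) (PiTensorProduct.tprod k (a j)) := by
      funext j
      by_cases e : j = i
      · subst e
        simp
      · rw [Function.update_of_ne e]
        exact (h2 j e).1
    have hR : Function.update y i (YPre.gen k A p (d i) (x i)
        (PiTensorProduct.tprod k (pushTuple (φ i) (a i)))) = fun j =>
        YPre.gen k A p (d j) (x j) (PiTensorProduct.tprod k (pushTuple (φ j) (a j))) := by
      funext j
      by_cases e : j = i
      · subst e
        simp
      · rw [Function.update_of_ne e]
        exact (h2 j e).2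
    rw [← Function.update_eq_self i y, h1 i rfl, MultilinearMap.map_update_sub, hL, hR,
      chiPre_gen, chiPre_gen, muFunctor_map, yCls_rel, concat_pushTensor, sub_self]
  · intro j
    by_cases e : j = i
    · subst e
      rw [if_pos rfl]
      exact tensorRel_le k A p hi
    · rw [if_neg e, YPre.span_gen]
      trivial

/-- The action of a simplex `σ` of `N(ES_n)` on `𝒴⁺A`. -/
noncomputable def chiSimplex {n p : ℕ} (σ : Fin (p + 1) → Equiv.Perm (Fin n)) :
    MultilinearMap k (fun _ : Fin n => (YPlus k A) _⦋p⦌) ((YPlus k A) _⦋p⦌) :=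
  multiQuot (fun _ => tensorRel (Bsym k A) ((kNerveUnder k).obj (op ⦋p⦌))) (chiPre k A σ)
    (chiPre_rel k A σ)

/-- The structure map `χ : k[N(ES_n)] ⊗̂ (𝒴⁺A)^{⊗̂ n} ⟶ 𝒴⁺A` in a degree `p`. -/
noncomputable def chiLevel (n p : ℕ) : (DMod k n) _⦋p⦌ →ₗ[k]
    MultilinearMap k (fun _ : Fin n => (YPlus k A) _⦋p⦌) ((YPlus k A) _⦋p⦌) :=
  Finsupp.linearCombination k fun σ : Fin (p + 1) → Equiv.Perm (Fin n) => chiSimplex k A σ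

theorem chiLevel_gen (n p : ℕ) (σ : Fin (p + 1) → Equiv.Perm (Fin n)) (c : Fin n → NCSet)
    (x : ∀ i, ComposableArrows (Under (c i)) p) (V : ∀ i, ⨂[k] _ : Fin (c i).size, A) :
    chiLevel k A n p (DMod.simplex k σ) (fun i => yCls k A p (c i) (x i) (V i)) =
      yCls k A p (NCSet.sum c) (muFunctor σ x) (concat k A c V) := by
  refine Eq.trans (congrArg (fun f : MultilinearMap k (fun _ : Fin n => (YPlus k A) _⦋p⦌)
      ((YPlus k A) _⦋p⦌) => f fun i => yCls k A p (c i) (x i) (V i))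
    ((Finsupp.linearCombination_single k 1 σ).trans (one_smul _ _))) ?_
  exact (multiQuot_mk _ _ _ fun i => YPre.gen k A p (c i) (x i) (V i)).trans
    (chiPre_gen k A σ c x V)

theorem yCls_map {p q : ℕ} (θ : ⦋q⦌ ⟶ ⦋p⦌) (c : NCSet) (x : ComposableArrows (Under c) p)
    (V : ⨂[k] _ : Fin c.size, A) :
    ((YPlus k A).map θ.op).hom (yCls k A p c x V) =
      yCls k A q c ((nerve (Under c)).map θ.op x) V := by
  classical
  show (tensorRel _ _).mkQ (tensorSumMap (Bsym k A) ((kNerveUnder k).map θ.op) _) = _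
  refine congrArg (tensorRel (Bsym k A) ((kNerveUnder k).obj (op ⦋q⦌))).mkQ ?_
  refine (DirectSum.lmap_lof _ _ _).trans ?_
  exact congrArg (fun u : ComposableArrows (Under c) q →₀ k => DirectSum.lof k NCSet
      (fun c => ((kNerveUnder k).obj (op ⦋q⦌)).obj (op c) ⊗[k] (Bsym k A).obj c) c (u ⊗ₜ[k] V))
    (Finsupp.mapDomain_single (f := fun x : ComposableArrows (Under c) p =>
      (nerve (Under c)).map θ.op x))

theorem yCls_span (p : ℕ) : Submodule.span k {z | ∃ c x V, z = yCls k A p c x V} = ⊤ := by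
  refine top_le_iff.mp fun z _ => ?_
  obtain ⟨z, rfl⟩ :=
    (tensorRel (Bsym k A) ((kNerveUnder k).obj (op ⦋p⦌))).mkQ_surjective z
  have hz : z ∈ Submodule.span k {z | ∃ c x a,
      z = YPre.gen k A p c x (PiTensorProduct.tprod k a)} := by
    rw [YPre.span_gen]
    trivial
  induction hz using Submodule.span_induction with
  | mem z hz =>
    obtain ⟨c, x, a, rfl⟩ := hz
    exact Submodule.subset_span ⟨c, x, PiTensorProduct.tprod k a, rfl⟩
  | zero => exact (map_zero (tensorRel (Bsym k A) ((kNerveUnder k).obj (op ⦋p⦌))).mkQ).symm ▸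
      Submodule.zero_mem _
  | add a b _ _ ha hb =>
    rw [map_add]
    exact Submodule.add_mem _ (ha trivial) (hb trivial)
  | smul c a _ ha =>
    rw [map_smul]
    exact Submodule.smul_mem _ c (ha trivial)

theorem chiLevel_naturality (n : ℕ) {p q : ℕ} (θ : ⦋q⦌ ⟶ ⦋p⦌) (x : (DMod k n) _⦋p⦌)
    (y : Fin n → (YPlus k A) _⦋p⦌) :
    chiLevel k A n q (((DMod k n).map θ.op).hom x) (fun i => ((YPlus k A).map θ.op).hom (y i)) =
      ((YPlus k A).map θ.op).hom (chiLevel k A n p x y) := by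
  have h : (MultilinearMap.compLinearMapₗ fun _ : Fin n => ((YPlus k A).map θ.op).hom) ∘ₗ
      chiLevel k A n q ∘ₗ ((DMod k n).map θ.op).hom =
      ((YPlus k A).map θ.op).hom.compMultilinearMapₗ k ∘ₗ chiLevel k A n p := by
    refine DMod.hom_ext _ _ fun σ => ?_
    rw [← sub_eq_zero]
    ext y
    refine multilinear_eq_zero_of_span _ (fun _ => {z | ∃ c x V, z = yCls k A p c x V}) ?_ y ?_
    · intro y hy
      choose c x V h using hy
      obtain rfl : y = fun i => yCls k A p (c i) (x i) (V i) := funext h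
      refine sub_eq_zero.mpr ?_
      show chiLevel k A n q (((DMod k n).map θ.op).hom (DMod.simplex k σ))
        (fun i => ((YPlus k A).map θ.op).hom (yCls k A p (c i) (x i) (V i))) =
        ((YPlus k A).map θ.op).hom (chiLevel k A n p (DMod.simplex k σ)
          fun i => yCls k A p (c i) (x i) (V i))
      rw [DMod.map_simplex, chiLevel_gen, yCls_map]
      simp only [yCls_map]
      exact chiLevel_gen k A n q _ c (fun i => (nerve (Under (c i))).map θ.op (x i)) V
    · intro i
      rw [yCls_span]
      trivial
  exact congrArg (fun f => f x y) h

/-- The structure map `χ : k[N(ES_n)] ⊗̂ (𝒴⁺A)^{⊗̂ n} ⟶ 𝒴⁺A` of the algebra `𝒴⁺A`. -/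
noncomputable def chiY (n : ℕ) :
    SMultimap (Fin.cons (α := fun _ => SimplicialObject (ModuleCat.{u} k)) ((Dsm k).P n)
      fun _ : Fin n => YPlus k A) (YPlus k A) :=
  SMultimap.ofLevel (chiLevel k A n) (chiLevel_naturality k A n)

end Chi

end SymHom
namespace SymHom

section DyerLashof

/-- The augmentation `(𝒩 k[N(ES_m)])_0 → k`, the sum of the coefficients. -/
noncomputable def dchAug (k : Type u) [CommRing k] (m : ℕ) : ((Dch k).P m).X 0 →ₗ[k] k :=
  Submodule.liftQ (degen (DMod k m) 0)
    (Finsupp.linearCombination k fun _ : Fin 1 → Equiv.Perm (Fin m) => (1 : k))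
    (Submodule.span_le.mpr fun _ ⟨_, hm, _⟩ => absurd hm (Nat.not_lt_zero _))

/-- The action of the generator `τ` of the cyclic group of order `p`, embedded in `S_p` by
`τ ↦ (1, p, p - 1, …, 2)`, on the Barratt–Eccles complex: right multiplication by the inverse
of this cycle. -/
noncomputable def cyc (k : Type u) [CommRing k] (p i : ℕ) :
    ((Dch k).P p).X i →ₗ[k] ((Dch k).P p).X i :=
  (((Dch k).act p (finRotate p)).f i).hom

/-- The images `ξ i` of the generators `e_i` under a chain map, over `k`, from the periodic
resolution of `k` by free modules over the group ring of the cyclic group of order `p`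
(with `d e_{2i+1} = (τ - 1) e_{2i}` and `d e_{2i+2} = (1 + τ + ⋯ + τ^{p-1}) e_{2i+1}`) to the
Barratt–Eccles complex. -/
structure IsCyclicLift (k : Type u) [CommRing k] (p : ℕ) (ξ : ∀ i, ((Dch k).P p).X i) : Prop where
  aug : dchAug k p (ξ 0) = 1
  odd : ∀ i, (((Dch k).P p).d (2 * i + 1) (2 * i)).hom (ξ (2 * i + 1)) =
    cyc k p (2 * i) (ξ (2 * i)) - ξ (2 * i)
  even : ∀ i, (((Dch k).P p).d (2 * i + 2) (2 * i + 1)).hom (ξ (2 * i + 2)) =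
    ∑ t ∈ Finset.range p, (cyc k p (2 * i + 1) ^ t) (ξ (2 * i + 1))

variable (k A : Type u) [CommRing k] [Ring A] [Algebra k A]

/-- The structure map of the Barratt–Eccles operad on `𝒩𝒴⁺A` induced by `chiY`: the shuffle map
followed by the normalization of `chiY`. -/
noncomputable def chiTilde (n : ℕ) : Tot ((Dch k).P n) →ₗ[k]
    MultilinearMap k (fun _ : Fin n => Tot (normalized (YPlus k A))) (Tot (normalized (YPlus k A))) :=
  (chiY k A n).chains

variable {k A}

/-- The function `D : HS_q(A) → HS_d(A)` (where `d = p q + i`) is `[z] ↦ [χ(e_i ⊗ z ⊗ ⋯ ⊗ z)]`,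
where the homology of `𝒩𝒴⁺A` is identified with `HS_*(A)` by `e`. -/
def IsDOperation (e : ∀ n, (normalized (YPlus k A)).homology n ≅ HS k A n) (p i q d : ℕ)
    (D : HS k A q → HS k A d) : Prop :=
  ∀ ξ, IsCyclicLift k p ξ → ∀ z : (normalized (YPlus k A)).cycles q,
    ∃ w : (normalized (YPlus k A)).cycles d,
      chiTilde k A p (Tot.of _ i (ξ i))
        (fun _ => Tot.of _ q (((normalized (YPlus k A)).iCycles q).hom z)) =
          Tot.of _ d (((normalized (YPlus k A)).iCycles d).hom w) ∧
      D ((e q).hom.hom (((normalized (YPlus k A)).homologyπ q).hom z)) =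
        (e d).hom.hom (((normalized (YPlus k A)).homologyπ d).hom w)

/-- The coefficient `(-1)^{s + q(q-1)(p-1)/4} (((p-1)/2)!)^q`. -/
def nu (p s q : ℕ) : ℤ :=
  (-1) ^ (s + q * (q - 1) * (p - 1) / 4) * (Nat.factorial ((p - 1) / 2) : ℤ) ^ q

/-- `P` is the operation `P_s : HS_q(A) → HS_{q+s}(A)`, for the prime `2`. -/
def IsP2 (e : ∀ n, (normalized (YPlus k A)).homology n ≅ HS k A n) (s q : ℕ)
    (P : HS k A q → HS k A (q + s)) : Prop :=
  (s < q → ∀ x, P x = 0) ∧ (q ≤ s → IsDOperation e 2 (s - q) q (q + s) P)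

/-- `P` is the operation `P_s : HS_q(A) → HS_{q+2s(p-1)}(A)`, for an odd prime `p`. -/
def IsP (e : ∀ n, (normalized (YPlus k A)).homology n ≅ HS k A n) (p s q : ℕ)
    (P : HS k A q → HS k A (q + 2 * s * (p - 1))) : Prop :=
  (2 * s < q → ∀ x, P x = 0) ∧
  (q ≤ 2 * s → ∃ D, IsDOperation e p ((2 * s - q) * (p - 1)) q (q + 2 * s * (p - 1)) D ∧
    ∀ x, P x = nu p s q • D x)

/-- `P` is the operation `βP_s : HS_q(A) → HS_{q+2s(p-1)-1}(A)`, for an odd prime `p`. -/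
def IsBetaP (e : ∀ n, (normalized (YPlus k A)).homology n ≅ HS k A n) (p s q : ℕ)
    (P : HS k A q → HS k A (q + 2 * s * (p - 1) - 1)) : Prop :=
  (2 * s ≤ q → ∀ x, P x = 0) ∧
  (q < 2 * s → ∃ D,
    IsDOperation e p ((2 * s - q) * (p - 1) - 1) q (q + 2 * s * (p - 1) - 1) D ∧
    ∀ x, P x = nu p s q • D x)

end DyerLashof

end SymHom

/-! The argument has four parts.

**Simplicial level.** The axioms of an operad for `k[N(ES_n)]`, and of an algebra for `𝒴⁺A`, are
multilinear, so that they may be checked on simplices. There they become, vertex by vertex, identities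
between block permutations (`SymHom.blockPerm_assoc`) and between the functors
`(σ, x₁, …, xₙ) ↦ σ{d₁, …, dₙ} ∘ (x₁ ⊙ ⋯ ⊙ xₙ)` (`SymHom.mu_assoc`, `SymHom.mu_reorder`,
`SymHom.mu_single`).

**Normalization.** The shuffle map of several variables is a signed sum over words: a word in the
letters of a finite set lists the directions of the steps of a lattice path, and its sign counts the
inversions. Composites of shuffle maps are shuffle maps of the combined variables, because a word in
the combined letters is the same as a word of words (`SymHom.Word.combine_bijective`); Koszul signs
arise from a change of the order of the letters (`SymHom.shSum_change`); and shuffle maps are chain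
maps, because inner faces at vertices between different letters cancel in pairs
(`SymHom.sum_faceTerm`). Hence normalized chains take operads and algebras in simplicial modules to
operads and algebras in chain complexes (`SymHom.chains_isDGOperad`, `SymHom.chains_isDGAlgebra`).
The chain-level Barratt–Eccles operad is `E_∞` (`SymHom.Dch_isEInfinity`), since
`(v₀, …, v_d) ↦ (1, v₀, …, v_d)` contracts it, and `S_n` permutes the nondegenerate simplices freely.

**Homology.** For a full subcategory `ι : C → D` with a functor `G : D → C` and a natural map
`1 → ιG`, each `c ↓ ι` has contractible nerve, so that `k[N(- ↓ ι)]` is a projective resolution of the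
constant functor and computes `Tor` over `D` (`SymHom.torIso`); moreover
`k[N(- ↓ ι)] ⊗_D F ≅ k[N(- ↓ C)] ⊗_C Fι` (`SymHom.tensorNerveHom`). For the inclusion of `ΔS` in `ΔS₊`,
adjoining a point to a set gives such a `G` (`SymHom.addPoint`). Therefore `Tor` over `ΔS₊` and over
`ΔS` agree, and `𝒩𝒴⁺A` computes symmetric homology (`SymHom.homologyIsoHS`).

**Operations.** A cyclic lift `ξ` exists, by filling cycles with the contraction
(`SymHom.cyclicLift`), and two of them differ by boundaries and values of the operators `τ - 1` and
`1 + τ + ⋯ + τ^(p-1)` (`SymHom.IsCyclicLift.exists_homotopy`). These operators kill powers `z^{⊗p}`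
when `p = 0` in `k`, so that `χ̃(ξ_i ⊗ z^{⊗p})` is a cycle whose class does not depend on `ξ`. For the
dependence on `z`, a non-additive question, one evaluates on the complex `k³` with basis `z`, `b`,
`d b`. Its `p`-th tensor power contracts onto the line of `z^{⊗p}`
(`SymHom.letterD_mul_letterS`), and although the contraction is not equivariant, it suffices, by
induction on `i`, to bound `χ̃(ξ_i ⊗ m)` for the invariant cycle
`m = (z + d b)^{⊗p} - z^{⊗p}` (`SymHom.exists_boundary_of_contraction`). -/

namespace SymHom

/-! ### Block permutations -/

/-- The position of the `a`-th element of block `s` in the concatenation of the blocks. -/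
theorem sigmaFin_val {n : ℕ} (j : Fin n → ℕ) (s : Fin n) (a : Fin (j s)) :
    (finSigmaFinEquiv (n := j) ⟨s, a⟩ : ℕ) = ∑ s₀ with s₀ < s, j s₀ + a := by
  rw [finSigmaFinEquiv_apply]
  congr 1
  refine Finset.sum_bij (fun i _ => Fin.castLE s.2.le i) ?_ ?_ ?_ ?_
  · intro i _
    simp only [Finset.mem_filter, Finset.mem_univ, true_and]
    exact i.2
  · intro i _ i' _ h
    simpa [Fin.ext_iff] using h
  · intro b hb
    simp only [Finset.mem_filter, Finset.mem_univ, true_and] at hb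
    exact ⟨⟨b, hb⟩, Finset.mem_univ _, rfl⟩
  · intro i _
    rfl

theorem sum_filter_add_le {n : ℕ} (j : Fin n → ℕ) (P Q : Fin n → Prop) [DecidablePred P]
    [DecidablePred Q] (s : Fin n) (hPs : ¬ P s) (hs : Q s) (h : ∀ t, P t → Q t) :
    ∑ t with P t, j t + j s ≤ ∑ t with Q t, j t := by
  rw [add_comm, ← Finset.sum_insert (s := Finset.univ.filter P) (by simpa using hPs)]
  refine Finset.sum_le_sum_of_subset fun t => ?_
  simp only [Finset.mem_insert, Finset.mem_filter, Finset.mem_univ, true_and]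
  rintro (rfl | ht)
  · exact hs
  · exact h t ht

/-- Positions `∑_{σ s₀ < σ s} j s₀ + a` are ordered lexicographically. -/
theorem position_lt_iff {n : ℕ} (σ : Equiv.Perm (Fin n)) (j : Fin n → ℕ) (s s' : Fin n)
    {a a' : ℕ} (ha : a < j s) (ha' : a' < j s') :
    ∑ s₀ with σ s₀ < σ s, j s₀ + a < ∑ s₀ with σ s₀ < σ s', j s₀ + a' ↔
      σ s < σ s' ∨ s = s' ∧ a < a' := by
  rcases lt_trichotomy (σ s) (σ s') with h | h | h
  · have := sum_filter_add_le j (fun t => σ t < σ s) (fun t => σ t < σ s') s (lt_irrefl _) h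
      fun t ht => ht.trans h
    simp only [h, true_or, iff_true]
    omega
  · obtain rfl := σ.injective h
    simp
  · have := sum_filter_add_le j (fun t => σ t < σ s') (fun t => σ t < σ s) s' (lt_irrefl _) h
      fun t ht => ht.trans h
    have h1 : ¬ σ s < σ s' := h.asymm
    have h2 : s ≠ s' := by
      rintro rfl
      exact lt_irrefl _ h
    simp only [h1, h2, false_and, or_self, iff_false]
    omega

theorem sigmaFin_lt_iff {n : ℕ} (j : Fin n → ℕ) (s s' : Fin n) (a : Fin (j s)) (a' : Fin (j s')) :
    finSigmaFinEquiv (n := j) ⟨s, a⟩ < finSigmaFinEquiv (n := j) ⟨s', a'⟩ ↔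
      s < s' ∨ s = s' ∧ (a : ℕ) < a' := by
  rw [Fin.lt_def, sigmaFin_val, sigmaFin_val]
  exact position_lt_iff 1 j s s' a.2 a'.2

theorem sigmaCongrLeft'_mk {n : ℕ} (σ : Equiv.Perm (Fin n)) (j : Fin n → ℕ) (s : Fin n)
    (a : Fin (j (σ.symm s))) :
    Equiv.sigmaCongrLeft' (β := fun s => Fin (j s)) σ ⟨σ.symm s, a⟩ = ⟨s, a⟩ :=
  (Equiv.symm_apply_eq _).mpr rfl

theorem blockPerm_symm_mk {n : ℕ} (σ : Equiv.Perm (Fin n)) (j : Fin n → ℕ) (s : Fin n)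
    (a : Fin (j (σ.symm s))) :
    blockPerm σ j (finSigmaFinEquiv (n := j) ⟨σ.symm s, a⟩) = Fin.cast (Equiv.sum_comp σ.symm j)
      (finSigmaFinEquiv (n := fun s => j (σ.symm s)) ⟨s, a⟩) := by
  simp only [blockPerm, Equiv.trans_apply, Equiv.symm_apply_apply, sigmaCongrLeft'_mk]
  rfl

/-- A block permutation moves block `s` behind all blocks that `σ` moves before it. The laws below
compare the two sides of an identity of block permutations through this formula. -/
theorem blockPerm_val {n : ℕ} (σ : Equiv.Perm (Fin n)) (j : Fin n → ℕ) (s : Fin n)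
    (a : Fin (j s)) :
    (blockPerm σ j (finSigmaFinEquiv (n := j) ⟨s, a⟩) : ℕ) = ∑ s₀ with σ s₀ < σ s, j s₀ + a := by
  obtain ⟨s, rfl⟩ := σ.symm.surjective s
  rw [blockPerm_symm_mk, Fin.val_cast, sigmaFin_val]
  congr 1
  refine Finset.sum_bij (fun i _ => σ.symm i) ?_ ?_ ?_ ?_
  · intro i hi
    simpa using hi
  · intro i _ i' _ h
    simpa using h
  · intro b hb
    exact ⟨σ b, by simpa using hb, by simp⟩
  · intro i _
    rfl

theorem blockPerm_lt_iff {n : ℕ} (σ : Equiv.Perm (Fin n)) (j : Fin n → ℕ) (s s' : Fin n)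
    (a : Fin (j s)) (a' : Fin (j s')) :
    blockPerm σ j (finSigmaFinEquiv (n := j) ⟨s, a⟩) <
      blockPerm σ j (finSigmaFinEquiv (n := j) ⟨s', a'⟩) ↔
      σ s < σ s' ∨ s = s' ∧ (a : ℕ) < a' := by
  rw [Fin.lt_def, blockPerm_val, blockPerm_val]
  exact position_lt_iff σ j s s' a.2 a'.2

theorem dirSumPerm_mk {n : ℕ} (j : Fin n → ℕ) (τ : ∀ s, Equiv.Perm (Fin (j s))) (s : Fin n)
    (a : Fin (j s)) :
    dirSumPerm j τ (finSigmaFinEquiv (n := j) ⟨s, a⟩) =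
      finSigmaFinEquiv (n := j) ⟨s, τ s a⟩ := by
  simp [dirSumPerm]

theorem dirSumPerm_mul {n : ℕ} (j : Fin n → ℕ) (τ τ' : ∀ s, Equiv.Perm (Fin (j s))) :
    dirSumPerm j (fun s => τ s * τ' s) = dirSumPerm j τ * dirSumPerm j τ' := by
  ext x
  obtain ⟨⟨s, a⟩, rfl⟩ := finSigmaFinEquiv.surjective x
  rw [Equiv.Perm.mul_apply, dirSumPerm_mk, dirSumPerm_mk, dirSumPerm_mk]
  rfl

/-- A sum over the positions of `j 0 + ⋯ + j (n-1)` that precede a given one in a lexicographic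
order: full blocks, then part of the block `s`. -/
theorem sum_positions {n : ℕ} (j : Fin n → ℕ) (i : ∀ s, Fin (j s) → ℕ)
    (L : Fin (∑ s, j s) → Prop) [DecidablePred L] (P : Fin n → Prop) [DecidablePred P]
    (s : Fin n) (Q : Fin (j s) → Prop) [DecidablePred Q] (hs : ¬ P s)
    (hP : ∀ s₀ t₀, s₀ ≠ s → (L (finSigmaFinEquiv ⟨s₀, t₀⟩) ↔ P s₀))
    (hQ : ∀ t₀, L (finSigmaFinEquiv ⟨s, t₀⟩) ↔ Q t₀) :
    ∑ r with L r, i (finSigmaFinEquiv.symm r).1 (finSigmaFinEquiv.symm r).2 =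
      ∑ s₀ with P s₀, ∑ t, i s₀ t + ∑ t with Q t, i s t := by
  simp only [Finset.sum_filter]
  have h : ∀ r, (if L r then i (finSigmaFinEquiv.symm r).1 (finSigmaFinEquiv.symm r).2 else 0) =
      (fun p : (s : Fin n) × Fin (j s) => if L (finSigmaFinEquiv p) then i p.1 p.2 else 0)
        (finSigmaFinEquiv.symm r) := fun r => by
    simp only [Equiv.apply_symm_apply]
  rw [Finset.sum_congr rfl fun r _ => h r]
  refine (Equiv.sum_comp finSigmaFinEquiv.symm fun p : (s : Fin n) × Fin (j s) =>
    if L (finSigmaFinEquiv p) then i p.1 p.2 else 0).trans ?_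
  rw [Fintype.sum_sigma]
  rw [← Finset.add_sum_erase _ _ (Finset.mem_univ s), add_comm]
  congr 1
  · rw [← Finset.add_sum_erase (Finset.univ) (fun s₀ => if P s₀ then _ else _)
      (Finset.mem_univ s), if_neg hs, zero_add]
    refine Finset.sum_congr rfl fun s₀ h₀ => ?_
    have h₀' : s₀ ≠ s := by simpa using h₀
    simp only [hP s₀ _ h₀']
    split_ifs <;> simp
  · simp only [hQ]

/-- `finSigmaFinEquiv` is associative. -/
theorem sigmaFin_assoc {n : ℕ} (j : Fin n → ℕ) (i : ∀ s, Fin (j s) → ℕ) (r : Fin (∑ s, j s))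
    (a : Fin (i (finSigmaFinEquiv.symm r).1 (finSigmaFinEquiv.symm r).2)) :
    (finSigmaFinEquiv (n := fun r : Fin (∑ s, j s) =>
        i (finSigmaFinEquiv.symm r).1 (finSigmaFinEquiv.symm r).2) ⟨r, a⟩ : ℕ) =
      (finSigmaFinEquiv (n := fun s => ∑ t, i s t) ⟨(finSigmaFinEquiv.symm r).1,
        finSigmaFinEquiv (n := i _) ⟨(finSigmaFinEquiv.symm r).2, a⟩⟩ : ℕ) := by
  rw [sigmaFin_val, sigmaFin_val, sigmaFin_val, ← add_assoc]
  congr 1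
  refine sum_positions j i _ (fun s => s < (finSigmaFinEquiv.symm r).1) _
    (fun t => t < (finSigmaFinEquiv.symm r).2) (lt_irrefl _) (fun s₀ t₀ h => ?_) fun t₀ => ?_
  · refine (iff_of_eq (congrArg (_ < ·) (Equiv.apply_symm_apply finSigmaFinEquiv r).symm)).trans ?_
    refine (sigmaFin_lt_iff j _ _ _ _).trans ?_
    simp [h]
  · refine (iff_of_eq (congrArg (_ < ·) (Equiv.apply_symm_apply finSigmaFinEquiv r).symm)).trans ?_
    refine (sigmaFin_lt_iff j _ _ _ _).trans ?_
    simp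

/-- Associativity of the composition of permutations in the Barratt–Eccles operad. -/
theorem blockPerm_assoc {n : ℕ} (j : Fin n → ℕ) (i : ∀ s, Fin (j s) → ℕ)
    (σ : Equiv.Perm (Fin n)) (τ : ∀ s, Equiv.Perm (Fin (j s)))
    (ρ : ∀ s t, Equiv.Perm (Fin (i s t))) :
    (finCongr (sum_blocks j i)).permCongr
      (blockPerm (blockPerm σ j * dirSumPerm j τ)
          (fun r => i (finSigmaFinEquiv.symm r).1 (finSigmaFinEquiv.symm r).2) *
        dirSumPerm (fun r => i (finSigmaFinEquiv.symm r).1 (finSigmaFinEquiv.symm r).2)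
          fun r => ρ (finSigmaFinEquiv.symm r).1 (finSigmaFinEquiv.symm r).2) =
      blockPerm σ (fun s => ∑ t, i s t) * dirSumPerm (fun s => ∑ t, i s t)
        fun s => blockPerm (τ s) (i s) * dirSumPerm (i s) (ρ s) := by
  ext x
  obtain ⟨x, rfl⟩ := (finCongr (sum_blocks j i)).surjective x
  obtain ⟨⟨r, a⟩, rfl⟩ := finSigmaFinEquiv.surjective x
  have hx : finCongr (sum_blocks j i) (finSigmaFinEquiv ⟨r, a⟩) =
      (finSigmaFinEquiv (n := fun s => ∑ t, i s t) ⟨(finSigmaFinEquiv.symm r).1,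
        finSigmaFinEquiv (n := i _) ⟨(finSigmaFinEquiv.symm r).2, a⟩⟩) :=
    Fin.ext (sigmaFin_assoc j i r a)
  rw [Equiv.permCongr_apply, Equiv.symm_apply_apply, hx, Equiv.Perm.mul_apply,
    Equiv.Perm.mul_apply, dirSumPerm_mk, dirSumPerm_mk, Equiv.Perm.mul_apply, dirSumPerm_mk,
    finCongr_apply, Fin.val_cast, blockPerm_val, blockPerm_val, blockPerm_val, ← add_assoc]
  congr 1
  have hπ : (blockPerm σ j * dirSumPerm j τ) r = blockPerm σ j (finSigmaFinEquiv
      ⟨(finSigmaFinEquiv.symm r).1, τ _ (finSigmaFinEquiv.symm r).2⟩) := by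
    rw [Equiv.Perm.mul_apply, ← dirSumPerm_mk]
    exact congrArg (fun r => blockPerm σ j (dirSumPerm j τ r))
      (Equiv.apply_symm_apply finSigmaFinEquiv r).symm
  refine sum_positions j i _ (fun s => σ s < σ (finSigmaFinEquiv.symm r).1) _
    (fun t => τ _ t < τ _ (finSigmaFinEquiv.symm r).2) (lt_irrefl _) (fun s₀ t₀ h => ?_)
    fun t₀ => ?_
  · rw [Equiv.Perm.mul_apply, dirSumPerm_mk]
    refine (iff_of_eq (congrArg (_ < ·) hπ)).trans ?_
    refine (blockPerm_lt_iff σ j _ _ _ _).trans ?_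
    simp [h]
  · rw [Equiv.Perm.mul_apply, dirSumPerm_mk]
    refine (iff_of_eq (congrArg (_ < ·) hπ)).trans ?_
    refine (blockPerm_lt_iff σ j _ _ _ _).trans ?_
    simp

/-- The left unit law of the composition of permutations. -/
theorem blockPerm_dirSum_one_left (n : ℕ) (τ : Equiv.Perm (Fin n)) (h : ∑ _ : Fin 1, n = n) :
    (finCongr h).permCongr (blockPerm 1 (fun _ : Fin 1 => n) * dirSumPerm _ fun _ => τ) = τ := by
  ext x
  obtain ⟨x, rfl⟩ := (finCongr h).surjective x
  obtain ⟨⟨s, a⟩, rfl⟩ := finSigmaFinEquiv.surjective x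
  obtain rfl := Subsingleton.elim s 0
  have hx : finCongr h (finSigmaFinEquiv ⟨0, a⟩) = a := Fin.ext (by simp)
  rw [Equiv.permCongr_apply, Equiv.symm_apply_apply, hx, Equiv.Perm.mul_apply, dirSumPerm_mk,
    finCongr_apply, Fin.val_cast, blockPerm_val]
  simp

/-- The right unit law of the composition of permutations. -/
theorem blockPerm_dirSum_one_right (n : ℕ) (σ : Equiv.Perm (Fin n)) (h : ∑ _ : Fin n, 1 = n) :
    (finCongr h).permCongr (blockPerm σ (fun _ => 1) * dirSumPerm _ fun _ => 1) = σ := by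
  have hc : ∀ b : Fin n, (Finset.univ.filter fun s₀ => σ s₀ < b).card = (b : ℕ) := by
    intro b
    rw [← Fin.card_Iio b]
    exact Finset.card_bij (fun s _ => σ s) (by simp) (by simp)
      fun b hb => ⟨σ.symm b, by simpa using hb, by simp⟩
  ext x
  obtain ⟨x, rfl⟩ := (finCongr h).surjective x
  obtain ⟨⟨s, a⟩, rfl⟩ := finSigmaFinEquiv.surjective x
  have hx : finCongr h (finSigmaFinEquiv ⟨s, a⟩) = s := Fin.ext (by simp)
  rw [Equiv.permCongr_apply, Equiv.symm_apply_apply, hx, Equiv.Perm.mul_apply, dirSumPerm_mk,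
    finCongr_apply, Fin.val_cast, blockPerm_val]
  simp [hc]

/-- The outer equivariance of the composition of permutations. -/
theorem blockPerm_mul_dirSum {n : ℕ} (j : Fin n → ℕ) (σ ρ : Equiv.Perm (Fin n))
    (τ : ∀ s, Equiv.Perm (Fin (j s))) :
    blockPerm (σ * ρ) j * dirSumPerm j τ =
      (finCongr (Equiv.sum_comp ρ.symm j)).permCongr (blockPerm σ (fun s => j (ρ.symm s)) *
        dirSumPerm (fun s => j (ρ.symm s)) fun s => τ (ρ.symm s)) * blockPerm ρ j := by
  ext x
  obtain ⟨⟨s, a⟩, rfl⟩ := finSigmaFinEquiv.surjective x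
  obtain ⟨s, rfl⟩ := ρ.symm.surjective s
  rw [Equiv.Perm.mul_apply, Equiv.Perm.mul_apply, dirSumPerm_mk, blockPerm_symm_mk, blockPerm_val,
    Equiv.permCongr_apply]
  have h : (finCongr (Equiv.sum_comp ρ.symm j)).symm (Fin.cast (Equiv.sum_comp ρ.symm j)
      (finSigmaFinEquiv ⟨s, a⟩)) = finSigmaFinEquiv (n := fun s => j (ρ.symm s)) ⟨s, a⟩ := rfl
  rw [h, Equiv.Perm.mul_apply (blockPerm σ _),
    dirSumPerm_mk (fun s => j (ρ.symm s)) (fun s => τ (ρ.symm s)) s a, finCongr_apply, Fin.val_cast,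
    blockPerm_val σ (fun s => j (ρ.symm s))]
  congr 1
  refine Finset.sum_bij (fun i _ => ρ i) ?_ ?_ ?_ ?_
  · intro i hi
    simpa using hi
  · intro i _ i' _ h
    simpa using h
  · intro b hb
    exact ⟨ρ.symm b, by simpa using hb, by simp⟩
  · intro i _
    simp

theorem blockPerm_mul {n : ℕ} (j : Fin n → ℕ) (σ ρ : Equiv.Perm (Fin n)) :
    blockPerm (σ * ρ) j = (finCongr (Equiv.sum_comp ρ.symm j)).permCongr
      (blockPerm σ fun s => j (ρ.symm s)) * blockPerm ρ j := by
  have h1 : ∀ (j : Fin n → ℕ), dirSumPerm j (fun _ => 1) = 1 := fun j => by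
    ext x
    obtain ⟨⟨s, a⟩, rfl⟩ := finSigmaFinEquiv.surjective x
    rw [dirSumPerm_mk]
    rfl
  have h := blockPerm_mul_dirSum j σ ρ fun _ => 1
  rwa [h1, h1, mul_one, mul_one] at h

/-! ### The operad `k[N(ES_n)]` in simplicial modules -/

section MultiSpan

variable {k : Type u} [CommRing k]

/-- Functions of several variables that are linear in each variable, as a predicate on plain
functions: the two sides of an operad axiom are composites whose linearity in each variable is
proved separately from their definition. -/
def IsMultilin (k : Type u) [CommRing k] {ι : Type} [DecidableEq ι] {M : ι → Type u}
    [∀ i, AddCommGroup (M i)] [∀ i, Module k (M i)] {N : Type u} [AddCommGroup N] [Module k N]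
    (f : (∀ i, M i) → N) : Prop :=
  ∀ (x : ∀ i, M i) (i : ι), ∃ l : M i →ₗ[k] N, ∀ a, f (Function.update x i a) = l a

variable {ι : Type} [DecidableEq ι] {M : ι → Type u}
  [∀ i, AddCommGroup (M i)] [∀ i, Module k (M i)] {N P : Type u} [AddCommGroup N] [Module k N]
  [AddCommGroup P] [Module k P]

/-- Functions that are linear in each variable agree if they agree on families of generators. -/
theorem IsMultilin.ext_span [Fintype ι] {f g : (∀ i, M i) → N} (hf : IsMultilin k f)
    (hg : IsMultilin k g) (S : ∀ i, Set (M i)) (hS : ∀ i, Submodule.span k (S i) = ⊤)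
    (h : ∀ x, (∀ i, x i ∈ S i) → f x = g x) (x : ∀ i, M i) : f x = g x := by
  have key : ∀ (s : Finset ι) (x : ∀ i, M i), (∀ i ∉ s, x i ∈ S i) → f x = g x := by
    intro s
    induction s using Finset.induction_on with
    | empty => exact fun x hx => h x fun i => hx i (by simp)
    | insert i s his ih =>
      intro x hx
      obtain ⟨l, hl⟩ := hf x i
      obtain ⟨m, hm⟩ := hg x i
      have hlm : l = m := by
        refine LinearMap.ext_on (hS i) fun a ha => ?_
        rw [← hl, ← hm]
        refine ih _ fun j hj => ?_
        by_cases e : j = i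
        · subst e
          simpa using ha
        · rw [Function.update_of_ne e]
          exact hx j (by simp [e, hj])
      rw [← Function.update_eq_self i x, hl, hm, hlm]
  exact key Finset.univ x fun i hi => absurd (Finset.mem_univ i) hi

theorem IsMultilin.of_multilinear {n : ℕ} {M : Fin n → Type u}
    [∀ i, AddCommGroup (M i)] [∀ i, Module k (M i)] (f : MultilinearMap k M N) :
    IsMultilin k f :=
  fun x i => ⟨f.toLinearMap x i, fun _ => rfl⟩

theorem IsMultilin.linear_comp {f : (∀ i, M i) → N} (hf : IsMultilin k f) (l : N →ₗ[k] P) :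
    IsMultilin k fun x => l (f x) := fun x i => by
  obtain ⟨m, hm⟩ := hf x i
  exact ⟨l ∘ₗ m, fun a => congrArg l (hm a)⟩

theorem IsMultilin.comp_linear {M' : ι → Type u} [∀ i, AddCommGroup (M' i)]
    [∀ i, Module k (M' i)] {f : (∀ i, M i) → N} (hf : IsMultilin k f)
    (l : ∀ i, M' i →ₗ[k] M i) : IsMultilin k fun x : ∀ i, M' i => f fun i => l i (x i) :=
  fun x i => by
    obtain ⟨m, hm⟩ := hf (fun i => l i (x i)) i
    refine ⟨m ∘ₗ l i, fun a => ?_⟩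
    rw [LinearMap.comp_apply, ← hm]
    exact congrArg f (funext fun j => Function.apply_update (fun i => l i) x i a j)

theorem IsMultilin.reindex {κ : Type} [DecidableEq κ] (e : κ ≃ ι)
    {f : (∀ r, M (e r)) → N} (hf : IsMultilin k f) :
    IsMultilin k fun x : ∀ i, M i => f fun r => x (e r) := fun x i => by
  obtain ⟨r, rfl⟩ := e.surjective i
  obtain ⟨m, hm⟩ := hf (fun r => x (e r)) r
  refine ⟨m, fun a => ?_⟩
  rw [← hm]
  refine congrArg f (funext fun r' => ?_)
  by_cases h : r' = r
  · subst h
    simp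
  · rw [Function.update_of_ne h, Function.update_of_ne (fun h' => h (e.injective h'))]

/-- Composites of multilinear functions, the inner ones in disjoint sets of variables. -/
theorem IsMultilin.sigma {n : ℕ} {j : Fin n → ℕ} {M : ((s : Fin n) × Fin (j s)) → Type u}
    [∀ i, AddCommGroup (M i)] [∀ i, Module k (M i)] {M' : Fin n → Type u}
    [∀ i, AddCommGroup (M' i)] [∀ i, Module k (M' i)] {f : (∀ s, M' s) → N}
    (hf : IsMultilin k f) {g : ∀ s, (∀ t, M ⟨s, t⟩) → M' s} (hg : ∀ s, IsMultilin k (g s)) :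
    IsMultilin k fun x : ∀ p, M p => f fun s => g s fun t => x ⟨s, t⟩ := fun x p => by
  obtain ⟨s, t⟩ := p
  obtain ⟨l, hl⟩ := hg s (fun t => x ⟨s, t⟩) t
  obtain ⟨m, hm⟩ := hf (fun s => g s fun t => x ⟨s, t⟩) s
  refine ⟨m ∘ₗ l, fun a => ?_⟩
  rw [LinearMap.comp_apply, ← hm, ← hl]
  refine congrArg f (funext fun s' => ?_)
  by_cases h : s' = s
  · subst h
    rw [Function.update_self]
    congr 1
    funext t'
    by_cases h : t' = t
    · subst h
      simp
    · rw [Function.update_of_ne h, Function.update_of_ne]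
      simpa using h
  · rw [Function.update_of_ne h]
    congr 1
    funext t'
    rw [Function.update_of_ne]
    intro h'
    exact h (congrArg Sigma.fst h')

/-- Evaluation of multilinear maps, as a linear map. -/
def evalₗ {n : ℕ} {M : Fin n → Type u} [∀ i, AddCommGroup (M i)] [∀ i, Module k (M i)]
    (y : ∀ i, M i) : MultilinearMap k M N →ₗ[k] N where
  toFun f := f y
  map_add' _ _ := rfl
  map_smul' _ _ := rfl

/-- Fixing the last arguments of a family of multilinear maps with linear parameters. -/
theorem IsMultilin.apply {n : ℕ} {j : Fin n → ℕ} {M : Fin n → Type u}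
    {Y : ∀ s, Fin (j s) → Type u}
    [∀ i, AddCommGroup (M i)] [∀ i, Module k (M i)] [∀ s t, AddCommGroup (Y s t)]
    [∀ s t, Module k (Y s t)] {M' : Fin n → Type u}
    [∀ i, AddCommGroup (M' i)] [∀ i, Module k (M' i)] {f : (∀ s, M' s) → N}
    (hf : IsMultilin k f) (g : ∀ s, M s →ₗ[k] MultilinearMap k (Y s) (M' s))
    (z : ∀ s t, Y s t) :
    IsMultilin k fun y : ∀ s, M s => f fun s => g s (y s) (z s) :=
  hf.comp_linear fun s => evalₗ (z s) ∘ₗ g s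

end MultiSpan

section BarrattEcclesOperad

variable {k : Type u} [CommRing k]

/-- Transport along an equality of arities. -/
noncomputable def DMod.castₗ (k : Type u) [CommRing k] (p : ℕ) {a b : ℕ} (h : a = b) :
    (DMod k a) _⦋p⦌ →ₗ[k] (DMod k b) _⦋p⦌ :=
  h ▸ LinearMap.id

theorem Dsm_castV (p : ℕ) {a b : ℕ} (h : a = b) (x : (DMod k a) _⦋p⦌) :
    ((Dsm k).level p).castV h x = DMod.castₗ k p h x := by
  subst h
  rfl

theorem DMod.span_simplex (m p : ℕ) :
    Submodule.span k (Set.range fun v : Fin (p + 1) → Equiv.Perm (Fin m) => DMod.simplex k v) = ⊤ := by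
  have h := (Finsupp.basisSingleOne (R := k) (ι := Fin (p + 1) → Equiv.Perm (Fin m))).span_eq
  rwa [Finsupp.coe_basisSingleOne] at h

theorem DMod.castₗ_simplex (p : ℕ) {a b : ℕ} (h : a = b) (v : Fin (p + 1) → Equiv.Perm (Fin a)) :
    DMod.castₗ k p h (DMod.simplex k v) =
      DMod.simplex k fun q => (finCongr h).permCongr (v q) := by
  subst h
  rfl

theorem Dsm_one (p : ℕ) : ((Dsm k).level p).one = DMod.simplex k fun _ => 1 :=
  DMod.map_simplex _ _

/-- Associativity of the composition of simplices of permutations: by multilinearity it suffices to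
compare generators, where it is `blockPerm_assoc` at each vertex. -/
theorem DMod.comp_assoc (p n : ℕ) (j : Fin n → ℕ) (i : ∀ s, Fin (j s) → ℕ) (x : (DMod k n) _⦋p⦌)
    (y : ∀ s, (DMod k (j s)) _⦋p⦌) (z : ∀ q : (s : Fin n) × Fin (j s), (DMod k (i q.1 q.2)) _⦋p⦌) :
    DMod.castₗ k p (sum_blocks j i) (DMod.comp k (∑ s, j s)
        (fun r => i (finSigmaFinEquiv.symm r).1 (finSigmaFinEquiv.symm r).2) p
        (DMod.comp k n j p x y) fun r => z (finSigmaFinEquiv.symm r)) =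
      DMod.comp k n (fun s => ∑ t, i s t) p x
        fun s => DMod.comp k (j s) (i s) p (y s) fun t => z ⟨s, t⟩ := by
  refine IsMultilin.ext_span (k := k)
      (f := fun z : ∀ q : (s : Fin n) × Fin (j s), (DMod k (i q.1 q.2)) _⦋p⦌ =>
        DMod.castₗ k p (sum_blocks j i) (DMod.comp k (∑ s, j s)
        (fun r => i (finSigmaFinEquiv.symm r).1 (finSigmaFinEquiv.symm r).2) p
        (DMod.comp k n j p x y) fun r => z (finSigmaFinEquiv.symm r)))
      (g := fun z => DMod.comp k n (fun s => ∑ t, i s t) p x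
        fun s => DMod.comp k (j s) (i s) p (y s) fun t => z ⟨s, t⟩)
      (((IsMultilin.of_multilinear _).reindex finSigmaFinEquiv.symm).linear_comp _)
      ((IsMultilin.of_multilinear (DMod.comp k n (fun s => ∑ t, i s t) p x)).sigma fun s =>
        IsMultilin.of_multilinear (DMod.comp k (j s) (i s) p (y s)))
      _ (fun q => DMod.span_simplex (i q.1 q.2) p) (fun z hz => ?_) z
  choose ρ hρ using hz
  obtain rfl : (fun q => DMod.simplex k (ρ q)) = z := funext hρ
  refine IsMultilin.ext_span (k := k)
    ((IsMultilin.of_multilinear (DMod.comp k n j p x)).linear_comp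
      (DMod.castₗ k p (sum_blocks j i) ∘ₗ
        evalₗ (fun r => DMod.simplex k (ρ (finSigmaFinEquiv.symm r))) ∘ₗ DMod.comp k (∑ s, j s)
        (fun r => i (finSigmaFinEquiv.symm r).1 (finSigmaFinEquiv.symm r).2) p))
    (IsMultilin.apply (IsMultilin.of_multilinear (DMod.comp k n (fun s => ∑ t, i s t) p x))
      (fun s => DMod.comp k (j s) (i s) p) fun s t => DMod.simplex k (ρ ⟨s, t⟩)) _
      (fun s => DMod.span_simplex (j s) p) (fun y hy => ?_) y
  choose τ hτ using hy
  obtain rfl : (fun q => DMod.simplex k (τ q)) = y := funext hτ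
  -- Linear maps on `k[N(ES_n)]` that agree on simplices are equal, which settles `x`.
  refine congrArg (fun f => f x) (DMod.hom_ext
    ((DMod.castₗ k p (sum_blocks j i) ∘ₗ
        evalₗ (fun r => DMod.simplex k (ρ (finSigmaFinEquiv.symm r))) ∘ₗ DMod.comp k (∑ s, j s)
        (fun r => i (finSigmaFinEquiv.symm r).1 (finSigmaFinEquiv.symm r).2) p) ∘ₗ
      evalₗ (fun s => DMod.simplex k (τ s)) ∘ₗ DMod.comp k n j p)
    (evalₗ (fun s => DMod.comp k (j s) (i s) p (DMod.simplex k (τ s))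
      fun t => DMod.simplex k (ρ ⟨s, t⟩)) ∘ₗ DMod.comp k n (fun s => ∑ t, i s t) p) fun σ => ?_)
  show DMod.castₗ k p (sum_blocks j i) (DMod.comp k (∑ s, j s)
        (fun r => i (finSigmaFinEquiv.symm r).1 (finSigmaFinEquiv.symm r).2) p
        (DMod.comp k n j p (DMod.simplex k σ) fun s => DMod.simplex k (τ s))
        fun r => DMod.simplex k (ρ (finSigmaFinEquiv.symm r))) =
      DMod.comp k n (fun s => ∑ t, i s t) p (DMod.simplex k σ)
        fun s => DMod.comp k (j s) (i s) p (DMod.simplex k (τ s))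
          fun t => DMod.simplex k (ρ ⟨s, t⟩)
  simp only [DMod.comp_simplex]
  rw [DMod.castₗ_simplex]
  exact congrArg (DMod.simplex k) (funext fun q => blockPerm_assoc j i (σ q) (fun s => τ s q)
    fun s t => ρ ⟨s, t⟩ q)

theorem DMod.comp_one_left (p n : ℕ) (x : (DMod k n) _⦋p⦌) (h : ∑ _ : Fin 1, n = n) :
    DMod.castₗ k p h (DMod.comp k 1 (fun _ => n) p (DMod.simplex k fun _ => 1) fun _ => x) = x := by
  refine IsMultilin.ext_span (k := k) (f := fun x : ∀ _ : Fin 1, (DMod k n) _⦋p⦌ =>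
      DMod.castₗ k p h (DMod.comp k 1 (fun _ => n) p (DMod.simplex k fun _ => 1) x))
    (g := fun x => x 0) ((IsMultilin.of_multilinear _).linear_comp _)
    (fun x i => ⟨LinearMap.id, fun a => ?_⟩) _ (fun _ => DMod.span_simplex n p) (fun x hx => ?_)
    fun _ => x
  · obtain rfl := Subsingleton.elim i 0
    simp
  choose τ hτ using hx
  obtain rfl : (fun q => DMod.simplex k (τ q)) = x := funext hτ
  have h0 : τ = fun _ => τ 0 := funext fun s => by rw [Subsingleton.elim s 0]
  rw [h0]
  simp only [DMod.comp_simplex, DMod.castₗ_simplex]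
  exact congrArg (DMod.simplex k) (funext fun q => blockPerm_dirSum_one_left n (τ 0 q) h)

theorem DMod.comp_one_right (p n : ℕ) (x : (DMod k n) _⦋p⦌) (h : ∑ _ : Fin n, 1 = n) :
    DMod.castₗ k p h (DMod.comp k n (fun _ => 1) p x fun _ => DMod.simplex k fun _ => 1) = x := by
  refine congrArg (fun f => f x) (DMod.hom_ext (DMod.castₗ k p h ∘ₗ
    evalₗ (fun _ => DMod.simplex k fun _ => 1) ∘ₗ DMod.comp k n (fun _ => 1) p)
      LinearMap.id fun v => ?_)
  show DMod.castₗ k p h (DMod.comp k n (fun _ => 1) p (DMod.simplex k v)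
    fun _ => DMod.simplex k fun _ => 1) = DMod.simplex k v
  simp only [DMod.comp_simplex, DMod.castₗ_simplex]
  exact congrArg (DMod.simplex k) (funext fun q => blockPerm_dirSum_one_right n (v q) h)

/-- Right multiplication by a permutation, on simplices of degree `p`. -/
noncomputable def DMod.act (k : Type u) [CommRing k] (p : ℕ) {n : ℕ} (τ : Equiv.Perm (Fin n)) :
    (DMod k n) _⦋p⦌ →ₗ[k] (DMod k n) _⦋p⦌ :=
  (((Dsm k).act n τ).app (op ⦋p⦌)).hom

theorem DMod.act_simplex (p : ℕ) {n : ℕ} (τ : Equiv.Perm (Fin n))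
    (v : Fin (p + 1) → Equiv.Perm (Fin n)) :
    DMod.act k p τ (DMod.simplex k v) = DMod.simplex k fun q => v q * τ :=
  Finsupp.mapDomain_single (f := fun v : Fin (p + 1) → Equiv.Perm (Fin n) => fun i => v i * τ)

theorem DMod.comp_act_left (p n : ℕ) (j : Fin n → ℕ) (σ : Equiv.Perm (Fin n))
    (x : (DMod k n) _⦋p⦌) (y : ∀ s, (DMod k (j s)) _⦋p⦌) :
    DMod.comp k n j p (DMod.act k p σ x) y = DMod.act k p (blockPerm σ j)
      (DMod.castₗ k p (Equiv.sum_comp σ.symm j)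
        (DMod.comp k n (fun s => j (σ.symm s)) p x fun s => y (σ.symm s))) := by
  refine IsMultilin.ext_span (k := k) (f := fun y : ∀ s, (DMod k (j s)) _⦋p⦌ =>
      DMod.comp k n j p (DMod.act k p σ x) y)
    (g := fun y => DMod.act k p (blockPerm σ j)
      (DMod.castₗ k p (Equiv.sum_comp σ.symm j)
        (DMod.comp k n (fun s => j (σ.symm s)) p x fun s => y (σ.symm s))))
    (IsMultilin.of_multilinear _)
    ((((IsMultilin.of_multilinear _).reindex σ.symm).linear_comp _).linear_comp _)
    _ (fun s => DMod.span_simplex (j s) p) (fun y hy => ?_) y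
  choose τ hτ using hy
  obtain rfl : (fun q => DMod.simplex k (τ q)) = y := funext hτ
  refine congrArg (fun f => f x) (DMod.hom_ext
    (evalₗ (fun s => DMod.simplex k (τ s)) ∘ₗ DMod.comp k n j p ∘ₗ DMod.act k p σ)
    (DMod.act k p (blockPerm σ j) ∘ₗ DMod.castₗ k p (Equiv.sum_comp σ.symm j) ∘ₗ
      evalₗ (fun s => DMod.simplex k (τ (σ.symm s))) ∘ₗ
        DMod.comp k n (fun s => j (σ.symm s)) p) fun v => ?_)
  show DMod.comp k n j p (DMod.act k p σ (DMod.simplex k v)) (fun s => DMod.simplex k (τ s)) =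
    DMod.act k p (blockPerm σ j) (DMod.castₗ k p (Equiv.sum_comp σ.symm j)
        (DMod.comp k n (fun s => j (σ.symm s)) p (DMod.simplex k v)
          fun s => DMod.simplex k (τ (σ.symm s))))
  simp only [DMod.act_simplex, DMod.comp_simplex, DMod.castₗ_simplex]
  exact congrArg (DMod.simplex k) (funext fun q => blockPerm_mul_dirSum j (v q) σ fun s => τ s q)

theorem DMod.comp_act_right (p n : ℕ) (j : Fin n → ℕ) (τ : ∀ s, Equiv.Perm (Fin (j s)))
    (x : (DMod k n) _⦋p⦌) (y : ∀ s, (DMod k (j s)) _⦋p⦌) :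
    DMod.comp k n j p x (fun s => DMod.act k p (τ s) (y s)) =
      DMod.act k p (dirSumPerm j τ) (DMod.comp k n j p x y) := by
  refine IsMultilin.ext_span (k := k) (f := fun y : ∀ s, (DMod k (j s)) _⦋p⦌ =>
      DMod.comp k n j p x (fun s => DMod.act k p (τ s) (y s)))
    (g := fun y => DMod.act k p (dirSumPerm j τ) (DMod.comp k n j p x y))
    ((IsMultilin.of_multilinear _).comp_linear _)
    ((IsMultilin.of_multilinear _).linear_comp _)
    _ (fun s => DMod.span_simplex (j s) p) (fun y hy => ?_) y
  choose ρ hρ using hy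
  obtain rfl : (fun q => DMod.simplex k (ρ q)) = y := funext hρ
  refine congrArg (fun f => f x) (DMod.hom_ext
    (evalₗ (fun s => DMod.act k p (τ s) (DMod.simplex k (ρ s))) ∘ₗ DMod.comp k n j p)
    (DMod.act k p (dirSumPerm j τ) ∘ₗ
      evalₗ (fun s => DMod.simplex k (ρ s)) ∘ₗ DMod.comp k n j p) fun v => ?_)
  show DMod.comp k n j p (DMod.simplex k v)
      (fun s => DMod.act k p (τ s) (DMod.simplex k (ρ s))) =
    DMod.act k p (dirSumPerm j τ) (DMod.comp k n j p (DMod.simplex k v)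
      fun s => DMod.simplex k (ρ s))
  simp only [DMod.act_simplex, DMod.comp_simplex]
  refine congrArg (DMod.simplex k) (funext fun q => ?_)
  rw [dirSumPerm_mul, mul_assoc]

theorem koszulShuffle_zero {n : ℕ} {j : Fin n → ℕ} (c : ∀ s, Fin (j s) → ℕ) :
    koszulShuffle (fun _ => 0) c = 0 := by
  simp [koszulShuffle]

theorem koszul_zero {n : ℕ} (σ : Equiv.Perm (Fin n)) : koszul σ (fun _ => 0) = 0 := by
  simp [koszul]

/-- A family of homogeneous elements of modules in degree `0` is of degree `0`, or has a zero. -/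
theorem GMod.ofModule_homog {n : ℕ} {M : Fin n → ModuleCat.{u} k} (b : Fin n → ℕ)
    (y : ∀ s, (GMod.ofModule (M s)).carrier) (hy : ∀ s, y s ∈ (GMod.ofModule (M s)).homog (b s)) :
    b = (fun _ => 0) ∨ ∃ s, y s = 0 := by
  by_cases h : ∃ s, b s ≠ 0
  · obtain ⟨s, hs⟩ := h
    have := hy s
    simp only [GMod.ofModule, if_neg hs] at this
    exact Or.inr ⟨s, this⟩
  · push Not at h
    exact Or.inl (funext h)

/-- In each simplicial degree the modules `k[S_n ^ (p + 1)]` form an operad. They are concentrated in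
degree `0`, so that the Koszul signs of the axioms are trivial unless an argument is `0`. -/
theorem Dsm_level_isOperad (p : ℕ) : IsOperad ((Dsm k).level p) where
  act_one n x := by
    refine congrArg (fun f => f x) (DMod.hom_ext (DMod.act k p 1) LinearMap.id fun v => ?_)
    rw [DMod.act_simplex]
    simp
  act_mul n σ τ x := by
    refine congrArg (fun f => f x) (DMod.hom_ext (DMod.act k p (σ * τ))
      (DMod.act k p τ ∘ₗ DMod.act k p σ) fun v => ?_)
    rw [LinearMap.comp_apply, DMod.act_simplex, DMod.act_simplex, DMod.act_simplex]
    simp only [mul_assoc]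
  assoc n j i x b y hy c z hz := by
    have key := (Dsm_castV p (sum_blocks j i) _).trans
      (DMod.comp_assoc p n j i x y fun q => z q.1 q.2)
    rcases GMod.ofModule_homog b y hy with rfl | ⟨s, hs⟩
    · rw [koszulShuffle_zero, pow_zero, one_smul]
      exact key
    · have h : DMod.comp k n (fun s => ∑ t, i s t) p x
          (fun s => DMod.comp k (j s) (i s) p (y s) (z s)) = 0 := by
        refine MultilinearMap.map_coord_zero _ s ?_
        have h' : y s = (0 : (DMod k (j s)) _⦋p⦌) := hs
        rw [h', map_zero]
        rfl
      exact key.trans (h.trans (((congrArg _ h).trans (smul_zero _)).symm))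
  one_left n x := by
    rw [Dsm_one]
    exact (Dsm_castV p _ _).trans (DMod.comp_one_left p n x _)
  one_right n x := by
    rw [Dsm_one]
    exact (Dsm_castV p _ _).trans (DMod.comp_one_right p n x _)
  equivariance_outer n j σ x b y hy := by
    have key := (DMod.comp_act_left p n j σ x y).trans (congrArg (DMod.act k p (blockPerm σ j))
      (Dsm_castV p (Equiv.sum_comp σ.symm j) _).symm)
    rcases GMod.ofModule_homog b y hy with rfl | ⟨s, hs⟩
    · rw [koszul_zero, pow_zero, one_smul]
      exact key
    · have h : DMod.comp k n j p (DMod.act k p σ x) y = 0 := MultilinearMap.map_coord_zero _ s hs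
      exact h.trans ((congrArg _ (key.symm.trans h)).trans (smul_zero _)).symm
  equivariance_inner n j τ x y := DMod.comp_act_right p n j τ x y

/-- `k[N(ES_0)]` is the constant simplicial module `k`. -/
noncomputable def DMod.zeroIso (k : Type u) [CommRing k] :
    DMod k 0 ≅ (Functor.const _).obj (ModuleCat.of k k) :=
  let e (p : SimplexCategoryᵒᵖ) :
      ((Fin (p.unop.len + 1) → Equiv.Perm (Fin 0)) →₀ k) ≃ₗ[k] k :=
    Finsupp.uniqueLinearEquiv k k fun _ => 1
  NatIso.ofComponents (fun p => LinearEquiv.toModuleIso (e p)) (by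
    intro p q θ
    refine ModuleCat.hom_ext (Finsupp.lhom_ext' fun v => LinearMap.ext_ring ?_)
    have h : ((DMod k 0).map θ).hom (Finsupp.single v 1) =
        (Finsupp.single (v ∘ θ.unop.toOrderHom) 1 :
          (Fin (q.unop.len + 1) → Equiv.Perm (Fin 0)) →₀ k) := Finsupp.mapDomain_single
    refine (congrArg (fun w : (Fin (q.unop.len + 1) → Equiv.Perm (Fin 0)) →₀ k =>
      w fun _ => 1) h).trans ?_
    obtain rfl : v = fun _ => 1 := Subsingleton.elim (α := Fin (p.unop.len + 1) → _) _ _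
    refine Eq.trans ?_ (Finsupp.single_eq_same
      (a := fun _ : Fin (p.unop.len + 1) => (1 : Equiv.Perm (Fin 0)))).symm
    exact Finsupp.single_eq_same)

theorem Dsm_isSOperad : IsSOperad (Dsm k) where
  level := Dsm_level_isOperad
  zero := ⟨DMod.zeroIso k⟩

end BarrattEcclesOperad

/-! ### The action on `𝒴⁺A` -/

namespace NCSet

/-- A bijection, as a morphism of noncommutative sets. -/
def isoHom {m n : NCSet} (e : Fin m.size ≃ Fin n.size) : m ⟶ n :=
  show Hom m n from
  { toFun := e
    fib := fun y => [e.symm y]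
    nodup := fun y => by simp
    mem_fib := fun x y => by simp [Equiv.eq_symm_apply] }

theorem comp_isoHom_fib {m n l : NCSet} (f : m ⟶ n) (e : Fin n.size ≃ Fin l.size)
    (x : Fin n.size) : Hom.fib (f ≫ isoHom e) (e x) = Hom.fib f x := by
  show [e.symm (e x)].flatMap (Hom.fib f) = _
  simp

theorem isoHom_comp_fib {m n l : NCSet} (e : Fin m.size ≃ Fin n.size) (g : n ⟶ l)
    (z : Fin l.size) : Hom.fib (isoHom e ≫ g) z = (Hom.fib g z).map e.symm := by
  show (Hom.fib g z).flatMap (fun y => [e.symm y]) = _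
  exact List.flatMap_pure_eq_map _ _

theorem isoHom_comp {m n l : NCSet} (e : Fin m.size ≃ Fin n.size) (e' : Fin n.size ≃ Fin l.size) :
    isoHom e ≫ isoHom e' = isoHom (e.trans e') := by
  refine Hom.ext rfl (funext fun z => ?_)
  obtain ⟨z, rfl⟩ := e'.surjective z
  rw [comp_isoHom_fib]
  show [e.symm z] = [e.symm (e'.symm (e' z))]
  simp

/-- Products of morphisms, conjugated by bijections that match the blocks, agree. -/
theorem hom_ext_blocks {m n l : NCSet} {f : m ⟶ n} (e : Fin n.size ≃ Fin l.size)
    {m' : NCSet} (e'' : Fin m.size ≃ Fin m'.size) {g : m' ⟶ l}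
    (h : ∀ x, e (Hom.toFun f x) = Hom.toFun g (e'' x))
    (h' : ∀ y, (Hom.fib f y).map e'' = Hom.fib g (e y)) :
    f ≫ isoHom e = isoHom e'' ≫ g := by
  refine Hom.ext (funext h) (funext fun z => ?_)
  obtain ⟨y, rfl⟩ := e.surjective z
  rw [comp_isoHom_fib, isoHom_comp_fib, ← h', List.map_map]
  simp

/-- The morphism `sum c ⟶ sum c'` induced by a product of bijections. -/
theorem sumHom_isoHom {n : ℕ} {c : Fin n → NCSet} (e : ∀ i, Equiv.Perm (Fin (c i).size)) :
    sumHom (fun i => isoHom (e i)) =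
      isoHom (m := sum c) (n := sum c) (dirSumPerm (fun i => (c i).size) e) := by
  refine Hom.ext (funext fun x => ?_) (funext fun x => ?_)
  · obtain ⟨p, rfl⟩ := (blk c).surjective x
    rw [sumHom_toFun]
    exact (dirSumPerm_mk _ e _ _).symm
  · obtain ⟨p, rfl⟩ := (blk c).surjective x
    rw [sumHom_fib]
    refine (List.map_singleton).trans (congrArg (fun x => [x]) ?_)
    refine (Equiv.eq_symm_apply _).mpr ((dirSumPerm_mk _ e _ _).trans ?_)
    show blk c ⟨p.1, e p.1 ((e p.1).symm p.2)⟩ = _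
    rw [Equiv.apply_symm_apply]

/-- Objects under `c` whose targets have the same size are equal if their structure morphisms agree
up to the identification of the targets. Objects of `ΔS₊` of the same size are equal, so that
simplices of `N(c \ ΔS₊)` can be compared by equality, and not only up to isomorphism. -/
theorem under_ext {c : NCSet} {X Y : Under c} (h : X.right.size = Y.right.size)
    (hh : X.hom ≫ isoHom (finCongr h) = Y.hom) : X = Y := by
  obtain ⟨⟨⟨⟩⟩, ⟨m⟩, f⟩ := X
  obtain ⟨⟨⟨⟩⟩, ⟨m'⟩, g⟩ := Y
  change m = m' at h
  subst h
  have h1 : f = g := by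
    exact (Category.comp_id f).symm.trans hh
  subst h1
  rfl

theorem eqToHom_right {c : NCSet} {X Y : Under c} (h : X = Y) :
    (eqToHom h).right = isoHom (finCongr (by rw [h])) := by
  subst h
  rfl

/-- Simplices of the nerve of an under-category agree if their vertices and arrows agree up to the
identifications of sets of the same size. -/
theorem composableArrows_ext {c : NCSet} {p : ℕ} {F G : ComposableArrows (Under c) p}
    (h : ∀ v, (F.obj v).right.size = (G.obj v).right.size)
    (hobj : ∀ v, (F.obj v).hom ≫ isoHom (finCongr (h v)) = (G.obj v).hom)
    (hmap : ∀ v w (f : v ⟶ w), (F.map f).right ≫ isoHom (finCongr (h w)) =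
      isoHom (finCongr (h v)) ≫ (G.map f).right) : F = G := by
  refine CategoryTheory.Functor.ext (fun v => under_ext (h v) (hobj v)) fun v w f => ?_
  rw [← Category.assoc, ← cancel_mono (eqToHom (under_ext (h w) (hobj w)))]
  simp only [Category.assoc, eqToHom_trans, eqToHom_refl, Category.comp_id]
  refine Under.UnderMorphism.ext ?_
  rw [Under.comp_right, Under.comp_right, eqToHom_right, eqToHom_right]
  exact hmap v w f

end NCSet

section Mu

open NCSet

/-- Two simplices given by `muFunctor` agree if the block permutations are intertwined by
morphisms `B v` that are compatible with the given simplices. -/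
theorem mu_ext {n n' p : ℕ} (σ : Fin (p + 1) → Equiv.Perm (Fin n)) {c : Fin n → NCSet}
    (x : ∀ i, ComposableArrows (Under (c i)) p) (σ' : Fin (p + 1) → Equiv.Perm (Fin n'))
    {c' : Fin n' → NCSet} (x' : ∀ i, ComposableArrows (Under (c' i)) p)
    (φ : NCSet.sum c ⟶ NCSet.sum c')
    (B : ∀ v, (NCSet.sum fun i => ((x i).obj v).right) ⟶ NCSet.sum fun i => ((x' i).obj v).right)
    (h : ∀ v, (NCSet.sum fun i => ((x i).obj v).right).size =
      (NCSet.sum fun i => ((x' i).obj v).right).size)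
    (hB : ∀ v, blockHom (σ v) (fun i => ((x i).obj v).right) ≫ isoHom (finCongr (h v)) =
      B v ≫ blockHom (σ' v) (fun i => ((x' i).obj v).right))
    (hobj : ∀ v, sumHom (fun i => ((x i).obj v).hom) ≫ B v =
      φ ≫ sumHom (fun i => ((x' i).obj v).hom))
    (hmap : ∀ v w (f : v ⟶ w), sumHom (fun i => ((x i).map f).right) ≫ B w =
      B v ≫ sumHom (fun i => ((x' i).map f).right)) :
    muFunctor σ x = muFunctor σ' x' ⋙ Under.map φ := by
  have key1 : ∀ {a b b₁ c a' : NCSet} {s : a ⟶ b} {b' : b ⟶ b} {i : b ⟶ c} {φ : a ⟶ a'}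
      {s' : a' ⟶ c} {B : b ⟶ c} {b'' : c ⟶ c}, b' ≫ i = B ≫ b'' → s ≫ B = φ ≫ s' →
      (s ≫ b') ≫ i = φ ≫ s' ≫ b'' := by
    intro a b b₁ c a' s b' i φ s' B b'' h1 h2
    rw [Category.assoc, h1, ← Category.assoc, h2, Category.assoc]
  have key2 : ∀ {X Y X' Y' : NCSet} {b bi : X ⟶ X} {bw : Y ⟶ Y} {i : X ⟶ X'} {iw : Y ⟶ Y'}
      {b' bi' : X' ⟶ X'} {bw' : Y' ⟶ Y'} {B : X ⟶ X'} {Bw : Y ⟶ Y'} {m : X ⟶ Y} {m' : X' ⟶ Y'},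
      bi ≫ b = 𝟙 X → b' ≫ bi' = 𝟙 X' → b ≫ i = B ≫ b' → bw ≫ iw = Bw ≫ bw' →
      m ≫ Bw = B ≫ m' → (bi ≫ m ≫ bw) ≫ iw = i ≫ bi' ≫ m' ≫ bw' := by
    intro X Y X' Y' b bi bw i iw b' bi' bw' B Bw m m' h1 h2 h3 h4 h5
    have h6 : i ≫ bi' = bi ≫ B := calc
      i ≫ bi' = bi ≫ (b ≫ i) ≫ bi' := by
        rw [← Category.assoc, ← Category.assoc, h1, Category.id_comp]
      _ = bi ≫ B := by rw [h3, Category.assoc, h2, Category.comp_id]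
    rw [Category.assoc, Category.assoc, h4, ← Category.assoc m, h5, ← Category.assoc i, h6]
    simp only [Category.assoc]
  refine composableArrows_ext h (fun v => ?_) fun v w f => ?_
  · exact key1 (b₁ := NCSet.sum c) (hB v) (hobj v)
  · exact key2 (blockHomInv_comp _ _) (permHom_comp_symm _) (hB v) (hB w) (hmap v w f)

/-- The identification of a product of products with a product, on elements. -/
def assocEquiv {n : ℕ} {j : Fin n → ℕ} (c : ((s : Fin n) × Fin (j s)) → NCSet) :
    Fin (NCSet.sum (fun r => c (finSigmaFinEquiv.symm r))).size ≃
      Fin (NCSet.sum fun s => NCSet.sum fun t => c ⟨s, t⟩).size :=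
  finCongr (sum_blocks j fun s t => (c ⟨s, t⟩).size)

/-- The identification of a product of products with a product. -/
def assocHom {n : ℕ} {j : Fin n → ℕ} (c : ((s : Fin n) × Fin (j s)) → NCSet) :
    NCSet.sum (fun r => c (finSigmaFinEquiv.symm r)) ⟶
      NCSet.sum fun s => NCSet.sum fun t => c ⟨s, t⟩ :=
  isoHom (assocEquiv c)

theorem assoc_blk {n : ℕ} {j : Fin n → ℕ} (c : ((s : Fin n) × Fin (j s)) → NCSet)
    (r : Fin (∑ s, j s)) (a : Fin (c (finSigmaFinEquiv.symm r)).size) :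
    assocEquiv c (blk (fun r => c (finSigmaFinEquiv.symm r)) ⟨r, a⟩) =
      blk (fun s => NCSet.sum fun t => c ⟨s, t⟩) ⟨(finSigmaFinEquiv.symm r).1,
        blk (fun t => c ⟨_, t⟩) ⟨(finSigmaFinEquiv.symm r).2, a⟩⟩ :=
  Fin.ext (sigmaFin_assoc j (fun s t => (c ⟨s, t⟩).size) r a)

theorem sumHom_comp_assocHom {n : ℕ} {j : Fin n → ℕ} {c d : ((s : Fin n) × Fin (j s)) → NCSet}
    (f : ∀ q, c q ⟶ d q) :
    sumHom (fun r => f (finSigmaFinEquiv.symm r)) ≫ assocHom d =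
      assocHom c ≫ sumHom fun s => sumHom fun t => f ⟨s, t⟩ := by
  refine hom_ext_blocks _ _ (fun x => ?_) fun y => ?_
  · obtain ⟨⟨r, a⟩, rfl⟩ := (blk _).surjective x
    rw [sumHom_toFun, assoc_blk, assoc_blk, sumHom_toFun, sumHom_toFun]
  · obtain ⟨⟨r, a⟩, rfl⟩ := (blk _).surjective y
    rw [sumHom_fib, assoc_blk, sumHom_fib, sumHom_fib, List.map_map, List.map_map]
    exact List.map_congr_left fun x _ => assoc_blk c r x

theorem blockHom_comp_assocHom {n : ℕ} {j : Fin n → ℕ} (d : ((s : Fin n) × Fin (j s)) → NCSet)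
    (σ : Equiv.Perm (Fin n)) (τ : ∀ s, Equiv.Perm (Fin (j s))) :
    blockHom (blockPerm σ j * dirSumPerm j τ) (fun r => d (finSigmaFinEquiv.symm r)) ≫
        assocHom d =
      assocHom d ≫ sumHom (fun s => blockHom (τ s) fun t => d ⟨s, t⟩) ≫
        blockHom σ fun s => NCSet.sum fun t => d ⟨s, t⟩ := by
  have h1 : ∀ {n : ℕ} (j : Fin n → ℕ), dirSumPerm j (fun _ => 1) = 1 := fun j => by
    ext x
    obtain ⟨⟨s, a⟩, rfl⟩ := finSigmaFinEquiv.surjective x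
    rw [dirSumPerm_mk]
    rfl
  have h := blockPerm_assoc j (fun s t => (d ⟨s, t⟩).size) σ τ fun _ _ => 1
  simp only [h1, mul_one] at h
  have h2 : sumHom (fun s => blockHom (τ s) fun t => d ⟨s, t⟩) = _ :=
    sumHom_isoHom (c := fun s => NCSet.sum fun t => d ⟨s, t⟩)
      fun s => blockPerm (τ s) fun t => (d ⟨s, t⟩).size
  rw [h2]
  refine (isoHom_comp _ _).trans (Eq.trans ?_ ((congrArg _ (isoHom_comp _ _)).trans
    (isoHom_comp _ _)).symm)
  congr 1
  ext x
  exact congrArg Fin.val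
    (Equiv.congr_fun h (finCongr (sum_blocks j fun s t => (d ⟨s, t⟩).size) x))

/-- Associativity of `muFunctor`, up to the identification `assocHom` of the sources. -/
theorem mu_assoc {n p : ℕ} {j : Fin n → ℕ} {c : ((s : Fin n) × Fin (j s)) → NCSet}
    (σ : Fin (p + 1) → Equiv.Perm (Fin n)) (τ : ∀ s, Fin (p + 1) → Equiv.Perm (Fin (j s)))
    (x : ∀ q, ComposableArrows (Under (c q)) p) :
    muFunctor (fun v => blockPerm (σ v) j * dirSumPerm j fun s => τ s v)
        (fun r => x (finSigmaFinEquiv.symm r)) =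
      muFunctor σ (fun s => muFunctor (τ s) fun t => x ⟨s, t⟩) ⋙ Under.map (assocHom c) := by
  refine mu_ext _ _ _ _ _ (fun v => assocHom (fun q => ((x q).obj v).right) ≫
      sumHom fun s => blockHom (τ s v) fun t => ((x ⟨s, t⟩).obj v).right)
    (fun v => sum_blocks j fun s t => ((x ⟨s, t⟩).obj v).right.size)
    (fun v => ?_) (fun v => ?_) fun v w f => ?_
  · exact (blockHom_comp_assocHom (fun q => ((x q).obj v).right) (σ v) fun s => τ s v).trans
      (Category.assoc _ _ _).symm
  · rw [← Category.assoc, sumHom_comp_assocHom fun q => ((x q).obj v).hom, Category.assoc]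
    exact congrArg (_ ≫ ·) (sumHom_comp (fun s => sumHom fun t => ((x ⟨s, t⟩).obj v).hom)
      fun s => blockHom (τ s v) fun t => ((x ⟨s, t⟩).obj v).right).symm
  · rw [← Category.assoc, sumHom_comp_assocHom fun q => ((x q).map f).right, Category.assoc,
      Category.assoc]
    refine congrArg (_ ≫ ·) ?_
    refine (sumHom_comp (fun s => sumHom fun t => ((x ⟨s, t⟩).map f).right)
      fun s => blockHom (τ s w) fun t => ((x ⟨s, t⟩).obj w).right).symm.trans ?_
    refine Eq.trans ?_ (sumHom_comp (fun s => blockHom (τ s v) fun t => ((x ⟨s, t⟩).obj v).right)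
      fun s => ((muFunctor (τ s) fun t => x ⟨s, t⟩).map f).right)
    exact congrArg sumHom (funext fun s => (blockHom_comp_inv _ _ _).symm)

/-- The permutation of the factors of a product, on elements. -/
def reorderEquiv {n : ℕ} (ρ : Equiv.Perm (Fin n)) (c : Fin n → NCSet) :
    Fin (NCSet.sum c).size ≃ Fin (NCSet.sum fun i => c (ρ.symm i)).size :=
  (blockPerm ρ fun i => (c i).size).trans
    (finCongr (Equiv.sum_comp ρ.symm fun i => (c i).size).symm)

/-- The permutation of the factors of a product. -/
def reorderHom {n : ℕ} (ρ : Equiv.Perm (Fin n)) (c : Fin n → NCSet) :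
    NCSet.sum c ⟶ NCSet.sum fun i => c (ρ.symm i) :=
  isoHom (reorderEquiv ρ c)

theorem reorder_blk {n : ℕ} (ρ : Equiv.Perm (Fin n)) (c : Fin n → NCSet) (i : Fin n)
    (a : Fin (c (ρ.symm i)).size) :
    reorderEquiv ρ c (blk c ⟨ρ.symm i, a⟩) = blk (fun i => c (ρ.symm i)) ⟨i, a⟩ := by
  have h := congrArg Fin.val (blockPerm_symm_mk ρ (fun i => (c i).size) i a)
  exact Fin.ext h

theorem sumHom_comp_reorderHom {n : ℕ} (ρ : Equiv.Perm (Fin n)) {c d : Fin n → NCSet}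
    (f : ∀ i, c i ⟶ d i) :
    sumHom f ≫ reorderHom ρ d = reorderHom ρ c ≫ sumHom fun i => f (ρ.symm i) := by
  refine hom_ext_blocks _ _ (fun x => ?_) fun y => ?_
  · obtain ⟨⟨i, a⟩, rfl⟩ := (blk _).surjective x
    obtain ⟨i, rfl⟩ := ρ.symm.surjective i
    rw [sumHom_toFun, reorder_blk, reorder_blk, sumHom_toFun]
  · obtain ⟨⟨i, a⟩, rfl⟩ := (blk _).surjective y
    obtain ⟨i, rfl⟩ := ρ.symm.surjective i
    rw [sumHom_fib, reorder_blk, sumHom_fib, List.map_map]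
    exact List.map_congr_left fun x _ => reorder_blk ρ c i x

theorem blockHom_comp_reorder {n : ℕ} (σ ρ : Equiv.Perm (Fin n)) (d : Fin n → NCSet)
    (h : (NCSet.sum d).size = (NCSet.sum fun i => d (ρ.symm i)).size) :
    blockHom (σ * ρ) d ≫ isoHom (finCongr h) =
      reorderHom ρ d ≫ blockHom σ fun i => d (ρ.symm i) := by
  refine (isoHom_comp _ _).trans (Eq.trans ?_ (isoHom_comp _ _).symm)
  congr 1
  ext x
  have h := congrArg Fin.val (Equiv.congr_fun (blockPerm_mul (fun i => (d i).size) σ ρ) x)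
  exact h

/-- Equivariance of `muFunctor`, up to the permutation `reorderHom` of the sources. -/
theorem mu_reorder {n p : ℕ} (ρ : Equiv.Perm (Fin n)) {c : Fin n → NCSet}
    (σ : Fin (p + 1) → Equiv.Perm (Fin n)) (x : ∀ i, ComposableArrows (Under (c i)) p) :
    muFunctor (fun v => σ v * ρ) x =
      muFunctor σ (fun i => x (ρ.symm i)) ⋙ Under.map (reorderHom ρ c) :=
  mu_ext _ _ _ _ _ (fun v => reorderHom ρ fun i => ((x i).obj v).right)
    (fun v => (Equiv.sum_comp ρ.symm fun i => ((x i).obj v).right.size).symm)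
    (fun _ => blockHom_comp_reorder _ _ _ _) (fun _ => sumHom_comp_reorderHom ρ _)
    fun _ _ _ => sumHom_comp_reorderHom ρ _

/-- The identification of a product with one factor, on elements. -/
def singleEquiv (c : NCSet) : Fin (NCSet.sum fun _ : Fin 1 => c).size ≃ Fin c.size :=
  finCongr (show ∑ _ : Fin 1, c.size = c.size from Fin.sum_univ_one _)

/-- The identification of a product with one factor. -/
def singleHom (c : NCSet) : NCSet.sum (fun _ : Fin 1 => c) ⟶ c :=
  isoHom (singleEquiv c)

theorem single_blk (c : NCSet) (i : Fin 1) (a : Fin c.size) :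
    singleEquiv c (blk (fun _ : Fin 1 => c) ⟨i, a⟩) = a :=
  Fin.ext (finSigmaFinEquiv_one (n := fun _ => c.size) ⟨i, a⟩)

theorem sumHom_comp_singleHom {c d : NCSet} (f : c ⟶ d) :
    sumHom (fun _ : Fin 1 => f) ≫ singleHom d = singleHom c ≫ f := by
  refine hom_ext_blocks _ _ (fun x => ?_) fun y => ?_
  · obtain ⟨⟨i, a⟩, rfl⟩ := (blk _).surjective x
    rw [sumHom_toFun, single_blk, single_blk]
  · obtain ⟨⟨i, a⟩, rfl⟩ := (blk _).surjective y
    rw [sumHom_fib, single_blk, List.map_map]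
    exact (List.map_congr_left fun x _ => single_blk c i x).trans (List.map_id _)

theorem blockHom_one {n : ℕ} (d : Fin n → NCSet) : blockHom 1 d = 𝟙 (NCSet.sum d) := by
  have h : blockPerm 1 (fun i => (d i).size) = 1 := by
    ext x
    obtain ⟨⟨s, a⟩, rfl⟩ := finSigmaFinEquiv.surjective x
    rw [blockPerm_val]
    exact (sigmaFin_val (fun i => (d i).size) s a).symm
  exact (congrArg (permHom (m := NCSet.sum d)) h).trans permHom_one

/-- Unitality of `muFunctor`, up to the identification `singleHom` of the sources. -/
theorem mu_single {p : ℕ} {c : NCSet} (x : ComposableArrows (Under c) p) :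
    muFunctor (n := 1) (fun _ => 1) (fun _ => x) = x ⋙ Under.map (singleHom c) := by
  refine composableArrows_ext (fun v => Fin.sum_univ_one fun _ => (x.obj v).right.size)
    (fun v => ?_) fun v w f => ?_
  · have h : (sumHom (fun _ : Fin 1 => (x.obj v).hom) ≫ blockHom 1 fun _ => (x.obj v).right) ≫
        singleHom _ = singleHom c ≫ (x.obj v).hom := by
      rw [blockHom_one, Category.comp_id, sumHom_comp_singleHom]
    exact h
  · have h1 : blockHomInv 1 (fun _ : Fin 1 => (x.obj v).right) = 𝟙 _ := by
      have h2 := blockHomInv_comp 1 (fun _ : Fin 1 => (x.obj v).right)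
      rwa [blockHom_one, Category.comp_id] at h2
    have h : (blockHomInv 1 (fun _ : Fin 1 => (x.obj v).right) ≫
        sumHom (fun _ : Fin 1 => (x.map f).right) ≫ blockHom 1 fun _ => (x.obj w).right) ≫
        singleHom _ = singleHom _ ≫ (x.map f).right := by
      rw [h1, blockHom_one, Category.comp_id, Category.id_comp, sumHom_comp_singleHom]
    exact h

end Mu

section ChiAlgebra

open NCSet

variable (k A : Type u) [CommRing k] [Ring A] [Algebra k A]

/-- A bijection acts on tuples by moving their entries. -/
theorem pushTuple_isoHom {m n : NCSet} (e : Fin m.size ≃ Fin n.size) (a : Fin m.size → A) :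
    pushTuple (isoHom e) a = a ∘ e.symm := by
  funext y
  show (List.map a [e.symm y]).prod = a (e.symm y)
  simp

theorem concat_assoc {n : ℕ} {j : Fin n → ℕ} (c : ((s : Fin n) × Fin (j s)) → NCSet)
    (a : ∀ q, Fin (c q).size → A) :
    pushTensor k A (assocHom c) (concat k A (fun r => c (finSigmaFinEquiv.symm r))
        fun r => PiTensorProduct.tprod k (a (finSigmaFinEquiv.symm r))) =
      concat k A (fun s => NCSet.sum fun t => c ⟨s, t⟩)
        fun s => concat k A (fun t => c ⟨s, t⟩) fun t => PiTensorProduct.tprod k (a ⟨s, t⟩) := by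
  simp only [concat_tprod, pushTensor_tprod]
  congr 1
  rw [assocHom, pushTuple_isoHom]
  refine (Equiv.comp_symm_eq (assocEquiv c) _ _).mpr (funext fun x => ?_)
  obtain ⟨⟨r, b⟩, rfl⟩ := (blk _).surjective x
  rw [Function.comp_apply, assoc_blk]
  show (fun q : (r : Fin (∑ s, j s)) × Fin (c (finSigmaFinEquiv.symm r)).size =>
      a (finSigmaFinEquiv.symm q.1) q.2) ((blk fun r => c (finSigmaFinEquiv.symm r)).symm
        (blk (fun r => c (finSigmaFinEquiv.symm r)) _)) =
    (fun q : (s : Fin n) × Fin (NCSet.sum fun t => c ⟨s, t⟩).size =>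
      (fun q' : (t : Fin (j q.1)) × Fin (c ⟨q.1, t⟩).size => a ⟨q.1, q'.1⟩ q'.2)
        ((blk fun t => c ⟨q.1, t⟩).symm q.2))
      ((blk fun s => NCSet.sum fun t => c ⟨s, t⟩).symm
        (blk (fun s => NCSet.sum fun t => c ⟨s, t⟩) _))
  rw [Equiv.symm_apply_apply, Equiv.symm_apply_apply]
  dsimp only
  rw [Equiv.symm_apply_apply]

theorem concat_reorder {n : ℕ} (ρ : Equiv.Perm (Fin n)) (c : Fin n → NCSet)
    (a : ∀ i, Fin (c i).size → A) :
    pushTensor k A (reorderHom ρ c) (concat k A c fun i => PiTensorProduct.tprod k (a i)) =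
      concat k A (fun i => c (ρ.symm i)) fun i => PiTensorProduct.tprod k (a (ρ.symm i)) := by
  simp only [concat_tprod, pushTensor_tprod]
  congr 1
  rw [reorderHom, pushTuple_isoHom]
  refine (Equiv.comp_symm_eq (reorderEquiv ρ c) _ _).mpr (funext fun x => ?_)
  obtain ⟨⟨i, b⟩, rfl⟩ := (blk _).surjective x
  obtain ⟨i, rfl⟩ := ρ.symm.surjective i
  rw [Function.comp_apply, reorder_blk]
  show (fun q : (i : Fin n) × Fin (c i).size => a q.1 q.2) ((blk c).symm (blk c _)) =
    (fun q : (i : Fin n) × Fin (c (ρ.symm i)).size => a (ρ.symm q.1) q.2)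
      ((blk fun i => c (ρ.symm i)).symm (blk (fun i => c (ρ.symm i)) _))
  rw [Equiv.symm_apply_apply, Equiv.symm_apply_apply]

theorem concat_single (c : NCSet) (a : Fin c.size → A) :
    pushTensor k A (singleHom c) (concat k A (fun _ : Fin 1 => c)
      fun _ => PiTensorProduct.tprod k a) = PiTensorProduct.tprod k a := by
  simp only [concat_tprod, pushTensor_tprod]
  congr 1
  rw [singleHom, pushTuple_isoHom]
  refine (Equiv.comp_symm_eq (singleEquiv c) _ _).mpr (funext fun x => ?_)
  obtain ⟨⟨i, b⟩, rfl⟩ := (blk _).surjective x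
  rw [Function.comp_apply, single_blk]
  show (fun q : (_ : Fin 1) × Fin c.size => a q.2)
    ((blk fun _ : Fin 1 => c).symm (blk (fun _ : Fin 1 => c) _)) = a b
  rw [Equiv.symm_apply_apply]

/-- The generator of `𝒴⁺A_p` given by a simplex of `N(c \ ΔS₊)` and a tuple of elements of `A`. -/
noncomputable def yGen (p : ℕ) (q : Σ c : NCSet, ComposableArrows (Under c) p × (Fin c.size → A)) :
    (YPlus k A) _⦋p⦌ :=
  yCls k A p q.1 q.2.1 (PiTensorProduct.tprod k q.2.2)

theorem yGen_span (p : ℕ) : Submodule.span k (Set.range (yGen k A p)) = ⊤ := by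
  rw [← top_le_iff, ← yCls_span k A p]
  refine Submodule.span_le.mpr ?_
  rintro _ ⟨c, x, V, rfl⟩
  have h : (⊤ : Submodule k (⨂[k] _ : Fin c.size, A)) ≤
      (Submodule.span k (Set.range (yGen k A p))).comap (yCls k A p c x) := by
    rw [← PiTensorProduct.span_tprod_eq_top, Submodule.span_le]
    rintro _ ⟨a, rfl⟩
    exact Submodule.subset_span ⟨⟨c, x, a⟩, rfl⟩
  exact h trivial

/-- Associativity of the action. On generators, `mu_assoc` moves the identification `assocHom` of the
under-categories across the tensor product over `ΔS₊`, where it becomes `concat_assoc`. -/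
theorem chiLevel_assoc (p n : ℕ) (j : Fin n → ℕ) (x : (DMod k n) _⦋p⦌)
    (y : ∀ s, (DMod k (j s)) _⦋p⦌) (z : ((s : Fin n) × Fin (j s)) → (YPlus k A) _⦋p⦌) :
    chiLevel k A (∑ s, j s) p (DMod.comp k n j p x y) (fun r => z (finSigmaFinEquiv.symm r)) =
      chiLevel k A n p x fun s => chiLevel k A (j s) p (y s) fun t => z ⟨s, t⟩ := by
  refine IsMultilin.ext_span (k := k)
      (f := fun z : ((s : Fin n) × Fin (j s)) → (YPlus k A) _⦋p⦌ =>
        chiLevel k A (∑ s, j s) p (DMod.comp k n j p x y) fun r => z (finSigmaFinEquiv.symm r))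
      (g := fun z => chiLevel k A n p x
        fun s => chiLevel k A (j s) p (y s) fun t => z ⟨s, t⟩)
      ((IsMultilin.of_multilinear _).reindex finSigmaFinEquiv.symm)
      ((IsMultilin.of_multilinear (chiLevel k A n p x)).sigma fun s =>
        IsMultilin.of_multilinear (chiLevel k A (j s) p (y s)))
      _ (fun q => yGen_span k A p) (fun z hz => ?_) z
  choose g hg using hz
  obtain rfl : (fun q => yGen k A p (g q)) = z := funext hg
  refine IsMultilin.ext_span (k := k)
    ((IsMultilin.of_multilinear (DMod.comp k n j p x)).linear_comp
      (evalₗ (fun r => yGen k A p (g (finSigmaFinEquiv.symm r))) ∘ₗ chiLevel k A (∑ s, j s) p))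
    (IsMultilin.apply (IsMultilin.of_multilinear (chiLevel k A n p x))
      (fun s => chiLevel k A (j s) p) fun s t => yGen k A p (g ⟨s, t⟩)) _
      (fun s => DMod.span_simplex (j s) p) (fun y hy => ?_) y
  choose τ hτ using hy
  obtain rfl : (fun q => DMod.simplex k (τ q)) = y := funext hτ
  refine congrArg (fun f => f x) (DMod.hom_ext
    ((evalₗ (fun r => yGen k A p (g (finSigmaFinEquiv.symm r))) ∘ₗ
      chiLevel k A (∑ s, j s) p) ∘ₗ
      evalₗ (fun s => DMod.simplex k (τ s)) ∘ₗ DMod.comp k n j p)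
    (evalₗ (fun s => chiLevel k A (j s) p (DMod.simplex k (τ s))
      fun t => yGen k A p (g ⟨s, t⟩)) ∘ₗ chiLevel k A n p) fun σ => ?_)
  show chiLevel k A (∑ s, j s) p
        (DMod.comp k n j p (DMod.simplex k σ) fun s => DMod.simplex k (τ s))
        (fun r => yGen k A p (g (finSigmaFinEquiv.symm r))) =
      chiLevel k A n p (DMod.simplex k σ)
        fun s => chiLevel k A (j s) p (DMod.simplex k (τ s)) fun t => yGen k A p (g ⟨s, t⟩)
  rw [DMod.comp_simplex]
  simp only [yGen, chiLevel_gen]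
  rw [mu_assoc (c := fun q => (g q).1) σ τ fun q => (g q).2.1, yCls_rel]
  exact congrArg _ (concat_assoc k A (fun q => (g q).1) fun q => (g q).2.2)

theorem chiLevel_one (p : ℕ) (z : (YPlus k A) _⦋p⦌) :
    chiLevel k A 1 p (DMod.simplex k fun _ => 1) (fun _ => z) = z := by
  refine IsMultilin.ext_span (k := k) (f := fun z : ∀ _ : Fin 1, (YPlus k A) _⦋p⦌ =>
      chiLevel k A 1 p (DMod.simplex k fun _ => 1) z)
    (g := fun x => x 0) (IsMultilin.of_multilinear _)
    (fun x i => ⟨LinearMap.id, fun a => ?_⟩) _ (fun _ => yGen_span k A p) (fun x hx => ?_)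
    fun _ => z
  · obtain rfl := Subsingleton.elim i 0
    simp
  choose g hg using hx
  obtain rfl : (fun q => yGen k A p (g q)) = x := funext hg
  have h0 : g = fun _ => g 0 := funext fun s => by rw [Subsingleton.elim s 0]
  rw [h0]
  simp only [yGen, chiLevel_gen]
  rw [mu_single, yCls_rel]
  exact congrArg _ (concat_single k A _ _)

theorem chiLevel_act (p n : ℕ) (ρ : Equiv.Perm (Fin n)) (x : (DMod k n) _⦋p⦌)
    (z : Fin n → (YPlus k A) _⦋p⦌) :
    chiLevel k A n p (DMod.act k p ρ x) z = chiLevel k A n p x fun i => z (ρ.symm i) := by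
  refine IsMultilin.ext_span (k := k) (f := fun z : Fin n → (YPlus k A) _⦋p⦌ =>
      chiLevel k A n p (DMod.act k p ρ x) z)
    (g := fun z => chiLevel k A n p x fun i => z (ρ.symm i))
    (IsMultilin.of_multilinear _) ((IsMultilin.of_multilinear _).reindex ρ.symm)
    _ (fun s => yGen_span k A p) (fun y hy => ?_) z
  choose g hg using hy
  obtain rfl : (fun q => yGen k A p (g q)) = y := funext hg
  refine congrArg (fun f => f x) (DMod.hom_ext
    (evalₗ (fun s => yGen k A p (g s)) ∘ₗ chiLevel k A n p ∘ₗ DMod.act k p ρ)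
    (evalₗ (fun s => yGen k A p (g (ρ.symm s))) ∘ₗ chiLevel k A n p) fun σ => ?_)
  show chiLevel k A n p (DMod.act k p ρ (DMod.simplex k σ)) (fun s => yGen k A p (g s)) =
    chiLevel k A n p (DMod.simplex k σ) fun s => yGen k A p (g (ρ.symm s))
  rw [DMod.act_simplex]
  simp only [yGen, chiLevel_gen]
  rw [mu_reorder, yCls_rel]
  exact congrArg _ (concat_reorder k A ρ (fun i => (g i).1) fun i => (g i).2.2)

theorem chiY_isSAlgebra : IsSAlgebra (Dsm k) (YPlus k A) (chiY k A) := fun p =>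
  { assoc := fun n j x b y hy c z hz => by
      have key := chiLevel_assoc k A p n j x y fun q => z q.1 q.2
      rcases GMod.ofModule_homog b y hy with rfl | ⟨s, hs⟩
      · rw [koszulShuffle_zero, pow_zero, one_smul]
        exact key
      · have h : chiLevel k A n p x (fun s => chiLevel k A (j s) p (y s) (z s)) = 0 := by
          refine MultilinearMap.map_coord_zero _ s ?_
          have h' : y s = (0 : (DMod k (j s)) _⦋p⦌) := hs
          rw [h', map_zero]
          rfl
        exact key.trans (h.trans (((congrArg _ h).trans (smul_zero _)).symm))
    unit := fun x => by
      rw [Dsm_one]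
      exact chiLevel_one k A p x
    equivariance := fun n σ x b z hz => by
      have key := chiLevel_act k A p n σ x z
      rcases GMod.ofModule_homog b z hz with rfl | ⟨s, hs⟩
      · rw [koszul_zero, pow_zero, one_smul]
        exact key
      · have h : chiLevel k A n p (DMod.act k p σ x) z = 0 :=
          MultilinearMap.map_coord_zero _ s hs
        exact h.trans ((congrArg _ (key.symm.trans h)).trans (smul_zero _)).symm }

end ChiAlgebra

/-! ### Words and shuffles -/

section Words

open Classical in
/-- The number of inversions of a word with respect to a relation on the letters. -/
noncomputable def inversions {I : Type} (r : I → I → Prop) {N : ℕ} (w : Fin N → I) : ℕ :=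
  (Finset.univ.filter fun t : Fin N × Fin N => t.1 < t.2 ∧ r (w t.2) (w t.1)).card

/-- Words of length `N` in which the letter `i` occurs `q i` times. Such a word is a shuffle: a maximal
nondegenerate simplex of the product of the simplices `Δ[q i]`, with vertices the numbers
`countBefore w i s` of letters `i` among the first `s` letters. -/
def Word {I : Type} [DecidableEq I] (N : ℕ) (q : I → ℕ) : Type :=
  {w : Fin N → I // ∀ i, (Finset.univ.filter fun t => w t = i).card = q i}

variable {I : Type} [DecidableEq I] {N : ℕ} {q : I → ℕ}

noncomputable instance [Fintype I] : Fintype (Word N q) := by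
  unfold Word
  infer_instance

/-- The number of letters `i` of a word among its first `s` letters. -/
def countBefore (w : Fin N → I) (i : I) (s : ℕ) : ℕ :=
  (Finset.univ.filter fun t : Fin N => (t : ℕ) < s ∧ w t = i).card

theorem countBefore_mono (w : Fin N → I) (i : I) {s s' : ℕ} (h : s ≤ s') :
    countBefore w i s ≤ countBefore w i s' := by
  refine Finset.card_le_card fun t ht => ?_
  simp only [Finset.mem_filter, Finset.mem_univ, true_and] at ht ⊢
  exact ⟨ht.1.trans_le h, ht.2⟩

theorem countBefore_succ (w : Fin N → I) (i : I) (t : Fin N) :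
    countBefore w i (t + 1) = countBefore w i t + if w t = i then 1 else 0 := by
  have hle : ∀ s : Fin N, (s : ℕ) < t + 1 ↔ (s : ℕ) < t ∨ s = t := by
    intro s
    rw [Fin.ext_iff]
    omega
  unfold countBefore
  split_ifs with h
  · rw [← Finset.card_insert_of_notMem (a := t) (by simp)]
    congr 1
    ext s
    simp only [Finset.mem_filter, Finset.mem_univ, true_and, Finset.mem_insert, hle]
    constructor
    · rintro ⟨h1 | h1, h2⟩
      · exact Or.inr ⟨h1, h2⟩
      · exact Or.inl h1
    · rintro (rfl | ⟨h1, h2⟩)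
      · exact ⟨Or.inr rfl, h⟩
      · exact ⟨Or.inl h1, h2⟩
  · rw [add_zero]
    congr 1
    ext s
    simp only [Finset.mem_filter, Finset.mem_univ, true_and, hle]
    constructor
    · rintro ⟨h1 | rfl, h2⟩
      · exact ⟨h1, h2⟩
      · exact absurd h2 h
    · rintro ⟨h1, h2⟩
      exact ⟨Or.inl h1, h2⟩

theorem countBefore_lt (w : Fin N → I) (t : Fin N) {s : ℕ} (h : (t : ℕ) < s) :
    countBefore w (w t) t < countBefore w (w t) s := by
  refine lt_of_lt_of_le ?_ (countBefore_mono w (w t) (Nat.succ_le_of_lt h))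
  rw [Nat.succ_eq_add_one, countBefore_succ, if_pos rfl]
  exact Nat.lt_succ_self _

theorem countBefore_all (w : Fin N → I) (i : I) :
    countBefore w i N = (Finset.univ.filter fun t => w t = i).card := by
  simp [countBefore]

/-- The monotone surjection `[N] → [q i]` that counts the letters `i` before a given place. -/
def Word.proj (w : Word N q) (i : I) : ⦋N⦌ ⟶ ⦋q i⦌ :=
  SimplexCategory.mkHom
    { toFun := fun s => ⟨countBefore w.1 i s, Nat.lt_succ_of_le
        (le_trans (countBefore_mono _ _ (Nat.lt_succ_iff.mp s.2))
          ((countBefore_all w.1 i).trans (w.2 i)).le)⟩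
      monotone' := fun _ _ h => Fin.mk_le_mk.mpr (countBefore_mono _ _ h) }

theorem Word.proj_val (w : Word N q) (i : I) (s : Fin (N + 1)) :
    ((w.proj i).toOrderHom s : ℕ) = countBefore w.1 i s := rfl

/-- The places of the letter `i`, numbered in increasing order. -/
noncomputable def Word.place (w : Word N q) (i : I) : {t // w.1 t = i} ≃ Fin (q i) :=
  Equiv.ofBijective (fun t => ⟨countBefore w.1 i t.1, by
      obtain ⟨t, rfl⟩ := t
      refine (countBefore_lt w.1 t t.2).trans_le ?_
      rw [countBefore_all, w.2]⟩) (by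
    rw [Fintype.bijective_iff_injective_and_card]
    constructor
    · rintro ⟨t, rfl⟩ ⟨t', h'⟩ h
      simp only [Fin.mk.injEq] at h
      refine Subtype.ext ?_
      rcases lt_trichotomy t t' with h1 | h1 | h1
      · have := countBefore_lt w.1 t h1
        omega
      · exact h1
      · have h2 := countBefore_lt w.1 t' h1
        rw [h'] at h2
        omega
    · rw [Fintype.card_fin, Fintype.card_subtype, w.2])

theorem Word.place_val (w : Word N q) (i : I) (t : {t // w.1 t = i}) :
    (w.place i t : ℕ) = countBefore w.1 i t.1 := rfl

theorem Word.place_lt_iff (w : Word N q) (i : I) (t : {t // w.1 t = i}) (s : ℕ) :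
    (w.place i t : ℕ) < countBefore w.1 i s ↔ (t.1 : ℕ) < s := by
  obtain ⟨t, rfl⟩ := t
  rw [Word.place_val]
  refine ⟨fun h => ?_, countBefore_lt w.1 t⟩
  by_contra! h'
  exact absurd h (countBefore_mono w.1 (w.1 t) h').not_gt

theorem Word.place_lt_place_iff (w : Word N q) (i : I) (t t' : {t // w.1 t = i}) :
    w.place i t < w.place i t' ↔ t.1 < t'.1 :=
  w.place_lt_iff i t t'.1

/-- The word in the letters `⟨j, i⟩` given by a word in the letters `j` and, for each `j`, a word
in the letters `i` that is written at the places of `j`. -/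
noncomputable def Word.comb {J : Type} [DecidableEq J] {I : J → Type} [∀ j, Fintype (I j)]
    [∀ j, DecidableEq (I j)] {q : (Σ j, I j) → ℕ} (w : Word N fun j => ∑ i, q ⟨j, i⟩)
    (v : ∀ j, Word (∑ i, q ⟨j, i⟩) fun i => q ⟨j, i⟩) (t : Fin N) : Σ j, I j :=
  ⟨w.1 t, (v (w.1 t)).1 (w.place (w.1 t) ⟨t, rfl⟩)⟩

section Comb

variable {J : Type} [DecidableEq J] {I : J → Type} [∀ j, Fintype (I j)]
    [∀ j, DecidableEq (I j)] {q : (Σ j, I j) → ℕ} (w : Word N fun j => ∑ i, q ⟨j, i⟩)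
    (v : ∀ j, Word (∑ i, q ⟨j, i⟩) fun i => q ⟨j, i⟩)

theorem Word.comb_eq (j : J) (t : {t // w.1 t = j}) :
    w.comb v t.1 = ⟨j, (v j).1 (w.place j t)⟩ := by
  obtain ⟨t, rfl⟩ := t
  rfl

theorem Word.comb_eq_iff (t : Fin N) (j : J) (i : I j) :
    w.comb v t = ⟨j, i⟩ ↔ ∃ h : w.1 t = j, (v j).1 (w.place j ⟨t, h⟩) = i := by
  constructor
  · intro h
    have h' : w.1 t = j := congrArg Sigma.fst h
    refine ⟨h', ?_⟩
    rw [Word.comb_eq w v j ⟨t, h'⟩] at h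
    simpa using h
  · rintro ⟨h, rfl⟩
    exact Word.comb_eq w v j ⟨t, h⟩

/-- The letters `⟨j, i⟩` of a combined word are counted by counting first the letters `j`, and among
them the letters `i`. -/
theorem Word.countBefore_comb (j : J) (i : I j) (s : ℕ) :
    countBefore (w.comb v) ⟨j, i⟩ s = countBefore (v j).1 i (countBefore w.1 j s) := by
  unfold countBefore
  refine Finset.card_bij (fun t ht => w.place j ⟨t, congrArg Sigma.fst
    (Finset.mem_filter.mp ht).2.2⟩) ?_ ?_ ?_
  · intro t ht
    simp only [Finset.mem_filter, Finset.mem_univ, true_and] at ht ⊢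
    obtain ⟨h, h'⟩ := (Word.comb_eq_iff w v t j i).mp ht.2
    exact ⟨(w.place_lt_iff j ⟨t, h⟩ s).mpr ht.1, h'⟩
  · intro t ht t' ht' h
    exact congrArg Subtype.val ((w.place j).injective h)
  · intro a ha
    simp only [Finset.mem_filter, Finset.mem_univ, true_and] at ha
    obtain ⟨⟨t, h⟩, rfl⟩ := (w.place j).surjective a
    refine ⟨t, ?_, rfl⟩
    simp only [Finset.mem_filter, Finset.mem_univ, true_and]
    exact ⟨(w.place_lt_iff j ⟨t, h⟩ s).mp ha.1, (Word.comb_eq_iff w v t j i).mpr ⟨h, ha.2⟩⟩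

/-- `Word.comb`, as a word with the right number of letters. -/
noncomputable def Word.combine : Word N q :=
  ⟨w.comb v, fun ⟨j, i⟩ => by
    rw [← countBefore_all, Word.countBefore_comb, countBefore_all, w.2, countBefore_all, (v j).2]⟩

theorem Word.proj_combine (j : J) (i : I j) :
    (w.combine v).proj ⟨j, i⟩ = w.proj j ≫ (v j).proj i := by
  refine SimplexCategory.Hom.ext _ _ (OrderHom.ext _ _ (funext fun s => Fin.ext ?_))
  exact Word.countBefore_comb w v j i s

/-- A word in the letters `⟨j, i⟩` is a shuffle of one word for each `j`, in exactly one way. This is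
the associativity of the shuffle maps, apart from signs. -/
theorem Word.combine_bijective :
    Function.Bijective fun p : (Σ _ : Word N fun j => ∑ i, q ⟨j, i⟩,
      ∀ j, Word (∑ i, q ⟨j, i⟩) fun i => q ⟨j, i⟩) => p.1.combine p.2 := by
  constructor
  · rintro ⟨w, v⟩ ⟨w', v'⟩ h
    have h1 : w.comb v = w'.comb v' := congrArg Subtype.val h
    obtain rfl : w = w' := Subtype.ext (funext fun t => congrArg Sigma.fst (congrFun h1 t))
    congr 1
    funext j
    refine Subtype.ext (funext fun a => ?_)
    obtain ⟨t, rfl⟩ := (w.place j).surjective a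
    have h2 := congrFun h1 t.1
    rw [Word.comb_eq, Word.comb_eq] at h2
    simpa using h2
  · intro W
    let w : Word N fun j => ∑ i, q ⟨j, i⟩ := ⟨fun t => (W.1 t).1, fun j => by
      simp only [← W.2]
      rw [Finset.card_eq_sum_card_fiberwise (f := fun t => W.1 t)
        (t := Finset.univ.map (Function.Embedding.sigmaMk j))]
      · rw [Finset.sum_map]
        refine Finset.sum_congr rfl fun i _ => congrArg Finset.card ?_
        ext t
        simp only [Finset.mem_filter, Finset.mem_univ, true_and, Function.Embedding.sigmaMk_apply]
        exact ⟨fun h => h.2, fun h => ⟨congrArg Sigma.fst h, h⟩⟩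
      · intro t ht
        simp only [Finset.coe_filter, Finset.mem_univ, true_and, Set.mem_ofPred_eq] at ht
        simp only [Finset.coe_map, Finset.coe_univ, Set.image_univ, Set.mem_range]
        exact ⟨ht ▸ (W.1 t).2, by obtain rfl := ht; rfl⟩⟩
    have key : ∀ j (t : {t // w.1 t = j}), (⟨j, t.2 ▸ (W.1 t.1).2⟩ : Σ j, I j) = W.1 t.1 := by
      rintro j ⟨t, rfl⟩
      rfl
    let u : ∀ j, Fin (∑ i, q ⟨j, i⟩) → I j := fun j a =>
      ((w.place j).symm a).2 ▸ (W.1 ((w.place j).symm a).1).2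
    have hu : ∀ j t, (⟨j, u j (w.place j t)⟩ : Σ j, I j) = W.1 t.1 := by
      intro j t
      have := key j ((w.place j).symm (w.place j t))
      exact this.trans (congrArg (fun t : {t // w.1 t = j} => W.1 t.1) (Equiv.symm_apply_apply _ _))
    let v : ∀ j, Word (∑ i, q ⟨j, i⟩) fun i => q ⟨j, i⟩ := fun j => ⟨u j, fun i => by
      refine Eq.trans (Eq.symm ?_) (W.2 ⟨j, i⟩)
      refine Finset.card_bij (fun t ht => w.place j ⟨t, congrArg Sigma.fst
        (Finset.mem_filter.mp ht).2⟩) ?_ ?_ ?_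
      · intro t ht
        simp only [Finset.mem_filter, Finset.mem_univ, true_and] at ht ⊢
        have := (hu j ⟨t, congrArg Sigma.fst ht⟩).trans ht
        simpa using this
      · intro t ht t' ht' h
        exact congrArg Subtype.val ((w.place j).injective h)
      · intro a ha
        simp only [Finset.mem_filter, Finset.mem_univ, true_and] at ha
        obtain ⟨t, rfl⟩ := (w.place j).surjective a
        refine ⟨t.1, ?_, rfl⟩
        simp only [Finset.mem_filter, Finset.mem_univ, true_and]
        rw [← hu, ha]⟩
    refine ⟨⟨w, v⟩, Subtype.ext (funext fun t => ?_)⟩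
    exact hu (w.1 t) ⟨t, rfl⟩

/-- Inversions of a combined word, for a lexicographic relation on its letters. -/
theorem Word.inversions_combine [Fintype J] (r : J → J → Prop) (hr : ∀ j, ¬ r j j)
    (r' : ∀ j, I j → I j → Prop) (R : (Σ j, I j) → (Σ j, I j) → Prop)
    (h1 : ∀ j j' i i', j ≠ j' → (R ⟨j, i⟩ ⟨j', i'⟩ ↔ r j j'))
    (h2 : ∀ j i i', R ⟨j, i⟩ ⟨j, i'⟩ ↔ r' j i i') :
    inversions R (w.combine v).1 = inversions r w.1 + ∑ j, inversions (r' j) (v j).1 := by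
  classical
  have hR : ∀ t t', R (w.comb v t) (w.comb v t') ↔ r (w.1 t) (w.1 t') ∨
      ∃ j, ∃ (h : w.1 t = j) (h' : w.1 t' = j), r' j ((v j).1 (w.place j ⟨t, h⟩))
        ((v j).1 (w.place j ⟨t', h'⟩)) := by
    intro t t'
    by_cases h : w.1 t = w.1 t'
    · have e := Word.comb_eq w v (w.1 t') ⟨t, h⟩
      have e' := Word.comb_eq w v (w.1 t') ⟨t', rfl⟩
      simp only at e e'
      have hno : ¬ r (w.1 t) (w.1 t') := by
        rw [h]
        exact hr _
      rw [e, e', h2]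
      constructor
      · intro h3
        exact Or.inr ⟨_, h, rfl, h3⟩
      · rintro (h3 | ⟨j, h3, rfl, h4⟩)
        · exact absurd h3 hno
        · exact h4
    · have e : R (w.comb v t) (w.comb v t') ↔ r (w.1 t) (w.1 t') := h1 _ _ _ _ h
      rw [e]
      refine ⟨Or.inl, ?_⟩
      rintro (h3 | ⟨j, rfl, h3, -⟩)
      · exact h3
      · exact absurd h3.symm h
  unfold inversions
  have hcard : ∀ j, (Finset.univ.filter fun t : Fin (∑ i, q ⟨j, i⟩) × Fin (∑ i, q ⟨j, i⟩) =>
      t.1 < t.2 ∧ r' j ((v j).1 t.2) ((v j).1 t.1)).card =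
      (Finset.univ.filter fun t : Fin N × Fin N => t.1 < t.2 ∧ ∃ (h : w.1 t.2 = j)
        (h' : w.1 t.1 = j), r' j ((v j).1 (w.place j ⟨t.2, h⟩))
          ((v j).1 (w.place j ⟨t.1, h'⟩))).card := by
    intro j
    symm
    refine Finset.card_bij (fun t ht => (w.place j ⟨t.1, (Finset.mem_filter.mp ht).2.2.2.1⟩,
      w.place j ⟨t.2, (Finset.mem_filter.mp ht).2.2.1⟩)) ?_ ?_ ?_
    · intro t ht
      simp only [Finset.mem_filter, Finset.mem_univ, true_and] at ht ⊢
      obtain ⟨h3, h4, h5, h6⟩ := ht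
      exact ⟨(w.place_lt_place_iff j ⟨t.1, h5⟩ ⟨t.2, h4⟩).mpr h3, h6⟩
    · intro t ht t' ht' h
      simp only [Prod.mk.injEq] at h
      exact Prod.ext (congrArg Subtype.val ((w.place j).injective h.1))
        (congrArg Subtype.val ((w.place j).injective h.2))
    · rintro ⟨a, b⟩ ha
      simp only [Finset.mem_filter, Finset.mem_univ, true_and] at ha
      obtain ⟨⟨t, h3⟩, rfl⟩ := (w.place j).surjective a
      obtain ⟨⟨t', h4⟩, rfl⟩ := (w.place j).surjective b
      refine ⟨(t, t'), ?_, rfl⟩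
      simp only [Finset.mem_filter, Finset.mem_univ, true_and]
      exact ⟨(w.place_lt_place_iff j ⟨t, h3⟩ ⟨t', h4⟩).mp ha.1, h4, h3, ha.2⟩
  simp only [hcard]
  rw [← Finset.card_biUnion, ← Finset.card_union_of_disjoint]
  · congr 1
    ext t
    simp only [Finset.mem_filter, Finset.mem_univ, true_and, Finset.mem_union,
      Finset.mem_biUnion]
    have := hR t.2 t.1
    change t.1 < t.2 ∧ R (w.comb v t.2) (w.comb v t.1) ↔ _
    rw [this]
    tauto
  · rw [Finset.disjoint_left]
    intro t ht ht'
    simp only [Finset.mem_filter, Finset.mem_univ, true_and, Finset.mem_biUnion] at ht ht'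
    obtain ⟨j, -, h3, h4, -⟩ := ht'
    rw [h3, h4] at ht
    exact hr _ ht.2
  · intro j _ j' _ hjj
    rw [Function.onFun, Finset.disjoint_left]
    intro t ht ht'
    simp only [Finset.mem_filter, Finset.mem_univ, true_and] at ht ht'
    exact hjj (ht.2.1.symm.trans ht'.2.1)

end Comb

/-- The inversions of a word with respect to two orders of the letters differ, modulo `2`, by the
number of pairs of places whose letters are in a different order. -/
theorem inversions_change [Fintype I] (w : Word N q) (r r' : I → I → Prop) [DecidableRel r]
    [DecidableRel r'] (h : ∀ a b, a ≠ b → (r a b ↔ ¬ r b a)) (hr : ∀ a, ¬ r a a)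
    (h' : ∀ a b, a ≠ b → (r' a b ↔ ¬ r' b a)) (hr' : ∀ a, ¬ r' a a) :
    (-1 : ℤ) ^ inversions r w.1 =
      (-1) ^ (∑ p : I × I with r p.1 p.2 ∧ r' p.2 p.1, q p.1 * q p.2) *
        (-1) ^ inversions r' w.1 := by
  classical
  let c : I × I → ℕ := fun p => (Finset.univ.filter fun t : Fin N × Fin N =>
    t.1 < t.2 ∧ w.1 t.2 = p.1 ∧ w.1 t.1 = p.2).card
  have hinv : ∀ (r : I → I → Prop) [DecidableRel r], inversions r w.1 =
      ∑ p : I × I with r p.1 p.2, c p := by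
    intro r _
    have hi : inversions r w.1 = (Finset.univ.filter fun t : Fin N × Fin N =>
      t.1 < t.2 ∧ r (w.1 t.2) (w.1 t.1)).card := by
        unfold inversions
        congr!
    rw [hi]
    rw [Finset.card_eq_sum_card_fiberwise (f := fun t => (w.1 t.2, w.1 t.1))
      (t := Finset.univ.filter fun p : I × I => r p.1 p.2)]
    · refine Finset.sum_congr rfl fun p hp => congrArg Finset.card ?_
      ext t
      simp only [Finset.mem_filter, Finset.mem_univ, true_and, Prod.ext_iff] at hp ⊢
      constructor
      · rintro ⟨⟨h1, -⟩, h2, h3⟩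
        exact ⟨h1, h2, h3⟩
      · rintro ⟨h1, h2, h3⟩
        exact ⟨⟨h1, h2 ▸ h3 ▸ hp⟩, h2, h3⟩
    · intro t ht
      simpa using (Finset.mem_filter.mp ht).2.2
  -- Each pair of places with letters `a` and `b` is counted in exactly one of the two orders.
  have hc : ∀ a b, a ≠ b → c (a, b) + c (b, a) = q a * q b := by
    intro a b hab
    have h1 : c (b, a) = (Finset.univ.filter fun t : Fin N × Fin N =>
        t.2 < t.1 ∧ w.1 t.2 = a ∧ w.1 t.1 = b).card := by
      refine Finset.card_bij (fun t _ => (t.2, t.1)) ?_ ?_ ?_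
      · intro t ht
        simp only [Finset.mem_filter, Finset.mem_univ, true_and] at ht ⊢
        exact ⟨ht.1, ht.2.2, ht.2.1⟩
      · intro t _ t' _ h
        simp only [Prod.mk.injEq] at h
        exact Prod.ext h.2 h.1
      · intro t ht
        simp only [Finset.mem_filter, Finset.mem_univ, true_and] at ht
        exact ⟨(t.2, t.1), by simpa using ⟨ht.1, ht.2.2, ht.2.1⟩, rfl⟩
    rw [h1, ← Finset.card_union_of_disjoint, ← w.2 a, ← w.2 b, mul_comm, ← Finset.card_product]
    · congr 1
      ext t
      simp only [Finset.mem_union, Finset.mem_filter, Finset.mem_univ, true_and,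
        Finset.mem_product]
      constructor
      · rintro (⟨-, h2, h3⟩ | ⟨-, h2, h3⟩) <;> exact ⟨h3, h2⟩
      · rintro ⟨h3, h2⟩
        rcases lt_trichotomy t.1 t.2 with h4 | h4 | h4
        · exact Or.inl ⟨h4, h2, h3⟩
        · rw [h4, h2] at h3
          exact absurd h3 hab
        · exact Or.inr ⟨h4, h2, h3⟩
    · rw [Finset.disjoint_left]
      intro t ht ht'
      simp only [Finset.mem_filter, Finset.mem_univ, true_and] at ht ht'
      exact absurd ht.1 ht'.1.asymm
  have hsplit : ∀ (r r' : I → I → Prop) [DecidableRel r] [DecidableRel r'],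
      ∑ p : I × I with r p.1 p.2, c p = ∑ p : I × I with r p.1 p.2 ∧ r' p.1 p.2, c p +
        ∑ p : I × I with r p.1 p.2 ∧ ¬ r' p.1 p.2, c p := by
    intro r r' _ _
    rw [← Finset.sum_filter_add_sum_filter_not _ (fun p : I × I => r' p.1 p.2),
      Finset.filter_filter, Finset.filter_filter]
  have hswap : ∑ p : I × I with r' p.1 p.2 ∧ ¬ r p.1 p.2, c p =
      ∑ p : I × I with r p.1 p.2 ∧ r' p.2 p.1, c (p.2, p.1) := by
    refine Finset.sum_bij (fun p _ => (p.2, p.1)) ?_ ?_ ?_ ?_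
    · intro p hp
      simp only [Finset.mem_filter, Finset.mem_univ, true_and] at hp ⊢
      have hne : p.1 ≠ p.2 := fun e => hr' p.2 (by rw [e] at hp; exact hp.1)
      refine ⟨?_, hp.1⟩
      rw [h _ _ hne.symm]
      exact hp.2
    · intro p _ p' _ h
      simp only [Prod.mk.injEq] at h
      exact Prod.ext h.2 h.1
    · intro p hp
      simp only [Finset.mem_filter, Finset.mem_univ, true_and] at hp
      have hne : p.1 ≠ p.2 := fun e => hr p.2 (by rw [e] at hp; exact hp.1)
      refine ⟨(p.2, p.1), ?_, rfl⟩
      simp only [Finset.mem_filter, Finset.mem_univ, true_and]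
      exact ⟨hp.2, (h _ _ hne).mp hp.1⟩
    · intro p _
      rfl
  have hset : ∑ p : I × I with r p.1 p.2 ∧ ¬ r' p.1 p.2, c p =
      ∑ p : I × I with r p.1 p.2 ∧ r' p.2 p.1, c p := by
    refine Finset.sum_congr (Finset.filter_congr fun p _ => ?_) fun _ _ => rfl
    refine and_congr_right fun hp => ?_
    have hne : p.1 ≠ p.2 := fun e => hr p.2 (by rw [e] at hp; exact hp)
    exact (h' _ _ hne.symm).symm
  have hsum : ∑ p : I × I with r p.1 p.2 ∧ r' p.2 p.1, q p.1 * q p.2 =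
      ∑ p : I × I with r p.1 p.2 ∧ r' p.2 p.1, c p +
        ∑ p : I × I with r p.1 p.2 ∧ r' p.2 p.1, c (p.2, p.1) := by
    rw [← Finset.sum_add_distrib]
    refine Finset.sum_congr rfl fun p hp => ?_
    simp only [Finset.mem_filter, Finset.mem_univ, true_and] at hp
    have hne : p.1 ≠ p.2 := fun e => hr p.2 (by rw [e] at hp; exact hp.1)
    exact (hc _ _ hne).symm
  have hcomm : ∑ p : I × I with r' p.1 p.2 ∧ r p.1 p.2, c p =
      ∑ p : I × I with r p.1 p.2 ∧ r' p.1 p.2, c p :=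
    Finset.sum_congr (Finset.filter_congr fun p _ => and_comm) fun _ _ => rfl
  rw [hinv r, hinv r', hsplit r r', hsplit r' r, hswap, hset, hsum, hcomm]
  generalize ∑ p : I × I with r p.1 p.2 ∧ r' p.1 p.2, c p = x
  generalize ∑ p : I × I with r p.1 p.2 ∧ r' p.2 p.1, c p = y
  generalize ∑ p : I × I with r p.1 p.2 ∧ r' p.2 p.1, c (p.2, p.1) = z
  simp only [pow_add]
  have hz : (-1 : ℤ) ^ z * (-1) ^ z = 1 := by rw [← mul_pow]; simp
  linear_combination (-(-1 : ℤ) ^ x * (-1) ^ y) * hz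

end Words

/-! ### Shuffle maps as sums over words -/

section ShuffleSums

theorem countBefore_relabel {L L' : Type} [DecidableEq L] [DecidableEq L'] {N : ℕ}
    (e : L' → L) (he : Function.Injective e) (w : Fin N → L')
    (l : L') (s : ℕ) : countBefore (e ∘ w) (e l) s = countBefore w l s := by
  simp [countBefore, he.eq_iff]

variable {k : Type u} [CommRing k]

/-- The class in `⨁ (𝒩Z)_p` of an element of `Z_N`. -/
noncomputable def cls (Z : SimplicialObject (ModuleCat.{u} k)) (N : ℕ) :
    Z _⦋N⦌ →ₗ[k] Tot (normalized Z) :=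
  Tot.of (normalized Z) N ∘ₗ (degen Z N).mkQ

theorem of_eq_cls (Z : SimplicialObject (ModuleCat.{u} k)) (N : ℕ) (z : (normalized Z).X N) :
    ∃ z', Tot.of (normalized Z) N z = cls Z N z' := by
  obtain ⟨z', rfl⟩ := (degen Z N).mkQ_surjective z
  exact ⟨z', rfl⟩

theorem cls_span (Z : SimplicialObject (ModuleCat.{u} k)) :
    Submodule.span k {x | ∃ N z, x = cls Z N z} = ⊤ := by
  rw [← Submodule.ker_mkQ (Submodule.span k _), LinearMap.ker_eq_top]
  refine DirectSum.linearMap_ext k fun N => Submodule.linearMap_qext _ (LinearMap.ext fun z => ?_)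
  exact (Submodule.Quotient.mk_eq_zero _).mpr (Submodule.subset_span ⟨N, z, rfl⟩)

theorem map_cls {Z Z' : SimplicialObject (ModuleCat.{u} k)} (c : Z ⟶ Z') (N : ℕ) (z : Z _⦋N⦌) :
    Tot.map (normalizedMap c) (cls Z N z) = cls Z' N ((c.app (op ⦋N⦌)).hom z) :=
  DirectSum.lmap_lof _ _ _

variable {L L' : Type} [Fintype L] [DecidableEq L] [Fintype L'] [DecidableEq L']

/-- The signed sum, over the words of length `N` with `q l` letters `l`, of the classes of the
values of `F` on the corresponding degeneracy operators. The relation `r` on the letters determines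
the signs. The length `N` is independent of `q`: there are no words unless `N = ∑ l, q l`, and a
free `N` avoids transport along equalities of degrees. -/
noncomputable def shSum {Z : SimplicialObject (ModuleCat.{u} k)} (r : L → L → Prop) (q : L → ℕ)
    (N : ℕ) (F : (∀ l, ⦋N⦌ ⟶ ⦋q l⦌) → Z _⦋N⦌) : Tot (normalized Z) :=
  ∑ w : Word N q, (-1 : k) ^ inversions r w.1 • cls Z N (F w.proj)

theorem map_shSum {Z Z' : SimplicialObject (ModuleCat.{u} k)} (c : Z ⟶ Z') (r : L → L → Prop)
    (q : L → ℕ) (N : ℕ) (F : (∀ l, ⦋N⦌ ⟶ ⦋q l⦌) → Z _⦋N⦌) :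
    Tot.map (normalizedMap c) (shSum r q N F) =
      shSum r q N fun θ => (c.app (op ⦋N⦌)).hom (F θ) := by
  simp only [shSum, map_sum, map_smul, map_cls]

theorem shuffle_sign_eq {n : ℕ} {q : Fin n → ℕ} (w : Shuffle q) :
    w.sign = (-1) ^ inversions (· < ·) w.1 := by
  classical
  unfold Shuffle.sign inversions
  congr!

/-- The Eilenberg–Zilber shuffle map, as a sum over words. -/
theorem shuffleMap_cls {n : ℕ} {X : Fin n → SimplicialObject (ModuleCat.{u} k)}
    {Z : SimplicialObject (ModuleCat.{u} k)} (f : SMultimap X Z) (q : Fin n → ℕ)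
    (x : ∀ i, (X i) _⦋q i⦌) :
    shuffleMap f (fun i => cls (X i) (q i) (x i)) =
      shSum (· < ·) q (∑ i, q i) fun θ => f.app _ fun i => ((X i).map (θ i).op).hom (x i) := by
  refine (MultilinearMap.fromDirectSumEquiv_lof (ι := Fin n)
    (M := fun i p => (normalized (X i)).X p) _ q
    (fun i => (degen (X i) (q i)).mkQ (x i))).trans ?_
  show Tot.of (normalized Z) (∑ i, q i) (multiQuot (fun i => degen (X i) (q i)) (shuffleSum f q)
    (shuffleSum_degen f q) fun i => (degen (X i) (q i)).mkQ (x i)) = _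
  rw [multiQuot_mk]
  show cls Z (∑ i, q i) ((∑ w : Shuffle q, w.sign •
    (f.app (∑ i, q i)).compLinearMap fun i => ((X i).map (w.proj i).op).hom) x) = _
  rw [_root_.sum_apply, map_sum]
  refine @Fintype.sum_equiv (Shuffle q) (Word _ q) _ _ _ _ (Equiv.refl _) _ _ fun w => ?_
  have h : ((-1 : k) ^ inversions (· < ·) w.1) = ((w.sign : ℤ) : k) := by
    rw [shuffle_sign_eq]
    simp
  refine Eq.trans ?_ (congrArg (· • _) h.symm)
  rw [Int.cast_smul_eq_zsmul]
  show cls Z _ (w.sign • _) = _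
  rw [map_zsmul]
  rfl

/-- Sums over words do not depend on the names of the letters. -/
theorem shSum_relabel {Z : SimplicialObject (ModuleCat.{u} k)} (e : L' → L)
    (he : Function.Bijective e) (r' : L' → L' → Prop) (r : L → L → Prop)
    (hr : ∀ a b, r' a b ↔ r (e a) (e b)) (q' : L' → ℕ) (q : L → ℕ) (hq : ∀ l, q' l = q (e l))
    (N : ℕ) (F' : (∀ l, ⦋N⦌ ⟶ ⦋q' l⦌) → Z _⦋N⦌) (F : (∀ l, ⦋N⦌ ⟶ ⦋q l⦌) → Z _⦋N⦌)
    (hF : ∀ θ' θ, (∀ l, HEq (θ' l) (θ (e l))) → F' θ' = F θ) :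
    shSum r' q' N F' = shSum r q N F := by
  obtain rfl : q' = fun l => q (e l) := funext hq
  let E : Word N (fun l => q (e l)) → Word N q := fun w => ⟨e ∘ w.1, fun l => by
    obtain ⟨l, rfl⟩ := he.2 l
    rw [← countBefore_all, countBefore_relabel e he.1, countBefore_all, w.2]⟩
  have hE : Function.Bijective E := by
    constructor
    · intro w w' h
      refine Subtype.ext (funext fun t => he.1 ?_)
      exact congrFun (congrArg Subtype.val h) t
    · intro w
      let i := (Equiv.ofBijective e he).symm
      have hi : ∀ l, e (i l) = l := (Equiv.ofBijective e he).apply_symm_apply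
      refine ⟨⟨fun t => i (w.1 t), fun l => ?_⟩, Subtype.ext (funext fun t => hi _)⟩
      refine Eq.trans (congrArg Finset.card ?_) (w.2 (e l))
      ext t
      simp only [Finset.mem_filter, Finset.mem_univ, true_and]
      rw [← he.1.eq_iff, hi]
  unfold shSum
  rw [← hE.sum_comp]
  refine Finset.sum_congr rfl fun w _ => ?_
  congr 1
  · congr 1
    classical
    unfold inversions
    congr 1
    ext t
    simp only [Finset.mem_filter, Finset.mem_univ, true_and, hr]
    rfl
  · -- Renaming the letters does not change the degeneracy operators.
    refine congrArg _ (hF _ _ fun l => heq_of_eq ?_)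
    refine SimplexCategory.Hom.ext _ _ (OrderHom.ext _ _ (funext fun s => Fin.ext ?_))
    exact (countBefore_relabel e he.1 w.1 l s).symm

/-- A word with only one letter. -/
theorem shSum_single {Z : SimplicialObject (ModuleCat.{u} k)} (l₀ : L) (r : L → L → Prop)
    (hr : ∀ a, ¬ r a a) (q : L → ℕ) (N : ℕ) (h₀ : q l₀ = N) (h : ∀ l, l ≠ l₀ → q l = 0)
    (F : (∀ l, ⦋N⦌ ⟶ ⦋q l⦌) → Z _⦋N⦌) (z : Z _⦋N⦌)
    (hF : ∀ θ, (∀ s : Fin (N + 1), ((θ l₀).toOrderHom s : ℕ) = s) → F θ = z) :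
    shSum r q N F = cls Z N z := by
  let w₀ : Word N q := ⟨fun _ => l₀, fun l => by
    by_cases hl : l = l₀
    · subst hl
      simp [h₀]
    · rw [h l hl, Finset.card_eq_zero, Finset.filter_eq_empty_iff]
      exact fun _ _ e => hl e.symm⟩
  have hw : ∀ w : Word N q, w = w₀ := fun w => by
    refine Subtype.ext (funext fun t => ?_)
    by_contra! hne
    have h1 := w.2 (w.1 t)
    rw [h _ hne, Finset.card_eq_zero, Finset.filter_eq_empty_iff] at h1
    exact h1 (Finset.mem_univ t) rfl
  unfold shSum
  rw [Fintype.sum_eq_single w₀ fun w hne => absurd (hw w) hne]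
  have hinv : inversions r w₀.1 = 0 := by
    classical
    unfold inversions
    rw [Finset.card_eq_zero, Finset.filter_eq_empty_iff]
    exact fun t _ ht => hr _ ht.2
  rw [hinv, pow_zero, one_smul, hF]
  intro s
  rw [Word.proj_val]
  show (Finset.univ.filter fun t : Fin N => (t : ℕ) < s ∧ l₀ = l₀).card = s
  simp only [and_true]
  exact Fin.card_filter_val_lt.trans (min_eq_right (Nat.lt_succ_iff.mp s.2))

/-- A change of the order of the letters changes sums over words by a sign. All Koszul signs in the
normalized operad arise in this way. -/
theorem shSum_change {Z : SimplicialObject (ModuleCat.{u} k)} (r r' : L → L → Prop)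
    [DecidableRel r] [DecidableRel r']
    (h : ∀ a b, a ≠ b → (r a b ↔ ¬ r b a)) (hr : ∀ a, ¬ r a a)
    (h' : ∀ a b, a ≠ b → (r' a b ↔ ¬ r' b a)) (hr' : ∀ a, ¬ r' a a) (q : L → ℕ) (N : ℕ)
    (F : (∀ l, ⦋N⦌ ⟶ ⦋q l⦌) → Z _⦋N⦌) :
    shSum r q N F =
      (-1 : ℤ) ^ (∑ p : L × L with r p.1 p.2 ∧ r' p.2 p.1, q p.1 * q p.2) • shSum r' q N F := by
  unfold shSum
  rw [Finset.smul_sum]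
  refine Finset.sum_congr rfl fun w _ => ?_
  have h1 := congrArg (fun z : ℤ => (z : k)) (inversions_change w r r' h hr h' hr')
  simp only [Int.cast_pow, Int.cast_neg, Int.cast_one, Int.cast_mul] at h1
  rw [h1, mul_smul, ← Int.cast_smul_eq_zsmul k]
  simp

/-- Shuffle maps of sums over words are sums over combined words. The letters `l` with `π l = j` are
those of the `j`-th argument `ξ j`, and the order `r` puts the letters of the arguments one after the
other. -/
theorem shuffleMap_nest {m : ℕ} {X : Fin m → SimplicialObject (ModuleCat.{u} k)}
    {Z : SimplicialObject (ModuleCat.{u} k)} (f : SMultimap X Z) (π : L → Fin m)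
    (r : L → L → Prop) (hr : ∀ a b, π a ≠ π b → (r a b ↔ π a < π b)) (q : L → ℕ)
    (G : ∀ j N, (∀ l : {l // π l = j}, ⦋N⦌ ⟶ ⦋q l⦌) → (X j) _⦋N⦌)
    (hG : ∀ j {N N' : ℕ} (φ : ⦋N'⦌ ⟶ ⦋N⦌) (θ : ∀ l : {l // π l = j}, ⦋N⦌ ⟶ ⦋q l⦌),
      G j N' (fun l => φ ≫ θ l) = ((X j).map φ.op).hom (G j N θ))
    (ξ : ∀ j, Tot (normalized (X j)))
    (hξ : ∀ j, ξ j = shSum (fun a b : {l // π l = j} => r a b) (fun l => q l)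
      (∑ l : {l // π l = j}, q l) (G j _)) :
    shuffleMap f ξ =
      shSum r q (∑ l, q l) fun θ => f.app _ fun j => G j _ fun l => θ l := by
  classical
  let q' : (Σ j, {l // π l = j}) → ℕ := fun p => q p.2
  let Q : Fin m → ℕ := fun j => ∑ i, q' ⟨j, i⟩
  let R : (Σ j, {l // π l = j}) → (Σ j, {l // π l = j}) → Prop := fun a b => r a.2 b.2
  have hN : ∑ j, Q j = ∑ l, q l := by
    rw [← (Equiv.sigmaFiberEquiv π).sum_comp, Fintype.sum_sigma]
    rfl
  obtain rfl : ξ = fun j => ∑ v : Word (Q j) (fun i => q' ⟨j, i⟩),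
      (-1 : k) ^ inversions (fun a b : {l // π l = j} => r a b) v.1 •
        cls (X j) (Q j) (G j _ v.proj) := funext hξ
  have hmid : shuffleMap f (fun j => ∑ v : Word (Q j) (fun i => q' ⟨j, i⟩),
      (-1 : k) ^ inversions (fun a b : {l // π l = j} => r a b) v.1 •
        cls (X j) (Q j) (G j _ v.proj)) = shSum R q' (∑ j, Q j) fun θ =>
          f.app _ fun j => G j _ fun l => θ ⟨j, l⟩ := by
    rw [MultilinearMap.map_sum]
    unfold shSum
    rw [← Word.combine_bijective.sum_comp, Fintype.sum_sigma, Finset.sum_comm]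
    refine Finset.sum_congr rfl fun v _ => ?_
    rw [MultilinearMap.map_smul_univ, shuffleMap_cls]
    unfold shSum
    rw [Finset.smul_sum]
    refine Finset.sum_congr rfl fun w _ => ?_
    rw [smul_smul, Word.inversions_combine w v (· < ·) (fun j => lt_irrefl j)
      (fun j a b => r a b) R (fun j j' i i' hjj => by
        obtain ⟨i, rfl⟩ := i
        obtain ⟨i', rfl⟩ := i'
        exact hr i i' hjj) (fun j i i' => Iff.rfl), pow_add, Finset.prod_pow_eq_pow_sum, mul_comm]
    refine congrArg _ (congrArg _ (congrArg _ (funext fun j => ?_)))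
    rw [← hG]
    congr 1
    funext i
    exact (Word.proj_combine w v j i).symm
  rw [hmid, hN]
  refine shSum_relabel (fun p : Σ j, {l // π l = j} => (p.2 : L))
    (Equiv.sigmaFiberEquiv π).bijective R r (fun _ _ => Iff.rfl) q' q (fun _ => rfl) _ _ _ ?_
  intro θ' θ h
  refine congrArg _ (funext fun j => congrArg _ (funext fun l => ?_))
  exact eq_of_heq (h ⟨j, l⟩)

end ShuffleSums

/-! ### Associativity of composites of shuffle maps -/

section Chains

variable {k : Type u} [CommRing k]

/-- `shSum_relabel`, for words of the maximal length. -/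
theorem shSum_relabel_total {L L' : Type} [Fintype L] [DecidableEq L] [Fintype L'] [DecidableEq L']
    {Z : SimplicialObject (ModuleCat.{u} k)} (e : L' → L)
    (he : Function.Bijective e) (r' : L' → L' → Prop) (r : L → L → Prop)
    (hr : ∀ a b, r' a b ↔ r (e a) (e b)) (q' : L' → ℕ) (q : L → ℕ) (hq : ∀ l, q' l = q (e l))
    (F' : ∀ N, (∀ l, ⦋N⦌ ⟶ ⦋q' l⦌) → Z _⦋N⦌) (F : ∀ N, (∀ l, ⦋N⦌ ⟶ ⦋q l⦌) → Z _⦋N⦌)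
    (hF : ∀ N θ' θ, (∀ l, HEq (θ' l) (θ (e l))) → F' N θ' = F N θ) :
    shSum r' q' (∑ l, q' l) (F' _) = shSum r q (∑ l, q l) (F _) := by
  have hN : ∑ l, q' l = ∑ l, q l := by
    rw [← he.sum_comp]
    exact Finset.sum_congr rfl fun l _ => hq l
  rw [← hN]
  exact shSum_relabel e he r' r hr q' q hq _ _ _ (hF _)

/-- The class of an element, as a sum over words in one letter. -/
theorem cls_eq_shSum (Z : SimplicialObject (ModuleCat.{u} k)) (d : ℕ) (z : Z _⦋d⦌) :
    cls Z d z = shSum (fun _ _ : Unit => False) (fun _ => d) (∑ _ : Unit, d)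
      fun θ => (Z.map (θ ()).op).hom z := by
  have key : ∀ N, d = N → cls Z d z = shSum (fun _ _ : Unit => False) (fun _ => d) N
      fun θ => (Z.map (θ ()).op).hom z := by
    rintro N rfl
    symm
    refine shSum_single () _ (fun _ h => h) _ _ rfl (fun l hl => absurd rfl hl) _ _ fun θ hθ => ?_
    have : θ () = 𝟙 _ :=
      SimplexCategory.Hom.ext _ _ (OrderHom.ext _ _ (funext fun s => Fin.ext (hθ s)))
    rw [this, op_id, Z.map_id]
    rfl
  exact key _ (by simp)

/-- The words of `cls_eq_shSum`, in any alphabet of one letter. -/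
theorem cls_eq_shSum_of_unique {L : Type} [Fintype L] [DecidableEq L] (l₀ : L)
    (hl : ∀ l, l = l₀) (r : L → L → Prop) (hr : ¬ r l₀ l₀) (q : L → ℕ)
    (Z : SimplicialObject (ModuleCat.{u} k)) (z : Z _⦋q l₀⦌) :
    cls Z (q l₀) z = shSum r q (∑ l, q l) fun θ => (Z.map (θ l₀).op).hom z := by
  rw [cls_eq_shSum]
  refine shSum_relabel_total (fun _ : Unit => l₀) ⟨fun _ _ _ => rfl, fun l => ⟨(), (hl l).symm⟩⟩ _ r
    (fun _ _ => ⟨False.elim, hr⟩) (fun _ => q l₀) q (fun _ => rfl)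
    (fun N θ => (Z.map (θ ()).op).hom z) (fun N θ => (Z.map (θ l₀).op).hom z) ?_
  intro N θ' θ h
  rw [eq_of_heq (h ())]

variable {n : ℕ} {X : SimplicialObject (ModuleCat.{u} k)}
    {Y : Fin n → SimplicialObject (ModuleCat.{u} k)} {Z : SimplicialObject (ModuleCat.{u} k)}
    (f : SMultimap (Fin.cons (α := fun _ => SimplicialObject (ModuleCat.{u} k)) X Y) Z)

theorem level_naturality {p q : ℕ} (θ : ⦋q⦌ ⟶ ⦋p⦌) (x : X _⦋p⦌) (y : ∀ i, (Y i) _⦋p⦌) :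
    f.level q ((X.map θ.op).hom x) (fun i => ((Y i).map θ.op).hom (y i)) =
      (Z.map θ.op).hom (f.level p x y) := by
  refine Eq.trans (congrArg (f.app q) (funext fun i => ?_)) (f.naturality θ _)
  induction i using Fin.cases <;> rfl

/-- `SMultimap.chains` on generators, as a sum over words; the letter `0` stands for the first
argument. -/
theorem chains_cls (a : ℕ) (x : X _⦋a⦌) (b : Fin n → ℕ) (y : ∀ i, (Y i) _⦋b i⦌) :
    f.chains (cls X a x) (fun i => cls (Y i) (b i) (y i)) =
      shSum (· < ·) (Fin.cons (α := fun _ => ℕ) a b)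
        (∑ i, (Fin.cons (α := fun _ => ℕ) a b : Fin (n + 1) → ℕ) i)
        fun θ => f.level _ ((X.map (θ 0).op).hom x)
          fun i => ((Y i).map (θ i.succ).op).hom (y i) := by
  have h := shuffleMap_cls f (Fin.cons (α := fun _ => ℕ) a b) fun i =>
    Fin.cases (motive := fun i => (Fin.cons (α := fun _ => SimplicialObject (ModuleCat.{u} k)) X Y i)
      _⦋(Fin.cons (α := fun _ => ℕ) a b : Fin (n + 1) → ℕ) i⦌) x y i
  refine Eq.trans ?_ (h.trans ?_)
  · refine congrArg (shuffleMap f) (funext fun i => ?_)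
    induction i using Fin.cases <;> rfl
  · refine congrArg (shSum _ _ _) (funext fun θ => congrArg (f.app _) (funext fun i => ?_))
    induction i using Fin.cases <;> rfl

/-- `shuffleMap_nest`, for a distinguished first argument. -/
theorem chains_nest {L : Type} [Fintype L] [DecidableEq L] (π : L → Fin (n + 1))
    (r : L → L → Prop) (hr : ∀ a b, π a ≠ π b → (r a b ↔ π a < π b)) (q : L → ℕ)
    (G₀ : ∀ N, (∀ l : {l // π l = 0}, ⦋N⦌ ⟶ ⦋q l⦌) → X _⦋N⦌)
    (hG₀ : ∀ {N N' : ℕ} (φ : ⦋N'⦌ ⟶ ⦋N⦌) (θ : ∀ l : {l // π l = 0}, ⦋N⦌ ⟶ ⦋q l⦌),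
      G₀ N' (fun l => φ ≫ θ l) = (X.map φ.op).hom (G₀ N θ))
    (G₁ : ∀ s N, (∀ l : {l // π l = Fin.succ s}, ⦋N⦌ ⟶ ⦋q l⦌) → (Y s) _⦋N⦌)
    (hG₁ : ∀ s {N N' : ℕ} (φ : ⦋N'⦌ ⟶ ⦋N⦌) (θ : ∀ l : {l // π l = Fin.succ s}, ⦋N⦌ ⟶ ⦋q l⦌),
      G₁ s N' (fun l => φ ≫ θ l) = ((Y s).map φ.op).hom (G₁ s N θ))
    (ξ : Tot (normalized X)) (η : ∀ s, Tot (normalized (Y s)))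
    (hξ : ξ = shSum (fun a b : {l // π l = 0} => r a b) (fun l => q l)
      (∑ l : {l // π l = 0}, q l) (G₀ _))
    (hη : ∀ s, η s = shSum (fun a b : {l // π l = Fin.succ s} => r a b) (fun l => q l)
      (∑ l : {l // π l = Fin.succ s}, q l) (G₁ s _)) :
    f.chains ξ η =
      shSum r q (∑ l, q l) fun θ => f.level _ (G₀ _ fun l => θ l) fun s => G₁ s _ fun l => θ l := by
  refine Eq.trans (b := shuffleMap f (fun i => Fin.cases (motive := fun i => Tot (normalized
    (Fin.cons (α := fun _ => SimplicialObject (ModuleCat.{u} k)) X Y i))) ξ η i)) ?_ ?_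
  · refine congrArg (shuffleMap f) (funext fun i => ?_)
    induction i using Fin.cases <;> rfl
  refine (shuffleMap_nest f π r hr q (fun i => Fin.cases (motive := fun i => ∀ N,
    (∀ l : {l // π l = i}, ⦋N⦌ ⟶ ⦋q l⦌) → (Fin.cons
      (α := fun _ => SimplicialObject (ModuleCat.{u} k)) X Y i) _⦋N⦌) G₀ G₁ i) ?_ _ ?_).trans ?_
  · intro i
    induction i using Fin.cases with
    | zero => exact hG₀
    | succ s => exact hG₁ s
  · intro i
    induction i using Fin.cases with
    | zero => exact hξ
    | succ s => exact hη s
  · refine congrArg (shSum _ _ _) (funext fun θ => congrArg (f.app _) (funext fun i => ?_))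
    induction i using Fin.cases <;> rfl

/-- Compatibility with maps of simplicial modules passes to normalized complexes. -/
theorem chains_naturality {X' Z' : SimplicialObject (ModuleCat.{u} k)}
    {Y' : Fin n → SimplicialObject (ModuleCat.{u} k)}
    (f' : SMultimap (Fin.cons (α := fun _ => SimplicialObject (ModuleCat.{u} k)) X' Y') Z')
    (α : X ⟶ X') (β : ∀ i, Y i ⟶ Y' i) (c : Z ⟶ Z')
    (h : ∀ p x y, f'.level p ((α.app (op ⦋p⦌)).hom x) (fun i => ((β i).app (op ⦋p⦌)).hom (y i)) =
      (c.app (op ⦋p⦌)).hom (f.level p x y))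
    (x : Tot (normalized X)) (y : ∀ i, Tot (normalized (Y i))) :
    f'.chains (Tot.map (normalizedMap α) x) (fun i => Tot.map (normalizedMap (β i)) (y i)) =
      Tot.map (normalizedMap c) (f.chains x y) := by
  have hx : x ∈ Submodule.span k {x | ∃ N z, x = cls X N z} := by rw [cls_span]; trivial
  induction hx using Submodule.span_induction with
  | zero => simp
  | add x x' _ _ hx hx' =>
    simp only [map_add, _root_.add_apply]
    rw [hx, hx']
  | smul t x _ hx =>
    simp only [map_smul, _root_.smul_apply]
    rw [hx]
  | mem x hx =>
    obtain ⟨a, x, rfl⟩ := hx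
    refine IsMultilin.ext_span (k := k)
      ((IsMultilin.of_multilinear (f'.chains _)).comp_linear fun i => Tot.map (normalizedMap (β i)))
      ((IsMultilin.of_multilinear (f.chains _)).linear_comp _)
      (fun i => {x | ∃ N z, x = cls (Y i) N z}) (fun i => cls_span _) ?_ y
    intro y hy
    choose b y' hy' using hy
    obtain rfl : y = _ := funext hy'
    simp only [map_cls]
    rw [chains_cls, chains_cls, map_shSum]
    refine congrArg (shSum _ _ _) (funext fun θ => ?_)
    rw [← h]
    have hn : ∀ {X X' : SimplicialObject (ModuleCat.{u} k)} (α : X ⟶ X') {p q : ℕ}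
        (θ : ⦋q⦌ ⟶ ⦋p⦌) (x : X _⦋p⦌), (X'.map θ.op).hom ((α.app (op ⦋p⦌)).hom x) =
          (α.app (op ⦋q⦌)).hom ((X.map θ.op).hom x) := by
      intro X X' α p q θ x
      exact (congrArg (fun g => g.hom x) (α.naturality θ.op)).symm
    exact congrArg₂ (fun u v => f'.level _ u v) (hn α (θ 0) x)
      (funext fun i => hn (β i) (θ i.succ) (y' i))

/-- The letters of the composites in the associativity axiom: one for the outer operation, one for
each inner operation, and one for each argument. -/
abbrev AssocLetter {n : ℕ} (j : Fin n → ℕ) : Type := Option (Σ s : Fin n, Option (Fin (j s)))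

namespace AssocLetter

variable {n : ℕ} {j : Fin n → ℕ}

/-- The number of occurrences of each letter. -/
def deg (a : ℕ) (b : Fin n → ℕ) (c : ∀ s, Fin (j s) → ℕ) (l : AssocLetter j) : ℕ :=
  match l with
  | none => a
  | some ⟨s, none⟩ => b s
  | some ⟨s, some t⟩ => c s t

/-- The place of a letter in the order `x, y_0, y_1, …, z_{0,0}, z_{0,1}, …`. -/
def keyL (l : AssocLetter j) : ℕ :=
  match l with
  | none => 0
  | some ⟨s, none⟩ => s + 1
  | some ⟨s, some t⟩ => n + 1 + finSigmaFinEquiv (n := j) ⟨s, t⟩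

/-- The factor that contains a letter, for the order of `keyL`. -/
def factorL (l : AssocLetter j) : Fin (∑ s, j s + 1) :=
  match l with
  | none => 0
  | some ⟨_, none⟩ => 0
  | some ⟨s, some t⟩ => (finSigmaFinEquiv (n := j) ⟨s, t⟩).succ

/-- The place of a letter in the order `x, y_0, z_{0,0}, z_{0,1}, …, y_1, …`. -/
def keyR (l : AssocLetter j) : ℕ ×ₗ ℕ :=
  match l with
  | none => toLex (0, 0)
  | some ⟨s, none⟩ => toLex (s + 1, 0)
  | some ⟨s, some t⟩ => toLex (s + 1, t + 1)

/-- The factor that contains a letter, for the order of `keyR`. -/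
def factorR (l : AssocLetter j) : Fin (n + 1) :=
  match l with
  | none => 0
  | some ⟨s, _⟩ => s.succ

theorem keyL_injective : Function.Injective (keyL (j := j)) := by
  rintro (_ | ⟨s, _ | t⟩) (_ | ⟨s', _ | t'⟩) h <;> simp only [keyL] at h
  · rfl
  · omega
  · omega
  · omega
  · obtain rfl : s = s' := Fin.ext (by omega)
    rfl
  · omega
  · omega
  · omega
  · have h2 : (finSigmaFinEquiv (n := j) ⟨s, t⟩) = finSigmaFinEquiv (n := j) ⟨s', t'⟩ :=
      Fin.ext (by omega)
    have h3 := finSigmaFinEquiv.injective h2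
    obtain ⟨rfl, h4⟩ := Sigma.mk.inj_iff.mp h3
    rw [eq_of_heq h4]

theorem keyR_injective : Function.Injective (keyR (j := j)) := by
  rintro (_ | ⟨s, _ | t⟩) (_ | ⟨s', _ | t'⟩) h <;>
    simp only [keyR, toLex_inj, Prod.mk.injEq] at h <;> try omega
  · rfl
  · obtain rfl : s = s' := Fin.ext (by omega)
    rfl
  · obtain rfl : s = s' := Fin.ext (by omega)
    obtain rfl : t = t' := Fin.ext (by omega)
    rfl

theorem keyL_lt_iff (l l' : AssocLetter j) (h : factorL l ≠ factorL l') :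
    keyL l < keyL l' ↔ factorL l < factorL l' := by
  rcases l with (_ | ⟨s, _ | t⟩) <;> rcases l' with (_ | ⟨s', _ | t'⟩) <;>
    simp only [keyL, factorL, ne_eq, not_true_eq_false, Fin.lt_def, Fin.val_succ, Fin.val_zero]
      at h ⊢ <;> omega

theorem keyR_lt_iff (l l' : AssocLetter j) (h : factorR l ≠ factorR l') :
    keyR l < keyR l' ↔ factorR l < factorR l' := by
  rcases l with (_ | ⟨s, _ | t⟩) <;> rcases l' with (_ | ⟨s', _ | t'⟩) <;>
    simp only [keyR, factorR, ne_eq, not_true_eq_false, Fin.lt_def, Fin.val_succ, Fin.val_zero,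
      Prod.Lex.toLex_lt_toLex, Fin.ext_iff] at h ⊢ <;> omega

/-- The change from the order of `keyL` to that of `keyR` is the Koszul shuffle. -/
theorem sum_keyL_keyR (a : ℕ) (b : Fin n → ℕ) (c : ∀ s, Fin (j s) → ℕ) :
    ∑ p : AssocLetter j × AssocLetter j with keyL p.1 < keyL p.2 ∧ keyR p.2 < keyR p.1,
      deg a b c p.1 * deg a b c p.2 = koszulShuffle b c := by
  unfold koszulShuffle
  simp only [Finset.mul_sum]
  rw [Finset.sum_sigma']
  symm
  refine Finset.sum_bij (fun p _ => (some ⟨p.1.2, none⟩, some ⟨p.1.1, some p.2⟩)) ?_ ?_ ?_ ?_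
  · rintro ⟨⟨s, s'⟩, t⟩ h
    simp only [Finset.mem_sigma, Finset.mem_filter, Finset.mem_univ, true_and, and_true,
      Fin.lt_def] at h
    refine Finset.mem_filter.mpr ⟨Finset.mem_univ _, ?_⟩
    simp only [keyL, keyR, Prod.Lex.toLex_lt_toLex]
    omega
  · rintro ⟨⟨s, s'⟩, t⟩ _ ⟨⟨s₁, s₁'⟩, t₁⟩ _ h
    simp only [Prod.mk.injEq, Option.some.injEq, Sigma.mk.injEq] at h
    obtain ⟨⟨rfl, -⟩, rfl, h⟩ := h
    simp only [heq_eq_eq, Option.some.injEq] at h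
    rw [h]
  · rintro ⟨(_ | ⟨s, _ | t⟩), (_ | ⟨s', _ | t'⟩)⟩ h <;>
      replace h := (Finset.mem_filter.mp h).2 <;>
      simp only [keyL, keyR, Prod.Lex.toLex_lt_toLex] at h <;>
      try (exfalso; omega)
    · refine ⟨⟨(s', s), t'⟩, ?_, rfl⟩
      simp only [Finset.mem_sigma, Finset.mem_filter, Finset.mem_univ, true_and, and_true,
        Fin.lt_def]
      omega
    · exfalso
      have h1 : finSigmaFinEquiv (n := j) ⟨s, t⟩ < finSigmaFinEquiv (n := j) ⟨s', t'⟩ := by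
        rw [Fin.lt_def]
        omega
      rw [sigmaFin_lt_iff] at h1
      simp only [Fin.lt_def] at h1
      omega
  · rintro ⟨⟨s, s'⟩, t⟩ _
    rfl

end AssocLetter

/-- `chains_cls`, for words in an alphabet `L` with `n + 1` letters. -/
theorem chains_cls_letters {n : ℕ} {X : SimplicialObject (ModuleCat.{u} k)}
    {Y : Fin n → SimplicialObject (ModuleCat.{u} k)} {Z : SimplicialObject (ModuleCat.{u} k)}
    (f : SMultimap (Fin.cons (α := fun _ => SimplicialObject (ModuleCat.{u} k)) X Y) Z)
    {L : Type} [Fintype L] [DecidableEq L] (e : Fin (n + 1) → L) (he : Function.Bijective e)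
    (r : L → L → Prop) (hr : ∀ a b, a < b ↔ r (e a) (e b)) (q : L → ℕ)
    (x : X _⦋q (e 0)⦌) (y : ∀ i : Fin n, (Y i) _⦋q (e i.succ)⦌) :
    f.chains (cls X (q (e 0)) x) (fun i => cls (Y i) (q (e i.succ)) (y i)) =
      shSum r q (∑ l, q l) fun θ => f.level _ ((X.map (θ (e 0)).op).hom x)
          fun i => ((Y i).map (θ (e i.succ)).op).hom (y i) := by
  let q' : Fin (n + 1) → ℕ := Fin.cons (α := fun _ => ℕ) (q (e 0)) fun i => q (e i.succ)
  let F' : ∀ N, (∀ l, ⦋N⦌ ⟶ ⦋q' l⦌) → Z _⦋N⦌ := fun N θ => f.level N ((X.map (θ 0).op).hom x)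
    fun i => ((Y i).map (θ i.succ).op).hom (y i)
  let F : ∀ N, (∀ l, ⦋N⦌ ⟶ ⦋q l⦌) → Z _⦋N⦌ := fun N θ => f.level N
      ((X.map (θ (e 0)).op).hom x) fun i => ((Y i).map (θ (e i.succ)).op).hom (y i)
  refine (chains_cls f _ x _ y).trans (shSum_relabel_total e he (· < ·) r hr q' q ?_ F' F ?_)
  · intro l
    induction l using Fin.cases <;> rfl
  · intro N θ' θ h
    have h0 : θ' 0 = θ (e 0) := eq_of_heq (h 0)
    have h1 : ∀ s : Fin n, θ' s.succ = θ (e s.succ) := fun s => eq_of_heq (h s.succ)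
    exact congrArg₂ (fun u v => f.level N u v)
      (congrArg (fun θ : ⦋N⦌ ⟶ ⦋q (e 0)⦌ => (X.map θ.op).hom x) h0)
      (funext fun s => congrArg (fun θ : ⦋N⦌ ⟶ ⦋q (e s.succ)⦌ => ((Y s).map θ.op).hom (y s)) (h1 s))

theorem level_map_comp {n : ℕ} {X : SimplicialObject (ModuleCat.{u} k)}
    {Y : Fin n → SimplicialObject (ModuleCat.{u} k)} {Z : SimplicialObject (ModuleCat.{u} k)}
    (f : SMultimap (Fin.cons (α := fun _ => SimplicialObject (ModuleCat.{u} k)) X Y) Z)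
    {N N' a : ℕ} {b : Fin n → ℕ} (φ : ⦋N'⦌ ⟶ ⦋N⦌) (θ : ⦋N⦌ ⟶ ⦋a⦌) (θ' : ∀ i, ⦋N⦌ ⟶ ⦋b i⦌)
    (x : X _⦋a⦌) (y : ∀ i, (Y i) _⦋b i⦌) :
    f.level N' ((X.map (φ ≫ θ).op).hom x) (fun i => ((Y i).map (φ ≫ θ' i).op).hom (y i)) =
      (Z.map φ.op).hom (f.level N ((X.map θ.op).hom x) fun i => ((Y i).map (θ' i).op).hom (y i)) :=
  (congrArg₂ (fun u v => f.level N' u v) (map_map_apply X φ θ x).symm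
    (funext fun i => (map_map_apply (Y i) φ (θ' i) (y i)).symm)).trans (level_naturality f φ _ _)

namespace AssocLetter

variable {n : ℕ} {j : Fin n → ℕ}

/-- The letters of the first factor, for the order of `keyL`. -/
def headL (j : Fin n → ℕ) : Fin (n + 1) → {l : AssocLetter j // factorL l = 0} :=
  Fin.cases ⟨none, rfl⟩ fun s => ⟨some ⟨s, none⟩, rfl⟩

theorem headL_bijective : Function.Bijective (headL j) := by
  constructor
  · intro s s' h
    replace h := congrArg Subtype.val h
    induction s using Fin.cases <;> induction s' using Fin.cases
    · rfl
    · simp [headL] at h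
    · simp [headL] at h
    · simp only [headL, Fin.cases_succ, Option.some.injEq, Sigma.mk.injEq] at h
      rw [h.1]
  · rintro ⟨_ | ⟨s, _ | t⟩, h⟩
    · exact ⟨0, rfl⟩
    · exact ⟨s.succ, rfl⟩
    · exact absurd h (Fin.succ_ne_zero _)

theorem headL_lt_iff (a b : Fin (n + 1)) : a < b ↔ keyL (headL j a).1 < keyL (headL j b).1 := by
  induction a using Fin.cases <;> induction b using Fin.cases <;> simp [headL, keyL]

/-- The letter of a later factor, for the order of `keyL`. -/
def tailL (r : Fin (∑ s, j s)) : {l : AssocLetter j // factorL l = r.succ} :=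
  ⟨some ⟨(finSigmaFinEquiv.symm r).1, some (finSigmaFinEquiv.symm r).2⟩,
    congrArg Fin.succ (finSigmaFinEquiv.apply_symm_apply r)⟩

theorem eq_tailL (r : Fin (∑ s, j s)) (l : {l : AssocLetter j // factorL l = r.succ}) :
    l = tailL r := by
  obtain ⟨_ | ⟨s, _ | t⟩, h⟩ := l
  · exact absurd h.symm (Fin.succ_ne_zero _)
  · exact absurd h.symm (Fin.succ_ne_zero _)
  · obtain rfl : (finSigmaFinEquiv (n := j) ⟨s, t⟩) = r := Fin.succ_injective _ h
    refine Subtype.ext (congrArg some ?_)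
    have := finSigmaFinEquiv.symm_apply_apply (⟨s, t⟩ : (s : Fin n) × Fin (j s))
    exact congrArg (fun p : (s : Fin n) × Fin (j s) => (⟨p.1, some p.2⟩ :
      Σ s : Fin n, Option (Fin (j s)))) this.symm

theorem eq_headR (l : {l : AssocLetter j // factorR l = 0}) : l = ⟨none, rfl⟩ := by
  obtain ⟨_ | ⟨s, t⟩, h⟩ := l
  · rfl
  · exact absurd h (Fin.succ_ne_zero _)

/-- The letters of a later factor, for the order of `keyR`. -/
def tailR (s : Fin n) : Fin (j s + 1) → {l : AssocLetter j // factorR l = s.succ} :=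
  Fin.cases ⟨some ⟨s, none⟩, rfl⟩ fun t => ⟨some ⟨s, some t⟩, rfl⟩

theorem tailR_bijective (s : Fin n) : Function.Bijective (tailR (j := j) s) := by
  constructor
  · intro t t' h
    replace h := congrArg Subtype.val h
    induction t using Fin.cases <;> induction t' using Fin.cases
    · rfl
    · simp [tailR] at h
    · simp [tailR] at h
    · simpa [tailR] using h
  · rintro ⟨_ | ⟨s', _ | t⟩, h⟩
    · exact absurd h.symm (Fin.succ_ne_zero _)
    · obtain rfl : s' = s := Fin.succ_injective _ h
      exact ⟨0, rfl⟩
    · obtain rfl : s' = s := Fin.succ_injective _ h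
      exact ⟨t.succ, rfl⟩

theorem tailR_lt_iff (s : Fin n) (a b : Fin (j s + 1)) :
    a < b ↔ keyR (tailR s a).1 < keyR (tailR s b).1 := by
  induction a using Fin.cases <;> induction b using Fin.cases <;>
    simp [tailR, keyR, Prod.Lex.toLex_lt_toLex]

end AssocLetter

section Assoc

variable {n : ℕ} {j : Fin n → ℕ} {X A Z Z' : SimplicialObject (ModuleCat.{u} k)}
    {Y B : Fin n → SimplicialObject (ModuleCat.{u} k)}
    {W : ∀ s, Fin (j s) → SimplicialObject (ModuleCat.{u} k)}
    (q : AssocLetter j → ℕ)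
    (x : X _⦋q none⦌) (y : ∀ s, (Y s) _⦋q (some ⟨s, none⟩)⦌)
    (w : ∀ s t, (W s t) _⦋q (some ⟨s, some t⟩)⦌)

/-- The composite `γ(γ(x; y); w)`, as a sum over words in all letters, in the order of `keyL`. -/
theorem chains_assoc_left
    (f₁ : SMultimap (Fin.cons (α := fun _ => SimplicialObject (ModuleCat.{u} k)) X Y) A)
    (f₂ : SMultimap (Fin.cons (α := fun _ => SimplicialObject (ModuleCat.{u} k)) A
      fun r : Fin (∑ s, j s) => W (finSigmaFinEquiv.symm r).1 (finSigmaFinEquiv.symm r).2) Z') :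
    f₂.chains (f₁.chains (cls X _ x) fun s => cls (Y s) _ (y s))
      (fun r => cls _ _ (w (finSigmaFinEquiv.symm r).1 (finSigmaFinEquiv.symm r).2)) =
    shSum (fun l l' => AssocLetter.keyL l < AssocLetter.keyL l') q (∑ l, q l) fun θ =>
      f₂.level _ (f₁.level _ ((X.map (θ none).op).hom x)
        fun s => ((Y s).map (θ (some ⟨s, none⟩)).op).hom (y s))
        fun r => ((W (finSigmaFinEquiv.symm r).1 (finSigmaFinEquiv.symm r).2).map
          (θ (some ⟨(finSigmaFinEquiv.symm r).1, some (finSigmaFinEquiv.symm r).2⟩)).op).hom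
            (w (finSigmaFinEquiv.symm r).1 (finSigmaFinEquiv.symm r).2) := by
  refine chains_nest f₂ (AssocLetter.factorL (j := j))
      (fun l l' => AssocLetter.keyL l < AssocLetter.keyL l') AssocLetter.keyL_lt_iff q
      (fun N θ => f₁.level N ((X.map (θ (AssocLetter.headL j 0)).op).hom x)
        fun s => ((Y s).map (θ (AssocLetter.headL j s.succ)).op).hom (y s))
      (fun {N N'} φ θ => level_map_comp f₁ φ _ _ x y)
      (fun r N θ => ((W (finSigmaFinEquiv.symm r).1 (finSigmaFinEquiv.symm r).2).map
        (θ (AssocLetter.tailL r)).op).hom (w (finSigmaFinEquiv.symm r).1 (finSigmaFinEquiv.symm r).2))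
      (fun r {N N'} φ θ => (map_map_apply _ _ _ _).symm) _ _ ?_ ?_
  · exact chains_cls_letters f₁ (AssocLetter.headL j) AssocLetter.headL_bijective
      (fun a b => AssocLetter.keyL a.1 < AssocLetter.keyL b.1) AssocLetter.headL_lt_iff
      (fun l => q l) x y
  · intro r
    exact cls_eq_shSum_of_unique (AssocLetter.tailL r) (AssocLetter.eq_tailL r)
      (fun a b => AssocLetter.keyL a.1 < AssocLetter.keyL b.1) (lt_irrefl _) (fun l => q l) _ _

/-- The composite `γ(x; γ(y; w))`, as a sum over words in all letters, in the order of `keyR`. -/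
theorem chains_assoc_right
    (g : ∀ s, SMultimap (Fin.cons (α := fun _ => SimplicialObject (ModuleCat.{u} k)) (Y s) (W s))
      (B s))
    (f₃ : SMultimap (Fin.cons (α := fun _ => SimplicialObject (ModuleCat.{u} k)) X B) Z) :
    f₃.chains (cls X _ x) (fun s => (g s).chains (cls (Y s) _ (y s))
        fun t => cls (W s t) _ (w s t)) =
    shSum (fun l l' => AssocLetter.keyR l < AssocLetter.keyR l') q (∑ l, q l) fun θ =>
      f₃.level _ ((X.map (θ none).op).hom x) fun s => (g s).level _
        (((Y s).map (θ (some ⟨s, none⟩)).op).hom (y s))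
        fun t => ((W s t).map (θ (some ⟨s, some t⟩)).op).hom (w s t) := by
  refine chains_nest f₃ (AssocLetter.factorR (j := j))
      (fun l l' => AssocLetter.keyR l < AssocLetter.keyR l') AssocLetter.keyR_lt_iff q
      (fun N θ => (X.map (θ ⟨none, rfl⟩).op).hom x)
      (fun {N N'} φ θ => (map_map_apply _ _ _ _).symm)
      (fun s N θ => (g s).level N (((Y s).map (θ (AssocLetter.tailR s 0)).op).hom (y s))
        fun t => ((W s t).map (θ (AssocLetter.tailR s t.succ)).op).hom (w s t))
      (fun s {N N'} φ θ => level_map_comp (g s) φ _ _ (y s) (w s)) _ _ ?_ ?_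
  · exact cls_eq_shSum_of_unique (⟨none, rfl⟩ : {l : AssocLetter j // AssocLetter.factorR l = 0})
      AssocLetter.eq_headR
      (fun a b => AssocLetter.keyR a.1 < AssocLetter.keyR b.1) (lt_irrefl _) (fun l => q l) _ _
  · intro s
    exact chains_cls_letters (g s) (AssocLetter.tailR s) (AssocLetter.tailR_bijective s)
      (fun a b => AssocLetter.keyR a.1 < AssocLetter.keyR b.1) (AssocLetter.tailR_lt_iff s)
      (fun l => q l) (y s) (w s)

end Assoc

/-- Associativity in each degree passes to normalized complexes: there the letters of the words
come in two different orders, whence the Koszul sign. -/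
theorem chains_assoc {n : ℕ} {j : Fin n → ℕ} {X A Z Z' : SimplicialObject (ModuleCat.{u} k)}
    {Y B : Fin n → SimplicialObject (ModuleCat.{u} k)}
    {W : ∀ s, Fin (j s) → SimplicialObject (ModuleCat.{u} k)}
    (f₁ : SMultimap (Fin.cons (α := fun _ => SimplicialObject (ModuleCat.{u} k)) X Y) A)
    (f₂ : SMultimap (Fin.cons (α := fun _ => SimplicialObject (ModuleCat.{u} k)) A
      fun r : Fin (∑ s, j s) => W (finSigmaFinEquiv.symm r).1 (finSigmaFinEquiv.symm r).2) Z')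
    (g : ∀ s, SMultimap (Fin.cons (α := fun _ => SimplicialObject (ModuleCat.{u} k)) (Y s) (W s))
      (B s))
    (f₃ : SMultimap (Fin.cons (α := fun _ => SimplicialObject (ModuleCat.{u} k)) X B) Z)
    (e : Z' ⟶ Z)
    (h : ∀ p x (y : ∀ s, (Y s) _⦋p⦌) (w : ∀ s t, (W s t) _⦋p⦌),
      (e.app (op ⦋p⦌)).hom (f₂.level p (f₁.level p x y)
        fun r => w (finSigmaFinEquiv.symm r).1 (finSigmaFinEquiv.symm r).2) =
      f₃.level p x fun s => (g s).level p (y s) (w s))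
    (x : Tot (normalized X)) (b : Fin n → ℕ) (y : ∀ s, (Y s) _⦋b s⦌) (c : ∀ s, Fin (j s) → ℕ)
    (w : ∀ s t, (W s t) _⦋c s t⦌) :
    Tot.map (normalizedMap e) (f₂.chains (f₁.chains x fun s => cls (Y s) (b s) (y s))
      fun r => cls _ (c (finSigmaFinEquiv.symm r).1 (finSigmaFinEquiv.symm r).2)
        (w (finSigmaFinEquiv.symm r).1 (finSigmaFinEquiv.symm r).2)) =
      (-1 : ℤ) ^ koszulShuffle b c • f₃.chains x fun s => (g s).chains (cls (Y s) (b s) (y s))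
        fun t => cls (W s t) (c s t) (w s t) := by
  have hx : x ∈ Submodule.span k {x | ∃ N z, x = cls X N z} := by rw [cls_span]; trivial
  induction hx using Submodule.span_induction with
  | zero => simp
  | add x x' _ _ hx hx' =>
    simp only [map_add, _root_.add_apply]
    rw [hx, hx', smul_add]
  | smul t x _ hx =>
    simp only [map_smul, _root_.smul_apply]
    rw [hx, smul_comm]
  | mem x hx =>
    obtain ⟨a, x, rfl⟩ := hx
    refine (congrArg _ (chains_assoc_left (AssocLetter.deg a b c) x y w f₁ f₂)).trans ?_
    refine Eq.trans ?_ (congrArg _ (chains_assoc_right (AssocLetter.deg a b c) x y w g f₃)).symm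
    rw [map_shSum, shSum_change _ (fun l l' => AssocLetter.keyR l < AssocLetter.keyR l')
      (fun l l' hne => ?_) (fun l => lt_irrefl (AssocLetter.keyL l)) (fun l l' hne => ?_)
      (fun l => lt_irrefl (AssocLetter.keyR l)),
      AssocLetter.sum_keyL_keyR]
    · refine congrArg _ (congrArg (shSum _ _ _) (funext fun θ => ?_))
      exact h _ _ _ fun s t => ((W s t).map (θ (some ⟨s, some t⟩)).op).hom (w s t)
    · have := AssocLetter.keyL_injective.ne hne
      omega
    · have := AssocLetter.keyR_injective.ne hne
      exact ⟨fun h => h.asymm, fun h => lt_of_le_of_ne (not_lt.mp h) this⟩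

end Chains

/-! ### Operads and algebras on normalized complexes -/

section ChainsAxioms

variable {k : Type u} [CommRing k]

/-- A permutation of the letters `1, …, n` of `0, …, n`. -/
def liftPerm {n : ℕ} (σ : Equiv.Perm (Fin n)) : Fin (n + 1) → Fin (n + 1) :=
  Fin.cases 0 fun s => (σ s).succ

theorem liftPerm_symm {n : ℕ} (σ : Equiv.Perm (Fin n)) (a : Fin (n + 1)) :
    liftPerm σ (liftPerm σ.symm a) = a := by
  induction a using Fin.cases <;> simp [liftPerm]

theorem liftPerm_bijective {n : ℕ} (σ : Equiv.Perm (Fin n)) : Function.Bijective (liftPerm σ) :=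
  ⟨Function.LeftInverse.injective (g := liftPerm σ.symm) fun a => liftPerm_symm σ.symm a,
    fun a => ⟨_, liftPerm_symm σ a⟩⟩

/-- Equivariance in each degree passes to normalized complexes, with a Koszul sign. -/
theorem chains_reorder {n : ℕ} (σ : Equiv.Perm (Fin n)) {X Z Z' : SimplicialObject (ModuleCat.{u} k)}
    {Y : Fin n → SimplicialObject (ModuleCat.{u} k)}
    (f₁ : SMultimap (Fin.cons (α := fun _ => SimplicialObject (ModuleCat.{u} k)) X Y) Z)
    (f₂ : SMultimap (Fin.cons (α := fun _ => SimplicialObject (ModuleCat.{u} k)) X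
      fun s => Y (σ.symm s)) Z') (α : X ⟶ X) (e : Z' ⟶ Z)
    (h : ∀ p x y, f₁.level p ((α.app (op ⦋p⦌)).hom x) y =
      (e.app (op ⦋p⦌)).hom (f₂.level p x fun s => y (σ.symm s)))
    (x : Tot (normalized X)) (b : Fin n → ℕ) (y : ∀ s, (Y s) _⦋b s⦌) :
    f₁.chains (Tot.map (normalizedMap α) x) (fun s => cls (Y s) (b s) (y s)) =
      (-1 : ℤ) ^ koszul σ b • Tot.map (normalizedMap e)
        (f₂.chains x fun s => cls (Y (σ.symm s)) (b (σ.symm s)) (y (σ.symm s))) := by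
  have hx : x ∈ Submodule.span k {x | ∃ N z, x = cls X N z} := by rw [cls_span]; trivial
  induction hx using Submodule.span_induction with
  | zero => simp
  | add x x' _ _ hx hx' =>
    simp only [map_add, _root_.add_apply]
    rw [hx, hx', smul_add]
  | smul t x _ hx =>
    simp only [map_smul, _root_.smul_apply]
    rw [hx, smul_comm]
  | mem x hx =>
    obtain ⟨a, x, rfl⟩ := hx
    let q : Fin (n + 1) → ℕ := Fin.cons (α := fun _ => ℕ) a b
    have hL := chains_cls f₁ a ((α.app (op ⦋a⦌)).hom x) b y
    have hR := chains_cls_letters f₂ (liftPerm σ.symm) (liftPerm_bijective σ.symm)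
      (fun u v => liftPerm σ u < liftPerm σ v)
      (fun u v => by rw [liftPerm_symm, liftPerm_symm]) q x fun s => y (σ.symm s)
    rw [map_cls, hL]
    refine Eq.trans ?_ (congrArg (fun z => (-1 : ℤ) ^ koszul σ b • Tot.map (normalizedMap e) z)
      hR).symm
    rw [map_shSum, shSum_change (· < ·) (fun u v => liftPerm σ u < liftPerm σ v)
      (fun u v hne => ?_) (fun u => lt_irrefl u) (fun u v hne => ?_)
      (fun u => lt_irrefl (liftPerm σ u))]
    · have hk : ∑ p : Fin (n + 1) × Fin (n + 1) with p.1 < p.2 ∧ liftPerm σ p.2 < liftPerm σ p.1,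
          q p.1 * q p.2 = koszul σ b := by
        unfold koszul
        symm
        refine Finset.sum_bij (fun p _ => (p.1.succ, p.2.succ)) ?_ ?_ ?_ ?_
        · intro p hp
          refine Finset.mem_filter.mpr ⟨Finset.mem_univ _, ?_⟩
          simpa [liftPerm] using (Finset.mem_filter.mp hp).2
        · intro p _ p' _ h
          simp only [Prod.mk.injEq, Fin.succ_inj] at h
          exact Prod.ext h.1 h.2
        · rintro ⟨u, v⟩ hp
          replace hp := (Finset.mem_filter.mp hp).2
          induction u using Fin.cases <;> induction v using Fin.cases <;>
            simp [liftPerm] at hp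
          rename_i u v
          exact ⟨(u, v), Finset.mem_filter.mpr ⟨Finset.mem_univ _, hp⟩, rfl⟩
        · intro p _
          rfl
      refine Eq.trans (congrArg (fun m => (-1 : ℤ) ^ m • _) hk) ?_
      refine congrArg _ (congrArg (shSum _ _ _) (funext fun θ => ?_))
      have hn : (X.map (θ 0).op).hom ((α.app (op ⦋a⦌)).hom x) =
          (α.app (op ⦋_⦌)).hom ((X.map (θ 0).op).hom x) :=
        (congrArg (fun g => g.hom x) (α.naturality (θ 0).op)).symm
      exact (congrArg (fun u => f₁.level _ u _) hn).trans
        (h _ _ fun s => ((Y s).map (θ s.succ).op).hom (y s))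
    · omega
    · have := (liftPerm_bijective σ).1.ne hne
      omega

theorem hom_zero_eq {p : ℕ} (θ : ⦋p⦌ ⟶ ⦋0⦌) : θ = SimplexCategory.const ⦋p⦌ ⦋0⦌ 0 :=
  SimplexCategory.Hom.ext _ _ (OrderHom.ext _ _ (funext fun _ => Subsingleton.elim (α := Fin 1) _ _))

theorem hom_eq_id {p : ℕ} (θ : ⦋p⦌ ⟶ ⦋p⦌) (h : ∀ s : Fin (p + 1), (θ.toOrderHom s : ℕ) = s) :
    θ = 𝟙 _ :=
  SimplexCategory.Hom.ext _ _ (OrderHom.ext _ _ (funext fun s => Fin.ext (h s)))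

/-- The left unit law passes to normalized complexes: a unit of degree `0` contributes no letters, so
that there is only one word. -/
theorem chains_one_left {X Y Z : SimplicialObject (ModuleCat.{u} k)}
    (f : SMultimap (Fin.cons (α := fun _ => SimplicialObject (ModuleCat.{u} k)) X
      fun _ : Fin 1 => Y) Z) (o : X _⦋0⦌) (e : Z ⟶ Y)
    (h : ∀ p y, (e.app (op ⦋p⦌)).hom
      (f.level p ((X.map (SimplexCategory.const ⦋p⦌ ⦋0⦌ 0).op).hom o) fun _ => y) = y)
    (y : Tot (normalized Y)) :
    Tot.map (normalizedMap e) (f.chains (cls X 0 o) fun _ => y) = y := by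
  refine IsMultilin.ext_span (k := k) (ι := Fin 1)
    (f := fun y : Fin 1 → Tot (normalized Y) =>
      Tot.map (normalizedMap e) (f.chains (cls X 0 o) fun i => y i))
    (g := fun y => y 0) ((IsMultilin.of_multilinear (f.chains (cls X 0 o))).linear_comp _) ?_
    (fun _ => {x | ∃ N z, x = cls Y N z}) (fun _ => cls_span _) ?_ fun _ => y
  · intro x i
    obtain rfl := Subsingleton.elim 0 i
    exact ⟨LinearMap.id, fun a => by simp⟩
  · intro y hy
    obtain ⟨b, z, hz⟩ := hy 0
    obtain rfl : y = fun _ => cls Y b z := funext fun i => by rw [Subsingleton.elim i 0, hz]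
    rw [chains_cls f 0 o (fun _ => b) fun _ => z, map_shSum]
    have key : ∀ N, b = N → shSum (· < ·) (Fin.cons (α := fun _ => ℕ) 0 fun _ : Fin 1 => b) N
        (fun θ => (e.app (op ⦋N⦌)).hom (f.level N ((X.map (θ 0).op).hom o)
          fun i => (Y.map (θ i.succ).op).hom z)) = cls Y b z := by
      rintro _ rfl
      refine shSum_single (1 : Fin 2) _ (fun a => lt_irrefl a) _ _ rfl (fun l hl => ?_) _ _ ?_
      · obtain rfl : l = 0 := by omega
        rfl
      · intro θ hθ
        have h0 : θ 0 = SimplexCategory.const ⦋b⦌ ⦋0⦌ 0 := hom_zero_eq (θ 0)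
        have h1 : θ 1 = 𝟙 ⦋b⦌ := hom_eq_id (θ 1) hθ
        have h2 : (fun i : Fin 1 => (Y.map (θ i.succ).op).hom z) = fun _ => z := funext fun i => by
          obtain rfl := Subsingleton.elim 0 i
          refine (congrArg (fun θ : ⦋b⦌ ⟶ ⦋b⦌ => (Y.map θ.op).hom z) h1).trans ?_
          simp
        refine Eq.trans ?_ (h b z)
        exact congrArg (e.app (op ⦋b⦌)).hom (congrArg₂ (fun u v => f.level b u v)
          (congrArg (fun θ : ⦋b⦌ ⟶ ⦋0⦌ => (X.map θ.op).hom o) h0) h2)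
    exact key _ (by simp [Fin.sum_univ_succ])

/-- The right unit law passes to normalized complexes. -/
theorem chains_one_right {n : ℕ} {X Y Z : SimplicialObject (ModuleCat.{u} k)}
    (f : SMultimap (Fin.cons (α := fun _ => SimplicialObject (ModuleCat.{u} k)) X
      fun _ : Fin n => Y) Z) (o : Y _⦋0⦌) (e : Z ⟶ X)
    (h : ∀ p x, (e.app (op ⦋p⦌)).hom
      (f.level p x fun _ => (Y.map (SimplexCategory.const ⦋p⦌ ⦋0⦌ 0).op).hom o) = x)
    (x : Tot (normalized X)) :
    Tot.map (normalizedMap e) (f.chains x fun _ => cls Y 0 o) = x := by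
  have hx : x ∈ Submodule.span k {x | ∃ N z, x = cls X N z} := by rw [cls_span]; trivial
  induction hx using Submodule.span_induction with
  | zero => simp
  | add x x' _ _ hx hx' =>
    simp only [map_add, _root_.add_apply]
    rw [hx, hx']
  | smul t x _ hx =>
    simp only [map_smul, _root_.smul_apply]
    rw [hx]
  | mem x hx =>
    obtain ⟨a, x, rfl⟩ := hx
    rw [chains_cls f a x (fun _ => 0) fun _ => o, map_shSum]
    have key : ∀ N, a = N → shSum (· < ·) (Fin.cons (α := fun _ => ℕ) a fun _ : Fin n => 0) N
        (fun θ => (e.app (op ⦋N⦌)).hom (f.level N ((X.map (θ 0).op).hom x)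
          fun i => (Y.map (θ i.succ).op).hom o)) = cls X a x := by
      rintro _ rfl
      refine shSum_single (0 : Fin (n + 1)) _ (fun a => lt_irrefl a) _ _ rfl (fun l hl => ?_) _ _ ?_
      · induction l using Fin.cases with
        | zero => exact absurd rfl hl
        | succ i => rfl
      · intro θ hθ
        have h1 : θ 0 = 𝟙 ⦋a⦌ := hom_eq_id (θ 0) hθ
        have h0 : (fun i : Fin n => (Y.map (θ i.succ).op).hom o) =
            fun _ => (Y.map (SimplexCategory.const ⦋a⦌ ⦋0⦌ 0).op).hom o := funext fun i =>
          congrArg (fun θ : ⦋a⦌ ⟶ ⦋0⦌ => (Y.map θ.op).hom o) (hom_zero_eq (θ i.succ))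
        have h2 : (X.map (θ 0).op).hom x = x := by
          refine (congrArg (fun θ : ⦋a⦌ ⟶ ⦋a⦌ => (X.map θ.op).hom x) h1).trans ?_
          simp
        refine Eq.trans ?_ (h a x)
        exact congrArg (e.app (op ⦋a⦌)).hom (congrArg₂ (fun u v => f.level a u v) h2 h0)
    exact key _ (by simp [Fin.sum_univ_succ])

end ChainsAxioms

section ChainsOperad

variable {k : Type u} [CommRing k]

theorem normalizedMap_id (X : SimplicialObject (ModuleCat.{u} k)) :
    normalizedMap (𝟙 X) = 𝟙 (normalized X) := by
  refine HomologicalComplex.hom_ext _ _ fun n => ModuleCat.hom_ext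
    (Submodule.linearMap_qext _ (LinearMap.ext fun x => rfl))

theorem normalizedMap_comp {X Y Z : SimplicialObject (ModuleCat.{u} k)} (f : X ⟶ Y) (g : Y ⟶ Z) :
    normalizedMap (f ≫ g) = normalizedMap f ≫ normalizedMap g := by
  refine HomologicalComplex.hom_ext _ _ fun n => ModuleCat.hom_ext
    (Submodule.linearMap_qext _ (LinearMap.ext fun x => rfl))

theorem Tot.map_of {K L : ChainComplex (ModuleCat.{u} k) ℕ} (f : K ⟶ L) (p : ℕ) (x : K.X p) :
    Tot.map f (Tot.of K p x) = Tot.of L p ((f.f p).hom x) :=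
  DirectSum.lmap_lof (fun p => (f.f p).hom) p x

theorem Tot.map_id (K : ChainComplex (ModuleCat.{u} k) ℕ) (x : Tot K) : Tot.map (𝟙 K) x = x := by
  have : Tot.map (𝟙 K) = LinearMap.id := by
    refine DirectSum.linearMap_ext k fun p => LinearMap.ext fun x => ?_
    exact Tot.map_of (𝟙 K) p x
  rw [this, LinearMap.id_apply]

theorem Tot.map_comp {K L M : ChainComplex (ModuleCat.{u} k) ℕ} (f : K ⟶ L) (g : L ⟶ M)
    (x : Tot K) : Tot.map (f ≫ g) x = Tot.map g (Tot.map f x) := by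
  have : Tot.map (f ≫ g) = Tot.map g ∘ₗ Tot.map f := by
    refine DirectSum.linearMap_ext k fun p => LinearMap.ext fun x => ?_
    refine (Tot.map_of (f ≫ g) p x).trans ?_
    rw [LinearMap.comp_apply, LinearMap.comp_apply, Tot.map_of, Tot.map_of]
    rfl
  rw [this, LinearMap.comp_apply]

theorem map_normalizedMap_id (X : SimplicialObject (ModuleCat.{u} k)) (x : Tot (normalized X)) :
    Tot.map (normalizedMap (𝟙 X)) x = x := by
  rw [normalizedMap_id, Tot.map_id]

theorem map_normalizedMap_comp {X Y Z : SimplicialObject (ModuleCat.{u} k)} (f : X ⟶ Y) (g : Y ⟶ Z)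
    (x : Tot (normalized X)) :
    Tot.map (normalizedMap (f ≫ g)) x = Tot.map (normalizedMap g) (Tot.map (normalizedMap f) x) := by
  rw [normalizedMap_comp, Tot.map_comp]

theorem level_castV (O : SOperadData k) {a b : ℕ} (h : a = b) (p : ℕ) (x : (O.P a) _⦋p⦌) :
    (O.level p).castV h x = ((eqToHom (congrArg O.P h)).app (op ⦋p⦌)).hom x := by
  subst h
  rfl

theorem chains_castV (O : SOperadData k) {a b : ℕ} (h : a = b) (x : Tot (normalized (O.P a))) :
    O.chains.graded.castV h x = Tot.map (normalizedMap (eqToHom (congrArg O.P h))) x := by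
  subst h
  refine Eq.trans ?_ (congrArg (fun f => Tot.map f x) (normalizedMap_id (O.P a))).symm
  exact (Tot.map_id _ x).symm

theorem mem_homog {X : SimplicialObject (ModuleCat.{u} k)} {b : ℕ} {y : Tot (normalized X)}
    (hy : y ∈ (GMod.tot (normalized X)).homog b) : ∃ z, y = cls X b z := by
  obtain ⟨z, rfl⟩ := hy
  exact of_eq_cls X b z

/-- In a fixed simplicial degree all elements have degree `0`, so that the axioms hold there without
signs. -/
theorem ofModule_top {M : ModuleCat.{u} k} (x : M) : x ∈ (GMod.ofModule M).homog 0 :=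
  Submodule.mem_top (x := x)

/-- The axioms of an operad pass from simplicial modules to normalized complexes. -/
theorem chains_isOperad {O : SOperadData k} (hO : ∀ p, IsOperad (O.level p)) :
    IsOperad O.chains.graded where
  act_one n x := by
    have h : O.act n 1 = 𝟙 _ := by
      refine NatTrans.ext (funext fun p => ModuleCat.hom_ext (LinearMap.ext fun x => ?_))
      exact (hO p.unop.len).act_one n x
    exact (congrArg (fun f => Tot.map (normalizedMap f) x) h).trans (map_normalizedMap_id _ x)
  act_mul n σ τ x := by
    have h : O.act n (σ * τ) = O.act n σ ≫ O.act n τ := by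
      refine NatTrans.ext (funext fun p => ModuleCat.hom_ext (LinearMap.ext fun x => ?_))
      exact (hO p.unop.len).act_mul n σ τ x
    exact (congrArg (fun f => Tot.map (normalizedMap f) x) h).trans (map_normalizedMap_comp _ _ x)
  assoc n j i x b y hy c z hz := by
    choose y' hy' using fun s => mem_homog (hy s)
    choose z' hz' using fun s t => mem_homog (hz s t)
    obtain rfl : y = _ := funext hy'
    obtain rfl : z = _ := funext fun s => funext (hz' s)
    refine (chains_castV O _ _).trans ?_
    refine chains_assoc (O.γ n j) (O.γ (∑ s, j s)
      (fun r => i (finSigmaFinEquiv.symm r).1 (finSigmaFinEquiv.symm r).2))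
      (W := fun s t => O.P (i s t)) (fun s => O.γ (j s) (i s)) (O.γ n fun s => ∑ t, i s t) _ ?_ x b y' c z'
    intro p x y w
    have := (hO p).assoc n j i x (fun _ => 0) y (fun s => ofModule_top _) (fun _ _ => 0) w
      fun s t => ofModule_top _
    rw [koszulShuffle_zero, pow_zero, one_smul] at this
    exact (level_castV O _ p _).symm.trans this
  one_left n x := by
    refine (chains_castV O _ _).trans ?_
    refine chains_one_left (O.γ 1 fun _ => n) O.one _ ?_ x
    intro p y
    exact (level_castV O _ p _).symm.trans ((hO p).one_left n y)
  one_right n x := by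
    refine (chains_castV O _ _).trans ?_
    refine chains_one_right (O.γ n fun _ => 1) O.one _ ?_ x
    intro p y
    exact (level_castV O _ p _).symm.trans ((hO p).one_right n y)
  equivariance_outer n j σ x b y hy := by
    choose y' hy' using fun s => mem_homog (hy s)
    obtain rfl : y = _ := funext hy'
    refine (chains_reorder σ (O.γ n j) (O.γ n fun s => j (σ.symm s)) (O.act n σ)
      (eqToHom (congrArg O.P (Equiv.sum_comp σ.symm j)) ≫ O.act _ (blockPerm σ j)) ?_ x b y').trans ?_
    · intro p x y
      have := (hO p).equivariance_outer n j σ x (fun _ => 0) y fun s => ofModule_top _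
      rw [koszul_zero, pow_zero, one_smul] at this
      refine this.trans ?_
      exact congrArg ((O.act _ (blockPerm σ j)).app (op ⦋p⦌)).hom (level_castV O _ p _)
    · rw [normalizedMap_comp, Tot.map_comp]
      refine congrArg (fun u => (-1 : ℤ) ^ koszul σ b • Tot.map (normalizedMap (O.act _ (blockPerm σ j))) u) ?_
      exact (chains_castV O _ _).symm
  equivariance_inner n j τ x y := by
    refine Eq.trans ?_ (chains_naturality (O.γ n j) (O.γ n j) (𝟙 _) (fun s => O.act (j s) (τ s))
      (O.act _ (dirSumPerm j τ)) (fun p x y => (hO p).equivariance_inner n j τ x y) x y)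
    exact congrArg (fun u => (O.γ n j).chains u fun s => Tot.map (normalizedMap (O.act (j s) (τ s))) (y s))
      (map_normalizedMap_id _ x).symm

/-- The axioms of an algebra pass from simplicial modules to normalized complexes. -/
theorem chains_isOperadAlgebra {O : SOperadData k} {X : SimplicialObject (ModuleCat.{u} k)}
    {χ : ∀ n, SMultimap (Fin.cons (α := fun _ => SimplicialObject (ModuleCat.{u} k)) (O.P n)
      fun _ : Fin n => X) X} (hχ : IsSAlgebra O X χ) :
    IsOperadAlgebra O.chains.graded (GMod.tot (normalized X)) fun n => (χ n).chains where
  assoc n j x b y hy c z hz := by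
    choose y' hy' using fun s => mem_homog (hy s)
    choose z' hz' using fun s t => mem_homog (hz s t)
    obtain rfl : y = _ := funext hy'
    obtain rfl : z = _ := funext fun s => funext (hz' s)
    have := chains_assoc (O.γ n j) (χ (∑ s, j s))
      (W := fun _ _ => X) (fun s => χ (j s)) (χ n) (𝟙 X) ?_ x b y' c z'
    · rw [normalizedMap_id, Tot.map_id] at this
      exact this
    intro p x y w
    have := (hχ p).assoc n j x (fun _ => 0) y (fun s => ofModule_top _) (fun _ _ => 0) w
      fun s t => ofModule_top _
    rw [koszulShuffle_zero, pow_zero, one_smul] at this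
    exact this
  unit x := by
    have := chains_one_left (χ 1) O.one (𝟙 X) (fun p y => (hχ p).unit y) x
    rw [normalizedMap_id, Tot.map_id] at this
    exact this
  equivariance n σ x b z hz := by
    choose z' hz' using fun s => mem_homog (hz s)
    obtain rfl : z = _ := funext hz'
    have := chains_reorder σ (χ n) (χ n) (O.act n σ) (𝟙 X) ?_ x b z'
    · rw [normalizedMap_id, Tot.map_id] at this
      exact this
    · intro p x y
      have := (hχ p).equivariance n σ x (fun _ => 0) y fun s => ofModule_top _
      rw [koszul_zero, pow_zero, one_smul] at this
      exact this

end ChainsOperad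

/-! ### The Leibniz rule for shuffle maps -/

section Leibniz

variable {L : Type}

theorem inversions_eq_sum (r : L → L → Prop) [DecidableRel r] {N : ℕ} (w : Fin N → L) :
    inversions r w = ∑ s : Fin N, ∑ t : Fin N, if s < t ∧ r (w t) (w s) then 1 else 0 := by
  rw [← Fintype.sum_prod_type' (f := fun s t : Fin N => if s < t ∧ r (w t) (w s) then 1 else 0),
    ← Finset.card_filter]
  unfold inversions
  congr!

/-- Inserting a letter `l` at the place `p` of a word. -/
theorem inversions_insertNth (r : L → L → Prop) [DecidableRel r] {N : ℕ}
    (w : Fin N → L) (l : L) (p : Fin (N + 1)) :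
    inversions r (p.insertNth (α := fun _ => L) l w) = inversions r w +
      ((∑ t : Fin N, if p ≤ t.castSucc ∧ r (w t) l then 1 else 0) +
        ∑ t : Fin N, if t.castSucc < p ∧ r l (w t) then 1 else 0) := by
  rw [inversions_eq_sum, inversions_eq_sum, Fin.sum_univ_succAbove _ p]
  simp only [Fin.sum_univ_succAbove _ p, Fin.insertNth_apply_same, Fin.insertNth_apply_succAbove,
    lt_irrefl, false_and, if_false, zero_add, Fin.lt_succAbove_iff_le_castSucc,
    Fin.succAbove_lt_iff_castSucc_lt, Fin.succAbove_lt_succAbove_iff, Finset.sum_add_distrib]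
  omega

/-- Moving an inserted letter one place to the right is a transposition. -/
theorem insertNth_swap {N : ℕ} (w : Fin N → L) (l : L) (p : Fin N) :
    (p.succ.insertNth (α := fun _ => L) l w) ∘ Equiv.swap p.castSucc p.succ =
      p.castSucc.insertNth (α := fun _ => L) l w := by
  funext x
  rcases Fin.eq_self_or_eq_succAbove p.castSucc x with rfl | ⟨y, rfl⟩
  · simp
  · rw [Function.comp_apply, Fin.insertNth_apply_succAbove]
    by_cases hy : y = p
    · subst hy
      have h1 : y.castSucc.succAbove y = y.succ := Fin.succAbove_castSucc_self y
      have h2 : y.succ.succAbove y = y.castSucc := Fin.succAbove_succ_self y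
      rw [h1, Equiv.swap_apply_right]
      conv_lhs => rw [← h2]
      rw [Fin.insertNth_apply_succAbove]
    · have h1 : p.castSucc.succAbove y = p.succ.succAbove y := by
        rw [Fin.ext_iff] at hy
        simp only [Fin.succAbove, Fin.lt_def, Fin.val_castSucc, Fin.val_succ]
        split_ifs <;> first | rfl | omega
      have h2 : p.castSucc.succAbove y ≠ p.castSucc := Fin.succAbove_ne _ _
      have h3 : p.castSucc.succAbove y ≠ p.succ := by
        rw [h1]
        exact Fin.succAbove_ne _ _
      rw [Equiv.swap_apply_of_ne_of_ne h2 h3, h1, Fin.insertNth_apply_succAbove]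

variable [DecidableEq L]

theorem countBefore_eq_sum {N : ℕ} (w : Fin N → L) (a : L) (s : ℕ) :
    countBefore w a s = ∑ t : Fin N, if (t : ℕ) < s ∧ w t = a then 1 else 0 := by
  unfold countBefore
  rw [Finset.card_filter]

theorem countBefore_insertNth {N : ℕ} (w : Fin N → L) (l : L) (p : Fin (N + 1)) (a : L) (s : ℕ) :
    countBefore (p.insertNth (α := fun _ => L) l w) a s =
      (if (p : ℕ) < s ∧ l = a then 1 else 0) + countBefore w a (if s ≤ p then s else s - 1) := by
  rw [countBefore_eq_sum, countBefore_eq_sum, Fin.sum_univ_succAbove _ p]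
  simp only [Fin.insertNth_apply_same, Fin.insertNth_apply_succAbove]
  congr 1
  refine Finset.sum_congr rfl fun t _ => ?_
  congr 2
  rw [Fin.succAbove]
  split_ifs with h1 h2 h2 <;> simp only [Fin.lt_def, Fin.val_castSucc, Fin.val_succ] at * <;>
    exact propext (by omega)

/-- The face of a word that omits a vertex of an inserted letter. -/
theorem countBefore_insertNth_succAbove {N : ℕ} (w : Fin N → L) (l : L) (p : Fin (N + 1))
    (t : Fin (N + 2)) (ht : t = p.castSucc ∨ t = p.succ) (a : L) (s : Fin (N + 1)) :
    countBefore (p.insertNth (α := fun _ => L) l w) a (t.succAbove s) =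
      countBefore w a s + if a = l ∧ (t : ℕ) ≤ s then 1 else 0 := by
  rw [countBefore_insertNth, add_comm]
  have h : ((t.succAbove s : Fin (N + 2)) : ℕ) = if (s : ℕ) < t then (s : ℕ) else s + 1 := by
    rw [Fin.succAbove]
    split_ifs with h1 h2 h2 <;> simp only [Fin.lt_def, Fin.val_castSucc] at h1 <;> simp <;> omega
  have ht' : (t : ℕ) = p ∨ (t : ℕ) = p + 1 := by
    rcases ht with rfl | rfl
    · exact Or.inl rfl
    · exact Or.inr rfl
  rw [h]
  congr 1
  · congr 1
    split_ifs <;> omega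
  · congr 1
    refine propext ⟨fun ⟨h1, h2⟩ => ⟨h2.symm, ?_⟩, fun ⟨h1, h2⟩ => ⟨?_, h1.symm⟩⟩
    · split_ifs at h1 <;> omega
    · split_ifs <;> omega

/-- Moving an inserted letter past a letter changes the parity of the number of inversions, unless
the letters are equal. -/
theorem neg_one_pow_inversions_insertNth {k : Type u} [CommRing k] (r : L → L → Prop)
    (h : ∀ a b, a ≠ b → (r a b ↔ ¬ r b a)) (hr : ∀ a, ¬ r a a) {N : ℕ}
    (w : Fin N → L) (l : L) (p : Fin N) :
    (-1 : k) ^ inversions r (p.succ.insertNth (α := fun _ => L) l w) =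
      (if w p = l then 1 else -1) *
        (-1) ^ inversions r (p.castSucc.insertNth (α := fun _ => L) l w) := by
  classical
  rw [inversions_insertNth, inversions_insertNth]
  have h1 : (∑ t : Fin N, if p.castSucc ≤ t.castSucc ∧ r (w t) l then 1 else 0) =
      (∑ t : Fin N, if p.succ ≤ t.castSucc ∧ r (w t) l then 1 else 0) +
        if r (w p) l then 1 else 0 := by
    rw [← Finset.add_sum_erase _ _ (Finset.mem_univ p), ← Finset.add_sum_erase
      (a := p) Finset.univ (fun t : Fin N => if p.succ ≤ t.castSucc ∧ r (w t) l then 1 else 0)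
      (Finset.mem_univ p)]
    have : ∑ t ∈ Finset.univ.erase p, (if p.castSucc ≤ t.castSucc ∧ r (w t) l then 1 else 0) =
      ∑ t ∈ Finset.univ.erase p, (if p.succ ≤ t.castSucc ∧ r (w t) l then 1 else 0) := by
      refine Finset.sum_congr rfl fun t ht => ?_
      have hne : (t : ℕ) ≠ p := fun e => (Finset.mem_erase.mp ht).1 (Fin.ext e)
      have : p.castSucc ≤ t.castSucc ↔ p.succ ≤ t.castSucc := by
        simp only [Fin.le_def, Fin.val_castSucc, Fin.val_succ]
        omega
      simp only [this]
    rw [this]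
    simp [Fin.le_def]
    omega
  have h2 : (∑ t : Fin N, if t.castSucc < p.succ ∧ r l (w t) then 1 else 0) =
      (∑ t : Fin N, if t.castSucc < p.castSucc ∧ r l (w t) then 1 else 0) +
        if r l (w p) then 1 else 0 := by
    rw [← Finset.add_sum_erase _ _ (Finset.mem_univ p), ← Finset.add_sum_erase
      (a := p) Finset.univ (fun t : Fin N => if t.castSucc < p.castSucc ∧ r l (w t) then 1 else 0)
      (Finset.mem_univ p)]
    have : ∑ t ∈ Finset.univ.erase p, (if t.castSucc < p.succ ∧ r l (w t) then 1 else 0) =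
      ∑ t ∈ Finset.univ.erase p, (if t.castSucc < p.castSucc ∧ r l (w t) then 1 else 0) := by
      refine Finset.sum_congr rfl fun t ht => ?_
      have hne : (t : ℕ) ≠ p := fun e => (Finset.mem_erase.mp ht).1 (Fin.ext e)
      have : t.castSucc < p.succ ↔ t.castSucc < p.castSucc := by
        simp only [Fin.lt_def, Fin.val_castSucc, Fin.val_succ]
        omega
      simp only [this]
    rw [this]
    simp
    omega
  rw [h1, h2]
  simp only [pow_add]
  by_cases e : w p = l
  · rw [e, if_pos rfl, if_neg (hr l)]
    simp
  · rw [if_neg e]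
    have hrr := h _ _ e
    have hsq : ∀ m : ℕ, (-1 : k) ^ m * (-1) ^ m = 1 := fun m => by rw [← mul_pow]; simp
    by_cases h3 : r (w p) l
    · rw [if_pos h3, if_neg (hrr.mp h3)]
      simp
    · have h4 : r l (w p) := by
        by_contra h4
        exact h3 (hrr.mpr h4)
      rw [if_neg h3, if_pos h4]
      simp

end Leibniz

section LeibnizWords

variable {L : Type} [LinearOrder L] {N : ℕ} {q : L → ℕ}

/-- Insertion of a letter in a word, as a word with one more letter. -/
def Word.ins (l : L) (hl : 0 < q l) (p : Fin (N + 1))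
    (w : Word N (Function.update q l (q l - 1))) : Word (N + 1) q :=
  ⟨p.insertNth (α := fun _ => L) l w.1, fun a => by
    have hp : ¬ N + 1 ≤ (p : ℕ) := by omega
    have h1 : countBefore w.1 a N = Function.update q l (q l - 1) a :=
      (countBefore_all w.1 a).trans (w.2 a)
    rw [← countBefore_all, countBefore_insertNth, if_neg hp, Nat.add_sub_cancel, h1]
    by_cases h : l = a
    · subst h
      rw [if_pos ⟨p.2, rfl⟩, Function.update_self]
      omega
    · rw [if_neg fun e => h e.2, Function.update_of_ne (Ne.symm h), zero_add]⟩

theorem Word.ins_succ (l : L) (hl : 0 < q l) (p : Fin N)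
    (w : Word N (Function.update q l (q l - 1))) : (Word.ins l hl p.succ w).1 p.succ = l :=
  Fin.insertNth_apply_same (α := fun _ => L) p.succ l w.1

theorem Word.ins_castSucc (l : L) (hl : 0 < q l) (p : Fin N)
    (w : Word N (Function.update q l (q l - 1))) :
    (Word.ins l hl p.succ w).1 p.castSucc = w.1 p := by
  have h : p.succ.succAbove p = p.castSucc := Fin.succAbove_succ_self p
  rw [← h]
  exact Fin.insertNth_apply_succAbove (α := fun _ => L) p.succ l w.1 p

/-- Each word arises, for a given place, by inserting its letter at that place. -/
theorem Word.ins_bijective (p : Fin (N + 1)) : Function.Bijective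
    fun x : (Σ l : {l // 0 < q l}, Word N (Function.update q l (q l - 1))) =>
      Word.ins x.1.1 x.1.2 p x.2 := by
  constructor
  · rintro ⟨⟨l, hl⟩, w⟩ ⟨⟨l', hl'⟩, w'⟩ h
    have h1 : p.insertNth (α := fun _ => L) l w.1 = p.insertNth (α := fun _ => L) l' w'.1 :=
      congrArg Subtype.val h
    obtain rfl : l = l' := by
      have := congrFun h1 p
      simpa using this
    obtain rfl : w = w' := by
      refine Subtype.ext (funext fun t => ?_)
      have := congrFun h1 (p.succAbove t)
      simpa using this
    rfl
  · intro W
    have hc : ∀ a, q a = (if W.1 p = a then 1 else 0) +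
        (Finset.univ.filter fun t => W.1 (p.succAbove t) = a).card := by
      intro a
      rw [← W.2 a, Finset.card_filter, Fin.sum_univ_succAbove _ p, Finset.card_filter]
    refine ⟨⟨⟨W.1 p, ?_⟩, ⟨fun t => W.1 (p.succAbove t), fun a => ?_⟩⟩, ?_⟩
    · rw [hc, if_pos rfl]
      omega
    · change (Finset.univ.filter fun t => W.1 (p.succAbove t) = a).card = _
      by_cases h : a = W.1 p
      · subst h
        rw [Function.update_self]
        have := hc (W.1 p)
        rw [if_pos rfl] at this
        change _ = q (W.1 p) - 1
        omega
      · rw [Function.update_of_ne h]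
        have := hc a
        rw [if_neg (Ne.symm h)] at this
        omega
    · refine Subtype.ext (Fin.insertNth_eq_iff.mpr ⟨rfl, rfl⟩)

variable [Fintype L] {k : Type u} [CommRing k] {M : Type u} [AddCommGroup M] [Module k M]

/-- The sign of a word with an inserted letter. -/
theorem Word.sign_ins (l : L) (hl : 0 < q l) (w : Word N (Function.update q l (q l - 1)))
    (p : Fin (N + 1)) :
    (-1 : k) ^ (p : ℕ) * (-1) ^ inversions (· < ·) (Word.ins l hl p w).1 =
      (-1) ^ countBefore w.1 l p * (-1) ^ (∑ a with a < l, q a) *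
        (-1) ^ inversions (· < ·) w.1 := by
  induction p using Fin.induction with
  | zero =>
    have h0 : countBefore w.1 l ((0 : Fin (N + 1)) : ℕ) = 0 := by simp [countBefore]
    rw [h0]
    show _ * (-1) ^ inversions _ ((0 : Fin (N + 1)).insertNth (α := fun _ => L) l w.1) = _
    rw [inversions_insertNth]
    have h1 : (∑ t : Fin N, if (0 : Fin (N + 1)) ≤ t.castSucc ∧ w.1 t < l then 1 else 0) =
        ∑ a with a < l, q a := by
      rw [← Finset.card_filter, Finset.card_eq_sum_card_fiberwise (f := w.1)
        (t := Finset.univ.filter (· < l))]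
      · refine Finset.sum_congr rfl fun a ha => ?_
        have hal : a < l := (Finset.mem_filter.mp ha).2
        have := w.2 a
        rw [Function.update_of_ne hal.ne] at this
        rw [← this]
        congr 1
        ext t
        simp only [Finset.mem_filter, Finset.mem_univ, true_and, Fin.zero_le]
        exact ⟨fun h => h.2, fun h => ⟨h ▸ hal, h⟩⟩
      · intro t ht
        simpa using ht
    rw [h1]
    simp [pow_add, mul_comm]
  | succ p ih =>
    have h := neg_one_pow_inversions_insertNth (k := k) (· < ·)
      (fun a b (hab : a ≠ b) => ⟨fun h => h.asymm, fun h => lt_of_le_of_ne (not_lt.mp h) hab⟩)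
      (fun a : L => lt_irrefl a) w.1 l p
    have h' : (-1 : k) ^ inversions (· < ·) (Word.ins l hl p.succ w).1 =
      (if w.1 p = l then 1 else -1) * (-1) ^ inversions (· < ·) (Word.ins l hl p.castSucc w).1 := h
    rw [h', Fin.val_succ, countBefore_succ]
    rw [Fin.val_castSucc] at ih
    by_cases e : w.1 p = l
    · rw [if_pos e, if_pos e, pow_succ, pow_succ]
      linear_combination (-1 : k) * ih
    · rw [if_neg e, if_neg e, pow_succ, add_zero]
      linear_combination ih

/-- A term of the alternating sum of the faces of the summand of a word. The value `Ψ` is a function of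
the numbers of letters before each place, which makes sense for faces of words as well. -/
noncomputable def faceTerm (k : Type u) [CommRing k] [Module k M]
    (Ψ : (L → Fin (N + 1) → ℕ) → M) (w : Fin (N + 1) → L) (t : Fin (N + 2)) : M :=
  ((-1 : k) ^ (t : ℕ) * (-1) ^ inversions (· < ·) w) •
    Ψ fun a s => countBefore w a (t.succAbove s)

/-- The face of a word at the left end of an inserted letter: omitting this vertex amounts to counting
the inserted letter at once from its place on. -/
theorem faceTerm_ins (Ψ : (L → Fin (N + 1) → ℕ) → M) (l : L) (hl : 0 < q l)
    (w : Word N (Function.update q l (q l - 1))) (p : Fin (N + 1)) :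
    faceTerm k Ψ (Word.ins l hl p w).1 p.castSucc =
      ((-1) ^ countBefore w.1 l p * (-1) ^ (∑ a with a < l, q a) *
        (-1) ^ inversions (· < ·) w.1 : k) •
        Ψ fun a s => countBefore w.1 a s + if a = l ∧ (p : ℕ) ≤ s then 1 else 0 := by
  unfold faceTerm
  rw [Fin.val_castSucc, Word.sign_ins]
  refine congrArg _ (congrArg Ψ (funext fun a => funext fun s => ?_))
  exact countBefore_insertNth_succAbove w.1 l p p.castSucc (Or.inl rfl) a s

/-- The last face of a word that ends in an inserted letter. -/
theorem faceTerm_ins_last (Ψ : (L → Fin (N + 1) → ℕ) → M) (l : L) (hl : 0 < q l)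
    (w : Word N (Function.update q l (q l - 1))) :
    faceTerm k Ψ (Word.ins l hl (Fin.last N) w).1 (Fin.last (N + 1)) =
      ((-1) ^ q l * (-1) ^ (∑ a with a < l, q a) * (-1) ^ inversions (· < ·) w.1 : k) •
        Ψ fun a s => countBefore w.1 a s := by
  unfold faceTerm
  have h := Word.sign_ins (k := k) l hl w (Fin.last N)
  rw [Fin.val_last, countBefore_all, w.2, Function.update_self] at h
  have h2 : (-1 : k) ^ q l = -(-1) ^ (q l - 1) := by
    conv_lhs => rw [← Nat.sub_add_cancel hl, pow_succ]
    ring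
  congr 1
  · rw [Fin.val_last, pow_succ, h2]
    linear_combination (-1 : k) * h
  · refine congrArg Ψ (funext fun a => funext fun s => ?_)
    refine (countBefore_insertNth_succAbove w.1 l (Fin.last N) (Fin.last (N + 1)) (Or.inr rfl)
      a s).trans ?_
    rw [if_neg, add_zero]
    rintro ⟨-, h⟩
    have := s.2
    rw [Fin.val_last] at h
    omega

/-- Faces at a vertex between two different letters cancel. -/
theorem sum_faceTerm_ne (Ψ : (L → Fin (N + 1) → ℕ) → M) (p : Fin N) :
    ∑ x : (Σ l : {l // 0 < q l}, Word N (Function.update q l (q l - 1))),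
      (if x.2.1 p = x.1.1 then 0 else
        faceTerm k Ψ (Word.ins x.1.1 x.1.2 p.succ x.2).1 p.succ.castSucc) = 0 := by
  have h1 : ∑ x : (Σ l : {l // 0 < q l}, Word N (Function.update q l (q l - 1))),
      (if x.2.1 p = x.1.1 then 0 else
        faceTerm k Ψ (Word.ins x.1.1 x.1.2 p.succ x.2).1 p.succ.castSucc) =
      ∑ W : Word (N + 1) q, if W.1 p.castSucc = W.1 p.succ then 0 else
        faceTerm k Ψ W.1 p.succ.castSucc := by
    rw [← (Word.ins_bijective p.succ).sum_comp]
    refine Finset.sum_congr rfl fun x _ => ?_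
    rw [Word.ins_succ, Word.ins_castSucc]
  rw [h1]
  -- Exchanging the two letters is a sign-reversing involution.
  let g : Word (N + 1) q → Word (N + 1) q := fun W =>
    ⟨W.1 ∘ Equiv.swap p.castSucc p.succ, fun a => by
      refine Eq.trans ?_ (W.2 a)
      refine Finset.card_bij (fun t _ => Equiv.swap p.castSucc p.succ t) ?_ ?_ ?_
      · intro t ht
        simpa using ht
      · intro t _ t' _ h
        exact (Equiv.swap _ _).injective h
      · intro t ht
        exact ⟨Equiv.swap p.castSucc p.succ t, by simpa using ht, by simp⟩⟩
  have hg : ∀ W : Word (N + 1) q, W.1 p.castSucc ≠ W.1 p.succ →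
      faceTerm k Ψ (g W).1 p.succ.castSucc = - faceTerm k Ψ W.1 p.succ.castSucc := by
    intro W hW
    obtain ⟨⟨⟨l, hl⟩, w⟩, rfl⟩ := (Word.ins_bijective p.succ).2 W
    simp only [Word.ins_succ, Word.ins_castSucc] at hW
    have e3 : (g (Word.ins l hl p.succ w)).1 = (Word.ins l hl p.castSucc w).1 :=
      insertNth_swap w.1 l p
    have h := neg_one_pow_inversions_insertNth (k := k) (· < ·)
      (fun a b (hab : a ≠ b) => ⟨fun h => h.asymm, fun h => lt_of_le_of_ne (not_lt.mp h) hab⟩)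
      (fun a : L => lt_irrefl a) w.1 l p
    rw [if_neg hW] at h
    simp only
    rw [e3]
    unfold faceTerm
    rw [← neg_smul]
    congr 1
    · have h' : (-1 : k) ^ inversions (· < ·) (Word.ins l hl p.succ w).1 =
        -1 * (-1) ^ inversions (· < ·) (Word.ins l hl p.castSucc w).1 := h
      rw [h']
      ring
    · refine congrArg Ψ (funext fun a => funext fun s => ?_)
      refine (countBefore_insertNth_succAbove w.1 l p.castSucc p.succ.castSucc
        (Or.inr (Fin.ext rfl)) a s).trans ?_
      exact (countBefore_insertNth_succAbove w.1 l p.succ p.succ.castSucc (Or.inl rfl) a s).symm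
  have hsw : ∀ W : Word (N + 1) q, (g W).1 p.castSucc = W.1 p.succ ∧
      (g W).1 p.succ = W.1 p.castSucc := fun W =>
    ⟨congrArg W.1 (Equiv.swap_apply_left _ _), congrArg W.1 (Equiv.swap_apply_right _ _)⟩
  refine Finset.sum_involution (fun W _ => g W) ?_ ?_ (fun _ _ => Finset.mem_univ _) ?_
  · intro W _
    simp only [hsw]
    by_cases h : W.1 p.castSucc = W.1 p.succ
    · rw [if_pos h, if_pos h.symm, add_zero]
    · rw [if_neg h, if_neg (Ne.symm h), hg W h, add_neg_cancel]
  · intro W _ hne e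
    apply hne
    rw [if_pos]
    have := (hsw W).1
    rw [e] at this
    exact this
  · intro W _
    refine Subtype.ext (funext fun t => ?_)
    have : Equiv.swap p.castSucc p.succ (Equiv.swap p.castSucc p.succ t) = t := by simp
    exact congrArg W.1 this

/-- The terms of the faces of a letter of a word are those of the faces at the ends of the words in
which the letter is inserted, and at the vertices between two equal letters. -/
theorem sum_faceTerm_eq (Ψ : (L → Fin (N + 1) → ℕ) → M) (l : L) (hl : 0 < q l)
    (w : Word N (Function.update q l (q l - 1))) :
    faceTerm k Ψ (Word.ins l hl 0 w).1 0 +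
      (∑ p : Fin N, if w.1 p = l then
        faceTerm k Ψ (Word.ins l hl p.succ w).1 p.succ.castSucc else 0) +
      faceTerm k Ψ (Word.ins l hl (Fin.last N) w).1 (Fin.last (N + 1)) =
    ((-1) ^ (∑ a with a < l, q a) * (-1) ^ inversions (· < ·) w.1 : k) •
      ∑ u : Fin (q l + 1), (-1 : k) ^ (u : ℕ) • Ψ fun a s =>
        countBefore w.1 a s + if a = l ∧ (u : ℕ) ≤ countBefore w.1 l s then 1 else 0 := by
  set g : ℕ → M := fun u => (-1 : k) ^ u • Ψ fun a s =>
    countBefore w.1 a s + if a = l ∧ u ≤ countBefore w.1 l s then 1 else 0 with hg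
  set c : k := (-1) ^ (∑ a with a < l, q a) * (-1) ^ inversions (· < ·) w.1 with hc
  have hlast : countBefore w.1 l N = q l - 1 := by
    refine (countBefore_all w.1 l).trans ((w.2 l).trans (Function.update_self _ _ _))
  have h0 : faceTerm k Ψ (Word.ins l hl 0 w).1 0 = c • g 0 := by
    refine (faceTerm_ins Ψ l hl w 0).trans ?_
    have hz : countBefore w.1 l ((0 : Fin (N + 1)) : ℕ) = 0 := by simp [countBefore]
    rw [hz, pow_zero, one_mul, ← hc, hg]
    simp
  have hN : faceTerm k Ψ (Word.ins l hl (Fin.last N) w).1 (Fin.last (N + 1)) = c • g (q l) := by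
    rw [faceTerm_ins_last, hg]
    simp only
    rw [smul_smul]
    congr 1
    · rw [hc]
      ring
    · refine congrArg Ψ (funext fun a => funext fun s => ?_)
      rw [if_neg, add_zero]
      rintro ⟨-, h⟩
      have := countBefore_mono w.1 l (Nat.lt_succ_iff.mp s.2)
      omega
  have hp : ∀ p, (if w.1 p = l then
        faceTerm k Ψ (Word.ins l hl p.succ w).1 p.succ.castSucc else 0) =
      if w.1 p = l then c • g (countBefore w.1 l p + 1) else 0 := by
    intro p
    by_cases h : w.1 p = l
    · rw [if_pos h, if_pos h, faceTerm_ins, Fin.val_succ, countBefore_succ, if_pos h, hg]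
      simp only
      rw [smul_smul]
      congr 1
      · rw [hc]
        ring
      · refine congrArg Ψ (funext fun a => funext fun s => ?_)
        have h1 := w.place_lt_iff l ⟨p, h⟩ s
        rw [Word.place_val] at h1
        congr 1
        exact if_congr (and_congr_right fun _ => h1.symm) rfl rfl
    · rw [if_neg h, if_neg h]
  rw [h0, hN, Finset.sum_congr rfl fun p _ => hp p]
  have hmid : (∑ p : Fin N, if w.1 p = l then c • g (countBefore w.1 l p + 1) else 0) =
      c • ∑ v ∈ Finset.range (q l - 1), g (v + 1) := by
    have hq : Function.update q l (q l - 1) l = q l - 1 := Function.update_self _ _ _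
    rw [(congrArg (fun m => ∑ v ∈ Finset.range m, g (v + 1)) hq.symm).trans
      (Finset.sum_range _), ← (w.place l).sum_comp, Finset.smul_sum, ← Finset.sum_filter]
    refine Finset.sum_subtype (p := fun t => w.1 t = l) _ (fun x => ?_)
      fun p => c • g (countBefore w.1 l p + 1)
    rw [Finset.mem_filter]
    exact and_iff_right (Finset.mem_univ x)
  rw [hmid, ← smul_add, ← smul_add, Fin.sum_univ_eq_sum_range g (q l + 1), Finset.sum_range_succ]
  congr 2
  conv_rhs => rw [← Nat.sub_add_cancel hl, Finset.sum_range_succ']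
  rw [add_comm]

/-- The Leibniz rule for the shuffle map, as an identity between sums over words. -/
theorem sum_faceTerm (Ψ : (L → Fin (N + 1) → ℕ) → M) :
    ∑ W : Word (N + 1) q, ∑ t, faceTerm k Ψ W.1 t =
      ∑ l : {l // 0 < q l}, ∑ w : Word N (Function.update q l.1 (q l.1 - 1)),
        ((-1) ^ (∑ a with a < l.1, q a) * (-1) ^ inversions (· < ·) w.1 : k) •
          ∑ u : Fin (q l.1 + 1), (-1 : k) ^ (u : ℕ) • Ψ fun a s =>
            countBefore w.1 a s + if a = l.1 ∧ (u : ℕ) ≤ countBefore w.1 l.1 s then 1 else 0 := by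
  simp only [Fin.sum_univ_castSucc (fun t : Fin (N + 2) => faceTerm k Ψ _ t)]
  rw [Finset.sum_add_distrib, Finset.sum_comm, Fin.sum_univ_succ]
  rw [← (Word.ins_bijective (q := q) (0 : Fin (N + 1))).sum_comp,
    ← (Word.ins_bijective (q := q) (Fin.last N)).sum_comp]
  have hmid : ∀ p : Fin N, ∑ W : Word (N + 1) q, faceTerm k Ψ W.1 p.succ.castSucc =
      ∑ x : (Σ l : {l // 0 < q l}, Word N (Function.update q l (q l - 1))),
        if x.2.1 p = x.1.1 then
          faceTerm k Ψ (Word.ins x.1.1 x.1.2 p.succ x.2).1 p.succ.castSucc else 0 := by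
    intro p
    rw [← (Word.ins_bijective (q := q) p.succ).sum_comp]
    refine Eq.trans ?_ ((congrArg (_ + ·) (sum_faceTerm_ne (k := k) (q := q) Ψ p)).trans
      (add_zero _))
    rw [← Finset.sum_add_distrib]
    refine Finset.sum_congr rfl fun x _ => ?_
    split_ifs <;> simp
  rw [Finset.sum_congr rfl fun p _ => hmid p, Finset.sum_comm, ← Finset.sum_add_distrib,
    ← Finset.sum_add_distrib, Fintype.sum_sigma]
  refine Finset.sum_congr rfl fun l _ => Finset.sum_congr rfl fun w _ => ?_
  exact sum_faceTerm_eq Ψ l.1 l.2 w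

end LeibnizWords

section Leibniz

variable {k : Type u} [CommRing k]

/-- The coface operator `⦋N - 1⦌ ⟶ ⦋N⦌` that omits `u`, for `0 < N`. -/
def coface (N : ℕ) (hN : 0 < N) (u : Fin (N + 1)) : ⦋N - 1⦌ ⟶ ⦋N⦌ :=
  SimplexCategory.mkHom
    { toFun := fun s => ⟨s + if (u : ℕ) ≤ s then 1 else 0, by
        have := s.2
        split_ifs <;> omega⟩
      monotone' := fun s s' h => by
        have h' : (s : ℕ) ≤ s' := h
        refine Fin.mk_le_mk.mpr ?_
        split_ifs <;> omega }

theorem tot_d_of (K : ChainComplex (ModuleCat.{u} k) ℕ) (p : ℕ) (x : K.X p) :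
    Tot.d K (Tot.of K p x) = Tot.of K (p - 1) ((K.d p (p - 1)).hom x) := by
  unfold Tot.d Tot.of
  rw [DirectSum.toModule_lof]
  rfl

theorem tot_sgn_of (K : ChainComplex (ModuleCat.{u} k) ℕ) (p : ℕ) (x : K.X p) :
    Tot.sgn K (Tot.of K p x) = (-1 : k) ^ p • Tot.of K p x := by
  unfold Tot.sgn Tot.of
  rw [DirectSum.toModule_lof]
  rfl

theorem tot_d_cls_zero (Z : SimplicialObject (ModuleCat.{u} k)) (z : Z _⦋0⦌) :
    Tot.d _ (cls Z 0 z) = 0 := by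
  refine (tot_d_of _ 0 _).trans ?_
  rw [(normalized Z).shape 0 (0 - 1) (by simp)]
  exact map_zero _

/-- The differential of `𝒩Z` is induced by the alternating sum of the faces. -/
theorem normalized_d_mkQ (Z : SimplicialObject (ModuleCat.{u} k)) (N : ℕ) (z : Z _⦋N + 1⦌) :
    ((normalized Z).d (N + 1) N).hom ((degen Z (N + 1)).mkQ z) =
      (degen Z N).mkQ (∑ t : Fin (N + 2), (-1 : k) ^ (t : ℕ) • (Z.δ t).hom z) := by
  have h : ((normalized Z).d (N + 1) N).hom ((degen Z (N + 1)).mkQ z) =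
      (degen Z N).mkQ ((AlgebraicTopology.AlternatingFaceMapComplex.objD Z N).hom z) := by
    simp only [normalized, ChainComplex.of_d]
    rfl
  have hd : (AlgebraicTopology.AlternatingFaceMapComplex.objD Z N).hom z =
      ∑ t : Fin (N + 2), ((-1 : ℤ) ^ (t : ℕ) • Z.δ t).hom z := by
    simp only [AlgebraicTopology.AlternatingFaceMapComplex.objD, ModuleCat.hom_sum,
      LinearMap.sum_apply]
  refine h.trans (congrArg _ (hd.trans (Finset.sum_congr rfl fun t _ => ?_)))
  change (-1 : ℤ) ^ (t : ℕ) • (Z.δ t).hom z = _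
  rw [← Int.cast_smul_eq_zsmul k]
  simp

theorem tot_d_cls_succ (Z : SimplicialObject (ModuleCat.{u} k)) (N : ℕ) (z : Z _⦋N + 1⦌) :
    Tot.d _ (cls Z (N + 1) z) =
      ∑ t : Fin (N + 2), (-1 : k) ^ (t : ℕ) • cls Z N ((Z.δ t).hom z) := by
  refine (tot_d_of _ (N + 1) _).trans ?_
  refine (congrArg (Tot.of (normalized Z) N) (normalized_d_mkQ Z N z)).trans ?_
  refine (map_sum (cls Z N) _ _).trans ?_
  exact Finset.sum_congr rfl fun t _ => map_smul (cls Z N) _ _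

theorem tot_d_cls (Z : SimplicialObject (ModuleCat.{u} k)) (N : ℕ) (hN : 0 < N) (z : Z _⦋N⦌) :
    Tot.d _ (cls Z N z) = ∑ t : Fin (N + 1), (-1 : k) ^ (t : ℕ) •
      cls Z (N - 1) ((Z.map (coface N hN t).op).hom z) := by
  obtain ⟨N, rfl⟩ := Nat.exists_eq_succ_of_ne_zero hN.ne'
  refine (tot_d_cls_succ Z N z).trans (Finset.sum_congr rfl fun t _ => ?_)
  have h : SimplexCategory.δ t = coface (N + 1) hN t := by
    refine SimplexCategory.Hom.ext _ _ (OrderHom.ext _ _ (funext fun s => Fin.ext ?_))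
    change ((t.succAbove s : Fin (N + 2)) : ℕ) = (s : ℕ) + if (t : ℕ) ≤ s then 1 else 0
    by_cases hts : (t : ℕ) ≤ s
    · rw [if_pos hts, Fin.succAbove_of_le_castSucc _ _ hts]
      rfl
    · rw [if_neg hts, Fin.succAbove_of_castSucc_lt _ _ (not_le.mp hts)]
      rfl
  exact congrArg (fun φ : ⦋N⦌ ⟶ ⦋N + 1⦌ => (-1 : k) ^ (t : ℕ) • cls Z N ((Z.map φ.op).hom z)) h

/-- `cls Z N (θ^* z)` depends only on the values of the operator `θ`. -/
theorem cls_map_congr (Z : SimplicialObject (ModuleCat.{u} k)) {N N' m : ℕ} (h : N = N')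
    (θ : ⦋N⦌ ⟶ ⦋m⦌) (θ' : ⦋N'⦌ ⟶ ⦋m⦌)
    (hθ : ∀ (s : Fin (N + 1)) (s' : Fin (N' + 1)), (s : ℕ) = s' →
      (θ.toOrderHom s : ℕ) = θ'.toOrderHom s') (z : Z _⦋m⦌) :
    cls Z N ((Z.map θ.op).hom z) = cls Z N' ((Z.map θ'.op).hom z) := by
  subst h
  obtain rfl : θ = θ' := SimplexCategory.Hom.ext _ _ (OrderHom.ext _ _
    (funext fun s => Fin.ext (hθ s s rfl)))
  rfl

/-- In the place `l`, the coface operator that omits `u`; in the other places, the identity. -/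
def cofaceAt {L : Type} [DecidableEq L] (q : L → ℕ) (l : L) (hl : 0 < q l) (u : ℕ) (j : L) :
    ⦋Function.update q l (q l - 1) j⦌ ⟶ ⦋q j⦌ :=
  SimplexCategory.mkHom
    { toFun := fun s => ⟨s + if j = l ∧ u ≤ s then 1 else 0, by
        have hs := s.2
        by_cases h : j = l
        · subst h
          have hs : (s : ℕ) < q j - 1 + 1 := hs.trans_eq
            (congrArg (· + 1) (Function.update_self j (q j - 1) q))
          change _ < q j + 1
          split_ifs <;> omega
        · have hs : (s : ℕ) < q j + 1 := hs.trans_eq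
            (congrArg (· + 1) (Function.update_of_ne h (q l - 1) q))
          rw [if_neg (fun h' => h h'.1)]
          exact hs⟩
      monotone' := fun s s' h => by
        have h' : (s : ℕ) ≤ s' := h
        refine Fin.mk_le_mk.mpr ?_
        split_ifs with h1 h2
        · omega
        · exact absurd ⟨h1.1, h1.2.trans h'⟩ h2
        · omega
        · omega }

variable {n : ℕ} {X : Fin n → SimplicialObject (ModuleCat.{u} k)}
  {Z : SimplicialObject (ModuleCat.{u} k)} (f : SMultimap X Z)

theorem shuffleMap_cls_of_eq (q : Fin n → ℕ) {N : ℕ} (hN : ∑ i, q i = N)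
    (x : ∀ i, (X i) _⦋q i⦌) :
    shuffleMap f (fun i => cls (X i) (q i) (x i)) =
      shSum (· < ·) q N fun θ => f.app _ fun i => ((X i).map (θ i).op).hom (x i) := by
  subst hN
  exact shuffleMap_cls f q x

open Classical in
/-- The class of `f(c_0^* x_0, …, c_{n-1}^* x_{n-1})`, as a function of the values of the
simplicial operators `c_i`; it is `0` if the `c_i` are not the values of simplicial operators. -/
noncomputable def operatorValue (q : Fin n → ℕ) (x : ∀ i, (X i) _⦋q i⦌) (N : ℕ)
    (c : Fin n → Fin (N + 1) → ℕ) : Tot (normalized Z) :=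
  if h : ∃ θ : ∀ i, ⦋N⦌ ⟶ ⦋q i⦌, ∀ i s, ((θ i).toOrderHom s : ℕ) = c i s then
    cls Z N (f.app N fun i => ((X i).map (h.choose i).op).hom (x i)) else 0

theorem operatorValue_eq (q : Fin n → ℕ) (x : ∀ i, (X i) _⦋q i⦌) (N : ℕ)
    (c : Fin n → Fin (N + 1) → ℕ) (θ : ∀ i, ⦋N⦌ ⟶ ⦋q i⦌)
    (h : ∀ i s, ((θ i).toOrderHom s : ℕ) = c i s) :
    operatorValue f q x N c = cls Z N (f.app N fun i => ((X i).map (θ i).op).hom (x i)) := by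
  have h' : ∃ θ : ∀ i, ⦋N⦌ ⟶ ⦋q i⦌, ∀ i s, ((θ i).toOrderHom s : ℕ) = c i s := ⟨θ, h⟩
  have he : h'.choose = θ := funext fun i => SimplexCategory.Hom.ext _ _ (OrderHom.ext _ _
    (funext fun s => Fin.ext ((h'.choose_spec i s).trans (h i s).symm)))
  rw [operatorValue, dif_pos h', he]

/-- The boundary of a shuffle product, as a sum over words and faces. -/
theorem tot_d_shuffleMap_cls (q : Fin n → ℕ) (x : ∀ i, (X i) _⦋q i⦌) {N : ℕ}
    (hN : ∑ i, q i = N + 1) :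
    Tot.d _ (shuffleMap f fun i => cls (X i) (q i) (x i)) =
      ∑ W : Word (N + 1) q, ∑ t, faceTerm k (operatorValue f q x N) W.1 t := by
  rw [shuffleMap_cls_of_eq f q hN, shSum, map_sum]
  refine Finset.sum_congr rfl fun W _ => ?_
  rw [map_smul, tot_d_cls_succ, Finset.smul_sum]
  refine Finset.sum_congr rfl fun t _ => ?_
  rw [faceTerm, smul_smul, mul_comm]
  refine congrArg _ ?_
  rw [operatorValue_eq f q x N _ fun i => SimplexCategory.δ t ≫ W.proj i]
  · refine congrArg _ ((f.naturality (SimplexCategory.δ t) _).symm.trans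
      (congrArg (f.app N) (funext fun i => ?_)))
    exact map_map_apply _ _ _ _
  · intro i s
    exact Word.proj_val W i _

/-- The terms of the Leibniz rule, as sums over words and faces. -/
theorem shuffleMap_update_d (q : Fin n → ℕ) (x : ∀ i, (X i) _⦋q i⦌) {N : ℕ}
    (hN : ∑ i, q i = N + 1) (l : Fin n) (hl : 0 < q l) :
    shuffleMap f (Function.update (fun i => cls (X i) (q i) (x i)) l
        (Tot.d _ (cls (X l) (q l) (x l)))) =
      ∑ w : Word N (Function.update q l (q l - 1)), (-1 : k) ^ inversions (· < ·) w.1 •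
        ∑ u : Fin (q l + 1), (-1 : k) ^ (u : ℕ) • operatorValue f q x N fun a s =>
          countBefore w.1 a s + if a = l ∧ (u : ℕ) ≤ countBefore w.1 l s then 1 else 0 := by
  have hN' : ∑ i, Function.update q l (q l - 1) i = N := by
    have h1 := Finset.sum_update_of_mem (Finset.mem_univ l) q (q l - 1)
    have h2 := Finset.add_sum_erase Finset.univ q (Finset.mem_univ l)
    rw [Finset.sdiff_singleton_eq_erase] at h1
    omega
  rw [tot_d_cls _ _ hl, MultilinearMap.map_update_sum]
  simp only [Finset.smul_sum]
  rw [Finset.sum_comm]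
  refine Finset.sum_congr rfl fun u _ => ?_
  rw [MultilinearMap.map_update_smul]
  have hu : Function.update (fun i => cls (X i) (q i) (x i)) l
      (cls (X l) (q l - 1) (((X l).map (coface (q l) hl u).op).hom (x l))) =
      fun j => cls (X j) (Function.update q l (q l - 1) j)
        (((X j).map (cofaceAt q l hl u j).op).hom (x j)) := by
    funext j
    by_cases h : j = l
    · subst h
      rw [Function.update_self]
      refine cls_map_congr (X j) (Function.update_self j (q j - 1) q).symm _ _ (fun s s' h => ?_) _
      change (s : ℕ) + (if (u : ℕ) ≤ s then 1 else 0) = s' + if j = j ∧ (u : ℕ) ≤ s' then 1 else 0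
      rw [h]
      simp
    · rw [Function.update_of_ne h]
      have h1 : x j = ((X j).map (𝟙 ⦋q j⦌ : ⦋q j⦌ ⟶ ⦋q j⦌).op).hom (x j) := by
        rw [op_id, (X j).map_id]
        rfl
      conv_lhs => rw [h1]
      refine cls_map_congr (X j) (Function.update_of_ne h (q l - 1) q).symm _ _ (fun s s' h' => ?_) _
      change (s : ℕ) = s' + if j = l ∧ (u : ℕ) ≤ s' then 1 else 0
      rw [if_neg (fun h' => h h'.1), h', add_zero]
  rw [hu, shuffleMap_cls_of_eq f _ hN', shSum, Finset.smul_sum]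
  refine Finset.sum_congr rfl fun w _ => ?_
  rw [smul_smul, smul_smul, mul_comm]
  refine congrArg _ ?_
  rw [operatorValue_eq f q x N _ fun i => w.proj i ≫ cofaceAt q l hl u i]
  · refine congrArg _ (congrArg (f.app N) (funext fun i => ?_))
    exact map_map_apply _ _ _ _
  · intro i s
    change ((w.proj i).toOrderHom s : ℕ) + (if i = l ∧ (u : ℕ) ≤ (w.proj i).toOrderHom s then 1
      else 0) = _
    rw [Word.proj_val]
    refine congrArg _ (if_congr (and_congr_right fun h => ?_) rfl rfl)
    rw [h]

/-- The shuffle map is a chain map, on generators. -/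
theorem tot_d_shuffleMap_cls_eq_sum (q : Fin n → ℕ) (x : ∀ i, (X i) _⦋q i⦌) :
    Tot.d _ (shuffleMap f fun i => cls (X i) (q i) (x i)) =
      ∑ i, (-1 : k) ^ (∑ a with a < i, q a) • shuffleMap f
        (Function.update (fun i => cls (X i) (q i) (x i)) i (Tot.d _ (cls (X i) (q i) (x i)))) := by
  have hz : ∀ i, q i = 0 → Tot.d _ (cls (X i) (q i) (x i)) = 0 := by
    intro i hi
    generalize x i = z
    revert z
    rw [hi]
    exact tot_d_cls_zero (X i)
  by_cases h0 : ∑ i, q i = 0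
  · have hq : ∀ i, q i = 0 := fun i =>
      Finset.sum_eq_zero_iff.mp h0 i (Finset.mem_univ i)
    rw [Finset.sum_eq_zero fun i _ => ?_]
    · rw [shuffleMap_cls_of_eq f q h0, shSum, map_sum]
      refine Finset.sum_eq_zero fun W _ => ?_
      rw [map_smul, tot_d_cls_zero, smul_zero]
    · rw [hz i (hq i), MultilinearMap.map_update_zero, smul_zero]
  · obtain ⟨N, hN⟩ := Nat.exists_eq_succ_of_ne_zero h0
    rw [tot_d_shuffleMap_cls f q x hN, sum_faceTerm]
    rw [← Finset.sum_filter_add_sum_filter_not Finset.univ (fun i => 0 < q i),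
      Finset.sum_eq_zero (s := Finset.univ.filter fun i => ¬ 0 < q i) fun i hi => ?_, add_zero]
    · rw [Finset.sum_subtype (p := fun i => 0 < q i) _ (fun i => by simp)]
      refine Finset.sum_congr rfl fun l _ => ?_
      rw [shuffleMap_update_d f q x hN l.1 l.2, Finset.smul_sum]
      refine Finset.sum_congr rfl fun w _ => ?_
      rw [mul_smul]
    · have hi0 : q i = 0 := by
        have := (Finset.mem_filter.mp hi).2
        omega
      rw [hz i hi0, MultilinearMap.map_update_zero, smul_zero]

/-- The factors of the `i`-th term of the Leibniz rule. -/
noncomputable def leibnizFactor (Y : Fin n → ChainComplex (ModuleCat.{u} k) ℕ) (i j : Fin n) :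
    Tot (Y j) →ₗ[k] Tot (Y j) :=
  if j < i then Tot.sgn (Y j) else if j = i then Tot.d (Y j) else LinearMap.id

theorem leibnizFactor_apply (Y : Fin n → ChainComplex (ModuleCat.{u} k) ℕ) (i j : Fin n)
    (y : Tot (Y j)) : leibnizFactor Y i j y =
      if j < i then Tot.sgn (Y j) y else if j = i then Tot.d (Y j) y else y := by
  unfold leibnizFactor
  split_ifs <;> rfl

/-- The shuffle map is a chain map. -/
theorem tot_d_shuffleMap (x : ∀ i, Tot (normalized (X i))) :
    Tot.d _ (shuffleMap f x) =
      ∑ i, shuffleMap f fun j => leibnizFactor (fun i => normalized (X i)) i j (x j) := by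
  have key := IsMultilin.ext_span (k := k) (f := fun x => Tot.d _ (shuffleMap f x))
    (g := fun x => (∑ i, (shuffleMap f).compLinearMap
      (leibnizFactor (fun i => normalized (X i)) i)) x)
    ((IsMultilin.of_multilinear _).linear_comp _) (IsMultilin.of_multilinear _)
    (fun i => {x | ∃ N z, x = cls (X i) N z}) (fun i => cls_span (X i)) ?_ x
  · refine key.trans ?_
    rw [_root_.sum_apply]
    rfl
  · intro x hx
    choose q z hz using hx
    obtain rfl : x = fun i => cls (X i) (q i) (z i) := funext hz
    rw [tot_d_shuffleMap_cls_eq_sum, _root_.sum_apply]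
    refine Finset.sum_congr rfl fun i _ => ?_
    rw [MultilinearMap.compLinearMap_apply]
    have h : (fun j => leibnizFactor (fun i => normalized (X i)) i j (cls (X j) (q j) (z j))) =
        fun j => (if j < i then (-1 : k) ^ q j else 1) • Function.update
          (fun i => cls (X i) (q i) (z i)) i (Tot.d _ (cls (X i) (q i) (z i))) j := by
      funext j
      rw [leibnizFactor_apply]
      by_cases h1 : j < i
      · rw [if_pos h1, if_pos h1, Function.update_of_ne h1.ne]
        exact tot_sgn_of _ _ _
      · rw [if_neg h1, if_neg h1, one_smul]
        by_cases h2 : j = i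
        · subst h2
          rw [if_pos rfl, Function.update_self]
        · rw [if_neg h2, Function.update_of_ne h2]
    rw [h, MultilinearMap.map_smul_univ, ← Finset.prod_filter, Finset.prod_pow_eq_pow_sum]

end Leibniz

section NormalizedOperads

variable {k : Type u} [CommRing k]

theorem shSum_eq_cls {L : Type} [Fintype L] [DecidableEq L]
    {Z : SimplicialObject (ModuleCat.{u} k)} (r : L → L → Prop) (q : L → ℕ) (N : ℕ)
    (F : (∀ l, ⦋N⦌ ⟶ ⦋q l⦌) → Z _⦋N⦌) :
    shSum r q N F = Tot.of (normalized Z) N ((degen Z N).mkQ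
      (∑ w : Word N q, (-1 : k) ^ inversions r w.1 • F w.proj)) := by
  refine Eq.trans ?_ (map_sum (cls Z N) _ _).symm
  exact Finset.sum_congr rfl fun w _ => (map_smul (cls Z N) _ _).symm

/-- Normalization takes maps out of degreewise tensor products to chain maps. -/
theorem chains_isChainMultimap {n : ℕ} {X : SimplicialObject (ModuleCat.{u} k)}
    {Y : Fin n → SimplicialObject (ModuleCat.{u} k)} {Z : SimplicialObject (ModuleCat.{u} k)}
    (f : SMultimap (Fin.cons (α := fun _ => SimplicialObject (ModuleCat.{u} k)) X Y) Z) :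
    IsChainMultimap f.chains where
  degree a q x y := by
    obtain ⟨x', hx⟩ := of_eq_cls X a x
    choose y' hy using fun i => of_eq_cls (Y i) (q i) (y i)
    rw [hx, funext hy, chains_cls]
    have hN : ∑ i, (Fin.cons (α := fun _ => ℕ) a q : Fin (n + 1) → ℕ) i = a + ∑ i, q i :=
      Fin.sum_univ_succ _
    rw [← hN]
    exact ⟨_, shSum_eq_cls _ _ _ _⟩
  leibniz x y := by
    refine (tot_d_shuffleMap f _).trans ?_
    rw [Fin.sum_univ_succ]
    refine congrArg₂ (· + ·) ?_ (Finset.sum_congr rfl fun i _ => ?_)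
    · refine congrArg (shuffleMap f) (funext fun j => ?_)
      rw [leibnizFactor_apply]
      induction j using Fin.cases with
      | zero => exact (if_neg (lt_irrefl _)).trans (if_pos rfl)
      | succ j => exact (if_neg (Fin.not_lt_zero _)).trans (if_neg (Fin.succ_ne_zero j))
    · refine congrArg (shuffleMap f) (funext fun j => ?_)
      rw [leibnizFactor_apply]
      induction j using Fin.cases with
      | zero => exact if_pos (Fin.succ_pos i)
      | succ j =>
        refine if_congr Fin.succ_lt_succ_iff rfl (if_congr Fin.succ_inj rfl rfl)

end NormalizedOperads

/-! ### Normalization of operads and algebras -/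

section NormalizedOperads

variable {k : Type u} [CommRing k]

theorem degen_zero (Z : SimplicialObject (ModuleCat.{u} k)) : degen Z 0 = ⊥ := by
  refine (Submodule.span_eq_bot).mpr ?_
  rintro _ ⟨m, hm, _⟩
  exact absurd hm (Nat.not_lt_zero _)

theorem degen_zero_le_ker (Z : SimplicialObject (ModuleCat.{u} k)) (a : (Z _⦋0⦌) →ₗ[k] k) :
    degen Z 0 ≤ LinearMap.ker a := by
  rw [degen_zero]
  exact bot_le

theorem d_comp_liftQ (Z : SimplicialObject (ModuleCat.{u} k)) (a : (Z _⦋0⦌) →ₗ[k] k)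
    (ha : ∀ z : Z _⦋1⦌, a ((Z.δ 0).hom z) = a ((Z.δ 1).hom z)) :
    (normalized Z).d 1 0 ≫
      ModuleCat.ofHom (Y := k) ((degen Z 0).liftQ a (degen_zero_le_ker Z a)) = 0 := by
  refine ModuleCat.hom_ext (Submodule.linearMap_qext _ (LinearMap.ext fun z => ?_))
  refine (congrArg ((degen Z 0).liftQ a (degen_zero_le_ker Z a)) (normalized_d_mkQ Z 0 z)).trans ?_
  refine ((degen Z 0).liftQ_apply a _).trans ?_
  rw [Fin.sum_univ_two]
  change a (((-1 : k) ^ 0) • (Z.δ 0).hom z + ((-1 : k) ^ 1) • (Z.δ 1).hom z) = 0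
  rw [map_add, map_smul, map_smul, ha]
  simp

/-- The augmentation of `𝒩Z` given by a linear form on `Z_0` that agrees on the two faces of each
`1`-simplex. -/
noncomputable def normAug (Z : SimplicialObject (ModuleCat.{u} k)) (a : (Z _⦋0⦌) →ₗ[k] k)
    (ha : ∀ z : Z _⦋1⦌, a ((Z.δ 0).hom z) = a ((Z.δ 1).hom z)) :
    normalized Z ⟶ unitComplex k :=
  (ChainComplex.toSingle₀Equiv (normalized Z) (ModuleCat.of k k)).symm ⟨_, d_comp_liftQ Z a ha⟩

theorem augment_normAug (Z : SimplicialObject (ModuleCat.{u} k)) (a : (Z _⦋0⦌) →ₗ[k] k)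
    (ha : ∀ z : Z _⦋1⦌, a ((Z.δ 0).hom z) = a ((Z.δ 1).hom z)) (z : Z _⦋0⦌) :
    augment (normAug Z a ha) ((degen Z 0).mkQ z) = a z :=
  congrArg (fun g => g.hom ((degen Z 0).mkQ z))
    (ChainComplex.toSingle₀Equiv_symm_apply_f_zero (C := normalized Z) _ (d_comp_liftQ Z a ha))

/-- The normalization of a constant simplicial module `k` is `k`, in degree `0`. -/
theorem normalized_const (Z : SimplicialObject (ModuleCat.{u} k))
    (α : Z ≅ (Functor.const _).obj (ModuleCat.of k k)) :
    Nonempty (normalized Z ≅ unitComplex k) := by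
  have hbij : ∀ c, Function.Bijective (α.hom.app c).hom := fun c =>
    (ConcreteCategory.isIso_iff_bijective (α.hom.app c)).mp inferInstance
  have hnat : ∀ {p q : ℕ} (θ : ⦋q⦌ ⟶ ⦋p⦌) (z : Z _⦋p⦌),
      (α.hom.app (op ⦋q⦌)).hom ((Z.map θ.op).hom z) = (α.hom.app (op ⦋p⦌)).hom z := by
    intro p q θ z
    exact congrArg (fun g => g.hom z) (α.hom.naturality θ.op)
  let ε := normAug Z (α.hom.app (op ⦋0⦌)).hom fun z =>
    (hnat (SimplexCategory.δ 0) z).trans (hnat (SimplexCategory.δ 1) z).symm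
  have : ∀ n, IsIso (ε.f n) := by
    intro n
    cases n with
    | zero =>
      refine (ConcreteCategory.isIso_iff_bijective (ε.f 0)).mpr ⟨?_, fun c => ?_⟩
      · refine (injective_iff_map_eq_zero (augment ε)).mpr fun z hz => ?_
        obtain ⟨z, rfl⟩ := (degen Z 0).mkQ_surjective z
        have hz' := (augment_normAug Z _ _ z).symm.trans hz
        rw [(hbij _).1 (hz'.trans (map_zero _).symm)]
        exact map_zero _
      · obtain ⟨z, hz⟩ := (hbij _).2 c
        exact ⟨(degen Z 0).mkQ z, (augment_normAug Z _ _ z).trans hz⟩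
    | succ n =>
      -- In positive degrees all elements of a constant simplicial module are degenerate.
      have h1 : Limits.IsZero ((normalized Z).X (n + 1)) := by
        refine ModuleCat.isZero_iff_subsingleton.mpr ?_
        refine Submodule.Quotient.subsingleton_iff.mpr (top_le_iff.mp fun z _ => ?_)
        refine Submodule.subset_span ⟨n, Nat.lt_succ_self n, SimplexCategory.σ 0,
          (Z.map (SimplexCategory.δ 0).op).hom z, (hbij _).1 ?_⟩
        rw [hnat, hnat]
      have h2 : Limits.IsZero ((unitComplex k).X (n + 1)) :=
        HomologicalComplex.isZero_single_obj_X _ _ _ _ (Nat.succ_ne_zero n)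
      exact Limits.isIso_of_source_target_iso_zero _ h1.isoZero h2.isoZero
  have := HomologicalComplex.Hom.isIso_of_components ε
  exact ⟨asIso ε⟩

/-- The normalization of an operad in simplicial modules is an operad in chain complexes. -/
theorem chains_isDGOperad {O : SOperadData k} (hO : IsSOperad O) : IsDGOperad O.chains where
  chain _ _ := chains_isChainMultimap _
  graded := chains_isOperad hO.level
  zero := hO.zero.elim fun α => normalized_const _ α

/-- The normalization of an algebra over an operad in simplicial modules is an algebra over the
normalized operad. -/
theorem chains_isDGAlgebra {O : SOperadData k} {X : SimplicialObject (ModuleCat.{u} k)}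
    {χ : ∀ n, SMultimap (Fin.cons (α := fun _ => SimplicialObject (ModuleCat.{u} k)) (O.P n)
      fun _ : Fin n => X) X} (hχ : IsSAlgebra O X χ) :
    IsDGAlgebra O.chains (normalized X) fun n => (χ n).chains where
  chain _ := chains_isChainMultimap _
  graded := chains_isOperadAlgebra hχ

end NormalizedOperads

/-! ### The chain-level Barratt–Eccles operad is `E_∞` -/

section HomotopyOfLinearMaps

variable {k : Type u} [CommRing k] {K L : ChainComplex (ModuleCat.{u} k) ℕ}

/-- A homotopy between chain maps, from linear maps of degree `1`. -/
noncomputable def homotopyOfLinear (f g : K ⟶ L) (h : ∀ n, K.X n →ₗ[k] L.X (n + 1))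
    (h0 : ∀ x, (f.f 0).hom x = (L.d 1 0).hom (h 0 x) + (g.f 0).hom x)
    (hs : ∀ n x, (f.f (n + 1)).hom x = h n ((K.d (n + 1) n).hom x) +
      (L.d (n + 2) (n + 1)).hom (h (n + 1) x) + (g.f (n + 1)).hom x) : Homotopy f g where
  hom i j := if e : i + 1 = j then ModuleCat.ofHom (h i) ≫ eqToHom (by rw [e]) else 0
  zero i j w := dif_neg w
  comm n := by
    cases n with
    | zero =>
      rw [Homotopy.dNext_zero_chainComplex, Homotopy.prevD_chainComplex]
      refine ModuleCat.hom_ext (LinearMap.ext fun x => ?_)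
      simpa using h0 x
    | succ n =>
      rw [Homotopy.dNext_succ_chainComplex, Homotopy.prevD_chainComplex]
      refine ModuleCat.hom_ext (LinearMap.ext fun x => ?_)
      simpa using hs n x

end HomotopyOfLinearMaps

section BarrattEcclesContraction

variable {k : Type u} [CommRing k]

/-- A simplex of `N(ES_m)` is degenerate if two successive vertices are equal. -/
def DMod.IsDegenerate {m d : ℕ} (v : Fin (d + 1) → Equiv.Perm (Fin m)) : Prop :=
  ∃ i : Fin d, v i.castSucc = v i.succ

theorem DMod.IsDegenerate.comp {m d q : ℕ} (v : Fin (q + 1) → Equiv.Perm (Fin m)) (hq : q < d)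
    (θ : ⦋d⦌ ⟶ ⦋q⦌) : DMod.IsDegenerate (v ∘ θ.toOrderHom) := by
  have h : ∃ i : Fin d, θ.toOrderHom i.castSucc = θ.toOrderHom i.succ := by
    by_contra! hne
    have hm : StrictMono θ.toOrderHom := Fin.strictMono_iff_lt_succ.mpr fun i =>
      lt_of_le_of_ne (θ.toOrderHom.monotone (Fin.castSucc_lt_succ).le) (hne i)
    have := Fintype.card_le_of_injective _ hm.injective
    simp at this
    omega
  obtain ⟨i, hi⟩ := h
  exact ⟨i, congrArg v hi⟩

/-- The degenerate elements of `k[N(ES_m)]` are spanned by the degenerate simplices. -/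
theorem DMod.degen_eq_span (m d : ℕ) : degen (DMod k m) d =
    Submodule.span k (DMod.simplex k '' {v | DMod.IsDegenerate v}) := by
  refine le_antisymm (Submodule.span_le.mpr ?_) (Submodule.span_le.mpr ?_)
  · rintro _ ⟨q, hq, θ, y, rfl⟩
    have hy : y ∈ Submodule.span k (Set.range fun v : Fin (q + 1) → Equiv.Perm (Fin m) =>
        DMod.simplex k v) := by
      rw [DMod.span_simplex]
      trivial
    induction hy using Submodule.span_induction with
    | mem y hy =>
      obtain ⟨v, rfl⟩ := hy
      rw [DMod.map_simplex]
      exact Submodule.subset_span ⟨_, DMod.IsDegenerate.comp v hq θ, rfl⟩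
    | zero => rw [map_zero]; exact Submodule.zero_mem _
    | add a b _ _ ha hb => rw [map_add]; exact Submodule.add_mem _ ha hb
    | smul c a _ ha => rw [map_smul]; exact Submodule.smul_mem _ c ha
  · rintro _ ⟨v, ⟨i, hi⟩, rfl⟩
    cases d with
    | zero => exact i.elim0
    | succ d =>
      refine Submodule.subset_span ⟨d, Nat.lt_succ_self d, SimplexCategory.σ i,
        DMod.simplex k (v ∘ i.succ.succAbove), ?_⟩
      rw [DMod.map_simplex]
      refine congrArg (DMod.simplex k) (funext fun t => ?_)
      change v t = v (i.succ.succAbove (i.predAbove t))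
      by_cases ht : t = i.succ
      · subst ht
        rw [Fin.predAbove_succ_self, Fin.succAbove_of_castSucc_lt _ _ (Fin.castSucc_lt_succ), hi]
      · rw [Fin.succ_succAbove_predAbove ht]

/-- The class in `𝒩 k[N(ES_m)]` of a simplex. -/
noncomputable def DMod.gen (k : Type u) [CommRing k] {m d : ℕ}
    (v : Fin (d + 1) → Equiv.Perm (Fin m)) : (normalized (DMod k m)).X d :=
  (degen (DMod k m) d).mkQ (DMod.simplex k v)

theorem DMod.gen_eq_zero {m d : ℕ} {v : Fin (d + 1) → Equiv.Perm (Fin m)}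
    (hv : DMod.IsDegenerate v) : DMod.gen k v = 0 := by
  refine (Submodule.Quotient.mk_eq_zero _).mpr ?_
  rw [DMod.degen_eq_span]
  exact Submodule.subset_span ⟨v, hv, rfl⟩

theorem DMod.normalized_hom_ext {m d : ℕ} {M : Type u} [AddCommGroup M] [Module k M]
    (f g : (normalized (DMod k m)).X d →ₗ[k] M) (h : ∀ v, f (DMod.gen k v) = g (DMod.gen k v)) :
    f = g :=
  Submodule.linearMap_qext _ (DMod.hom_ext _ _ h)

theorem DMod.d_gen {m d : ℕ} (v : Fin (d + 2) → Equiv.Perm (Fin m)) :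
    ((normalized (DMod k m)).d (d + 1) d).hom (DMod.gen k v) =
      ∑ t : Fin (d + 2), (-1 : k) ^ (t : ℕ) • DMod.gen k (v ∘ t.succAbove) := by
  refine (normalized_d_mkQ _ _ _).trans ?_
  rw [map_sum]
  refine Finset.sum_congr rfl fun t _ => ?_
  rw [map_smul]
  refine congrArg (fun z => (-1 : k) ^ (t : ℕ) • (degen (DMod k m) d).mkQ z) ?_
  exact DMod.map_simplex v (SimplexCategory.δ t)

/-- A linear map out of `𝒩 k[N(ES_m)]`, from its values on simplices. -/
noncomputable def DMod.desc {m d : ℕ} {M : Type u} [AddCommGroup M] [Module k M]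
    (g : (Fin (d + 1) → Equiv.Perm (Fin m)) → M) (hg : ∀ v, DMod.IsDegenerate v → g v = 0) :
    (normalized (DMod k m)).X d →ₗ[k] M :=
  (degen (DMod k m) d).liftQ (Finsupp.linearCombination k g) (by
    rw [DMod.degen_eq_span]
    refine Submodule.span_le.mpr ?_
    rintro _ ⟨v, hv, rfl⟩
    exact (Finsupp.linearCombination_single k 1 v).trans ((one_smul _ _).trans (hg v hv)))

theorem DMod.desc_gen {m d : ℕ} {M : Type u} [AddCommGroup M] [Module k M]
    (g : (Fin (d + 1) → Equiv.Perm (Fin m)) → M) (hg : ∀ v, DMod.IsDegenerate v → g v = 0)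
    (v : Fin (d + 1) → Equiv.Perm (Fin m)) : DMod.desc (k := k) g hg (DMod.gen k v) = g v :=
  (Finsupp.linearCombination_single k 1 v).trans (one_smul _ _)

/-- The sum of the coefficients, on `k[N(ES_m)]_0`. -/
noncomputable def DMod.coeffSum (k : Type u) [CommRing k] (m : ℕ) : (DMod k m) _⦋0⦌ →ₗ[k] k :=
  Finsupp.linearCombination k fun _ : Fin 1 → Equiv.Perm (Fin m) => (1 : k)

theorem DMod.coeffSum_simplex (m : ℕ) (v : Fin 1 → Equiv.Perm (Fin m)) :
    DMod.coeffSum k m (DMod.simplex k v) = 1 :=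
  (Finsupp.linearCombination_single k 1 v).trans (one_smul _ _)

/-- The augmentation of the Barratt–Eccles complex. -/
noncomputable def dchEps (k : Type u) [CommRing k] (m : ℕ) : (Dch k).P m ⟶ unitComplex k :=
  normAug (DMod k m) (DMod.coeffSum k m) fun z => by
    have h : DMod.coeffSum k m ∘ₗ ((DMod k m).δ (n := 0) 0).hom =
        DMod.coeffSum k m ∘ₗ ((DMod k m).δ (n := 0) 1).hom := by
      refine DMod.hom_ext _ _ fun v => ?_
      refine (congrArg (DMod.coeffSum k m) (DMod.map_simplex v (SimplexCategory.δ 0))).trans ?_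
      refine Eq.trans ?_
        (congrArg (DMod.coeffSum k m) (DMod.map_simplex v (SimplexCategory.δ 1))).symm
      rw [DMod.coeffSum_simplex, DMod.coeffSum_simplex]
    exact congrArg (fun f => f z) h

theorem augment_dchEps_gen (m : ℕ) (v : Fin 1 → Equiv.Perm (Fin m)) :
    augment (dchEps k m) (DMod.gen k v) = 1 :=
  (augment_normAug _ _ _ _).trans (DMod.coeffSum_simplex m v)

theorem augment_dchEps (m : ℕ) : augment (dchEps k m) = dchAug k m :=
  DMod.normalized_hom_ext _ _ fun v => (augment_dchEps_gen m v).trans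
    (DMod.coeffSum_simplex (k := k) m v).symm

/-- The vertex `1` of `N(ES_m)`. -/
noncomputable def dchEta (k : Type u) [CommRing k] (m : ℕ) : unitComplex k ⟶ (Dch k).P m :=
  (ChainComplex.fromSingle₀Equiv ((Dch k).P m) (ModuleCat.of k k)).symm
    (ModuleCat.ofHom (LinearMap.toSpanSingleton k _ (DMod.gen k (m := m) fun _ : Fin 1 => 1)))

theorem dchEta_f_zero (m : ℕ) (c : k) :
    ((dchEta k m).f 0).hom c = c • DMod.gen k (m := m) fun _ : Fin 1 => 1 :=
  congrArg (fun g : ModuleCat.of k k ⟶ (normalized (DMod k m)).X 0 => g.hom c)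
    ((ChainComplex.fromSingle₀Equiv ((Dch k).P m) (ModuleCat.of k k)).apply_symm_apply
    (ModuleCat.ofHom (LinearMap.toSpanSingleton k _ (DMod.gen k (m := m) fun _ : Fin 1 => 1))))

/-- The contraction `(v_0, …, v_d) ↦ (1, v_0, …, v_d)`. -/
noncomputable def dchContraction (k : Type u) [CommRing k] (m d : ℕ) :
    (normalized (DMod k m)).X d →ₗ[k] (normalized (DMod k m)).X (d + 1) :=
  DMod.desc (fun v => DMod.gen k (Fin.cons 1 v : Fin (d + 2) → Equiv.Perm (Fin m)))
    fun _ ⟨i, hi⟩ => DMod.gen_eq_zero ⟨i.succ, hi⟩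

theorem dchContraction_gen (m d : ℕ) (v : Fin (d + 1) → Equiv.Perm (Fin m)) :
    dchContraction k m d (DMod.gen k v) =
      DMod.gen k (Fin.cons 1 v : Fin (d + 2) → Equiv.Perm (Fin m)) :=
  DMod.desc_gen _ _ v

/-- In degree `0`, `dchContraction` is a homotopy between the identity and the augmentation. -/
theorem dchContraction_zero (m : ℕ) (x : (normalized (DMod k m)).X 0) :
    ((normalized (DMod k m)).d 1 0).hom (dchContraction k m 0 x) = x - dchAug k m x •
      DMod.gen k (m := m) fun _ : Fin 1 => 1 := by
  have h : ((normalized (DMod k m)).d 1 0).hom ∘ₗ dchContraction k m 0 =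
      LinearMap.id - (dchAug k m).smulRight (DMod.gen k (m := m) fun _ : Fin 1 => 1) := by
    refine DMod.normalized_hom_ext _ _ fun v => ?_
    change ((normalized (DMod k m)).d 1 0).hom (dchContraction k m 0 (DMod.gen k v)) =
      DMod.gen k v - dchAug k m (DMod.gen k v) • _
    rw [dchContraction_gen, DMod.d_gen, ← augment_dchEps, augment_dchEps_gen, Fin.sum_univ_two]
    have h0 : (Fin.cons 1 v : Fin 2 → Equiv.Perm (Fin m)) ∘ (0 : Fin 2).succAbove = v := rfl
    have h1 : (Fin.cons 1 v : Fin 2 → Equiv.Perm (Fin m)) ∘ (1 : Fin 2).succAbove = fun _ => 1 :=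
      funext fun s => by rw [Subsingleton.elim s 0]; rfl
    rw [h0, h1]
    simp [sub_eq_add_neg]
  exact congrArg (fun f => f x) h

/-- In positive degrees, `dchContraction` is a homotopy between the identity and `0`. -/
theorem dchContraction_succ (m d : ℕ) (x : (normalized (DMod k m)).X (d + 1)) :
    ((normalized (DMod k m)).d (d + 2) (d + 1)).hom (dchContraction k m (d + 1) x) =
      x - dchContraction k m d (((normalized (DMod k m)).d (d + 1) d).hom x) := by
  have h : ((normalized (DMod k m)).d (d + 2) (d + 1)).hom ∘ₗ dchContraction k m (d + 1) =
      LinearMap.id - dchContraction k m d ∘ₗ ((normalized (DMod k m)).d (d + 1) d).hom := by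
    refine DMod.normalized_hom_ext _ _ fun v => ?_
    change ((normalized (DMod k m)).d (d + 2) (d + 1)).hom
      (dchContraction k m (d + 1) (DMod.gen k v)) = DMod.gen k v - dchContraction k m d
        (((normalized (DMod k m)).d (d + 1) d).hom (DMod.gen k v))
    rw [dchContraction_gen, DMod.d_gen, DMod.d_gen, map_sum, Fin.sum_univ_succ, sub_eq_add_neg,
      ← Finset.sum_neg_distrib]
    refine congrArg₂ (· + ·) ?_ (Finset.sum_congr rfl fun t _ => ?_)
    · simp only [Fin.val_zero, pow_zero, one_smul]
      rfl
    · have ht : (Fin.cons 1 v : Fin (d + 3) → Equiv.Perm (Fin m)) ∘ t.succ.succAbove =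
          Fin.cons 1 (v ∘ t.succAbove) := by
        funext s
        induction s using Fin.cases with
        | zero => rfl
        | succ s => simp
      rw [ht, map_smul, dchContraction_gen, Fin.val_succ, pow_succ]
      simp
  exact congrArg (fun f => f x) h

/-- The augmentation of the Barratt–Eccles complex is a homotopy equivalence. -/
noncomputable def dchHomotopyEquiv (k : Type u) [CommRing k] (m : ℕ) :
    HomotopyEquiv ((Dch k).P m) (unitComplex k) where
  hom := dchEps k m
  inv := dchEta k m
  homotopyHomInvId := by
    refine (homotopyOfLinear _ _ (dchContraction k m) (fun x => ?_) fun n x => ?_).symm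
    · have h : ((dchEps k m ≫ dchEta k m).f 0).hom x =
          dchAug k m x • DMod.gen k (m := m) fun _ : Fin 1 => 1 :=
        (dchEta_f_zero m _).trans (by rw [← augment_dchEps]; rfl)
      refine Eq.trans ?_ (congrArg₂ (fun a b : (normalized (DMod k m)).X 0 => a + b)
        (dchContraction_zero m x) h).symm
      exact (sub_add_cancel _ _).symm
    · have h : (dchEps k m ≫ dchEta k m).f (n + 1) = 0 := by
        rw [HomologicalComplex.comp_f]
        exact (HomologicalComplex.isZero_single_obj_X (ComplexShape.down ℕ) 0
          (ModuleCat.of k k) (n + 1) (Nat.succ_ne_zero n)).eq_of_tgt ((dchEps k m).f (n + 1)) 0 ▸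
            Limits.zero_comp
      have h' : ((dchEps k m ≫ dchEta k m).f (n + 1)).hom x = 0 := by rw [h]; rfl
      refine Eq.trans ?_ (congrArg₂ (fun a b : (normalized (DMod k m)).X (n + 1) => _ + a + b)
        (dchContraction_succ m n x) h').symm
      exact ((add_zero _).trans (add_sub_cancel _ _)).symm
  homotopyInvHomId := Homotopy.ofEq (by
    refine HomologicalComplex.to_single_hom_ext (ModuleCat.hom_ext (LinearMap.ext fun (c : k) => ?_))
    refine (congrArg (augment (dchEps k m)) (dchEta_f_zero m c)).trans ?_
    exact (map_smul (augment (dchEps k m)) (c : k) _).trans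
      ((congrArg ((c : k) • ·) (augment_dchEps_gen m _)).trans (mul_one (c : k))))

theorem dch_act_gen (m d : ℕ) (σ : Equiv.Perm (Fin m)) (v : Fin (d + 1) → Equiv.Perm (Fin m)) :
    (((Dch k).act m σ).f d).hom (DMod.gen k v) = DMod.gen k fun i => v i * σ := by
  refine congrArg (degen (DMod k m) d).mkQ ?_
  exact Finsupp.mapDomain_single (f := fun v : Fin (d + 1) → Equiv.Perm (Fin m) =>
    fun i => v i * σ)

theorem dch_act_comp_eps (m : ℕ) (σ : Equiv.Perm (Fin m)) :
    (Dch k).act m σ ≫ dchEps k m = dchEps k m := by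
  refine HomologicalComplex.to_single_hom_ext (ModuleCat.hom_ext
    (DMod.normalized_hom_ext _ _ fun v => ?_))
  refine (congrArg (augment (dchEps k m)) (dch_act_gen m 0 σ v)).trans ?_
  exact (augment_dchEps_gen m _).trans (augment_dchEps_gen m v).symm

/-- The classes of the nondegenerate simplices form a basis, on which the symmetric group acts freely;
the orbits are represented by the simplices with first vertex `1`. -/
theorem dch_free (n d : ℕ) :
    ∃ (ι : Type) (b : Module.Basis (ι × Equiv.Perm (Fin n)) k (((Dch k).P n).X d)),
      ∀ (i : ι) (τ σ : Equiv.Perm (Fin n)),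
        (((Dch k).act n σ).f d).hom (b (i, τ)) = b (i, τ * σ) := by
  classical
  let S : Type := {v : Fin (d + 1) → Equiv.Perm (Fin n) // ¬ DMod.IsDegenerate v}
  let ι : Type := {v : S // v.1 0 = 1}
  let e : ι × Equiv.Perm (Fin n) ≃ S :=
    { toFun := fun p => ⟨fun i => p.1.1.1 i * p.2, fun ⟨i, hi⟩ => p.1.1.2
        ⟨i, mul_right_cancel hi⟩⟩
      invFun := fun v => (⟨⟨fun i => v.1 i * (v.1 0)⁻¹, fun ⟨i, hi⟩ => v.2
        ⟨i, mul_right_cancel hi⟩⟩, mul_inv_cancel _⟩, v.1 0)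
      left_inv := by
        rintro ⟨⟨⟨v, hv⟩, h0⟩, τ⟩
        have h0 : v 0 = 1 := h0
        simp [h0]
      right_inv := by
        rintro ⟨v, hv⟩
        simp }
  let f : (normalized (DMod k n)).X d →ₗ[k] (S →₀ k) :=
    DMod.desc (fun v => if h : DMod.IsDegenerate v then 0 else Finsupp.single ⟨v, h⟩ 1)
      fun v hv => dif_pos hv
  let g : (S →₀ k) →ₗ[k] (normalized (DMod k n)).X d :=
    Finsupp.linearCombination k fun v : S => DMod.gen k v.1
  have hf : ∀ v : S, f (DMod.gen k v.1) = Finsupp.single v 1 := fun v =>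
    (DMod.desc_gen _ _ v.1).trans (dif_neg v.2)
  have hg : ∀ v : S, g (Finsupp.single v 1) = DMod.gen k v.1 := fun v =>
    (Finsupp.linearCombination_single k 1 v).trans (one_smul _ _)
  have hfg : f ∘ₗ g = LinearMap.id := Finsupp.lhom_ext' fun v => LinearMap.ext_ring
    ((congrArg f (hg v)).trans (hf v))
  have hgf : g ∘ₗ f = LinearMap.id := by
    refine DMod.normalized_hom_ext _ _ fun v => ?_
    by_cases hv : DMod.IsDegenerate v
    · rw [DMod.gen_eq_zero hv, map_zero, map_zero]
    · exact (congrArg g (hf ⟨v, hv⟩)).trans (hg ⟨v, hv⟩)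
  let E : (normalized (DMod k n)).X d ≃ₗ[k] (S →₀ k) := LinearEquiv.ofLinearMap f g hfg hgf
  let b : Module.Basis (ι × Equiv.Perm (Fin n)) k ((normalized (DMod k n)).X d) :=
    Module.Basis.ofRepr (E.trans (Finsupp.domLCongr e.symm))
  have hb : ∀ p, b p = DMod.gen k (e p).1 := by
    intro p
    refine (congrArg g (Finsupp.domLCongr_single (R := k) e p (1 : k))).trans (hg _)
  refine ⟨ι, b, fun i τ σ => ?_⟩
  refine (congrArg _ (hb _)).trans ((dch_act_gen n d σ _).trans (Eq.trans ?_ (hb _).symm))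
  exact congrArg (DMod.gen k) (funext fun s => mul_assoc _ _ _)

/-- In degree `0` there is only the empty word, so that operations on normalized complexes are those
of simplicial degree `0`. -/
theorem chains_cls_zero {n : ℕ} {X : SimplicialObject (ModuleCat.{u} k)}
    {Y : Fin n → SimplicialObject (ModuleCat.{u} k)} {Z : SimplicialObject (ModuleCat.{u} k)}
    (f : SMultimap (Fin.cons (α := fun _ => SimplicialObject (ModuleCat.{u} k)) X Y) Z)
    (x : X _⦋0⦌) (y : ∀ i, (Y i) _⦋0⦌) :
    f.chains (cls X 0 x) (fun i => cls (Y i) 0 (y i)) = cls Z 0 (f.level 0 x y) := by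
  rw [chains_cls]
  have key : ∀ N, 0 = N → shSum (· < ·) (Fin.cons (α := fun _ => ℕ) 0 fun _ : Fin n => 0) N
      (fun θ => f.level N ((X.map (θ 0).op).hom x) fun i => ((Y i).map (θ i.succ).op).hom (y i)) =
        cls Z 0 (f.level 0 x y) := by
    rintro _ rfl
    refine shSum_single (0 : Fin (n + 1)) _ (fun a => lt_irrefl a) _ _ rfl (fun l _ => ?_) _ _ ?_
    · induction l using Fin.cases <;> rfl
    · intro θ _
      have h : ∀ (W : SimplicialObject (ModuleCat.{u} k)) (φ : ⦋0⦌ ⟶ ⦋0⦌) (w : W _⦋0⦌),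
          (W.map φ.op).hom w = w := fun W φ w => by
        rw [(hom_zero_eq φ).trans (hom_zero_eq (𝟙 _)).symm, op_id, W.map_id]
        rfl
      exact congrArg₂ (fun u v => f.level 0 u v) (h X (θ 0) x)
        (funext fun i => h (Y i) (θ i.succ) (y i))
  exact key _ (by simp [Fin.sum_univ_succ])

/-- The sum of the coefficients is multiplicative. -/
theorem DMod.coeffSum_comp (n : ℕ) (j : Fin n → ℕ) (x : (DMod k n) _⦋0⦌)
    (y : ∀ s, (DMod k (j s)) _⦋0⦌) :
    DMod.coeffSum k _ (DMod.comp k n j 0 x y) =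
      DMod.coeffSum k n x * ∏ s, DMod.coeffSum k (j s) (y s) := by
  have h : (DMod.coeffSum k _).compMultilinearMapₗ k ∘ₗ DMod.comp k n j 0 =
      (DMod.coeffSum k n).smulRight ((MultilinearMap.mkPiAlgebra k (Fin n) k).compLinearMap
        fun s => DMod.coeffSum k (j s)) := by
    refine DMod.hom_ext _ _ fun σ => MultilinearMap.ext fun y => ?_
    refine IsMultilin.ext_span (IsMultilin.of_multilinear _) (IsMultilin.of_multilinear _) _
      (fun s => DMod.span_simplex (j s) 0) (fun y hy => ?_) y
    choose τ hτ using hy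
    obtain rfl : (fun s => DMod.simplex k (τ s)) = y := funext hτ
    change DMod.coeffSum k _ (DMod.comp k n j 0 (DMod.simplex k σ) fun s => DMod.simplex k (τ s)) =
      DMod.coeffSum k n (DMod.simplex k σ) *
        MultilinearMap.mkPiAlgebra k (Fin n) k fun s => DMod.coeffSum k (j s) (DMod.simplex k (τ s))
    rw [DMod.comp_simplex, MultilinearMap.mkPiAlgebra_apply]
    simp only [DMod.coeffSum_simplex, Finset.prod_const_one, mul_one]
  exact congrArg (fun f => f x y) h

/-- The chain-level Barratt–Eccles operad is an `E_∞`-operad. -/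
theorem Dch_isEInfinity : IsEInfinity (Dch k) where
  operad := chains_isDGOperad Dsm_isSOperad
  contractible := by
    refine ⟨dchEps k, fun n => ⟨dchHomotopyEquiv k n, rfl⟩, dch_act_comp_eps,
      augment_dchEps_gen 1 _, fun n j x y z h => ?_⟩
    obtain ⟨x, rfl⟩ := (degen (DMod k n) 0).mkQ_surjective x
    choose y' hy using fun s => (degen (DMod k (j s)) 0).mkQ_surjective (y s)
    obtain rfl : (fun s => (degen (DMod k (j s)) 0).mkQ (y' s)) = y := funext hy
    have h1 : (degen (DMod k (∑ s, j s)) 0).mkQ (DMod.comp k n j 0 x y') = z :=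
      DirectSum.of_injective (β := fun p => (normalized (DMod k (∑ s, j s))).X p) 0
        ((chains_cls_zero ((Dsm k).γ n j) x y').symm.trans h)
    rw [← h1]
    refine (augment_normAug _ _ _ _).trans ((DMod.coeffSum_comp n j x y').trans ?_)
    refine congrArg₂ (· * ·) (augment_normAug _ _ _ _).symm (Finset.prod_congr rfl fun s _ => ?_)
    exact (augment_normAug _ _ _ _).symm
  free := dch_free

end BarrattEcclesContraction

/-! ### Normalization, and homotopies of nerves -/

section Normalization

open AlgebraicTopology

variable {k : Type u} [CommRing k] (X : SimplicialObject (ModuleCat.{u} k))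

theorem toNormalized_comm (n : ℕ) :
    (ModuleCat.ofHom (degen X (n + 1)).mkQ : X _⦋n + 1⦌ ⟶ (normalized X).X (n + 1)) ≫
      (normalized X).d (n + 1) n = AlternatingFaceMapComplex.objD X n ≫
        (ModuleCat.ofHom (degen X n).mkQ : X _⦋n⦌ ⟶ (normalized X).X n) := by
  refine ModuleCat.hom_ext (LinearMap.ext fun x => ?_)
  change ((normalized X).d (n + 1) n).hom ((degen X (n + 1)).mkQ x) =
    (degen X n).mkQ ((AlternatingFaceMapComplex.objD X n).hom x)
  simp only [normalized, ChainComplex.of_d]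
  rfl

/-- The quotient map from the alternating face map complex to the normalized complex. -/
noncomputable def toNormalized : AlternatingFaceMapComplex.obj X ⟶ normalized X where
  f n := (ModuleCat.ofHom (degen X n).mkQ : X _⦋n⦌ ⟶ (normalized X).X n)
  comm' i j h := by
    obtain rfl : j + 1 = i := h
    rw [AlternatingFaceMapComplex.obj_d_eq]
    exact toNormalized_comm X j

theorem toNormalized_surjective (n : ℕ) : Function.Surjective ((toNormalized X).f n).hom :=
  (degen X n).mkQ_surjective

instance (n : ℕ) : Epi ((toNormalized X).f n) :=
  (ModuleCat.epi_iff_surjective _).mpr (toNormalized_surjective X n)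

/-- The projector `PInfty` onto the Moore complex vanishes on degenerate elements. -/
theorem degen_le_ker_PInfty (n : ℕ) :
    degen X n ≤ LinearMap.ker ((DoldKan.PInfty (X := X)).f n).hom := by
  refine Submodule.span_le.mpr fun z hz => ?_
  obtain ⟨m, hm, θ, y, rfl⟩ := hz
  have h := DoldKan.degeneracy_comp_PInfty X n θ (fun hθ => by
    have := SimplexCategory.len_le_of_mono (f := θ)
    simp at this
    omega)
  exact congrArg (fun g => g.hom y) h

theorem PInfty_comp_toNormalized (n : ℕ) :
    (DoldKan.PInfty (X := X)).f n ≫ (toNormalized X).f n = (toNormalized X).f n := by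
  have hv : DoldKan.DegeneraciesVanish (X := X) (n := n) ((toNormalized X).f n) := by
    cases n with
    | zero => trivial
    | succ n =>
      intro i
      refine ModuleCat.hom_ext (LinearMap.ext fun x => ?_)
      exact (Submodule.Quotient.mk_eq_zero _).mpr (Submodule.subset_span
        ⟨n, Nat.lt_succ_self n, SimplexCategory.σ i, x, rfl⟩)
  have h := DoldKan.PInfty_f_add_QInfty_f (X := X) n =≫ (toNormalized X).f n
  rw [Preadditive.add_comp, (DoldKan.degeneraciesVanish_iff_QInfty_f_comp _).mp hv] at h
  exact (add_zero _).symm.trans (h.trans (Category.id_comp _))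

/-- The components of the section of `toNormalized` given by `PInfty`. -/
noncomputable def fromNormalizedF (n : ℕ) :
    (normalized X).X n ⟶ (AlternatingFaceMapComplex.obj X).X n :=
  ModuleCat.ofHom ((degen X n).liftQ ((DoldKan.PInfty (X := X)).f n).hom
    (degen_le_ker_PInfty X n))

theorem toNormalized_comp_fromNormalizedF (n : ℕ) :
    (toNormalized X).f n ≫ fromNormalizedF X n = (DoldKan.PInfty (X := X)).f n := rfl

/-- The section of `toNormalized` given by `PInfty`. -/
noncomputable def fromNormalized : normalized X ⟶ AlternatingFaceMapComplex.obj X where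
  f := fromNormalizedF X
  comm' i j h := by
    rw [← cancel_epi ((toNormalized X).f i), ← Category.assoc, ← Category.assoc,
      (toNormalized X).comm i j, Category.assoc]
    exact (DoldKan.PInfty (X := X)).comm i j

/-- The quotient map onto the normalized complex is a homotopy equivalence. -/
noncomputable def normalizedEquiv :
    HomotopyEquiv (AlternatingFaceMapComplex.obj X) (normalized X) where
  hom := toNormalized X
  inv := fromNormalized X
  homotopyHomInvId := (Homotopy.ofEq (by
    ext n : 1
    exact toNormalized_comp_fromNormalizedF X n)).trans (DoldKan.homotopyPInftyToId X)
  homotopyInvHomId := Homotopy.ofEq (by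
    ext n : 1
    rw [← cancel_epi ((toNormalized X).f n), HomologicalComplex.comp_f, ← Category.assoc]
    exact (PInfty_comp_toNormalized X n).trans (Category.comp_id _).symm)

end Normalization

section NerveHomotopy

variable {C D : Type} [Category.{0} C] [Category.{0} D]

/-- The functor `Fin (p + 1) ⥤ Fin 2` given by a simplex of `Δ[1]`. -/
def simplexFunctor {p : SimplexCategoryᵒᵖ} (θ : (Δ[1] : SSet.{0}).obj p) :
    Fin (p.unop.len + 1) ⥤ Fin 2 :=
  (SSet.stdSimplex.objEquiv θ).toOrderHom.monotone.functor

theorem uncurry_mk₁_map_left {F G : C ⥤ D} (α : F ⟶ G) {a b : C} (f : a ⟶ b) :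
    (Functor.uncurry.obj (ComposableArrows.mk₁ α : ComposableArrows (C ⥤ D) 1)).map
      (show ((0 : Fin 2), a) ⟶ ((0 : Fin 2), b) from (𝟙 (0 : Fin 2), f)) = F.map f :=
  Category.id_comp _

theorem uncurry_mk₁_map_right {F G : C ⥤ D} (α : F ⟶ G) {a b : C} (f : a ⟶ b) :
    (Functor.uncurry.obj (ComposableArrows.mk₁ α : ComposableArrows (C ⥤ D) 1)).map
      (show ((1 : Fin 2), a) ⟶ ((1 : Fin 2), b) from (𝟙 (1 : Fin 2), f)) = G.map f :=
  Category.id_comp _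

/-- A natural transformation induces a homotopy between maps of nerves: it is a functor `Fin 2 × C ⥤ D`,
and its nerve is a map out of the product with `Δ[1]`. -/
def nerveHomotopy {F G : C ⥤ D} (α : F ⟶ G) : SSet.Homotopy (nerveMap F) (nerveMap G) where
  h :=
    { app := fun p => ↾ fun x => (show ComposableArrows D p.unop.len from
        (Functor.prod' (simplexFunctor x.2) (show ComposableArrows C p.unop.len from x.1)) ⋙
          Functor.uncurry.obj (ComposableArrows.mk₁ α : ComposableArrows (C ⥤ D) 1))
      naturality := fun _ _ _ => rfl }
  h₀ := by
    ext p x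
    refine CategoryTheory.Functor.ext (fun i => rfl) fun i j f => ?_
    refine Eq.trans ?_ ((Category.id_comp _).trans (Category.comp_id _)).symm
    exact uncurry_mk₁_map_left α _
  h₁ := by
    ext p x
    refine CategoryTheory.Functor.ext (fun i => rfl) fun i j f => ?_
    refine Eq.trans ?_ ((Category.id_comp _).trans (Category.comp_id _)).symm
    exact uncurry_mk₁_map_right α _
  rel := by
    ext p x
    exact x.1.2.elim

end NerveHomotopy

section NerveAugmentation

open AlgebraicTopology

variable (k : Type u) [CommRing k] (E : Type) [Category.{0} E]

/-- The simplicial module `k[N(E)]`. -/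
noncomputable def kNerve : SimplicialObject (ModuleCat.{u} k) :=
  nerve E ⋙ freeMod k

/-- The augmentation `k[N(E)] ⟶ k`. -/
noncomputable def kNerveAug : kNerve k E ⟶ (Functor.const _).obj (ModuleCat.of k k) where
  app p := ModuleCat.ofHom (Finsupp.linearCombination k fun _ : (nerve E).obj p => (1 : k))
  naturality p q θ := by
    refine ModuleCat.hom_ext (Finsupp.lhom_ext' fun x => LinearMap.ext_ring ?_)
    refine Eq.trans (congrArg (Finsupp.linearCombination k fun _ : (nerve E).obj q => (1 : k))
      (Finsupp.mapDomain_single (f := (nerve E).map θ))) ?_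
    exact (Finsupp.linearCombination_single (v := fun _ : (nerve E).obj q => (1 : k)) k 1 _).trans
      (Finsupp.linearCombination_single (v := fun _ : (nerve E).obj p => (1 : k)) k 1 x).symm

variable {E}

/-- The inclusion `k ⟶ k[N(E)]` of a vertex. -/
noncomputable def kNerveVertex (e : E) : (Functor.const _).obj (ModuleCat.of k k) ⟶ kNerve k E where
  app p := ModuleCat.ofHom (LinearMap.toSpanSingleton k _ (Finsupp.single
    ((Functor.const (Fin (p.unop.len + 1))).obj e : (nerve E).obj p) 1))
  naturality p q θ := by
    refine ModuleCat.hom_ext (LinearMap.ext_ring ?_)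
    refine (one_smul k (Finsupp.single ((Functor.const (Fin (q.unop.len + 1))).obj e :
      (nerve E).obj q) (1 : k))).trans ?_
    refine Eq.trans ?_ (congrArg ((freeMod k).map ((nerve E).map θ)).hom (one_smul k _)).symm
    exact (Finsupp.mapDomain_single (M := k) (b := 1) (f := (nerve E).map θ)
      (a := (Functor.const (Fin (p.unop.len + 1))).obj e)).symm

/-- The map of `k[N(E)]` induced by an endofunctor. -/
noncomputable def kNerveMap (F : E ⥤ E) : kNerve k E ⟶ kNerve k E :=
  Functor.whiskerRight (nerveMap F) (freeMod k)

/-- A natural transformation between endofunctors induces a homotopy between their maps of chain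
complexes. -/
noncomputable def kNerveHomotopy {F G : E ⥤ E} (α : F ⟶ G) :
    Homotopy ((alternatingFaceMapComplex _).map (kNerveMap k F))
      ((alternatingFaceMapComplex _).map (kNerveMap k G)) :=
  ((nerveHomotopy α).toSimplicialObjectHomotopy.whiskerRight (freeMod k)).toChainHomotopy

theorem kNerveMap_id : kNerveMap k (𝟭 E) = 𝟙 (kNerve k E) :=
  NatTrans.ext (funext fun _ => (freeMod k).map_id _)

theorem kNerveVertex_comp_aug (e : E) : kNerveVertex k e ≫ kNerveAug k E = 𝟙 _ := by
  refine NatTrans.ext (funext fun p => ModuleCat.hom_ext (LinearMap.ext_ring ?_))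
  refine (congrArg (Finsupp.linearCombination k fun _ : (nerve E).obj p => (1 : k))
    (one_smul k _)).trans ?_
  exact (Finsupp.linearCombination_single k 1 _).trans (one_smul _ _)

theorem kNerveAug_comp_vertex (e : E) :
    kNerveAug k E ≫ kNerveVertex k e = kNerveMap k ((Functor.const E).obj e) := by
  refine NatTrans.ext (funext fun p => ModuleCat.hom_ext
    (Finsupp.lhom_ext' fun x => LinearMap.ext_ring ?_))
  refine (congrArg (LinearMap.toSpanSingleton k _ (Finsupp.single
    ((Functor.const (Fin (p.unop.len + 1))).obj e : (nerve E).obj p) (1 : k)))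
    ((Finsupp.linearCombination_single k 1 x).trans (one_smul _ _))).trans ?_
  refine (one_smul k _).trans ?_
  exact (Finsupp.mapDomain_single (f := (nerveMap ((Functor.const E).obj e)).app p)).symm

/-- If there are natural transformations `𝟭 ⟶ F ⟵ const e`, the nerve of `E` is acyclic. -/
theorem quasiIso_kNerveAug (F : E ⥤ E) (e : E) (α : 𝟭 E ⟶ F) (β : (Functor.const E).obj e ⟶ F) :
    QuasiIso ((alternatingFaceMapComplex _).map (kNerveAug k E)) := by
  let h : HomotopyEquiv ((alternatingFaceMapComplex _).obj (kNerve k E))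
      ((alternatingFaceMapComplex _).obj ((Functor.const _).obj (ModuleCat.of k k))) :=
    { hom := (alternatingFaceMapComplex _).map (kNerveAug k E)
      inv := (alternatingFaceMapComplex _).map (kNerveVertex k e)
      homotopyHomInvId := (Homotopy.ofEq (by
          rw [← Functor.map_comp, kNerveAug_comp_vertex])).trans
        ((kNerveHomotopy k β).trans ((kNerveHomotopy k α).symm.trans (Homotopy.ofEq (by
          rw [kNerveMap_id, CategoryTheory.Functor.map_id]))))
      homotopyInvHomId := Homotopy.ofEq (by
        rw [← Functor.map_comp, kNerveVertex_comp_aug, CategoryTheory.Functor.map_id]) }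
  exact HomotopyEquiv.quasiIso_hom h

end NerveAugmentation

/-! ### Resolutions by nerves of comma categories -/

section Resolution

open AlgebraicTopology

variable {C D : Type} [Category.{0} C] [Category.{0} D]

/-- The simplicial sets `N(c ↓ ι)`, as a contravariant functor of `c`. -/
def nerveOver (ι : D ⥤ C) : Cᵒᵖ ⥤ SSet.{0} := StructuredArrow.functor ι ⋙ nerveFunctor

/-- A functor into `c ↓ ι` is determined by its projection and its structure maps. -/
theorem structuredArrow_functor_eq {ι : D ⥤ C} {c : C} {J : Type} [Category.{0} J]
    (y : J ⥤ D) (x : J ⥤ StructuredArrow c ι) (h : x ⋙ StructuredArrow.proj c ι = y)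
    (f : ∀ j, c ⟶ ι.obj (y.obj j)) (hf : ∀ {i j : J} (g : i ⟶ j), f i ≫ ι.map (y.map g) = f j)
    (hx : ∀ j, (x.obj j).hom ≫ ι.map (eqToHom (Functor.congr_obj h j)) = f j) :
    x = y.toStructuredArrow c ι f hf := by
  subst h
  refine CategoryTheory.Functor.ext (fun j => StructuredArrow.obj_ext _ _ rfl (hx j))
    fun i j g => StructuredArrow.hom_ext _ _ ?_
  rw [StructuredArrow.comp_right, StructuredArrow.comp_right, StructuredArrow.eqToHom_right,
    StructuredArrow.eqToHom_right]
  exact ((Category.id_comp _).trans (Category.comp_id _)).symm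

variable (ι : D ⥤ C)

/-- The simplex `y` of `N(D)`, as a simplex of `N(ι(y_0) ↓ ι)`. -/
def canonicalSimplex {n : ℕ} (y : ComposableArrows D n) :
    ComposableArrows (StructuredArrow (ι.obj (y.obj 0)) ι) n :=
  Functor.toStructuredArrow y (ι.obj (y.obj 0)) ι
    (fun i => ι.map (y.map (homOfLE (Fin.zero_le i)))) (fun g => by
      rw [← ι.map_comp, ← y.map_comp]
      rfl)

variable {ι}

/-- Every simplex of `N(c ↓ ι)` is the restriction of a canonical simplex. -/
theorem canonicalSimplex_map {c : C} {n : ℕ} (x : ComposableArrows (StructuredArrow c ι) n) :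
    (canonicalSimplex ι (x ⋙ StructuredArrow.proj c ι : Fin (n + 1) ⥤ D) ⋙
      StructuredArrow.map (x.obj 0).hom : Fin (n + 1) ⥤ StructuredArrow c ι) = x := by
  have hf : ∀ {i j : Fin (n + 1)} (g : i ⟶ j), (x.obj i).hom ≫
      ι.map ((x ⋙ StructuredArrow.proj c ι).map g) = (x.obj j).hom :=
    fun g => StructuredArrow.w (x.map g)
  refine (structuredArrow_functor_eq (x ⋙ StructuredArrow.proj c ι)
    (canonicalSimplex ι (x ⋙ StructuredArrow.proj c ι : Fin (n + 1) ⥤ D) ⋙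
      StructuredArrow.map (x.obj 0).hom) rfl (fun j => (x.obj j).hom) hf fun j => ?_).trans
    (structuredArrow_functor_eq (x ⋙ StructuredArrow.proj c ι) x rfl _ hf fun j => ?_).symm
  · refine Eq.trans ?_ (StructuredArrow.w (x.map (homOfLE (Fin.zero_le j))))
    exact (congrArg _ (ι.map_id _)).trans (Category.comp_id _)
  · exact (congrArg _ (ι.map_id _)).trans (Category.comp_id _)

variable (k : Type u) [CommRing k] (ι)

/-- The simplicial functor `k[N(- ↓ ι)]`. -/
noncomputable def kNerveOver : SimplicialObject (Cᵒᵖ ⥤ ModuleCat.{u} k) :=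
  (nerveOver ι ⋙ (Functor.whiskeringRight SimplexCategoryᵒᵖ Type (ModuleCat.{u} k)).obj
    (freeMod k)).flip

/-- Natural transformations out of `k[N_p(- ↓ ι)]` from their values on canonical simplices. -/
noncomputable def kNerveOverDesc (p : SimplexCategoryᵒᵖ) {E : Cᵒᵖ ⥤ ModuleCat.{u} k}
    (v : ∀ y : ComposableArrows D p.unop.len, E.obj (op (ι.obj (y.obj 0)))) :
    (kNerveOver ι k).obj p ⟶ E where
  app c := ModuleCat.ofHom (Finsupp.linearCombination k
    fun x : ComposableArrows (StructuredArrow c.unop ι) p.unop.len =>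
      (E.map (x.obj 0).hom.op).hom (v (x ⋙ StructuredArrow.proj c.unop ι : Fin _ ⥤ D)))
  naturality c c' φ := by
    refine ModuleCat.hom_ext (Finsupp.lhom_ext' fun x => LinearMap.ext_ring ?_)
    refine Eq.trans (congrArg (Finsupp.linearCombination k
      fun x : ComposableArrows (StructuredArrow c'.unop ι) p.unop.len =>
      (E.map (x.obj 0).hom.op).hom (v (x ⋙ StructuredArrow.proj c'.unop ι : Fin _ ⥤ D)))
      (Finsupp.mapDomain_single (M := k) (b := 1)
        (f := fun x : ComposableArrows (StructuredArrow c.unop ι) p.unop.len =>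
          (x ⋙ StructuredArrow.map φ.unop : Fin _ ⥤ StructuredArrow c'.unop ι)) (a := x))) ?_
    refine (Finsupp.linearCombination_single (R := k) (c := 1) _).trans ?_
    refine Eq.trans ?_ (congrArg (E.map φ).hom
      (Finsupp.linearCombination_single (v := fun x : ComposableArrows
        (StructuredArrow c.unop ι) p.unop.len => (E.map (x.obj 0).hom.op).hom
        (v (x ⋙ StructuredArrow.proj c.unop ι : Fin _ ⥤ D))) k 1 x)).symm
    rw [one_smul, one_smul]
    exact congrArg (fun g => g.hom (v (x ⋙ StructuredArrow.proj c.unop ι : Fin _ ⥤ D)))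
      (E.map_comp (x.obj 0).hom.op φ)

/-- Natural transformations out of `k[N_p(- ↓ ι)]` are determined by their values on canonical
simplices, which generate this functor freely. -/
theorem kNerveOver_hom_ext (p : SimplexCategoryᵒᵖ) {E : Cᵒᵖ ⥤ ModuleCat.{u} k}
    (a b : (kNerveOver ι k).obj p ⟶ E)
    (h : ∀ y : ComposableArrows D p.unop.len,
      (a.app (op (ι.obj (y.obj 0)))).hom (Finsupp.single (canonicalSimplex ι y) 1) =
      (b.app (op (ι.obj (y.obj 0)))).hom (Finsupp.single (canonicalSimplex ι y) 1)) : a = b := by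
  refine NatTrans.ext (funext fun c => ?_)
  refine ModuleCat.hom_ext (Finsupp.lhom_ext' fun x => LinearMap.ext_ring ?_)
  change ComposableArrows (StructuredArrow c.unop ι) p.unop.len at x
  have key : ∀ a : (kNerveOver ι k).obj p ⟶ E, (a.app c).hom (Finsupp.single x 1) =
      (E.map (x.obj 0).hom.op).hom ((a.app (op (ι.obj (x.obj 0).right))).hom (Finsupp.single
        (canonicalSimplex ι (x ⋙ StructuredArrow.proj c.unop ι : Fin _ ⥤ D)) 1)) := by
    intro a
    refine Eq.trans ?_ (congrArg (fun f => f.hom (Finsupp.single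
      (canonicalSimplex ι (x ⋙ StructuredArrow.proj c.unop ι : Fin _ ⥤ D)) 1))
      (a.naturality (x.obj 0).hom.op))
    refine congrArg (a.app c).hom ?_
    refine Eq.trans ?_ (Finsupp.mapDomain_single (M := k) (b := 1)
      (f := fun z : ComposableArrows (StructuredArrow (ι.obj (x.obj 0).right) ι) p.unop.len =>
        (z ⋙ StructuredArrow.map (x.obj 0).hom : Fin _ ⥤ StructuredArrow c.unop ι))).symm
    exact congrArg (fun z => Finsupp.single z (1 : k)) (canonicalSimplex_map x).symm
  exact (key a).trans ((congrArg (E.map (x.obj 0).hom.op).hom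
    (h (x ⋙ StructuredArrow.proj c.unop ι : Fin _ ⥤ D))).trans (key b).symm)

/-- `k[N_p(- ↓ ι)]` is a sum of representable functors, whence projective. -/
instance (p : SimplexCategoryᵒᵖ) : Projective ((kNerveOver ι k).obj p) where
  factors {E X} f q hq := by
    have hs : ∀ d, Function.Surjective (q.app d).hom := fun d =>
      (ModuleCat.epi_iff_surjective _).mp inferInstance
    refine ⟨kNerveOverDesc ι k p fun y => Function.surjInv (hs (op (ι.obj (y.obj 0))))
      ((f.app _).hom (Finsupp.single (canonicalSimplex ι y) 1)), ?_⟩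
    refine kNerveOver_hom_ext ι k p _ _ fun y => ?_
    refine (congrArg (q.app _).hom
      (Finsupp.linearCombination_single (R := k) (c := 1) _)).trans ?_
    rw [one_smul]
    have h1 : (E.map ((canonicalSimplex ι y).obj 0).hom.op) = 𝟙 _ := by
      refine Eq.trans (congrArg (fun g => E.map (Quiver.Hom.op g)) ?_) (E.map_id _)
      exact (congrArg ι.map (y.map_id 0)).trans (ι.map_id _)
    refine (congrArg (fun g : E.obj (op (ι.obj (y.obj 0))) ⟶ E.obj (op (ι.obj (y.obj 0))) =>
      (q.app (op (ι.obj (y.obj 0)))).hom (g.hom (Function.surjInv (hs (op (ι.obj (y.obj 0))))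
      ((f.app _).hom (Finsupp.single (canonicalSimplex ι y) 1))))) h1).trans ?_
    exact Function.surjInv_eq (hs (op (ι.obj (y.obj 0)))) _

/-- The augmentation of `k[N(- ↓ ι)]`. -/
noncomputable def kNerveOverAug : kNerveOver ι k ⟶
    (Functor.const SimplexCategoryᵒᵖ).obj ((Functor.const Cᵒᵖ).obj (ModuleCat.of k k)) where
  app p :=
    { app := fun c => (kNerveAug k (StructuredArrow c.unop ι)).app p
      naturality := fun c c' φ => by
        refine ModuleCat.hom_ext (Finsupp.lhom_ext' fun x => LinearMap.ext_ring ?_)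
        refine Eq.trans (congrArg (Finsupp.linearCombination k
          fun _ : ComposableArrows (StructuredArrow c'.unop ι) p.unop.len => (1 : k))
          (Finsupp.mapDomain_single (M := k) (b := 1)
            (f := fun x : ComposableArrows (StructuredArrow c.unop ι) p.unop.len =>
            (x ⋙ StructuredArrow.map φ.unop : Fin _ ⥤ StructuredArrow c'.unop ι)) (a := x))) ?_
        exact (Finsupp.linearCombination_single (v := fun _ => (1 : k)) k 1 _).trans
          (Finsupp.linearCombination_single (v := fun _ : ComposableArrows
            (StructuredArrow c.unop ι) p.unop.len => (1 : k)) k 1 x).symm }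
  naturality p q θ := NatTrans.ext (funext fun c =>
    (kNerveAug k (StructuredArrow c.unop ι)).naturality θ)

/-- The quasi-isomorphism from the complex of a constant simplicial object to the complex
concentrated in degree zero. -/
noncomputable def constToSingle {V : Type*} [Category* V] [Abelian V] (X : V) :
    (alternatingFaceMapComplex V).obj ((Functor.const SimplexCategoryᵒᵖ).obj X) ⟶
      (ChainComplex.single₀ V).obj X :=
  (SimplicialObject.Augmented.ExtraDegeneracy.const X).homotopyEquiv.hom

instance {V : Type*} [Category* V] [Abelian V] (X : V) : QuasiIso (constToSingle X) :=
  HomotopyEquiv.quasiIso_hom (SimplicialObject.Augmented.ExtraDegeneracy.const X).homotopyEquiv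

/-- The augmentation from `k[N(- ↓ ι)]` to the constant functor, as a map of complexes. -/
noncomputable def kNerveOverπ : (alternatingFaceMapComplex _).obj (kNerveOver ι k) ⟶
    (ChainComplex.single₀ _).obj ((Functor.const Cᵒᵖ).obj (ModuleCat.of k k)) :=
  (alternatingFaceMapComplex _).map (kNerveOverAug ι k) ≫ constToSingle _

section Contraction

variable {ι} {G : C ⥤ D}

/-- The endofunctor of `c ↓ ι` given by a functor `G` and a transformation `𝟭 ⟶ G ⋙ ι`. -/
def overShift (η : 𝟭 C ⟶ G ⋙ ι) (c : C) : StructuredArrow c ι ⥤ StructuredArrow c ι where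
  obj f := StructuredArrow.mk (Y := G.obj (ι.obj f.right)) (f.hom ≫ η.app (ι.obj f.right))
  map {f g} φ := StructuredArrow.homMk (G.map (ι.map φ.right)) (by
    have h := η.naturality (ι.map φ.right)
    have h' : ι.map φ.right ≫ η.app (ι.obj g.right) =
      η.app (ι.obj f.right) ≫ ι.map (G.map (ι.map φ.right)) := h
    have hw := StructuredArrow.w φ
    change (f.hom ≫ η.app (ι.obj f.right)) ≫ ι.map (G.map (ι.map φ.right)) =
      g.hom ≫ η.app (ι.obj g.right)
    rw [Category.assoc, ← h', ← Category.assoc, hw])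
  map_id f := StructuredArrow.hom_ext _ _ (by simp)
  map_comp φ ψ := StructuredArrow.hom_ext _ _ (by simp)

/-- The category `c ↓ ι` is contractible if `ι` is fully faithful with a functor `G` in the opposite
direction and a transformation `𝟭 ⟶ G ⋙ ι`: there are transformations from the identity and from
the constant functor at `c ⟶ ι (G c)` to `overShift`. -/
theorem quasiIso_kNerveAug_structuredArrow [ι.Full] [ι.Faithful] (η : 𝟭 C ⟶ G ⋙ ι) (c : C) :
    QuasiIso ((alternatingFaceMapComplex _).map (kNerveAug k (StructuredArrow c ι))) := by
  refine quasiIso_kNerveAug k (overShift η c) (StructuredArrow.mk (Y := G.obj c) (η.app c)) ?_ ?_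
  · exact
      { app := fun f => StructuredArrow.homMk (ι.preimage (η.app (ι.obj f.right)))
          (congrArg (f.hom ≫ ·) (ι.map_preimage _))
        naturality := fun f g φ => StructuredArrow.hom_ext _ _ (ι.map_injective (by
          have h := η.naturality (ι.map φ.right)
          change ι.map (φ.right ≫ ι.preimage (η.app (ι.obj g.right))) =
            ι.map (ι.preimage (η.app (ι.obj f.right)) ≫ G.map (ι.map φ.right))
          rw [ι.map_comp, ι.map_comp, ι.map_preimage, ι.map_preimage]
          exact h)) }
  · exact
      { app := fun f => StructuredArrow.homMk (G.map f.hom) (η.naturality f.hom).symm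
        naturality := fun f g φ => StructuredArrow.hom_ext _ _ (by
          change 𝟙 _ ≫ G.map g.hom = G.map f.hom ≫ G.map (ι.map φ.right)
          rw [Category.id_comp, ← G.map_comp, StructuredArrow.w φ]) }

end Contraction

variable {ι} in
theorem quasiIso_kNerveOverπ {G : C ⥤ D} (η : 𝟭 C ⟶ G ⋙ ι) [ι.Full] [ι.Faithful] :
    QuasiIso (kNerveOverπ ι k) := by
  have h1 : QuasiIso ((alternatingFaceMapComplex _).map (kNerveOverAug ι k)) := by
    rw [HomologicalComplex.quasiIso_iff_evaluation]
    intro c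
    have h := Functor.congr_hom (map_alternatingFaceMapComplex
      ((evaluation Cᵒᵖ (ModuleCat.{u} k)).obj c)) (kNerveOverAug ι k)
    have hq : QuasiIso ((alternatingFaceMapComplex _).map
        (((SimplicialObject.whiskering _ _).obj
          ((evaluation Cᵒᵖ (ModuleCat.{u} k)).obj c)).map (kNerveOverAug ι k))) :=
      quasiIso_kNerveAug_structuredArrow k η c.unop
    refine Eq.mpr (congrArg (fun g => QuasiIso g) h) ?_
    change QuasiIso (_ ≫ (alternatingFaceMapComplex _).map
        (((SimplicialObject.whiskering _ _).obj
          ((evaluation Cᵒᵖ (ModuleCat.{u} k)).obj c)).map (kNerveOverAug ι k)) ≫ _)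
    infer_instance
  exact quasiIso_comp _ _

variable {ι} in
/-- The resolution `k[N(- ↓ ι)]` of the constant functor `k`. -/
noncomputable def kNerveOverResolution {G : C ⥤ D} (η : 𝟭 C ⟶ G ⋙ ι) [ι.Full] [ι.Faithful] :
    ProjectiveResolution ((Functor.const Cᵒᵖ).obj (ModuleCat.of k k)) where
  complex := (alternatingFaceMapComplex _).obj (kNerveOver ι k)
  projective n := inferInstanceAs (Projective ((kNerveOver ι k).obj (op ⦋n⦌)))
  π := kNerveOverπ ι k
  quasiIso := quasiIso_kNerveOverπ k η

variable {ι k} in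
/-- `Tor^C(k, F)` is the homology of `k[N(- ↓ ι)] ⊗_C F`. -/
noncomputable def torIso {G : C ⥤ D} (η : 𝟭 C ⟶ G ⋙ ι) [ι.Full] [ι.Faithful]
    (F : C ⥤ ModuleCat.{u} k) (n : ℕ) : Tor k n F ≅
      ((alternatingFaceMapComplex _).obj (kNerveOver ι k ⋙ tensorOver F)).homology n :=
  (kNerveOverResolution k η).isoLeftDerivedObj (tensorOver F) n ≪≫
    (HomologicalComplex.homologyFunctor _ _ n).mapIso
      (eqToIso (Functor.congr_obj (map_alternatingFaceMapComplex (tensorOver F))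
        (kNerveOver ι k)))

end Resolution

/-! ### The homology of `𝒩𝒴⁺A` is symmetric homology -/

section Comparison

open AlgebraicTopology

variable {k : Type u} [CommRing k] {C D : Type} [Category.{0} C] [Category.{0} D]

/-- Linear maps out of `G ⊗_C F`. -/
noncomputable def tensorDesc (F : C ⥤ ModuleCat.{u} k) (G : Cᵒᵖ ⥤ ModuleCat.{u} k)
    {M : Type u} [AddCommGroup M] [Module k M]
    (b : ∀ c, G.obj (op c) →ₗ[k] F.obj c →ₗ[k] M)
    (hb : ∀ (c d : C) (φ : c ⟶ d) (x : G.obj (op d)) (y : F.obj c),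
      b c ((G.map φ.op).hom x) y = b d x ((F.map φ).hom y)) :
    ((tensorOver F).obj G : Type u) →ₗ[k] M :=
  letI := Classical.decEq C
  (tensorRel F G).liftQ (DirectSum.toModule k C M fun c => TensorProduct.lift (b c)) (by
    refine Submodule.span_le.mpr ?_
    rintro _ ⟨c, d, φ, x, y, rfl⟩
    refine LinearMap.mem_ker.mpr ?_
    rw [map_sub, sub_eq_zero]
    refine (DirectSum.toModule_lof k c _).trans (Eq.trans ?_ (DirectSum.toModule_lof k d _).symm)
    exact hb c d φ x y)

theorem tensorDesc_cls (F : C ⥤ ModuleCat.{u} k) (G : Cᵒᵖ ⥤ ModuleCat.{u} k)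
    {M : Type u} [AddCommGroup M] [Module k M]
    (b : ∀ c, G.obj (op c) →ₗ[k] F.obj c →ₗ[k] M) (hb) (c : C) (x : G.obj (op c)) (y : F.obj c) :
    tensorDesc F G b hb (tensorCls F G c (x ⊗ₜ y)) = b c x y := by
  let _ := Classical.decEq C
  exact DirectSum.toModule_lof (φ := fun c => TensorProduct.lift (b c)) k c (x ⊗ₜ y)

theorem tensorCls_rel (F : C ⥤ ModuleCat.{u} k) (G : Cᵒᵖ ⥤ ModuleCat.{u} k) {c d : C}
    (φ : c ⟶ d) (x : G.obj (op d)) (y : F.obj c) :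
    tensorCls F G c ((G.map φ.op).hom x ⊗ₜ y) = tensorCls F G d (x ⊗ₜ (F.map φ).hom y) := by
  refine (Submodule.Quotient.eq _).mpr (Submodule.subset_span ⟨c, d, φ, x, y, ?_⟩)
  congr!

theorem tensorOver_hom_ext (F : C ⥤ ModuleCat.{u} k) (G : Cᵒᵖ ⥤ ModuleCat.{u} k)
    {M : Type u} [AddCommGroup M] [Module k M]
    {f g : ((tensorOver F).obj G : Type u) →ₗ[k] M}
    (h : ∀ c (x : G.obj (op c)) (y : F.obj c),
      f (tensorCls F G c (x ⊗ₜ y)) = g (tensorCls F G c (x ⊗ₜ y))) : f = g := by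
  let _ := Classical.decEq C
  exact Submodule.linearMap_qext _ (DirectSum.linearMap_ext k fun c =>
    TensorProduct.ext' fun x y => h c x y)

theorem tensorOver_map_cls (F : C ⥤ ModuleCat.{u} k) {G G' : Cᵒᵖ ⥤ ModuleCat.{u} k}
    (θ : G ⟶ G') (c : C) (x : G.obj (op c)) (y : F.obj c) :
    ((tensorOver F).map θ).hom (tensorCls F G c (x ⊗ₜ y)) =
      tensorCls F G' c ((θ.app (op c)).hom x ⊗ₜ y) := by
  classical
  refine congrArg (tensorRel F G').mkQ ?_
  exact (DirectSum.lmap_lof _ _ _).trans rfl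

variable (ι : D ⥤ C) (F : C ⥤ ModuleCat.{u} k)

/-- The map of tensor products induced by a functor `ι` between the indexing categories. -/
noncomputable def tensorPush {H : Dᵒᵖ ⥤ ModuleCat.{u} k} {K : Cᵒᵖ ⥤ ModuleCat.{u} k}
    (τ : H ⟶ ι.op ⋙ K) :
    ((tensorOver (ι ⋙ F)).obj H : Type u) →ₗ[k] ((tensorOver F).obj K : Type u) :=
  tensorDesc (ι ⋙ F) H
    (fun d => (TensorProduct.mk k (K.obj (op (ι.obj d))) (F.obj (ι.obj d))).compr₂
      (tensorCls F K (ι.obj d)) ∘ₗ (τ.app (op d)).hom)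
    (fun c d φ x y => by
      have h := congrArg (fun f => f.hom x) (τ.naturality φ.op)
      refine (congrArg (fun z => tensorCls F K (ι.obj c) (z ⊗ₜ y)) h).trans ?_
      exact tensorCls_rel F K (ι.map φ) ((τ.app (op d)).hom x) y)

theorem tensorPush_cls {H : Dᵒᵖ ⥤ ModuleCat.{u} k} {K : Cᵒᵖ ⥤ ModuleCat.{u} k}
    (τ : H ⟶ ι.op ⋙ K) (d : D) (x : H.obj (op d)) (y : F.obj (ι.obj d)) :
    tensorPush ι F τ (tensorCls (ι ⋙ F) H d (x ⊗ₜ y)) =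
      tensorCls F K (ι.obj d) ((τ.app (op d)).hom x ⊗ₜ y) :=
  tensorDesc_cls _ _ _ _ _ _ _

/-- The functor `d \ D ⥤ ι(d) ↓ ι`. -/
def overPost (d : D) : StructuredArrow d (𝟭 D) ⥤ StructuredArrow (ι.obj d) ι where
  obj f := StructuredArrow.mk (Y := f.right) (ι.map f.hom)
  map {f g} φ := StructuredArrow.homMk φ.right (by
    change ι.map f.hom ≫ ι.map φ.right = ι.map g.hom
    rw [← ι.map_comp]
    exact congrArg ι.map (StructuredArrow.w φ))

/-- The map `k[N(d \ D)] ⟶ k[N(ι(d) ↓ ι)]`. -/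
noncomputable def nerveOverPost (p : SimplexCategoryᵒᵖ) :
    (kNerveOver (𝟭 D) k).obj p ⟶ ι.op ⋙ (kNerveOver ι k).obj p where
  app d := (freeMod k).map ((nerveMap (overPost ι d.unop)).app p)
  naturality c d φ := by
    refine ((freeMod k).map_comp _ _).symm.trans (Eq.trans (congrArg (freeMod k).map ?_)
      ((freeMod k).map_comp _ _))
    ext x
    change ComposableArrows (StructuredArrow c.unop (𝟭 D)) p.unop.len at x
    have key : (StructuredArrow.map φ.unop ⋙ overPost ι d.unop :
      StructuredArrow c.unop (𝟭 D) ⥤ _) = overPost ι c.unop ⋙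
        StructuredArrow.map (ι.map φ.unop) := by
      refine CategoryTheory.Functor.ext (fun f => ?_) fun f g ψ => ?_
      · exact StructuredArrow.obj_ext _ _ rfl ((congrArg _ (ι.map_id _)).trans
          ((Category.comp_id _).trans (ι.map_comp φ.unop f.hom)))
      · refine StructuredArrow.hom_ext _ _ ?_
        rw [StructuredArrow.comp_right, StructuredArrow.comp_right, StructuredArrow.eqToHom_right,
          StructuredArrow.eqToHom_right]
        exact ((Category.id_comp _).trans (Category.comp_id _)).symm
    exact congrArg (fun K : StructuredArrow c.unop (𝟭 D) ⥤ StructuredArrow (ι.obj d.unop) ι =>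
      (x ⋙ K : Fin _ ⥤ _)) key

theorem nerveOverPost_single (p : SimplexCategoryᵒᵖ) (d : D)
    (x : ComposableArrows (StructuredArrow d (𝟭 D)) p.unop.len) :
    ((nerveOverPost (k := k) ι p).app (op d)).hom (Finsupp.single x 1) =
      Finsupp.single (x ⋙ overPost ι d : Fin _ ⥤ StructuredArrow (ι.obj d) ι) 1 :=
  Finsupp.mapDomain_single

/-- The comparison `k[N(- \ D)] ⊗_D F ∘ ι ⟶ k[N(- ↓ ι)] ⊗_C F`. -/
noncomputable def tensorNerveHom :
    kNerveOver (𝟭 D) k ⋙ tensorOver (ι ⋙ F) ⟶ kNerveOver ι k ⋙ tensorOver F where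
  app p := ModuleCat.ofHom (tensorPush ι F (nerveOverPost ι p))
  naturality p q θ := by
    refine ModuleCat.hom_ext (tensorOver_hom_ext _ _ fun d x y => ?_)
    refine (congrArg (tensorPush ι F (nerveOverPost ι q))
      (tensorOver_map_cls (ι ⋙ F) ((kNerveOver (𝟭 D) k).map θ) d x y)).trans ?_
    refine (tensorPush_cls ι F (nerveOverPost ι q) d _ y).trans ?_
    refine Eq.trans ?_ (congrArg ((tensorOver F).map ((kNerveOver ι k).map θ)).hom
      (tensorPush_cls ι F (nerveOverPost ι p) d x y)).symm
    refine Eq.trans ?_ (tensorOver_map_cls F ((kNerveOver ι k).map θ) (ι.obj d) _ y).symm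
    refine congrArg (fun z => tensorCls F ((kNerveOver ι k).obj q) (ι.obj d) (z ⊗ₜ y)) ?_
    have h := congrArg (freeMod k).map ((nerveMap (overPost ι d)).naturality θ)
    rw [(freeMod k).map_comp, (freeMod k).map_comp] at h
    exact congrArg (fun f => f.hom x) h

/-- The value of the inverse of the comparison map on `x ⊗ -`, for a simplex `x`. -/
noncomputable def tensorNerveInvTerm (p : SimplexCategoryᵒᵖ) (c : C)
    (x : ComposableArrows (StructuredArrow c ι) p.unop.len) :
    F.obj c →ₗ[k] ((tensorOver (ι ⋙ F)).obj ((kNerveOver (𝟭 D) k).obj p) : Type u) :=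
  tensorCls (ι ⋙ F) ((kNerveOver (𝟭 D) k).obj p) (x.obj 0).right ∘ₗ
    TensorProduct.mk k (((kNerveOver (𝟭 D) k).obj p).obj (op (x.obj 0).right))
      (F.obj (ι.obj (x.obj 0).right)) (Finsupp.single (canonicalSimplex (𝟭 D)
      (x ⋙ StructuredArrow.proj c ι : Fin _ ⥤ D)) (1 : k)) ∘ₗ (F.map (x.obj 0).hom).hom

/-- The inverse of the comparison map, in a fixed simplicial degree. -/
noncomputable def tensorNerveInv (p : SimplexCategoryᵒᵖ) :
    ((tensorOver F).obj ((kNerveOver ι k).obj p) : Type u) →ₗ[k]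
      ((tensorOver (ι ⋙ F)).obj ((kNerveOver (𝟭 D) k).obj p) : Type u) :=
  tensorDesc F _ (fun c => Finsupp.linearCombination k (tensorNerveInvTerm ι F p c))
    (fun c d φ x y => by
      have key : (Finsupp.linearCombination k (tensorNerveInvTerm ι F p c)).flip y ∘ₗ
          (((kNerveOver ι k).obj p).map φ.op).hom =
          (Finsupp.linearCombination k (tensorNerveInvTerm ι F p d)).flip
            ((F.map φ).hom y) := by
        refine Finsupp.lhom_ext' fun z => LinearMap.ext_ring ?_
        change ComposableArrows (StructuredArrow d ι) p.unop.len at z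
        refine (congrArg (fun l => Finsupp.linearCombination k (tensorNerveInvTerm ι F p c) l y)
          (Finsupp.mapDomain_single (M := k) (b := 1)
            (f := fun x : ComposableArrows (StructuredArrow d ι) p.unop.len =>
              (x ⋙ StructuredArrow.map φ : Fin _ ⥤ StructuredArrow c ι)) (a := z))).trans ?_
        refine (congrArg (fun l => l y) ((Finsupp.linearCombination_single
          (v := tensorNerveInvTerm ι F p c) k 1 _).trans (one_smul k _))).trans ?_
        refine Eq.trans ?_ (congrArg (fun l => l ((F.map φ).hom y))
          ((Finsupp.linearCombination_single (v := tensorNerveInvTerm ι F p d) k 1 z).trans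
            (one_smul k _))).symm
        refine congrArg (fun w => tensorCls (ι ⋙ F) ((kNerveOver (𝟭 D) k).obj p)
          (z.obj 0).right (Finsupp.single (canonicalSimplex (𝟭 D)
            (z ⋙ StructuredArrow.proj d ι : Fin _ ⥤ D)) (1 : k) ⊗ₜ w)) ?_
        exact congrArg (fun g => g.hom y) (F.map_comp φ (z.obj 0).hom)
      exact congrArg (fun l => l x) key)

theorem tensorNerveInv_cls (p : SimplexCategoryᵒᵖ) (c : C)
    (x : ComposableArrows (StructuredArrow c ι) p.unop.len) (y : F.obj c) :
    tensorNerveInv ι F p (tensorCls F ((kNerveOver ι k).obj p) c (Finsupp.single x 1 ⊗ₜ y)) =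
      tensorCls (ι ⋙ F) ((kNerveOver (𝟭 D) k).obj p) (x.obj 0).right
        (Finsupp.single (canonicalSimplex (𝟭 D)
          (x ⋙ StructuredArrow.proj c ι : Fin _ ⥤ D)) (1 : k) ⊗ₜ (F.map (x.obj 0).hom).hom y) := by
  refine (tensorDesc_cls _ _ _ _ _ _ _).trans ?_
  exact congrArg (fun l => l y) ((Finsupp.linearCombination_single
    (v := tensorNerveInvTerm ι F p c) k 1 x).trans (one_smul k _))

theorem tensorOver_kNerve_ext (p : SimplexCategoryᵒᵖ) {M : Type u} [AddCommGroup M] [Module k M]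
    {f g : ((tensorOver F).obj ((kNerveOver ι k).obj p) : Type u) →ₗ[k] M}
    (h : ∀ c (x : ComposableArrows (StructuredArrow c ι) p.unop.len) (y : F.obj c),
      f (tensorCls F _ c (Finsupp.single x 1 ⊗ₜ y)) =
        g (tensorCls F _ c (Finsupp.single x 1 ⊗ₜ y))) : f = g := by
  refine tensorOver_hom_ext _ _ fun c x y => ?_
  have : f ∘ₗ tensorCls F _ c ∘ₗ (TensorProduct.mk k _ _).flip y =
      g ∘ₗ tensorCls F _ c ∘ₗ (TensorProduct.mk k _ _).flip y :=
    Finsupp.lhom_ext' fun z => LinearMap.ext_ring (h c z y)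
  exact congrArg (fun l => l x) this

/-- A simplex of `N(c ↓ ι)` tensored with `y` is the canonical simplex tensored with the image
of `y`. -/
theorem tensorCls_canonical (p : SimplexCategoryᵒᵖ) (c : C)
    (x : ComposableArrows (StructuredArrow c ι) p.unop.len) (y : F.obj c) :
    tensorCls F ((kNerveOver ι k).obj p) c (Finsupp.single x 1 ⊗ₜ y) =
      tensorCls F ((kNerveOver ι k).obj p) (ι.obj (x.obj 0).right)
        (Finsupp.single (canonicalSimplex ι (x ⋙ StructuredArrow.proj c ι : Fin _ ⥤ D)) (1 : k) ⊗ₜ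
          (F.map (x.obj 0).hom).hom y) := by
  refine Eq.trans ?_ (tensorCls_rel F ((kNerveOver ι k).obj p) (x.obj 0).hom _ y)
  refine congrArg (fun z => tensorCls F ((kNerveOver ι k).obj p) c (z ⊗ₜ y)) ?_
  refine Eq.trans ?_ (Finsupp.mapDomain_single (M := k) (b := 1)
    (f := fun z : ComposableArrows (StructuredArrow (ι.obj (x.obj 0).right) ι) p.unop.len =>
      (z ⋙ StructuredArrow.map (x.obj 0).hom : Fin _ ⥤ StructuredArrow c ι))).symm
  exact congrArg (fun z => Finsupp.single z (1 : k)) (canonicalSimplex_map x).symm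

theorem tensorNerveInv_comp (p : SimplexCategoryᵒᵖ) :
    tensorNerveInv (k := k) ι F p ∘ₗ tensorPush ι F (nerveOverPost ι p) = LinearMap.id := by
  refine tensorOver_kNerve_ext (𝟭 D) (ι ⋙ F) p fun d x y => ?_
  refine (congrArg (tensorNerveInv ι F p) (tensorPush_cls ι F (nerveOverPost ι p) d _ y)).trans ?_
  refine (congrArg (fun z => tensorNerveInv ι F p (tensorCls F ((kNerveOver ι k).obj p)
    (ι.obj d) (z ⊗ₜ y))) (nerveOverPost_single ι p d x)).trans ?_
  exact (tensorNerveInv_cls ι F p _ _ y).trans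
    (tensorCls_canonical (𝟭 D) (ι ⋙ F) p d x y).symm

theorem tensorPush_comp_inv (p : SimplexCategoryᵒᵖ) :
    tensorPush ι F (nerveOverPost ι p) ∘ₗ tensorNerveInv (k := k) ι F p = LinearMap.id := by
  refine tensorOver_kNerve_ext ι F p fun c x y => ?_
  refine (congrArg (tensorPush ι F (nerveOverPost ι p)) (tensorNerveInv_cls ι F p c x y)).trans ?_
  refine (tensorPush_cls ι F (nerveOverPost ι p) _ _ _).trans ?_
  refine (congrArg (fun z => tensorCls F ((kNerveOver ι k).obj p) (ι.obj (x.obj 0).right)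
    (z ⊗ₜ (F.map (x.obj 0).hom).hom y)) (nerveOverPost_single ι p (x.obj 0).right _)).trans ?_
  exact (tensorCls_canonical ι F p c x y).symm

/-- Both sides are sums over the simplices `y` of `N(D)` of the modules `F (ι y₀)`. -/
instance : IsIso (tensorNerveHom (k := k) ι F) := by
  have : ∀ p, IsIso ((tensorNerveHom (k := k) ι F).app p) := fun p =>
    ⟨ModuleCat.ofHom (tensorNerveInv ι F p),
      ModuleCat.hom_ext (tensorNerveInv_comp ι F p),
      ModuleCat.hom_ext (tensorPush_comp_inv ι F p)⟩
  exact NatIso.isIso_of_isIso_app _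

end Comparison

section SymmetricHomology

open AlgebraicTopology

/-- Adjoining a new first element, as a functor from `ΔS₊` to `ΔS`. -/
def addPoint : NCSet ⥤ DeltaS where
  obj m := ⟨⟨m.size + 1⟩, Nat.succ_pos _⟩
  map {m n} f := ObjectProperty.homMk (show NCSet.Hom ⟨m.size + 1⟩ ⟨n.size + 1⟩ from
    { toFun := Fin.cases 0 fun x => (NCSet.Hom.toFun f x).succ
      fib := Fin.cases [0] fun y => (NCSet.Hom.fib f y).map Fin.succ
      nodup := fun y => by
        cases y using Fin.cases with
        | zero => simp
        | succ y => exact (NCSet.Hom.nodup f y).map (Fin.succ_injective _)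
      mem_fib := fun x y => by
        cases x using Fin.cases <;> cases y using Fin.cases <;>
          simp [NCSet.Hom.mem_fib, Fin.succ_ne_zero, (Fin.succ_ne_zero _).symm] })
  map_id m := by
    refine ObjectProperty.hom_ext _ (NCSet.Hom.ext ?_ ?_)
    · funext x
      cases x using Fin.cases <;> rfl
    · funext x
      cases x using Fin.cases <;> rfl
  map_comp f g := by
    refine ObjectProperty.hom_ext _ (NCSet.Hom.ext ?_ ?_)
    · funext x
      cases x using Fin.cases <;> rfl
    · funext x
      cases x using Fin.cases with
      | zero => rfl
      | succ y =>
        change ((NCSet.Hom.fib g y).flatMap (NCSet.Hom.fib f)).map Fin.succ =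
          ((NCSet.Hom.fib g y).map Fin.succ).flatMap _
        rw [List.map_flatMap, List.flatMap_map]
        rfl

/-- The inclusion of a set into the set with a point adjoined. -/
def addPointInclusion : 𝟭 NCSet ⟶ addPoint ⋙ ObjectProperty.ι fun m : NCSet => 0 < m.size where
  app m := show NCSet.Hom m ⟨m.size + 1⟩ from
    { toFun := Fin.succ
      fib := Fin.cases [] fun y => [y]
      nodup := fun y => by cases y using Fin.cases <;> simp
      mem_fib := fun x y => by
        cases y using Fin.cases <;> simp [Fin.succ_ne_zero] }
  naturality m n f := by
    refine NCSet.Hom.ext rfl ?_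
    funext y
    cases y using Fin.cases with
    | zero => rfl
    | succ y =>
      change ([y]).flatMap (NCSet.Hom.fib f) =
        ((NCSet.Hom.fib f y).map Fin.succ).flatMap (Fin.cases [] fun y => [y])
      rw [List.flatMap_map]
      simp

variable (k A : Type u) [CommRing k] [Ring A] [Algebra k A]

/-- The homology of `𝒩𝒴⁺A` is the symmetric homology of `A`. By definition it is computed by the
resolution `k[N(- \ ΔS₊)]`. The resolution `k[N(- ↓ ι)]` for the inclusion `ι` of `ΔS` yields the same
homology, and its complex is that of the resolution `k[N(- \ ΔS)]` over `ΔS`. -/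
noncomputable def homologyIsoHS (n : ℕ) : (normalized (YPlus k A)).homology n ≅ HS k A n :=
  (normalizedEquiv (YPlus k A)).symm.toHomologyIso n ≪≫
    (torIso (ι := 𝟭 NCSet) (G := 𝟭 NCSet) (𝟙 (𝟭 NCSet)) (Bsym k A) n).symm ≪≫
    torIso addPointInclusion (Bsym k A) n ≪≫
    (HomologicalComplex.homologyFunctor _ _ n).mapIso ((alternatingFaceMapComplex _).mapIso
      (asIso (tensorNerveHom (ObjectProperty.ι fun m : NCSet => 0 < m.size) (Bsym k A))).symm) ≪≫
    (torIso (ι := 𝟭 DeltaS) (G := 𝟭 DeltaS) (𝟙 (𝟭 DeltaS)) ((ObjectProperty.ι _) ⋙ Bsym k A) n).symm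

end SymmetricHomology

/-! ### Operators on tensor powers -/

section Slide

variable {k : Type u} [CommRing k] {C : Type u} [AddCommGroup C] [Module k C]

/-- The family of endomorphisms `(α, …, α, β, 1, …, 1)` with `β` in position `j`. -/
def slidePattern {n : ℕ} (α β : Module.End k C) (j i : Fin n) : Module.End k C :=
  if i < j then α else if i = j then β else 1

/-- The operator `∑ j, α ⊗ ⋯ ⊗ α ⊗ β ⊗ 1 ⊗ ⋯ ⊗ 1` on a tensor power. It is the differential if `α`
is the grading involution and `β` is the differential of `C`. -/
noncomputable def slide (n : ℕ) (α β : Module.End k C) : Module.End k (⨂[k] _ : Fin n, C) :=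
  ∑ j, PiTensorProduct.map (slidePattern α β j)

theorem piMap_mul {n : ℕ} (F G : Fin n → Module.End k C) :
    (PiTensorProduct.map F * PiTensorProduct.map G : Module.End k (⨂[k] _ : Fin n, C)) =
      PiTensorProduct.map fun i => F i * G i :=
  (PiTensorProduct.map_comp F G).symm

theorem piMap_smul {n : ℕ} (c : Fin n → k) {F G : Fin n → Module.End k C}
    (h : ∀ i, F i = c i • G i) :
    (PiTensorProduct.map F : Module.End k (⨂[k] _ : Fin n, C)) =
      (∏ i, c i) • PiTensorProduct.map G := by
  rw [funext h]
  exact (PiTensorProduct.mapMultilinear k (fun _ : Fin n => C) (fun _ => C)).map_smul_univ c G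

/-- Two tensor products of operators cancel if their factors agree but for one sign. -/
theorem piMap_add_eq_zero {n : ℕ} (m : Fin n) {F G : Fin n → Module.End k C} (hm : F m = -G m)
    (h : ∀ i, i ≠ m → F i = G i) :
    (PiTensorProduct.map F + PiTensorProduct.map G : Module.End k (⨂[k] _ : Fin n, C)) = 0 := by
  rw [piMap_smul (fun i => if i = m then (-1 : k) else 1) (F := F) (G := G)]
  · rw [Finset.prod_ite_eq' Finset.univ m fun _ => (-1 : k), if_pos (Finset.mem_univ m)]
    exact (congrArg (· + _) (neg_one_smul k
      (PiTensorProduct.map G : Module.End k (⨂[k] _ : Fin n, C)))).trans (neg_add_cancel _)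
  · intro i
    by_cases hi : i = m
    · subst hi
      simp [hm]
    · simp [hi, h i hi]

/-- `1 - γ ⊗ ⋯ ⊗ γ = ∑ j, γ ⊗ ⋯ ⊗ γ ⊗ (1 - γ) ⊗ 1 ⊗ ⋯ ⊗ 1`, a telescoping sum. -/
theorem slide_one_sub (n : ℕ) (γ : Module.End k C) :
    slide n γ (1 - γ) = 1 - PiTensorProduct.map fun _ => γ := by
  have h : ∀ j : Fin n, (PiTensorProduct.map (slidePattern γ (1 - γ) j) :
      Module.End k (⨂[k] _ : Fin n, C)) =
      PiTensorProduct.map (fun i : Fin n => if (i : ℕ) < j then γ else 1) -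
        PiTensorProduct.map (fun i : Fin n => if (i : ℕ) < j + 1 then γ else 1) := by
    intro j
    have e : ∀ β : Module.End k C, Function.update
        (fun i : Fin n => if (i : ℕ) < j then γ else 1) j β = slidePattern γ β j := by
      intro β
      funext i
      by_cases hi : i = j
      · subst hi
        simp [slidePattern]
      · simp only [Function.update_of_ne hi, slidePattern, if_neg hi, Fin.lt_def]
    have e1 : slidePattern γ 1 j = fun i : Fin n => if (i : ℕ) < j then γ else 1 := by
      rw [← e, Function.update_eq_self_iff]
      simp
    have e2 : slidePattern γ γ j = fun i : Fin n => if (i : ℕ) < j + 1 then γ else 1 := by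
      funext i
      simp only [slidePattern, Fin.lt_def, Fin.ext_iff]
      split_ifs <;> first | rfl | omega
    rw [← e1, ← e2, ← e, ← e, ← e]
    exact (PiTensorProduct.mapMultilinear k (fun _ : Fin n => C) (fun _ => C)).map_update_sub
      _ j 1 γ
  unfold slide
  rw [Finset.sum_congr rfl fun j _ => h j, Fin.sum_univ_eq_sum_range (fun t : ℕ =>
    (PiTensorProduct.map (fun i : Fin n => if (i : ℕ) < t then γ else 1) -
      PiTensorProduct.map (fun i : Fin n => if (i : ℕ) < t + 1 then γ else 1) :
      Module.End k (⨂[k] _ : Fin n, C))), Finset.sum_range_sub']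
  congr 1
  · simp only [Nat.not_lt_zero, if_false]
    exact PiTensorProduct.map_one
  · congr 1
    funext i
    rw [if_pos i.2]

theorem slide_add (n : ℕ) (α β β' : Module.End k C) :
    slide n α (β + β') = slide n α β + slide n α β' := by
  have e : ∀ (j : Fin n) (β : Module.End k C), slidePattern α β j =
      Function.update (slidePattern α 1 j) j β := by
    intro j β
    funext i
    by_cases hi : i = j
    · subst hi
      simp [slidePattern]
    · simp [slidePattern, hi]
  unfold slide
  rw [← Finset.sum_add_distrib]
  refine Finset.sum_congr rfl fun j _ => ?_
  rw [e, e j β, e j β']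
  exact (PiTensorProduct.mapMultilinear k (fun _ : Fin n => C) (fun _ => C)).map_update_add _ j _ _

/-- The anticommutator of two slides: the terms with `β` and `β'` in different positions cancel. -/
theorem slide_anticommutator (n : ℕ) {α β α' β' : Module.End k C} (h : α * α' = α' * α)
    (h1 : β * α' = -(α' * β)) (h2 : α * β' = -(β' * α)) :
    slide n α β * slide n α' β' + slide n α' β' * slide n α β =
      slide n (α * α') (β * β' + β' * β) := by
  have key : ∀ j l : Fin n, (PiTensorProduct.map (slidePattern α β j) *
      PiTensorProduct.map (slidePattern α' β' l) + PiTensorProduct.map (slidePattern α' β' l) *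
      PiTensorProduct.map (slidePattern α β j) : Module.End k (⨂[k] _ : Fin n, C)) =
      if j = l then PiTensorProduct.map (slidePattern (α * α') (β * β') j) +
        PiTensorProduct.map (slidePattern (α * α') (β' * β) j) else 0 := by
    intro j l
    rw [piMap_mul, piMap_mul]
    rcases lt_trichotomy j l with hjl | rfl | hjl
    · rw [if_neg hjl.ne]
      refine piMap_add_eq_zero j ?_ fun i hi => ?_
      · simp [slidePattern, hjl, h1]
      · simp only [slidePattern, if_neg hi]
        split_ifs <;> first | simp [h] | (exfalso; omega)
    · rw [if_pos rfl]
      congr 2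
      · funext i
        simp only [slidePattern]
        split_ifs <;> simp
      · funext i
        simp only [slidePattern]
        split_ifs <;> simp [h]
    · rw [if_neg hjl.ne']
      refine piMap_add_eq_zero l ?_ fun i hi => ?_
      · simp [slidePattern, hjl, h2]
      · simp only [slidePattern, if_neg hi]
        split_ifs <;> first | simp [h] | (exfalso; omega)
  rw [slide_add]
  unfold slide
  rw [Finset.sum_mul_sum, Finset.sum_mul_sum, Finset.sum_comm (f := fun l j =>
    (PiTensorProduct.map (slidePattern α' β' l) *
      PiTensorProduct.map (slidePattern α β j) : Module.End k (⨂[k] _ : Fin n, C))),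
    ← Finset.sum_add_distrib, ← Finset.sum_add_distrib]
  refine Finset.sum_congr rfl fun j _ => ?_
  rw [← Finset.sum_add_distrib, Finset.sum_congr rfl fun l _ => key j l]
  simp

theorem piMap_mul_slide_eq_zero (n : ℕ) {γ α β : Module.End k C} (h : γ * β = 0) :
    (PiTensorProduct.map fun _ => γ) * slide n α β = 0 := by
  unfold slide
  rw [Finset.mul_sum]
  refine Finset.sum_eq_zero fun j _ => ?_
  rw [piMap_mul]
  refine (PiTensorProduct.mapMultilinear k (fun _ : Fin n => C) (fun _ => C)).map_coord_zero j ?_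
  simp [slidePattern, h]

theorem slide_tprod_eq_zero (n : ℕ) {α β : Module.End k C} {c : C} (h : β c = 0) :
    slide n α β (PiTensorProduct.tprod k fun _ => c) = 0 := by
  unfold slide
  rw [LinearMap.sum_apply]
  refine Finset.sum_eq_zero fun j _ => ?_
  rw [PiTensorProduct.map_tprod]
  refine (PiTensorProduct.tprod k).map_coord_zero j ?_
  simp [slidePattern, h]

end Slide

section Rotation

variable {k : Type u} [CommRing k] {C : Type u} [AddCommGroup C] [Module k C]

/-- The rotation of tensors, without signs. -/
noncomputable def rotate (n : ℕ) : Module.End k (⨂[k] _ : Fin (n + 1), C) :=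
  (PiTensorProduct.reindex k (fun _ => C) (finRotate (n + 1))).toLinearMap

theorem rotate_tprod (n : ℕ) (v : Fin (n + 1) → C) :
    rotate n (PiTensorProduct.tprod k v) =
      PiTensorProduct.tprod k fun i => v ((finRotate (n + 1)).symm i) :=
  PiTensorProduct.reindex_tprod _ _

theorem piMap_mul_rotate (n : ℕ) (F : Fin (n + 1) → Module.End k C) :
    PiTensorProduct.map F * rotate n = rotate n * PiTensorProduct.map fun i =>
      F (finRotate (n + 1) i) := by
  refine PiTensorProduct.ext (MultilinearMap.ext fun v => ?_)
  change PiTensorProduct.map F (rotate n (PiTensorProduct.tprod k v)) =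
    rotate n (PiTensorProduct.map (fun i => F (finRotate (n + 1) i)) (PiTensorProduct.tprod k v))
  rw [rotate_tprod, PiTensorProduct.map_tprod, PiTensorProduct.map_tprod, rotate_tprod]
  simp only [Equiv.apply_symm_apply]

/-- The family `(α, …, α, β)`. -/
def lastPattern {n : ℕ} (α β : Module.End k C) (i : Fin (n + 1)) : Module.End k C :=
  if i = Fin.last n then β else α

/-- The Koszul sign of moving the last factor to the front; `σ` is the grading involution, and
`π₀`, `π₁` are the projections to the even and the odd part. -/
noncomputable def koszulOp (n : ℕ) (σ π₀ π₁ : Module.End k C) :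
    Module.End k (⨂[k] _ : Fin (n + 1), C) :=
  PiTensorProduct.map (lastPattern 1 π₀) + PiTensorProduct.map (lastPattern σ π₁)

/-- The rotation of tensors that moves the last factor to the front, with the Koszul sign. -/
noncomputable def signedRotate (n : ℕ) (σ π₀ π₁ : Module.End k C) :
    Module.End k (⨂[k] _ : Fin (n + 1), C) :=
  rotate n * koszulOp n σ π₀ π₁

theorem slidePattern_rotate_castSucc {n : ℕ} {σ d : Module.End k C} (j i : Fin n) :
    slidePattern σ d (finRotate (n + 1) j.castSucc) (finRotate (n + 1) i.castSucc) =
      slidePattern σ d j.castSucc i.castSucc := by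
  simp only [slidePattern, finRotate_apply, Fin.coeSucc_eq_succ, Fin.succ_lt_succ_iff,
    Fin.succ_inj, Fin.castSucc_lt_castSucc_iff, Fin.castSucc_inj]

theorem slidePattern_rotate_last {n : ℕ} {σ d : Module.End k C} (j : Fin n) :
    slidePattern σ d (finRotate (n + 1) j.castSucc) (finRotate (n + 1) (Fin.last n)) = σ := by
  rw [finRotate_last, finRotate_apply, Fin.coeSucc_eq_succ, slidePattern,
    if_pos (Fin.succ_pos j)]

theorem slidePattern_castSucc_last {n : ℕ} {σ d : Module.End k C} (j : Fin n) :
    slidePattern σ d j.castSucc (Fin.last n) = 1 := by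
  rw [slidePattern, if_neg (Fin.castSucc_lt_last j).le.not_gt,
    if_neg (Fin.castSucc_lt_last j).ne']

/-- The term of the differential in a position other than the last one is carried by the rotation
to the next position. -/
theorem rotate_slidePattern_castSucc {n : ℕ} {σ π₀ π₁ d : Module.End k C}
    (h0 : σ * π₀ = π₀) (h1 : σ * π₁ = -π₁) (hd : d * σ = -(σ * d)) (j : Fin n) :
    (PiTensorProduct.map fun i => slidePattern σ d (finRotate (n + 1) j.castSucc)
      (finRotate (n + 1) i)) * koszulOp n σ π₀ π₁ =
      koszulOp n σ π₀ π₁ * PiTensorProduct.map (slidePattern σ d j.castSucc) := by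
  unfold koszulOp
  rw [mul_add, add_mul, piMap_mul, piMap_mul, piMap_mul, piMap_mul]
  refine congrArg₂ (fun a b : Module.End k (⨂[k] _ : Fin (n + 1), C) => a + b) ?_ ?_
  · refine congrArg PiTensorProduct.map (funext fun i => ?_)
    cases i using Fin.lastCases with
    | last =>
      rw [slidePattern_rotate_last, slidePattern_castSucc_last]
      simp [lastPattern, h0]
    | cast i =>
      rw [slidePattern_rotate_castSucc]
      simp [lastPattern, (Fin.castSucc_lt_last i).ne]
  · rw [piMap_smul (fun i => if i = Fin.last n ∨ i = j.castSucc then (-1 : k) else 1)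
      (G := fun i => lastPattern σ π₁ i * slidePattern σ d j.castSucc i)]
    · rw [Fin.prod_univ_castSucc]
      simp [(Fin.castSucc_lt_last _).ne]
    · intro i
      cases i using Fin.lastCases with
      | last =>
        rw [slidePattern_rotate_last, slidePattern_castSucc_last]
        simp [lastPattern, h1]
      | cast i =>
        rw [slidePattern_rotate_castSucc]
        simp only [slidePattern, lastPattern, Fin.castSucc_lt_castSucc_iff, Fin.castSucc_inj,
          (Fin.castSucc_lt_last i).ne, if_false, false_or]
        split_ifs with h h' <;> first | (exfalso; omega) | simp [hd]

/-- The term of the differential in the last position is carried by the rotation to the first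
position. -/
theorem rotate_slidePattern_last {n : ℕ} {σ π₀ π₁ d : Module.End k C} (hσ : σ * σ = 1)
    (hd0 : π₀ * d = d * π₁) (hd1 : π₁ * d = d * π₀) :
    (PiTensorProduct.map fun i => slidePattern σ d (finRotate (n + 1) (Fin.last n))
      (finRotate (n + 1) i)) * koszulOp n σ π₀ π₁ =
      koszulOp n σ π₀ π₁ * PiTensorProduct.map (slidePattern σ d (Fin.last n)) := by
  have hc : ∀ i : Fin n, slidePattern σ d (finRotate (n + 1) (Fin.last n))
      (finRotate (n + 1) i.castSucc) = 1 := fun i => by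
    rw [finRotate_last, finRotate_apply, Fin.coeSucc_eq_succ, slidePattern,
      if_neg (Fin.not_lt_zero _), if_neg (Fin.succ_ne_zero i)]
  have hl : slidePattern σ d (finRotate (n + 1) (Fin.last n))
      (finRotate (n + 1) (Fin.last n)) = d := by
    simp [slidePattern]
  unfold koszulOp
  rw [mul_add, add_mul, piMap_mul, piMap_mul, piMap_mul, piMap_mul,
    add_comm (PiTensorProduct.map fun i => lastPattern 1 π₀ i * slidePattern σ d (Fin.last n) i)]
  refine congrArg₂ (fun a b : Module.End k (⨂[k] _ : Fin (n + 1), C) => a + b)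
    (congrArg PiTensorProduct.map (funext fun i => ?_))
    (congrArg PiTensorProduct.map (funext fun i => ?_))
  · cases i using Fin.lastCases with
    | last =>
      rw [hl]
      simp [slidePattern, lastPattern, hd1]
    | cast i =>
      rw [hc]
      simp [slidePattern, lastPattern, Fin.castSucc_lt_last, (Fin.castSucc_lt_last i).ne, hσ]
  · cases i using Fin.lastCases with
    | last =>
      rw [hl]
      simp [slidePattern, lastPattern, hd0]
    | cast i =>
      rw [hc]
      simp [slidePattern, lastPattern, Fin.castSucc_lt_last, (Fin.castSucc_lt_last i).ne]

/-- The signed rotation commutes with the differential of the tensor power. -/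
theorem slide_mul_signedRotate (n : ℕ) {σ π₀ π₁ d : Module.End k C} (hσ : σ * σ = 1)
    (h0 : σ * π₀ = π₀) (h1 : σ * π₁ = -π₁) (hd : d * σ = -(σ * d)) (hd0 : π₀ * d = d * π₁)
    (hd1 : π₁ * d = d * π₀) :
    slide (n + 1) σ d * signedRotate n σ π₀ π₁ = signedRotate n σ π₀ π₁ * slide (n + 1) σ d := by
  have hR : slide (n + 1) σ d * rotate n = rotate n * ∑ j, PiTensorProduct.map fun i =>
      slidePattern σ d (finRotate (n + 1) j) (finRotate (n + 1) i) := by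
    unfold slide
    rw [Finset.sum_mul, ← Equiv.sum_comp (finRotate (n + 1)), Finset.mul_sum]
    exact Finset.sum_congr rfl fun j _ => piMap_mul_rotate n _
  unfold signedRotate
  rw [← mul_assoc, hR, mul_assoc, mul_assoc]
  refine congrArg (fun a => rotate n * a) ?_
  unfold slide
  rw [Finset.sum_mul, Finset.mul_sum]
  refine Finset.sum_congr rfl fun j _ => ?_
  cases j using Fin.lastCases with
  | last => exact rotate_slidePattern_last hσ hd0 hd1
  | cast j => exact rotate_slidePattern_castSucc h0 h1 hd j

theorem piMap_mul_signedRotate (n : ℕ) {σ π₀ π₁ γ : Module.End k C} (hσ : γ * σ = σ * γ)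
    (h0 : γ * π₀ = π₀ * γ) (h1 : γ * π₁ = π₁ * γ) :
    (PiTensorProduct.map fun _ => γ) * signedRotate n σ π₀ π₁ =
      signedRotate n σ π₀ π₁ * PiTensorProduct.map fun _ => γ := by
  unfold signedRotate koszulOp
  rw [← mul_assoc, piMap_mul_rotate, mul_assoc, mul_assoc, mul_add, add_mul, piMap_mul, piMap_mul,
    piMap_mul, piMap_mul]
  congr 4 <;>
  · funext i
    simp only [lastPattern]
    split_ifs <;> simp [hσ, h0, h1]

/-- `c` is homogeneous, of a degree of the parity of `b`. All three conditions are required, since the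
sign does not determine the parity in characteristic `2`. -/
structure IsHomogeneous (σ π₀ π₁ : Module.End k C) (b : ℕ) (c : C) : Prop where
  sign : σ c = (-1 : k) ^ b • c
  even : π₀ c = if Even b then c else 0
  odd : π₁ c = if Even b then 0 else c

/-- On tensors of homogeneous elements the signed rotation is the rotation with the Koszul sign of
moving the last factor across the others. -/
theorem signedRotate_tprod (n : ℕ) {σ π₀ π₁ : Module.End k C} (b : Fin (n + 1) → ℕ)
    (v : Fin (n + 1) → C) (hv : ∀ i, IsHomogeneous σ π₀ π₁ (b i) (v i)) :
    signedRotate n σ π₀ π₁ (PiTensorProduct.tprod k v) =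
      (-1 : k) ^ ((∑ i : Fin n, b i.castSucc) * b (Fin.last n)) •
        PiTensorProduct.tprod k fun i => v ((finRotate (n + 1)).symm i) := by
  change rotate n (PiTensorProduct.map (lastPattern 1 π₀) (PiTensorProduct.tprod k v) +
    PiTensorProduct.map (lastPattern σ π₁) (PiTensorProduct.tprod k v)) = _
  rw [← rotate_tprod, ← map_smul]
  congr 1
  rw [PiTensorProduct.map_tprod, PiTensorProduct.map_tprod]
  -- One of the two summands of `koszulOp` vanishes, by the parity of the last factor.
  by_cases hb : Even (b (Fin.last n))
  · have h1 : (fun i => lastPattern 1 π₀ i (v i)) = v := by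
      funext i
      by_cases hi : i = Fin.last n
      · subst hi
        simp [lastPattern, (hv _).even, hb]
      · simp [lastPattern, hi]
    rw [h1, (hb.mul_left _).neg_one_pow, one_smul, (PiTensorProduct.tprod k).map_coord_zero
      (m := fun i => lastPattern σ π₁ i (v i))
      (Fin.last n) (by simp [lastPattern, (hv _).odd, hb]), add_zero]
  · have h1 : (fun i => lastPattern σ π₁ i (v i)) =
        fun i => (if i = Fin.last n then 1 else (-1 : k) ^ b i) • v i := by
      funext i
      by_cases hi : i = Fin.last n
      · subst hi
        simp [lastPattern, (hv _).odd, hb]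
      · simp [lastPattern, hi, (hv _).sign]
    rw [h1, MultilinearMap.map_smul_univ, (PiTensorProduct.tprod k).map_coord_zero
      (m := fun i => lastPattern 1 π₀ i (v i))
      (Fin.last n) (by simp [lastPattern, (hv _).even, hb]), zero_add, Fin.prod_univ_castSucc,
      pow_mul', (Nat.not_even_iff_odd.mp hb).neg_one_pow, ← Finset.prod_pow_eq_pow_sum]
    simp [(Fin.castSucc_lt_last _).ne]

theorem finRotate_symm_pow (n t : ℕ) (i : Fin (n + 1)) :
    ((finRotate (n + 1)).symm ^ t : Equiv.Perm (Fin (n + 1))) i = i - Fin.ofNat (n + 1) t := by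
  induction t generalizing i with
  | zero => simp
  | succ t ih =>
    have h : Fin.ofNat (n + 1) (t + 1) = Fin.ofNat (n + 1) t + 1 := by
      ext
      simp [Fin.val_add]
    rw [pow_succ, Equiv.Perm.mul_apply, ih, finRotate_symm_apply, h, sub_sub, add_comm 1]

theorem finRotate_symm_pow_self (n : ℕ) : (finRotate (n + 1)).symm ^ (n + 1) = 1 := by
  ext i : 1
  rw [finRotate_symm_pow]
  simp

/-- Moving a factor of degree `c` across the others, of total degree `B`, costs `B * c`, which has the
parity of `(1 + (B + c)) * c`; hence the exponent in terms of the total degree. -/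
theorem signedRotate_pow_tprod (n : ℕ) {σ π₀ π₁ : Module.End k C} (b : Fin (n + 1) → ℕ)
    (v : Fin (n + 1) → C) (hv : ∀ i, IsHomogeneous σ π₀ π₁ (b i) (v i)) (t : ℕ) :
    (signedRotate n σ π₀ π₁ ^ t) (PiTensorProduct.tprod k v) =
      (-1 : k) ^ ((1 + ∑ i, b i) * ∑ s ∈ Finset.range t,
        b (((finRotate (n + 1)).symm ^ s : Equiv.Perm (Fin (n + 1))) (Fin.last n))) •
        PiTensorProduct.tprod k fun i =>
          v (((finRotate (n + 1)).symm ^ t : Equiv.Perm (Fin (n + 1))) i) := by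
  induction t with
  | zero => simp
  | succ t ih =>
    set ρ : Equiv.Perm (Fin (n + 1)) := (finRotate (n + 1)).symm ^ t with hρ
    rw [pow_succ', Module.End.mul_apply, ih, map_smul, signedRotate_tprod n (fun i => b (ρ i)) _
      (fun i => hv (ρ i)), smul_smul, ← pow_add, Finset.sum_range_succ, mul_add]
    congr 1
    · rw [pow_add, pow_add]
      congr 1
      have hs : ∑ i, b i = (∑ i : Fin n, b (ρ i.castSucc)) + b (ρ (Fin.last n)) := by
        rw [← Fin.sum_univ_castSucc (fun i => b (ρ i)), Equiv.sum_comp ρ]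
      rw [hs, ← hρ]
      generalize (∑ i : Fin n, b (ρ i.castSucc)) = B
      generalize b (ρ (Fin.last n)) = c
      have hc : Even (c * (c + 1)) := Nat.even_mul_succ_self c
      rw [show (1 + (B + c)) * c = B * c + c * (c + 1) by ring, pow_add, hc.neg_one_pow, mul_one]

/-- A full turn is the identity: its sign has the even exponent `(1 + ∑ b) * ∑ b`. -/
theorem signedRotate_pow_tprod_self (n : ℕ) {σ π₀ π₁ : Module.End k C} (b : Fin (n + 1) → ℕ)
    (v : Fin (n + 1) → C) (hv : ∀ i, IsHomogeneous σ π₀ π₁ (b i) (v i)) :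
    (signedRotate n σ π₀ π₁ ^ (n + 1)) (PiTensorProduct.tprod k v) =
      PiTensorProduct.tprod k v := by
  have h2 : ∑ s ∈ Finset.range (n + 1),
      b (((finRotate (n + 1)).symm ^ s : Equiv.Perm (Fin (n + 1))) (Fin.last n)) = ∑ i, b i := by
    simp only [finRotate_symm_pow]
    rw [← Fin.sum_univ_eq_sum_range (fun s : ℕ => b (Fin.last n - Fin.ofNat (n + 1) s))]
    simp only [Fin.ofNat_val_eq_self]
    exact Equiv.sum_comp (Equiv.subLeft (Fin.last n)) b
  rw [signedRotate_pow_tprod n b v hv, h2, add_comm 1 (∑ i, b i), mul_comm,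
    (Nat.even_mul_succ_self _).neg_one_pow, one_smul]
  exact congrArg (fun ρ : Equiv.Perm (Fin (n + 1)) => PiTensorProduct.tprod k fun i => v (ρ i))
    (finRotate_symm_pow_self n)

end Rotation

/-! ### Cyclic operators and words in the letters `z`, `b`, `d b` -/

section CyclicOperators

/-- The operators `τ - 1` (for `i` even) and `1 + τ + ⋯ + τ^{p-1}` (for `i` odd) of the periodic
resolution, which express `d e_{i+1}` in terms of `e_i`. -/
def cyclicOp {R : Type*} [Ring R] (p i : ℕ) (τ : R) : R :=
  if Even i then τ - 1 else ∑ t ∈ Finset.range p, τ ^ t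

theorem cyclicOp_mul {R : Type*} [Ring R] {p : ℕ} {τ : R} (h : τ ^ p = 1) (i : ℕ) :
    cyclicOp p (i + 1) τ * cyclicOp p i τ = 0 := by
  unfold cyclicOp
  by_cases hi : Even i
  · rw [if_pos hi, if_neg (by simpa [Nat.even_add_one] using hi), geom_sum_mul, h, sub_self]
  · rw [if_neg hi, if_pos (by simpa [Nat.even_add_one] using hi), mul_geom_sum, h, sub_self]

theorem cyclicOp_mul' {R : Type*} [Ring R] {p : ℕ} {τ : R} (h : τ ^ p = 1) (i : ℕ) :
    cyclicOp p i τ * cyclicOp p (i + 1) τ = 0 := by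
  unfold cyclicOp
  by_cases hi : Even i
  · rw [if_pos hi, if_neg (by simpa [Nat.even_add_one] using hi), mul_geom_sum, h, sub_self]
  · rw [if_neg hi, if_pos (by simpa [Nat.even_add_one] using hi), geom_sum_mul, h, sub_self]

theorem commute_cyclicOp {R : Type*} [Ring R] {D τ : R} (h : D * τ = τ * D) (p i : ℕ) :
    D * cyclicOp p i τ = cyclicOp p i τ * D := by
  have hc : Commute D τ := h
  unfold cyclicOp
  split_ifs
  · exact hc.sub_right (Commute.one_right D)
  · exact Commute.sum_right _ _ _ fun t _ => hc.pow_right t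

variable {k : Type u} [CommRing k]

/-- A linear map that intertwines two operators intertwines their cyclic operators. -/
theorem cyclicOp_intertwine {E F : Type*} [AddCommGroup E] [Module k E] [AddCommGroup F]
    [Module k F] (f : E →ₗ[k] F) {a : Module.End k E} {b : Module.End k F}
    (h : ∀ x, f (a x) = b (f x)) (p i : ℕ) (x : E) :
    f (cyclicOp p i a x) = cyclicOp p i b (f x) := by
  have hpow : ∀ (t : ℕ) x, f ((a ^ t) x) = (b ^ t) (f x) := by
    intro t
    induction t with
    | zero => intro x; rfl
    | succ t ih =>
      intro x
      rw [pow_succ, pow_succ, Module.End.mul_apply, Module.End.mul_apply, ih, h]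
  unfold cyclicOp
  split_ifs
  · rw [LinearMap.sub_apply, LinearMap.sub_apply, map_sub, h]
    rfl
  · rw [LinearMap.sum_apply, LinearMap.sum_apply, map_sum]
    exact Finset.sum_congr rfl fun t _ => hpow t x

/-- If `τ` acts adjointly on the two sides of a pairing, then so do its cyclic operators. -/
theorem cyclicOp_adjoint {E M Y : Type*} [AddCommGroup E] [Module k E] [AddCommGroup M]
    [Module k M] [AddCommGroup Y] [Module k Y] (ev : E →ₗ[k] M →ₗ[k] Y) {τE : Module.End k E}
    {τ : Module.End k M} (hequi : ∀ x m, ev (τE x) m = ev x (τ m)) (p j : ℕ) (x : E) (m : M) :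
    ev (cyclicOp p j τE x) m = ev x (cyclicOp p j τ m) := by
  have hpow : ∀ (t : ℕ) x m, ev ((τE ^ t) x) m = ev x ((τ ^ t) m) := by
    intro t
    induction t with
    | zero => intro x m; rfl
    | succ t ih =>
      intro x m
      rw [pow_succ', pow_succ, Module.End.mul_apply, Module.End.mul_apply, hequi, ih]
  unfold cyclicOp
  split_ifs
  · rw [LinearMap.sub_apply, LinearMap.sub_apply, map_sub, map_sub, LinearMap.sub_apply, hequi]
    rfl
  · rw [LinearMap.sum_apply, LinearMap.sum_apply, map_sum, map_sum, LinearMap.sum_apply]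
    exact Finset.sum_congr rfl fun t _ => hpow t x m

/-- Let `M` be a complex with an action of the cyclic group and a contraction `S` onto the image
of a projection `Z`, neither of which need be compatible otherwise. Then invariant cycles of `M`
on which `Z` vanishes are paired with the elements `ξ i` of a cyclic lift to boundaries. Indeed, by
the Leibniz rule the pairing of `ξ i` with `m = D (S m)` is, up to a boundary and sign, that of
`d ξ i`, hence of `ξ (i - 1)`, with a cyclic operator applied to `S m`; the latter is again a cycle
on which `Z` vanishes, which permits induction on `i`. -/
theorem exists_boundary_of_contraction {E M Y : Type*} [AddCommGroup E] [Module k E]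
    [AddCommGroup M] [Module k M] [AddCommGroup Y] [Module k Y] (p : ℕ)
    (ev : E →ₗ[k] M →ₗ[k] Y) {dE sE τE : Module.End k E} {dY : Module.End k Y}
    {D S Z τ : Module.End k M}
    (hleib : ∀ x m, dY (ev x m) = ev (dE x) m + ev (sE x) (D m))
    (hequi : ∀ x m, ev (τE x) m = ev x (τ m)) (hDS : D * S + S * D = 1 - Z) (hZS : Z * S = 0)
    (hD : D * τ = τ * D) (hZ : Z * τ = τ * Z) (hτ : τ ^ p = 1) {ξ : ℕ → E}
    (hs : ∀ i, sE (ξ i) = (-1 : k) ^ i • ξ i) (h0 : dE (ξ 0) = 0)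
    (hξ : ∀ i, dE (ξ (i + 1)) = cyclicOp p i τE (ξ i)) (i : ℕ) (m : M) (hm : D m = 0)
    (hmZ : Z m = 0) (hmτ : ∀ j, i = j + 1 → cyclicOp p j τ m = 0) :
    ∃ y, ev (ξ i) m = dY y := by
  have hcontr : ∀ m, D m = 0 → Z m = 0 → D (S m) = m := by
    intro m hm hmZ
    have h := congrArg (fun f : Module.End k M => f m) hDS
    simpa [hm, hmZ] using h
  induction i generalizing m with
  | zero =>
    refine ⟨ev (ξ 0) (S m), ?_⟩
    rw [hleib, h0, hs, hcontr m hm hmZ]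
    simp
  | succ i ih =>
    obtain ⟨y, hy⟩ := ih (cyclicOp p i τ (S m)) (by
        rw [← Module.End.mul_apply, commute_cyclicOp hD, Module.End.mul_apply,
          hcontr m hm hmZ, hmτ i rfl]) (by
        rw [← Module.End.mul_apply, commute_cyclicOp hZ, Module.End.mul_apply,
          ← Module.End.mul_apply Z S, hZS]
        simp) (by
        rintro j rfl
        rw [← Module.End.mul_apply, cyclicOp_mul' hτ]
        rfl)
    have h := hleib (ξ (i + 1)) (S m)
    rw [hξ, cyclicOp_adjoint ev hequi, hy, hs, hcontr m hm hmZ] at h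
    have hsq : ((-1 : k) ^ (i + 1)) * (-1 : k) ^ (i + 1) = 1 := by
      rw [← mul_pow]
      simp
    refine ⟨(-1 : k) ^ (i + 1) • (ev (ξ (i + 1)) (S m) - y), ?_⟩
    rw [map_smul, map_sub, h, add_sub_cancel_left, map_smul, LinearMap.smul_apply, smul_smul,
      hsq, one_smul]

end CyclicOperators

section Letters

variable {k : Type u} [CommRing k]

/-- The endomorphism of `k³` that takes the `i`-th basis element to the `j`-th one and the others
to `0`. -/
def coordMap (k : Type u) [CommRing k] (i j : Fin 3) : Module.End k (Fin 3 → k) :=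
  LinearMap.single k (fun _ : Fin 3 => k) j ∘ₗ LinearMap.proj i

/-- The diagonal endomorphisms of `k³`. -/
def diagMap (c : Fin 3 → k) : Module.End k (Fin 3 → k) :=
  LinearMap.pi fun i => c i • LinearMap.proj i

theorem coordMap_apply (i j : Fin 3) (v : Fin 3 → k) :
    coordMap k i j v = Pi.single j (v i) := rfl

theorem diagMap_apply (c : Fin 3 → k) (v : Fin 3 → k) (i : Fin 3) :
    diagMap c v i = c i * v i := rfl

theorem diagMap_mul (c c' : Fin 3 → k) : diagMap c * diagMap c' = diagMap (c * c') :=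
  LinearMap.ext fun v => funext fun i => by
    simp [diagMap_apply, mul_assoc]

theorem diagMap_mul_coordMap (c : Fin 3 → k) (i j : Fin 3) :
    diagMap c * coordMap k i j = c j • coordMap k i j :=
  LinearMap.ext fun v => funext fun l => by
    by_cases h : l = j
    · subst h
      simp [diagMap_apply, coordMap_apply]
    · simp [diagMap_apply, coordMap_apply, h]

theorem coordMap_mul_diagMap (c : Fin 3 → k) (i j : Fin 3) :
    coordMap k i j * diagMap c = c i • coordMap k i j :=
  LinearMap.ext fun v => funext fun l => by
    by_cases h : l = j
    · subst h
      simp [diagMap_apply, coordMap_apply]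
    · simp [diagMap_apply, coordMap_apply, h]

theorem coordMap_mul_coordMap (i j i' j' : Fin 3) :
    coordMap k i j * coordMap k i' j' = if i = j' then coordMap k i' j else 0 :=
  LinearMap.ext fun v => by
    by_cases h : i = j'
    · subst h
      simp [coordMap_apply]
    · simp [coordMap_apply, h]

/-- The degrees of the basis elements `z`, `b`, `d b` of `k³`, for `z` of degree `q`. -/
def letterDeg (q : ℕ) : Fin 3 → ℕ := ![q, q + 1, q]

/-- The grading involution. -/
def letterSign (k : Type u) [CommRing k] (q : ℕ) : Module.End k (Fin 3 → k) :=
  diagMap fun i => (-1) ^ letterDeg q i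

/-- The projection to the even part. -/
def letterEven (k : Type u) [CommRing k] (q : ℕ) : Module.End k (Fin 3 → k) :=
  diagMap fun i => if Even (letterDeg q i) then 1 else 0

/-- The projection to the odd part. -/
def letterOdd (k : Type u) [CommRing k] (q : ℕ) : Module.End k (Fin 3 → k) :=
  diagMap fun i => if Even (letterDeg q i) then 0 else 1

theorem letter_isHomogeneous (q : ℕ) (i : Fin 3) : IsHomogeneous (letterSign k q)
    (letterEven k q) (letterOdd k q) (letterDeg q i) (Pi.single i (1 : k)) := by
  constructor <;>
  · funext l
    by_cases h : l = i
    · subst h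
      simp only [letterSign, letterEven, letterOdd, diagMap_apply, Pi.single_eq_same, Pi.smul_apply,
        smul_eq_mul]
      try split_ifs <;> simp
    · simp only [letterSign, letterEven, letterOdd, diagMap_apply, Pi.single_eq_of_ne h,
        Pi.smul_apply, smul_zero, mul_zero]
      try split_ifs <;> simp [h]

theorem isHomogeneous_add {C : Type u} [AddCommGroup C] [Module k C] {σ π₀ π₁ : Module.End k C}
    {b : ℕ} {c c' : C} (h : IsHomogeneous σ π₀ π₁ b c) (h' : IsHomogeneous σ π₀ π₁ b c') :
    IsHomogeneous σ π₀ π₁ b (c + c') where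
  sign := by rw [map_add, h.sign, h'.sign, smul_add]
  even := by
    rw [map_add, h.even, h'.even]
    split_ifs <;> simp
  odd := by
    rw [map_add, h.odd, h'.odd]
    split_ifs <;> simp

/-- The signed rotation of words in the letters. -/
noncomputable def letterRotate (k : Type u) [CommRing k] (n q : ℕ) :
    Module.End k (⨂[k] _ : Fin (n + 1), (Fin 3 → k)) :=
  signedRotate n (letterSign k q) (letterEven k q) (letterOdd k q)

/-- The differential of words in the letters. -/
noncomputable def letterD (k : Type u) [CommRing k] (n q : ℕ) :
    Module.End k (⨂[k] _ : Fin (n + 1), (Fin 3 → k)) :=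
  slide (n + 1) (letterSign k q) (coordMap k 1 2)

/-- The contraction of words in the letters onto the power of the first letter, from the contraction
`d b ↦ b` of `k³`. It does not commute with the rotation. -/
noncomputable def letterS (k : Type u) [CommRing k] (n q : ℕ) :
    Module.End k (⨂[k] _ : Fin (n + 1), (Fin 3 → k)) :=
  slide (n + 1) (coordMap k 0 0 * letterSign k q) (coordMap k 2 1)

/-- The projection of words in the letters to the power of the first letter. -/
noncomputable def letterZ (k : Type u) [CommRing k] (n : ℕ) :
    Module.End k (⨂[k] _ : Fin (n + 1), (Fin 3 → k)) :=
  PiTensorProduct.map fun _ => coordMap k 0 0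

theorem neg_one_pow_mul_self (q : ℕ) : (-1 : k) ^ q * (-1) ^ q = 1 := by
  rw [← mul_pow]
  simp

theorem letterSign_mul_self (q : ℕ) : letterSign k q * letterSign k q = 1 := by
  refine (diagMap_mul _ _).trans (LinearMap.ext fun v => funext fun i => ?_)
  rw [diagMap_apply, Pi.mul_apply, neg_one_pow_mul_self, one_mul]
  rfl

/-- `letterS` is a homotopy from the projection to the power of the letter `z` to the identity. -/
theorem letterD_mul_letterS (n q : ℕ) :
    letterD k n q * letterS k n q + letterS k n q * letterD k n q = 1 - letterZ k n := by
  have h1 : letterSign k q * (coordMap k 0 0 * letterSign k q) = coordMap k 0 0 := by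
    simp only [letterSign, coordMap_mul_diagMap, diagMap_mul_coordMap, smul_smul, mul_smul_comm,
      neg_one_pow_mul_self, one_smul]
  have h2 : coordMap k 0 0 * letterSign k q * letterSign k q = coordMap k 0 0 := by
    rw [mul_assoc, letterSign_mul_self, mul_one]
  have h3 : coordMap k 1 2 * coordMap k 2 1 + coordMap k 2 1 * coordMap k 1 2 =
      1 - coordMap k 0 0 := by
    refine LinearMap.ext fun v => funext fun i => ?_
    fin_cases i <;> simp [coordMap_apply]
  unfold letterD letterS letterZ
  rw [slide_anticommutator, h1, h3, slide_one_sub]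
  · rw [h1, h2]
  · simp [letterSign, coordMap_mul_diagMap, coordMap_mul_coordMap]
  · simp [letterSign, coordMap_mul_diagMap, diagMap_mul_coordMap, letterDeg, pow_succ]
    exact neg_smul ((-1 : k) ^ q) (coordMap k 2 1)

theorem letterZ_mul_letterS (n q : ℕ) : letterZ k n * letterS k n q = 0 :=
  piMap_mul_slide_eq_zero (n + 1) (by simp [coordMap_mul_coordMap])

theorem letterD_mul_letterRotate (n q : ℕ) :
    letterD k n q * letterRotate k n q = letterRotate k n q * letterD k n q := by
  refine slide_mul_signedRotate n (letterSign_mul_self q) ?_ ?_ ?_ ?_ ?_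
  · refine (diagMap_mul _ _).trans (congrArg diagMap (funext fun i => ?_))
    by_cases h : Even (letterDeg q i) <;> simp [h]
  · refine LinearMap.ext fun v => funext fun i => ?_
    simp only [letterSign, letterOdd, Module.End.mul_apply, diagMap_apply, LinearMap.neg_apply,
      Pi.neg_apply]
    by_cases h : Even (letterDeg q i)
    · simp [h]
    · simp [h, (Nat.not_even_iff_odd.mp h).neg_one_pow]
  · simp [letterSign, coordMap_mul_diagMap, diagMap_mul_coordMap, letterDeg, pow_succ]
    exact neg_smul ((-1 : k) ^ q) (coordMap k 1 2)
  · refine (diagMap_mul_coordMap _ _ _).trans (Eq.trans ?_ (coordMap_mul_diagMap _ _ _).symm)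
    by_cases h : Even q <;> simp [letterDeg, Nat.even_add_one, h]
  · refine (diagMap_mul_coordMap _ _ _).trans (Eq.trans ?_ (coordMap_mul_diagMap _ _ _).symm)
    by_cases h : Even q <;> simp [letterDeg, Nat.even_add_one, h]

theorem letterZ_mul_letterRotate (n q : ℕ) :
    letterZ k n * letterRotate k n q = letterRotate k n q * letterZ k n := by
  refine piMap_mul_signedRotate n ?_ ?_ ?_ <;>
    simp [letterSign, letterEven, letterOdd, coordMap_mul_diagMap, diagMap_mul_coordMap]

/-- The cyclic group of order `n + 1` acts on words of length `n + 1`. -/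
theorem letterRotate_pow (n q : ℕ) : letterRotate k n q ^ (n + 1) = 1 := by
  refine PiTensorProduct.ext (Module.Basis.ext_multilinear (fun _ => Pi.basisFun k (Fin 3))
    fun w => ?_)
  simp only [Pi.basisFun_apply]
  exact signedRotate_pow_tprod_self n (fun i => letterDeg q (w i)) _
    fun i => letter_isHomogeneous q (w i)

/-- Powers of an element of degree `q` are invariant, since the Koszul sign is trivial when the number
of factors is a prime that vanishes in `k`. The cyclic operators map them to zero or to a multiple of
that prime. -/
theorem cyclicOp_letterRotate {n q : ℕ} (hp : (n + 1).Prime) (hk : ((n + 1 : ℕ) : k) = 0)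
    {c : Fin 3 → k} (hc : IsHomogeneous (letterSign k q) (letterEven k q) (letterOdd k q) q c)
    (j : ℕ) :
    cyclicOp (n + 1) j (letterRotate k n q) (PiTensorProduct.tprod k fun _ => c) = 0 := by
  have hfix : letterRotate k n q (PiTensorProduct.tprod k fun _ => c) =
      PiTensorProduct.tprod k fun _ => c := by
    refine (signedRotate_tprod n (fun _ => q) _ fun _ => hc).trans ?_
    have hs : (-1 : k) ^ ((∑ _ : Fin n, q) * q) = 1 := by
      rcases hp.eq_two_or_odd' with h2 | ho
      · have h1 : (-1 : k) = 1 := by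
          rw [h2] at hk
          rw [neg_eq_iff_add_eq_zero]
          push_cast at hk
          rw [one_add_one_eq_two, hk]
        rw [h1, one_pow]
      · have he : Even n := by
          obtain ⟨m, hm⟩ := ho
          exact ⟨m, by omega⟩
        rw [Finset.sum_const, Finset.card_univ, Fintype.card_fin, smul_eq_mul, mul_assoc]
        exact (he.mul_right _).neg_one_pow
    rw [hs, one_smul]
  unfold cyclicOp
  split_ifs
  · rw [LinearMap.sub_apply, hfix]
    exact sub_self _
  · have hpow : ∀ t : ℕ, (letterRotate k n q ^ t) (PiTensorProduct.tprod k fun _ => c) =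
        PiTensorProduct.tprod k fun _ => c := by
      intro t
      induction t with
      | zero => rfl
      | succ t ih => rw [pow_succ, Module.End.mul_apply, hfix, ih]
    rw [LinearMap.sum_apply, Finset.sum_congr rfl fun t _ => hpow t, Finset.sum_const,
      Finset.card_range, ← Nat.cast_smul_eq_nsmul k, hk, zero_smul]

end Letters

/-! ### Evaluation of multilinear operations on words -/

section Evaluation

variable {k : Type u} [CommRing k]

/-- The exponent of the Koszul sign of the rotation. -/
theorem koszul_finRotate (n : ℕ) (b : Fin (n + 1) → ℕ) :
    koszul (finRotate (n + 1)) b = (∑ i : Fin n, b i.castSucc) * b (Fin.last n) := by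
  unfold koszul
  rw [Finset.sum_filter, Fintype.sum_prod_type, Fin.sum_univ_castSucc, Finset.sum_mul]
  have hlast : ∀ j, (if Fin.last n < j ∧ finRotate (n + 1) j < finRotate (n + 1) (Fin.last n)
      then b (Fin.last n) * b j else 0) = 0 := fun j =>
    if_neg fun hj => (Fin.le_last j).not_gt hj.1
  rw [Finset.sum_eq_zero fun j _ => hlast j, add_zero]
  refine Finset.sum_congr rfl fun i _ => ?_
  rw [Fin.sum_univ_castSucc]
  simp only [finRotate_apply, Fin.coeSucc_eq_succ, Fin.succ_lt_succ_iff,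
    Fin.castSucc_lt_castSucc_iff, Fin.castSucc_lt_last, Fin.last_add_one, Fin.succ_pos, and_self,
    if_true]
  rw [Finset.sum_eq_zero fun j _ => if_neg fun h => lt_asymm h.1 h.2, zero_add]

variable {E C Y : Type u} [AddCommGroup E] [Module k E] [AddCommGroup C] [Module k C]
  [AddCommGroup Y] [Module k Y]

/-- The evaluation of a multilinear map at tensors in a module `C`, along a map `φ` of modules. -/
noncomputable def evalTensor {n : ℕ} (θ : E →ₗ[k] MultilinearMap k (fun _ : Fin n => Y) Y)
    (φ : C →ₗ[k] Y) : E →ₗ[k] (⨂[k] _ : Fin n, C) →ₗ[k] Y :=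
  PiTensorProduct.lift.toLinearMap ∘ₗ MultilinearMap.compLinearMapₗ (fun _ => φ) ∘ₗ θ

theorem evalTensor_tprod {n : ℕ} (θ : E →ₗ[k] MultilinearMap k (fun _ : Fin n => Y) Y)
    (φ : C →ₗ[k] Y) (x : E) (v : Fin n → C) :
    evalTensor θ φ x (PiTensorProduct.tprod k v) = θ x fun i => φ (v i) :=
  PiTensorProduct.lift.tprod _

end Evaluation

section PowerOperations

variable {k : Type u} [CommRing k] {X : ChainComplex (ModuleCat.{u} k) ℕ}

/-- Evaluation along a map compatible with signs and differentials is a chain map. -/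
theorem evalTensor_leibniz {P : ChainComplex (ModuleCat.{u} k) ℕ} {n : ℕ}
    {θ : Tot P →ₗ[k] MultilinearMap k (fun _ : Fin n => Tot X) (Tot X)}
    (hθ : IsChainMultimap (Y := fun _ => X) θ) {C : Type u} [AddCommGroup C] [Module k C]
    {φ : C →ₗ[k] Tot X} {σ d : Module.End k C} (hσ : ∀ c, φ (σ c) = Tot.sgn X (φ c))
    (hd : ∀ c, φ (d c) = Tot.d X (φ c)) (x : Tot P) (m : ⨂[k] _ : Fin n, C) :
    Tot.d X (evalTensor θ φ x m) = evalTensor θ φ (Tot.d P x) m +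
      evalTensor θ φ (Tot.sgn P x) (slide n σ d m) := by
  have h : Tot.d X ∘ₗ evalTensor θ φ x = evalTensor θ φ (Tot.d P x) +
      evalTensor θ φ (Tot.sgn P x) ∘ₗ slide n σ d := by
    refine PiTensorProduct.ext (MultilinearMap.ext fun v => ?_)
    change Tot.d X (evalTensor θ φ x (PiTensorProduct.tprod k v)) =
      evalTensor θ φ (Tot.d P x) (PiTensorProduct.tprod k v) +
        evalTensor θ φ (Tot.sgn P x) (slide n σ d (PiTensorProduct.tprod k v))
    rw [evalTensor_tprod, evalTensor_tprod, hθ.leibniz, slide, LinearMap.sum_apply, map_sum]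
    refine congrArg (_ + ·) (Finset.sum_congr rfl fun j _ => ?_)
    rw [PiTensorProduct.map_tprod, evalTensor_tprod]
    refine congrArg _ (funext fun i => ?_)
    unfold slidePattern
    split_ifs
    · exact (hσ _).symm
    · exact (hd _).symm
    · rfl
  exact congrArg (fun f => f m) h

theorem tot_d_d (K : ChainComplex (ModuleCat.{u} k) ℕ) (p : ℕ) (x : K.X p) :
    Tot.d K (Tot.d K (Tot.of K p x)) = 0 := by
  rw [tot_d_of, tot_d_of]
  have h := congrArg (fun f => f.hom x) (K.d_comp_d p (p - 1) (p - 1 - 1))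
  exact (congrArg (Tot.of K (p - 1 - 1)) h).trans (map_zero _)

/-- The images in `X` of the letters `z`, `b`, `d b`. -/
noncomputable def letterVal {q : ℕ} (z : X.X q) (b : X.X (q + 1)) : Fin 3 → Tot X :=
  ![Tot.of X q z, Tot.of X (q + 1) b, Tot.of X q ((X.d (q + 1) q).hom b)]

/-- The chain map from the module on the letters `z`, `b`, `d b` to `X`. -/
noncomputable def letterMap {q : ℕ} (z : X.X q) (b : X.X (q + 1)) : (Fin 3 → k) →ₗ[k] Tot X :=
  Fintype.linearCombination k (letterVal z b)

theorem letterMap_single {q : ℕ} (z : X.X q) (b : X.X (q + 1)) (i : Fin 3) :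
    letterMap z b (Pi.single i 1) = letterVal z b i := by
  simp [letterMap, Fintype.linearCombination_apply_single]

theorem letterVal_mem {q : ℕ} (z : X.X q) (b : X.X (q + 1)) (i : Fin 3) :
    letterVal z b i ∈ LinearMap.range (Tot.of X (letterDeg q i)) := by
  fin_cases i
  · exact ⟨z, rfl⟩
  · exact ⟨b, rfl⟩
  · exact ⟨(X.d (q + 1) q).hom b, rfl⟩

theorem letterMap_sign {q : ℕ} (z : X.X q) (b : X.X (q + 1)) (c : Fin 3 → k) :
    letterMap z b (letterSign k q c) = Tot.sgn X (letterMap z b c) := by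
  have h : letterMap z b ∘ₗ letterSign k q = Tot.sgn X ∘ₗ letterMap z b := by
    refine (Pi.basisFun k (Fin 3)).ext fun i => ?_
    rw [Pi.basisFun_apply]
    change letterMap z b (letterSign k q (Pi.single i 1)) =
      Tot.sgn X (letterMap z b (Pi.single i 1))
    rw [(letter_isHomogeneous q i).sign, map_smul, letterMap_single]
    obtain ⟨y, hy⟩ := letterVal_mem z b i
    rw [← hy, tot_sgn_of]
  exact congrArg (fun f => f c) h

/-- On the letters the differential is `b ↦ d b`, as `z` and `d b` are cycles. -/
theorem letterMap_d {q : ℕ} (z : X.X q) (hz : Tot.d X (Tot.of X q z) = 0) (b : X.X (q + 1))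
    (c : Fin 3 → k) :
    letterMap z b (coordMap k 1 2 c) = Tot.d X (letterMap z b c) := by
  have h : letterMap z b ∘ₗ coordMap k 1 2 = Tot.d X ∘ₗ letterMap z b := by
    have hb : Tot.of X q ((X.d (q + 1) q).hom b) = Tot.d X (Tot.of X (q + 1) b) :=
      (tot_d_of X (q + 1) b).symm
    refine (Pi.basisFun k (Fin 3)).ext fun i => ?_
    rw [Pi.basisFun_apply]
    change letterMap z b (coordMap k 1 2 (Pi.single i 1)) =
      Tot.d X (letterMap z b (Pi.single i 1))
    rw [letterMap_single, coordMap_apply]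
    fin_cases i
    · refine Eq.trans ?_ hz.symm
      simp
    · refine Eq.trans ?_ hb
      exact letterMap_single z b 2
    · refine Eq.trans ?_ ((congrArg (Tot.d X) hb).trans (tot_d_d X _ b)).symm
      simp
  exact congrArg (fun f => f c) h

theorem neg_one_zsmul {M : Type*} [AddCommGroup M] [Module k M] (n : ℕ) (x : M) :
    (-1 : ℤ) ^ n • x = (-1 : k) ^ n • x := by
  rcases Nat.even_or_odd n with h | h <;> simp [h.neg_one_pow]

variable {χ : ∀ n, Tot ((Dch k).P n) →ₗ[k] MultilinearMap k (fun _ : Fin n => Tot X) (Tot X)}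

/-- The action of the generator of the cyclic group on `⨁_i 𝒩k[N(ES_p)]_i`. -/
noncomputable def totCyc (k : Type u) [CommRing k] (p : ℕ) : Module.End k (Tot ((Dch k).P p)) :=
  Tot.map ((Dch k).act p (finRotate p))

/-- The evaluation of words is adjoint for the two actions of the cyclic group, by the equivariance
of the algebra structure. -/
theorem evalTensor_rotate (hχ : IsDGAlgebra (Dch k) X χ) {q : ℕ} (z : X.X q) (b : X.X (q + 1))
    (n : ℕ) (x : Tot ((Dch k).P (n + 1))) (m : ⨂[k] _ : Fin (n + 1), (Fin 3 → k)) :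
    evalTensor (χ (n + 1)) (letterMap z b) (totCyc k (n + 1) x) m =
      evalTensor (χ (n + 1)) (letterMap z b) x (letterRotate k n q m) := by
  have h : evalTensor (χ (n + 1)) (letterMap z b) (totCyc k (n + 1) x) =
      evalTensor (χ (n + 1)) (letterMap z b) x ∘ₗ letterRotate k n q := by
    refine PiTensorProduct.ext (Module.Basis.ext_multilinear (fun _ => Pi.basisFun k (Fin 3))
      fun w => ?_)
    simp only [Pi.basisFun_apply]
    change evalTensor (χ (n + 1)) (letterMap z b) (totCyc k (n + 1) x)
        (PiTensorProduct.tprod k fun i => Pi.single (w i) 1) =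
      evalTensor (χ (n + 1)) (letterMap z b) x (letterRotate k n q
        (PiTensorProduct.tprod k fun i => Pi.single (w i) 1))
    rw [evalTensor_tprod, letterRotate, signedRotate_tprod n (fun i => letterDeg q (w i)) _
      fun i => letter_isHomogeneous q (w i), map_smul, evalTensor_tprod, ← neg_one_zsmul,
      ← koszul_finRotate n fun i => letterDeg q (w i)]
    simp only [letterMap_single]
    exact hχ.graded.equivariance (n + 1) (finRotate (n + 1)) x _ _
      fun i => letterVal_mem z b (w i)
  exact congrArg (fun f => f m) h

end PowerOperations

/-! ### Cyclic lifts -/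

section CyclicLifts

variable {k : Type u} [CommRing k]

theorem finRotate_pow_self (n : ℕ) : finRotate (n + 1) ^ (n + 1) = 1 := by
  have h := finRotate_symm_pow_self n
  rw [show (finRotate (n + 1)).symm = (finRotate (n + 1))⁻¹ from rfl, inv_pow] at h
  exact inv_eq_one.mp h

/-- The action of the generator of the cyclic group on `𝒩k[N(ES_p)]`. -/
noncomputable def dchRotate (k : Type u) [CommRing k] (p i : ℕ) :
    Module.End k ((normalized (DMod k p)).X i) :=
  cyc k p i

theorem cyc_pow_gen (p i t : ℕ) (v : Fin (i + 1) → Equiv.Perm (Fin p)) :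
    (dchRotate k p i ^ t) (DMod.gen k v) =
      DMod.gen k fun j => v j * finRotate p ^ t := by
  induction t generalizing v with
  | zero => simp
  | succ t ih =>
    rw [pow_succ, Module.End.mul_apply]
    refine (congrArg (dchRotate k p i ^ t)
      (dch_act_gen p i (finRotate p) v)).trans ((ih _).trans ?_)
    simp only [mul_assoc, pow_succ']

theorem cyc_pow_self (n i : ℕ) :
    (dchRotate k (n + 1) i) ^ (n + 1) = 1 := by
  refine DMod.normalized_hom_ext _ _ fun v => (cyc_pow_gen (n + 1) i (n + 1) v).trans ?_
  refine congrArg (DMod.gen k) (funext fun j => ?_)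
  rw [finRotate_pow_self, mul_one]

theorem d_cyc (p i : ℕ) (x : (normalized (DMod k p)).X (i + 1)) :
    ((normalized (DMod k p)).d (i + 1) i).hom (dchRotate k p (i + 1) x) =
      dchRotate k p i (((normalized (DMod k p)).d (i + 1) i).hom x) :=
  (congrArg (fun f => f.hom x) (((Dch k).act p (finRotate p)).comm (i + 1) i))

theorem d_cyclicOp_cyc (p i j : ℕ) (x : (normalized (DMod k p)).X (i + 1)) :
    ((normalized (DMod k p)).d (i + 1) i).hom (cyclicOp p j (dchRotate k p (i + 1)) x) =
      cyclicOp p j (dchRotate k p i)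
        (((normalized (DMod k p)).d (i + 1) i).hom x) :=
  cyclicOp_intertwine ((normalized (DMod k p)).d (i + 1) i).hom (d_cyc p i) p j x

theorem dchAug_cyc (p : ℕ) (x : (normalized (DMod k p)).X 0) :
    dchAug k p (dchRotate k p 0 x) = dchAug k p x := by
  rw [← augment_dchEps]
  exact congrArg (fun f => (f.f 0).hom x) (dch_act_comp_eps (k := k) p (finRotate p))

/-- Cycles of the augmented complex: cycles in positive degrees, and elements of augmentation zero in
degree zero. -/
def IsAugCycle {p : ℕ} (i : ℕ) (x : (normalized (DMod k p)).X i) : Prop :=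
  match i, x with
  | 0, x => dchAug k p x = 0
  | i + 1, x => ((normalized (DMod k p)).d (i + 1) i).hom x = 0

theorem IsAugCycle.exists_filling {p i : ℕ} {x : (normalized (DMod k p)).X i}
    (h : IsAugCycle i x) : ((normalized (DMod k p)).d (i + 1) i).hom (dchContraction k p i x) = x := by
  cases i with
  | zero =>
    refine (dchContraction_zero p x).trans ?_
    rw [show dchAug k p x = 0 from h, zero_smul, sub_zero]
  | succ i =>
    refine (dchContraction_succ p i x).trans ?_
    rw [show ((normalized (DMod k p)).d (i + 1) i).hom x = 0 from h, map_zero, sub_zero]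

/-- The relations of a cyclic lift in even and odd degrees, in a uniform form. -/
theorem isCyclicLift_iff {p : ℕ} {ξ : ∀ i, ((Dch k).P p).X i} :
    IsCyclicLift k p ξ ↔ dchAug k p (ξ 0) = 1 ∧
      ∀ i, ((normalized (DMod k p)).d (i + 1) i).hom (ξ (i + 1)) =
        cyclicOp p i (dchRotate k p i) (ξ i) := by
  have h0 : ∀ i (x : (normalized (DMod k p)).X (2 * i)),
      cyclicOp p (2 * i) (dchRotate k p (2 * i)) x =
        dchRotate k p (2 * i) x - x := by
    intro i x
    rw [cyclicOp, if_pos (even_two_mul i)]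
    rfl
  have h1 : ∀ i (x : (normalized (DMod k p)).X (2 * i + 1)), cyclicOp p (2 * i + 1)
      (dchRotate k p (2 * i + 1)) x =
        ∑ t ∈ Finset.range p, (dchRotate k p (2 * i + 1) ^ t) x := by
    intro i x
    rw [cyclicOp, if_neg (by simp), LinearMap.sum_apply]
  constructor
  · intro h
    refine ⟨h.aug, fun i => ?_⟩
    obtain ⟨j, rfl | rfl⟩ := Nat.even_or_odd' i
    · exact (h.odd j).trans (h0 j _).symm
    · exact (h.even j).trans (h1 j _).symm
  · intro h
    exact ⟨h.1, fun i => (h.2 (2 * i)).trans (h0 i _), fun i => (h.2 (2 * i + 1)).trans (h1 i _)⟩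

/-- A cyclic lift, constructed by filling cycles with the contraction. -/
noncomputable def cyclicLift (k : Type u) [CommRing k] (p i : ℕ) : (normalized (DMod k p)).X i :=
  Nat.rec (motive := fun i => (normalized (DMod k p)).X i) (DMod.gen k fun _ => 1)
    (fun i x => dchContraction k p i (cyclicOp p i (dchRotate k p i) x)) i

theorem isCyclicLift_cyclicLift (n : ℕ) : IsCyclicLift k (n + 1) (cyclicLift k (n + 1)) := by
  refine isCyclicLift_iff.mpr ⟨?_, fun i => ?_⟩
  · rw [← augment_dchEps]
    exact augment_dchEps_gen (n + 1) _
  · refine IsAugCycle.exists_filling ?_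
    induction i with
    | zero =>
      exact (map_sub (dchAug k (n + 1)) (dchRotate k (n + 1) 0 (cyclicLift k (n + 1) 0))
        (cyclicLift k (n + 1) 0)).trans (sub_eq_zero.mpr (dchAug_cyc (n + 1) _))
    | succ i ih =>
      refine (d_cyclicOp_cyc (n + 1) i (i + 1) _).trans ?_
      refine (congrArg _ (IsAugCycle.exists_filling ih)).trans ?_
      exact congrArg (fun f : Module.End k ((normalized (DMod k (n + 1))).X i) =>
        f (cyclicLift k (n + 1) i)) (cyclicOp_mul (cyc_pow_self n i) i)

/-- Any two cyclic lifts differ by boundaries and values of cyclic operators: the equivariant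
homotopy `u` between them, given on the generators of the periodic resolution. -/
theorem IsCyclicLift.exists_homotopy {n : ℕ} {ξ ξ' : ∀ i, (normalized (DMod k (n + 1))).X i}
    (h : IsCyclicLift k (n + 1) ξ) (h' : IsCyclicLift k (n + 1) ξ') (i : ℕ) :
    ∃ (u : (normalized (DMod k (n + 1))).X (i + 1)) (g : (normalized (DMod k (n + 1))).X i),
      ((normalized (DMod k (n + 1))).d (i + 1) i).hom u = ξ i - ξ' i - g ∧
      cyclicOp (n + 1) i (dchRotate k (n + 1) i) g = 0 ∧
      ∃ j x, g = cyclicOp (n + 1) j (dchRotate k (n + 1) i) x := by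
  obtain ⟨ha, hd⟩ := isCyclicLift_iff.mp h
  obtain ⟨ha', hd'⟩ := isCyclicLift_iff.mp h'
  induction i with
  | zero =>
    refine ⟨dchContraction k (n + 1) 0 (ξ 0 - ξ' 0), 0, ?_, map_zero _, 0, 0, (map_zero _).symm⟩
    rw [sub_zero]
    refine IsAugCycle.exists_filling ?_
    exact (map_sub (dchAug k (n + 1)) (ξ 0) (ξ' 0)).trans (sub_eq_zero.mpr (ha.trans ha'.symm))
  | succ i ih =>
    obtain ⟨u, g, hu, hg, -⟩ := ih
    set g' : (normalized (DMod k (n + 1))).X (i + 1) :=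
      cyclicOp (n + 1) i (dchRotate k (n + 1) (i + 1)) u with hg'
    refine ⟨dchContraction k (n + 1) (i + 1) (ξ (i + 1) - ξ' (i + 1) - g'), g',
      IsAugCycle.exists_filling ?_, ?_, i, u, rfl⟩
    · change ((normalized (DMod k (n + 1))).d (i + 1) i).hom (ξ (i + 1) - ξ' (i + 1) - g') = 0
      rw [map_sub, map_sub, hd, hd', hg', d_cyclicOp_cyc, hu, map_sub, map_sub, hg, sub_zero,
        sub_self]
    · exact congrArg (fun f : Module.End k ((normalized (DMod k (n + 1))).X (i + 1)) => f u)
        (cyclicOp_mul (cyc_pow_self n (i + 1)) i)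

theorem of_cyclicOp_cyc (p i j : ℕ) (x : (normalized (DMod k p)).X i) :
    Tot.of ((Dch k).P p) i (cyclicOp p j (dchRotate k p i) x) =
      cyclicOp p j (totCyc k p) (Tot.of ((Dch k).P p) i x) :=
  cyclicOp_intertwine (Tot.of ((Dch k).P p) i)
    (fun x => (Tot.map_of ((Dch k).act p (finRotate p)) i x).symm) p j x

theorem IsCyclicLift.tot_d_zero {p : ℕ} (ξ : ∀ i, ((Dch k).P p).X i) :
    Tot.d _ (Tot.of ((Dch k).P p) 0 (ξ 0)) = 0 := by
  rw [tot_d_of, ((Dch k).P p).shape _ _ (by simp)]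
  exact map_zero _

theorem IsCyclicLift.tot_d_succ {p : ℕ} {ξ : ∀ i, ((Dch k).P p).X i} (h : IsCyclicLift k p ξ)
    (i : ℕ) : Tot.d _ (Tot.of ((Dch k).P p) (i + 1) (ξ (i + 1))) =
      cyclicOp p i (totCyc k p) (Tot.of ((Dch k).P p) i (ξ i)) := by
  rw [tot_d_of]
  exact (congrArg (Tot.of ((Dch k).P p) i) ((isCyclicLift_iff.mp h).2 i)).trans
    (of_cyclicOp_cyc p i i (ξ i))

end CyclicLifts

/-! ### Independence of the class of `χ(ξ_i ⊗ z ⊗ ⋯ ⊗ z)` of choices -/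

section PowerOperations

variable {k : Type u} [CommRing k] {X : ChainComplex (ModuleCat.{u} k) ℕ}
  {χ : ∀ n, Tot ((Dch k).P n) →ₗ[k] MultilinearMap k (fun _ : Fin n => Tot X) (Tot X)}
  (hχ : IsDGAlgebra (Dch k) X χ) {n q : ℕ} (hp : (n + 1).Prime) (hk : ((n + 1 : ℕ) : k) = 0)

theorem evalTensor_single {z : X.X q} (b : X.X (q + 1)) (x : Tot ((Dch k).P (n + 1))) :
    evalTensor (χ (n + 1)) (letterMap z b) x (PiTensorProduct.tprod k fun _ => Pi.single 0 1) =
      χ (n + 1) x fun _ => Tot.of X q z := by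
  rw [evalTensor_tprod]
  exact congrArg _ (funext fun _ => letterMap_single z b 0)

include hχ hp hk

/-- The values of the cyclic operators act trivially on powers. -/
theorem apply_cyclicOp_power (z : X.X q) (j : ℕ) (x : Tot ((Dch k).P (n + 1))) :
    χ (n + 1) (cyclicOp (n + 1) j (totCyc k (n + 1)) x) (fun _ => Tot.of X q z) = 0 := by
  rw [← evalTensor_single 0, cyclicOp_adjoint _ (evalTensor_rotate hχ z 0 n),
    cyclicOp_letterRotate hp hk (letter_isHomogeneous q 0), map_zero]

omit hp hk in
/-- On powers of cycles, `χ` is a chain map. -/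
theorem tot_d_apply_power {z : X.X q} (hz : Tot.d X (Tot.of X q z) = 0)
    (x : Tot ((Dch k).P (n + 1))) :
    Tot.d X (χ (n + 1) x fun _ => Tot.of X q z) =
      χ (n + 1) (Tot.d _ x) fun _ => Tot.of X q z := by
  rw [← evalTensor_single 0, ← evalTensor_single 0,
    evalTensor_leibniz (hχ.chain (n + 1)) (letterMap_sign z 0) (letterMap_d z hz 0),
    slide_tprod_eq_zero (n + 1) (by simp [coordMap_apply]), map_zero, add_zero]

/-- `χ(ξ_i ⊗ z ⊗ ⋯ ⊗ z)` is a cycle. -/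
theorem IsCyclicLift.tot_d_apply_power {ξ : ∀ i, ((Dch k).P (n + 1)).X i}
    (h : IsCyclicLift k (n + 1) ξ) {z : X.X q} (hz : Tot.d X (Tot.of X q z) = 0) (i : ℕ) :
    Tot.d X (χ (n + 1) (Tot.of _ i (ξ i)) fun _ => Tot.of X q z) = 0 := by
  rw [SymHom.tot_d_apply_power hχ hz]
  cases i with
  | zero =>
    rw [IsCyclicLift.tot_d_zero]
    simp
  | succ i => rw [h.tot_d_succ, apply_cyclicOp_power hχ hp hk]

/-- The class of `χ(ξ_i ⊗ z ⊗ ⋯ ⊗ z)` does not depend on the cyclic lift `ξ`. -/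
theorem exists_boundary_lift {ξ ξ' : ∀ i, ((Dch k).P (n + 1)).X i}
    (h : IsCyclicLift k (n + 1) ξ) (h' : IsCyclicLift k (n + 1) ξ') {z : X.X q}
    (hz : Tot.d X (Tot.of X q z) = 0) (i : ℕ) :
    ∃ y, (χ (n + 1) (Tot.of _ i (ξ i)) fun _ => Tot.of X q z) -
      (χ (n + 1) (Tot.of _ i (ξ' i)) fun _ => Tot.of X q z) = Tot.d X y := by
  obtain ⟨u, g, hu, -, j, x, rfl⟩ := h.exists_homotopy h' i
  refine ⟨χ (n + 1) (Tot.of _ (i + 1) u) fun _ => Tot.of X q z, ?_⟩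
  have hd : Tot.d _ (Tot.of ((Dch k).P (n + 1)) (i + 1) u) =
      Tot.of ((Dch k).P (n + 1)) i (ξ i) - Tot.of ((Dch k).P (n + 1)) i (ξ' i) -
        cyclicOp (n + 1) j (totCyc k (n + 1)) (Tot.of ((Dch k).P (n + 1)) i x) := by
    refine (tot_d_of ((Dch k).P (n + 1)) (i + 1) u).trans ?_
    refine (congrArg (Tot.of ((Dch k).P (n + 1)) i) hu).trans ?_
    refine (map_sub (Tot.of ((Dch k).P (n + 1)) i) (ξ i - ξ' i) _).trans ?_
    exact congrArg₂ (fun a b : Tot ((Dch k).P (n + 1)) => a - b) (map_sub _ _ _)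
      (of_cyclicOp_cyc (n + 1) i j x)
  rw [tot_d_apply_power hχ hz, hd, map_sub, map_sub, _root_.sub_apply,
    _root_.sub_apply, apply_cyclicOp_power hχ hp hk, sub_zero]

/-- The class of `χ(ξ_i ⊗ z ⊗ ⋯ ⊗ z)` depends only on the homology class of `z`. -/
theorem exists_boundary_cycle {ξ : ∀ i, ((Dch k).P (n + 1)).X i}
    (h : IsCyclicLift k (n + 1) ξ) {z : X.X q} (hz : Tot.d X (Tot.of X q z) = 0)
    (b : X.X (q + 1)) (i : ℕ) :
    ∃ y, (χ (n + 1) (Tot.of _ i (ξ i)) fun _ => Tot.of X q (z + (X.d (q + 1) q).hom b)) -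
      (χ (n + 1) (Tot.of _ i (ξ i)) fun _ => Tot.of X q z) = Tot.d X y := by
  -- `z + d b` and `z` are the images of sums of letters, whose powers have equal projections
  have hc0 := letter_isHomogeneous (k := k) q 0
  have hc1 : IsHomogeneous (letterSign k q) (letterEven k q) (letterOdd k q) q
      (Pi.single 0 1 + Pi.single 2 1 : Fin 3 → k) :=
    isHomogeneous_add hc0 (letter_isHomogeneous q 2)
  have hv : letterMap z b (Pi.single 0 1 + Pi.single 2 1 : Fin 3 → k) =
      Tot.of X q (z + (X.d (q + 1) q).hom b) := by
    rw [map_add, letterMap_single, letterMap_single, map_add]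
    rfl
  obtain ⟨y, hy⟩ := exists_boundary_of_contraction (n + 1)
    (evalTensor (χ (n + 1)) (letterMap z b))
    (evalTensor_leibniz (hχ.chain (n + 1)) (letterMap_sign z b) (letterMap_d z hz b))
    (evalTensor_rotate hχ z b n) (letterD_mul_letterS n q) (letterZ_mul_letterS n q)
    (letterD_mul_letterRotate n q) (letterZ_mul_letterRotate n q) (letterRotate_pow n q)
    (ξ := fun i => Tot.of _ i (ξ i)) (fun i => tot_sgn_of _ i _) (IsCyclicLift.tot_d_zero ξ)
    h.tot_d_succ i
    ((PiTensorProduct.tprod k fun _ => Pi.single 0 1 + Pi.single 2 1) -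
      PiTensorProduct.tprod k fun _ => Pi.single 0 1)
    (by
      rw [map_sub, slide_tprod_eq_zero, slide_tprod_eq_zero, sub_zero] <;>
        simp [coordMap_apply])
    (by
      unfold letterZ
      rw [map_sub, PiTensorProduct.map_tprod, PiTensorProduct.map_tprod]
      simp [coordMap_apply])
    (fun j _ => by
      rw [map_sub, cyclicOp_letterRotate hp hk hc0, cyclicOp_letterRotate hp hk hc1, sub_zero])
  refine ⟨y, ?_⟩
  rw [← hy, map_sub, evalTensor_single, evalTensor_tprod, hv]

end PowerOperations

/-! ### Dyer–Lashof operations on symmetric homology -/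

section Homology

variable {k : Type u} [CommRing k] (K : ChainComplex (ModuleCat.{u} k) ℕ)

theorem tot_d_component (v : Tot K) (N : ℕ) : (Tot.d K v) N = (K.d (N + 1) N).hom (v (N + 1)) := by
  have h : DirectSum.component k ℕ (fun p => K.X p) N ∘ₗ Tot.d K =
      (K.d (N + 1) N).hom ∘ₗ DirectSum.component k ℕ (fun p => K.X p) (N + 1) := by
    refine DirectSum.linearMap_ext k fun p => LinearMap.ext fun x => ?_
    change DirectSum.component k ℕ (fun p => K.X p) N (Tot.d K (Tot.of K p x)) =
      (K.d (N + 1) N).hom (DirectSum.component k ℕ (fun p => K.X p) (N + 1) (Tot.of K p x))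
    rw [tot_d_of]
    by_cases hp : p = N + 1
    · subst hp
      rw [DirectSum.component.lof_self]
      exact DirectSum.component.lof_self k N _
    · have h2 : DirectSum.component k ℕ (fun p => K.X p) (N + 1) (Tot.of K p x) = 0 := by
        rw [DirectSum.component.of, dif_neg hp]
      rw [h2, map_zero]
      cases p with
      | zero =>
        rw [K.shape _ _ (by simp)]
        simp
      | succ p => rw [DirectSum.component.of, dif_neg (by omega)]
  exact congrArg (fun f => f v) h

theorem of_injective (d : ℕ) : Function.Injective (Tot.of K d) :=
  DirectSum.of_injective (β := fun p => K.X p) d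

theorem iCycles_injective (d : ℕ) : Function.Injective (K.iCycles d).hom :=
  (ModuleCat.mono_iff_injective _).mp inferInstance

theorem homologyπ_surjective (d : ℕ) : Function.Surjective (K.homologyπ d).hom :=
  (ModuleCat.epi_iff_surjective _).mp inferInstance

theorem tot_d_iCycles {d : ℕ} (w : K.cycles d) :
    Tot.d K (Tot.of K d ((K.iCycles d).hom w)) = 0 := by
  rw [tot_d_of]
  exact (congrArg (Tot.of K (d - 1)) (congrArg (fun f => f.hom w) (K.iCycles_d d (d - 1)))).trans
    (map_zero _)

/-- Elements with vanishing differential come from the object of cycles. -/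
theorem exists_cycle {d : ℕ} {x : K.X d} (h : Tot.d K (Tot.of K d x) = 0) :
    ∃ w : K.cycles d, (K.iCycles d).hom w = x := by
  have hx : (K.d d (d - 1)).hom x = 0 := by
    rw [tot_d_of] at h
    exact of_injective K (d - 1) (h.trans (map_zero _).symm)
  have hn : (ComplexShape.down ℕ).next d = d - 1 := by
    cases d with
    | zero => exact ChainComplex.next_nat_zero
    | succ d => exact ChainComplex.next_nat_succ d
  let f : ModuleCat.of k k ⟶ K.X d := ModuleCat.ofHom (LinearMap.toSpanSingleton k _ x)
  have hf : f ≫ K.d d (d - 1) = 0 := by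
    refine ModuleCat.hom_ext (LinearMap.ext_ring ?_)
    exact (congrArg (K.d d (d - 1)).hom (one_smul k x)).trans hx
  refine ⟨(K.liftCycles f (d - 1) hn hf).hom 1, ?_⟩
  exact (congrArg (fun g => g.hom 1) (K.liftCycles_i f (d - 1) hn hf)).trans (one_smul k x)

theorem homologyπ_eq {d : ℕ} {w w' : K.cycles d} {y : Tot K}
    (h : Tot.of K d ((K.iCycles d).hom w) - Tot.of K d ((K.iCycles d).hom w') = Tot.d K y) :
    (K.homologyπ d).hom w = (K.homologyπ d).hom w' := by
  have h1 : (K.iCycles d).hom (w - w') = (K.d (d + 1) d).hom (y (d + 1)) := by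
    rw [← tot_d_component, ← h, ← map_sub (Tot.of K d), ← map_sub (K.iCycles d).hom]
    exact (DirectSum.component.lof_self (M := fun p => K.X p) k d _).symm
  have h2 : w - w' = (K.toCycles (d + 1) d).hom (y (d + 1)) := iCycles_injective K d (h1.trans
    (congrArg (fun g => g.hom (y (d + 1))) (K.toCycles_i (d + 1) d)).symm)
  rw [← sub_eq_zero, ← map_sub, h2]
  exact congrArg (fun g => g.hom (y (d + 1))) (K.toCycles_comp_homologyπ (d + 1) d)

theorem exists_of_homologyπ_eq {d : ℕ} {w w' : K.cycles d}
    (h : (K.homologyπ d).hom w = (K.homologyπ d).hom w') :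
    ∃ b, (K.iCycles d).hom w = (K.iCycles d).hom w' + (K.d (d + 1) d).hom b := by
  have he := ShortComplex.exact_of_g_is_cokernel
    (ShortComplex.mk _ _ (K.toCycles_comp_homologyπ (d + 1) d))
    (K.homologyIsCokernel (d + 1) d (ChainComplex.prev ℕ d))
  obtain ⟨b, hb⟩ := (ShortComplex.moduleCat_exact_iff _).mp he (w - w') (by
    rw [← sub_eq_zero, ← map_sub] at h
    exact h)
  refine ⟨b, ?_⟩
  rw [← sub_eq_iff_eq_add', ← map_sub, ← congrArg (K.iCycles d).hom hb]
  exact congrArg (fun g => g.hom b) (K.toCycles_i (d + 1) d)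

end Homology

section DyerLashofOperations

variable {k A : Type u} [CommRing k] [Ring A] [Algebra k A]
  (e : ∀ n, (normalized (YPlus k A)).homology n ≅ HS k A n)

theorem chiTilde_isDGAlgebra :
    IsDGAlgebra (Dch k) (normalized (YPlus k A)) (chiTilde k A) :=
  chains_isDGAlgebra (chiY_isSAlgebra k A)

theorem exists_class {q : ℕ} (x : HS k A q) :
    ∃ z : (normalized (YPlus k A)).cycles q,
      (e q).hom.hom (((normalized (YPlus k A)).homologyπ q).hom z) = x := by
  obtain ⟨z, hz⟩ := homologyπ_surjective (normalized (YPlus k A)) q ((e q).inv.hom x)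
  refine ⟨z, ?_⟩
  rw [hz]
  exact congrArg (fun f => f.hom x) (e q).inv_hom_id

/-- `χ̃(ξ_i ⊗ z ⊗ ⋯ ⊗ z)` comes from a cycle of degree `p q + i`. -/
theorem chiTilde_power_cycle {p : ℕ} (hp : p.Prime) (hk : (p : k) = 0) {i q d : ℕ}
    (hd : d = p * q + i) {ξ : ∀ i, ((Dch k).P p).X i} (hξ : IsCyclicLift k p ξ)
    (z : (normalized (YPlus k A)).cycles q) :
    ∃ w : (normalized (YPlus k A)).cycles d,
      chiTilde k A p (Tot.of _ i (ξ i))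
        (fun _ => Tot.of _ q (((normalized (YPlus k A)).iCycles q).hom z)) =
          Tot.of _ d (((normalized (YPlus k A)).iCycles d).hom w) := by
  obtain ⟨n, rfl⟩ := Nat.exists_eq_succ_of_ne_zero hp.ne_zero
  have hdeg : ∃ v, chiTilde k A (n + 1) (Tot.of _ i (ξ i))
      (fun _ => Tot.of _ q (((normalized (YPlus k A)).iCycles q).hom z)) =
        Tot.of (normalized (YPlus k A)) d v := by
    have hs : d = i + ∑ _ : Fin (n + 1), q := by
      rw [Finset.sum_const, Finset.card_univ, Fintype.card_fin, smul_eq_mul, hd, add_comm]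
    rw [hs]
    exact (chiTilde_isDGAlgebra.chain (n + 1)).degree i (fun _ => q) (ξ i) _
  obtain ⟨v, hv⟩ := hdeg
  have hz := hξ.tot_d_apply_power chiTilde_isDGAlgebra hp hk
    (tot_d_iCycles (normalized (YPlus k A)) z) i
  rw [hv] at hz
  obtain ⟨w, hw⟩ := exists_cycle _ hz
  exact ⟨w, by rw [hv, hw]⟩

/-- The class of `χ̃(ξ_i ⊗ z ⊗ ⋯ ⊗ z)` depends neither on the cyclic lift `ξ` nor on the cycle `z` in
its homology class. -/
theorem chiTilde_power_class {p : ℕ} (hp : p.Prime) (hk : (p : k) = 0) {i q d : ℕ}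
    {ξ ξ' : ∀ i, ((Dch k).P p).X i} (hξ : IsCyclicLift k p ξ) (hξ' : IsCyclicLift k p ξ')
    {z z' : (normalized (YPlus k A)).cycles q}
    (hz : ((normalized (YPlus k A)).homologyπ q).hom z =
      ((normalized (YPlus k A)).homologyπ q).hom z')
    {w w' : (normalized (YPlus k A)).cycles d}
    (hw : chiTilde k A p (Tot.of _ i (ξ i))
        (fun _ => Tot.of _ q (((normalized (YPlus k A)).iCycles q).hom z)) =
          Tot.of _ d (((normalized (YPlus k A)).iCycles d).hom w))
    (hw' : chiTilde k A p (Tot.of _ i (ξ' i))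
        (fun _ => Tot.of _ q (((normalized (YPlus k A)).iCycles q).hom z')) =
          Tot.of _ d (((normalized (YPlus k A)).iCycles d).hom w')) :
    ((normalized (YPlus k A)).homologyπ d).hom w =
      ((normalized (YPlus k A)).homologyπ d).hom w' := by
  obtain ⟨n, rfl⟩ := Nat.exists_eq_succ_of_ne_zero hp.ne_zero
  obtain ⟨b, hb⟩ := exists_of_homologyπ_eq _ hz
  have hcyc := tot_d_iCycles (normalized (YPlus k A)) z'
  obtain ⟨y, hy⟩ := exists_boundary_cycle chiTilde_isDGAlgebra hp hk hξ hcyc b i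
  obtain ⟨y', hy'⟩ := exists_boundary_lift chiTilde_isDGAlgebra hp hk hξ hξ' hcyc i
  refine homologyπ_eq _ (y := y + y') ?_
  rw [map_add, ← hy, ← hy', ← hb, ← hw, ← hw', sub_add_sub_cancel]

/-- The operation `D_i` is well defined on homology classes. -/
theorem existsUnique_isDOperation {p : ℕ} (hp : p.Prime) (hk : (p : k) = 0) {i q d : ℕ}
    (hd : d = p * q + i) : ∃! D : HS k A q → HS k A d, IsDOperation e p i q d D := by
  have hlift : ∃ ξ, IsCyclicLift k p ξ := by
    obtain ⟨n, rfl⟩ := Nat.exists_eq_succ_of_ne_zero hp.ne_zero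
    exact ⟨_, isCyclicLift_cyclicLift n⟩
  obtain ⟨ξ₀, hξ₀⟩ := hlift
  choose z hz using exists_class e (q := q)
  choose w hw using fun x => chiTilde_power_cycle hp hk hd hξ₀ (z x)
  refine ⟨fun x => (e d).hom.hom (((normalized (YPlus k A)).homologyπ d).hom (w x)), ?_, ?_⟩
  · intro ξ hξ v
    obtain ⟨u, hu⟩ := chiTilde_power_cycle hp hk hd hξ v
    refine ⟨u, hu, congrArg (e d).hom.hom (chiTilde_power_class hp hk hξ₀ hξ ?_ (hw _) hu)⟩
    have h := congrArg (e q).inv.hom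
      (hz ((e q).hom.hom (((normalized (YPlus k A)).homologyπ q).hom v)))
    have hi : ∀ y, (e q).inv.hom ((e q).hom.hom y) = y := fun y =>
      congrArg (fun f => f.hom y) (e q).hom_inv_id
    rw [hi, hi] at h
    exact h
  · intro D hD
    funext x
    obtain ⟨u, hu, hDu⟩ := hD ξ₀ hξ₀ (z x)
    rw [hz] at hDu
    refine hDu.trans (congrArg (fun v => (e d).hom.hom
      (((normalized (YPlus k A)).homologyπ d).hom v)) ?_)
    exact iCycles_injective _ d (of_injective _ d (hu.symm.trans (hw x)))

theorem existsUnique_isP2 (hk : ((2 : ℕ) : k) = 0) (s q : ℕ) : ∃! P, IsP2 e s q P := by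
  rcases lt_or_ge s q with h | h
  · exact ⟨fun _ => 0, ⟨fun _ _ => rfl, fun h' => absurd h h'.not_gt⟩,
      fun P hP => funext (hP.1 h)⟩
  · obtain ⟨D, hD, huniq⟩ := existsUnique_isDOperation (A := A) e Nat.prime_two hk
      (show q + s = 2 * q + (s - q) by omega)
    exact ⟨D, ⟨fun h' => absurd h' h.not_gt, fun _ => hD⟩, fun P hP => huniq P (hP.2 h)⟩

/-- The function that is zero in the range `c`, and a multiple of the unique `D` with `Q D` in the
complementary range `c'`, exists uniquely. -/
theorem existsUnique_multiple {S T : Type*} [AddCommGroup T] {c c' : Prop} (hc : c' ↔ ¬ c)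
    (Q : (S → T) → Prop) (h : c' → ∃! D, Q D) (ν : ℤ) :
    ∃! P : S → T, (c → ∀ x, P x = 0) ∧ (c' → ∃ D, Q D ∧ ∀ x, P x = ν • D x) := by
  by_cases h0 : c
  · exact ⟨fun _ => 0, ⟨fun _ _ => rfl, fun h' => absurd h0 (hc.mp h')⟩,
      fun P hP => funext (hP.1 h0)⟩
  · obtain ⟨D, hD, huniq⟩ := h (hc.mpr h0)
    refine ⟨fun x => ν • D x, ⟨fun h' => absurd h' h0, fun _ => ⟨D, hD, fun _ => rfl⟩⟩,
      fun P hP => funext fun x => ?_⟩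
    obtain ⟨D', hD', hP'⟩ := hP.2 (hc.mpr h0)
    rw [hP', huniq D' hD']

theorem existsUnique_isP {p : ℕ} (hp : p.Prime) (hk : (p : k) = 0) (s q : ℕ) :
    ∃! P, IsP e p s q P := by
  refine existsUnique_multiple not_lt.symm _ (fun h => existsUnique_isDOperation e hp hk ?_)
    (nu p s q)
  obtain ⟨r, rfl⟩ := Nat.exists_eq_succ_of_ne_zero hp.ne_zero
  obtain ⟨t, ht⟩ := Nat.exists_eq_add_of_le h
  rw [ht, Nat.add_sub_cancel_left, Nat.succ_sub_one, Nat.succ_eq_add_one]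
  ring

theorem existsUnique_isBetaP {p : ℕ} (hp : p.Prime) (hk : (p : k) = 0) (s q : ℕ) :
    ∃! P, IsBetaP e p s q P := by
  refine existsUnique_multiple not_le.symm _ (fun h => existsUnique_isDOperation e hp hk ?_)
    (nu p s q)
  obtain ⟨r, rfl⟩ := Nat.exists_eq_add_of_le hp.two_le
  obtain ⟨t, ht⟩ := Nat.exists_eq_add_of_lt h
  have h1 : (2 * s - q) * (2 + r - 1) = (t + 1) * (r + 1) := by
    rw [ht]
    congr 1 <;> omega
  have h2 : q + 2 * s * (2 + r - 1) = (2 + r) * q + (t + 1) * (r + 1) := by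
    rw [ht, show 2 + r - 1 = r + 1 by omega]
    ring
  have h3 : 1 ≤ (t + 1) * (r + 1) := Nat.one_le_iff_ne_zero.mpr (by positivity)
  rw [h1, h2, Nat.add_sub_assoc h3]

end DyerLashofOperations

end SymHom

theorem mainTheorem1 {k A : Type u} [CommRing k] [Ring A] [Algebra k A] :
    SymHom.IsSOperad (SymHom.Dsm k) ∧
    SymHom.IsSAlgebra (SymHom.Dsm k) (SymHom.YPlus k A) (SymHom.chiY k A) ∧
    SymHom.IsEInfinity (SymHom.Dch k) ∧
    SymHom.IsDGAlgebra (SymHom.Dch k) (SymHom.normalized (SymHom.YPlus k A))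
      (SymHom.chiTilde k A) ∧
    ∃ e : ∀ n, (SymHom.normalized (SymHom.YPlus k A)).homology n ≅ SymHom.HS k A n,
      ∀ p : ℕ, p.Prime → (p : k) = 0 →
        (∃ ξ, SymHom.IsCyclicLift k p ξ) ∧
        (∀ i q, ∃! D : SymHom.HS k A q → SymHom.HS k A (p * q + i),
          SymHom.IsDOperation e p i q (p * q + i) D) ∧
        (p = 2 → ∀ s q, ∃! P, SymHom.IsP2 e s q P) ∧
        (p ≠ 2 → ∀ s q, (∃! P, SymHom.IsP e p s q P) ∧ ∃! P, SymHom.IsBetaP e p s q P) := by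
  refine ⟨SymHom.Dsm_isSOperad, SymHom.chiY_isSAlgebra k A, SymHom.Dch_isEInfinity,
    SymHom.chiTilde_isDGAlgebra, SymHom.homologyIsoHS k A, fun p hp hk =>
      ⟨?_, fun i q => SymHom.existsUnique_isDOperation _ hp hk rfl, ?_, fun _ s q =>
        ⟨SymHom.existsUnique_isP _ hp hk s q, SymHom.existsUnique_isBetaP _ hp hk s q⟩⟩⟩
  · obtain ⟨n, rfl⟩ := Nat.exists_eq_succ_of_ne_zero hp.ne_zero
    exact ⟨_, SymHom.isCyclicLift_cyclicLift n⟩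
  · rintro rfl s q
    exact SymHom.existsUnique_isP2 _ hk s q
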